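/- \textbf{Setting.} Let $T>0$, let $v:\mathbb R^3\to\mathbb R$ be even with $v\in L^2(\mathbb R^3)$, and let $\phi:[0,T]\times\mathbb R^3\to\mathbb C$ be measurable with $\int_0^T\|\phi(t,\cdot)\|_{L^4(\mathbb R^3)}^2\,dt<\infty$. Put $$m(t,x,y)=-v(x-y)\,\overline{\phi(t,x)}\,\overline{\phi(t,y)},\qquad g(t,x,y)=-\Delta_x\delta(x-y)+v(x-y)\phi(t,x)\overline{\phi(t,y)}+(v*|\phi|^2)(t,x)\,\delta(x-y).$$ Kernels in $L^2(dx\,dy)=L^2(\mathbb R^3\times\mathbb R^3)$ are identified with Hilbert--Schmidt operators on $L^2(\mathbb R^3)$, products are operator compositions, $\overline u$ is the operator whose kernel is the complex conjugate of that of $u$, and $g^T$ has kernel $g(t,y,x)$. Put $$S(u)=i\,\partial_tu+gu+ug^T,\qquad W(a)=i\,\partial_ta+[g,a],$$ in the sense of distributions on $(0,T)\times\mathbb R^3\times\mathbb R^3$. Let $u\in L^\infty([0,T];L^2(dx\,dy))$ be symmetric, $u(t,x,y)=u(t,y,x)$, and set $$q=u\overline u,\quad 1+p=\sqrt{1+u\overline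 u},\quad r=(1+p)^{-1},\quad F=m\overline u(1+p)-(1+p)u\overline m,$$ $$W=\frac1{2\pi i}\int_\Gamma (q-z)^{-1}F(q-z)^{-1}\sqrt{1+z}\,dz,$$ where $\sqrt{\cdot}$ is the principal branch and, for almost every $t$, $\Gamma=\Gamma_t$ is a closed piecewise $C^1$ contour in $\mathbb C\setminus(-\infty,-1]$ that avoids the spectrum of $q(t)$ and winds once counterclockwise around each of its points. \textbf{Theorem.} The following equations are equivalent: \begin{align} S(u)&=(1+p)m+\bigl(W(p)+u\overline m\bigr)ru,\tag{1}\\ S(u)&=(1+p)m+\tfrac12[W(p),r]u+\tfrac12\bigl(rm\overline u+u\overline mr\bigr)u,\tag{2}\\ S(u)&=(1+p)m+\tfrac12[W,r]u+\tfrac12\bigl(rm\overline u+u\overline mr\bigr)u.\tag{3} \end{align} Here a solution of (1) or (2) is understood to have $W(p)\in L^1([0,T];L^2(dx\,dy))$, and in each equation both sides are equal elements of $L^1([0,T];L^2(dx\,dy))$; in particular every solution of (3) has $W(p)\in L^1([0,T];L^2(dx\,dy))$. If these equations hold, then $W(q)=F$ and $W(p)=W$. Moreover, (1) is the original equation for the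 pair excitation kernel: if $k(t)\in L^2(dx\,dy)$ is symmetric and $u=\mathrm{sh}(k)=k+\frac1{3!}k\overline kk+\cdots$ for almost every $t$, then (1) holds if and only if $$S(u)-(1+p')m=\bigl(W(p')+u\overline m\bigr)(1+p')^{-1}u,\qquad 1+p'=\mathrm{ch}(k)=1+\tfrac1{2!}k\overline k+\cdots$$ (with $S(u)$ and $W(p')$ in $L^1([0,T];L^2(dx\,dy))$ as before). -/

import Mathlib

open MeasureTheory Set
open scoped ENNReal

namespace PairExcitation

noncomputable section

/-- One-particle configuration space `ℝ³`. -/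
abbrev E3 : Type := EuclideanSpace ℝ (Fin 3)
/-- The one-particle Hilbert space `L²(ℝ³)`. -/
abbrev L2 : Type := Lp ℂ 2 (volume : Measure E3)
/-- Hilbert-Schmidt kernels: `L²(dx dy)` on `ℝ³ × ℝ³`. -/
abbrev Ker : Type := Lp ℂ 2 (volume : Measure (E3 × E3))

theorem Ker.enorm_integral_sq_le (k : E3 → ℂ) (f : E3 → ℂ) (hk : AEStronglyMeasurable k volume)
    (hf : AEStronglyMeasurable f volume) :
    ‖∫ y, k y * f y‖ₑ ^ (2 : ℝ) ≤ (∫⁻ y, ‖k y‖ₑ ^ (2 : ℝ)) * ∫⁻ y, ‖f y‖ₑ ^ (2 : ℝ) := by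
  have h1 : ‖∫ y, k y * f y‖ₑ ≤ ∫⁻ y, ‖k y‖ₑ * ‖f y‖ₑ := by
    refine (enorm_integral_le_lintegral_enorm _).trans (le_of_eq ?_)
    simp [enorm_mul]
  have h2 := ENNReal.lintegral_mul_le_Lp_mul_Lq (volume : Measure E3)
    (Real.HolderConjugate.two_two) hk.enorm hf.enorm
  have h3 := ENNReal.rpow_le_rpow (h1.trans h2) (by norm_num : (0 : ℝ) ≤ 2)
  refine h3.trans (le_of_eq ?_)
  rw [ENNReal.mul_rpow_of_nonneg _ _ (by norm_num), ← ENNReal.rpow_mul, ← ENNReal.rpow_mul]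
  norm_num

theorem Ker.lintegral_slice (k : Ker) :
    ∫⁻ x, ∫⁻ y, ‖k (x, y)‖ₑ ^ (2 : ℝ) = ‖k‖ₑ ^ (2 : ℝ) := by
  have hm : AEMeasurable (fun z : E3 × E3 => ‖k z‖ₑ ^ (2 : ℝ)) volume :=
    (Lp.aestronglyMeasurable k).enorm.pow_const _
  rw [Lp.enorm_def, eLpNorm_eq_lintegral_rpow_enorm_toReal (by norm_num) (by norm_num),
    ← ENNReal.rpow_mul]
  simp only [ENNReal.toReal_ofNat, one_div]
  rw [inv_mul_cancel₀ (by norm_num : (2 : ℝ) ≠ 0), ENNReal.rpow_one]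
  exact (lintegral_prod (μ := (volume : Measure E3)) (ν := (volume : Measure E3)) _ hm).symm

theorem Ker.aesm_slice (k : Ker) :
    ∀ᵐ x : E3, AEStronglyMeasurable (fun y => k (x, y)) (volume : Measure E3) := by
  have h : AEStronglyMeasurable k ((volume : Measure E3).prod (volume : Measure E3)) :=
    Lp.aestronglyMeasurable k
  exact h.prodMk_left

theorem Ker.memLp_slice (k : Ker) :
    ∀ᵐ x : E3, MemLp (fun y => k (x, y)) 2 (volume : Measure E3) := by
  have hm : AEMeasurable (fun z : E3 × E3 => ‖k z‖ₑ ^ (2 : ℝ))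
      ((volume : Measure E3).prod (volume : Measure E3)) :=
    (Lp.aestronglyMeasurable k).enorm.pow_const _
  have hfin : ∫⁻ x, ∫⁻ y, ‖k (x, y)‖ₑ ^ (2 : ℝ) ≠ ∞ := by
    rw [Ker.lintegral_slice]
    exact ENNReal.rpow_ne_top_of_nonneg (by norm_num) enorm_ne_top
  filter_upwards [Ker.aesm_slice k, ae_lt_top' hm.lintegral_prod_right' hfin] with x hx hx'
  refine ⟨hx, ?_⟩
  rw [eLpNorm_eq_lintegral_rpow_enorm_toReal (by norm_num) (by norm_num)]
  exact ENNReal.rpow_lt_top_of_nonneg (by norm_num) (by simpa using hx'.ne)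

theorem Ker.eLpNorm_apply_le (k : Ker) (f : L2) :
    eLpNorm (fun x => ∫ y, k (x, y) * f y) 2 volume ≤ ‖k‖ₑ * ‖f‖ₑ := by
  have hf : ∫⁻ y, ‖f y‖ₑ ^ (2 : ℝ) = ‖f‖ₑ ^ (2 : ℝ) := by
    rw [Lp.enorm_def, eLpNorm_eq_lintegral_rpow_enorm_toReal (by norm_num) (by norm_num),
      ← ENNReal.rpow_mul]
    norm_num
  have hb : ∫⁻ x, ‖∫ y, k (x, y) * f y‖ₑ ^ (2 : ℝ) ≤ (‖k‖ₑ * ‖f‖ₑ) ^ (2 : ℝ) := by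
    rw [ENNReal.mul_rpow_of_nonneg _ _ (by norm_num), ← Ker.lintegral_slice, ← hf,
      ← lintegral_mul_const' _ _ (by
        rw [hf]; exact ENNReal.rpow_ne_top_of_nonneg (by norm_num) enorm_ne_top)]
    refine lintegral_mono_ae ?_
    filter_upwards [Ker.aesm_slice k] with x hx
    exact Ker.enorm_integral_sq_le _ _ hx (Lp.aestronglyMeasurable f)
  rw [eLpNorm_eq_lintegral_rpow_enorm_toReal (by norm_num) (by norm_num)]
  refine (ENNReal.rpow_le_rpow hb (by norm_num)).trans (le_of_eq ?_)
  rw [← ENNReal.rpow_mul]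
  norm_num

theorem Ker.memLp_apply (k : Ker) (f : L2) :
    MemLp (fun x => ∫ y, k (x, y) * f y) 2 (volume : Measure E3) := by
  refine ⟨?_, (Ker.eLpNorm_apply_le k f).trans_lt
    (ENNReal.mul_lt_top enorm_lt_top enorm_lt_top)⟩
  have h1 : AEStronglyMeasurable k ((volume : Measure E3).prod (volume : Measure E3)) :=
    Lp.aestronglyMeasurable k
  have h2 := Lp.aestronglyMeasurable f
  exact (h1.mul h2.comp_snd).integral_prod_right'

/-- The Hilbert-Schmidt operator `(op k f)(x) = ∫ k(x,y) f(y) dy` on `L²(ℝ³)`. -/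
def op (k : Ker) : L2 →L[ℂ] L2 :=
  LinearMap.mkContinuous
    { toFun := fun f => (Ker.memLp_apply k f).toLp _
      map_add' := by
        intro f g
        rw [← MemLp.toLp_add]
        refine MemLp.toLp_congr _ _ ?_
        filter_upwards [Ker.memLp_slice k] with x hx
        have hf : Integrable (fun y => k (x, y) * f y) volume := hx.integrable_mul (Lp.memLp f)
        have hg : Integrable (fun y => k (x, y) * g y) volume := hx.integrable_mul (Lp.memLp g)
        simp only [Pi.add_apply]
        rw [← integral_add hf hg]
        refine integral_congr_ae ?_
        filter_upwards [Lp.coeFn_add f g] with y hy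
        rw [hy, Pi.add_apply, mul_add]
      map_smul' := by
        intro c f
        rw [RingHom.id_apply, ← MemLp.toLp_const_smul]
        refine MemLp.toLp_congr _ _ (Filter.Eventually.of_forall fun x => ?_)
        simp only [Pi.smul_apply, smul_eq_mul]
        rw [← integral_const_mul]
        refine integral_congr_ae ?_
        filter_upwards [Lp.coeFn_smul c f] with y hy
        simp only [hy, Pi.smul_apply, smul_eq_mul]
        ring }
    ‖k‖ (by
      intro f
      simp only [LinearMap.coe_mk, AddHom.coe_mk, Lp.norm_toLp]
      refine ENNReal.toReal_le_of_le_ofReal (by positivity) ?_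
      rw [ENNReal.ofReal_mul (norm_nonneg _), ofReal_norm, ofReal_norm]
      exact Ker.eLpNorm_apply_le k f)

/-- Bounded operators on `L²(ℝ³)`; multiplication is composition. -/
abbrev Op : Type := L2 →L[ℂ] L2

/-- The element of `L²(dx dy)` given by a function (`0` if the function is not in `L²`). -/
def toKer (k : E3 × E3 → ℂ) : Ker :=
  open Classical in if h : MemLp k 2 volume then h.toLp k else 0

/-- `u(x,y) = u(y,x)`. -/
def IsSymm (u : Ker) : Prop := ∀ᵐ z : E3 × E3, u z.swap = u z

/-- Positive square root of a non-negative bounded operator. -/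
def posSqrt {H : Type*} [NormedAddCommGroup H] [InnerProductSpace ℂ H] [CompleteSpace H]
    (a : H →L[ℂ] H) : H →L[ℂ] H := CFC.sqrt a

/-! ### The coefficients `m` and `g` -/

section Coefficients

variable (v : E3 → ℝ) (φ : ℝ → E3 → ℂ)

/-- `m(t,x,y) = - v(x-y) conj φ(t,x) conj φ(t,y)`. -/
def mKer (t : ℝ) : Ker :=
  toKer fun z => -((v (z.1 - z.2) : ℂ) * star (φ t z.1) * star (φ t z.2))

/-- `v(x-y) φ(t,x) conj φ(t,y)`. -/
def exchange (t : ℝ) (x y : E3) : ℂ := (v (x - y) : ℂ) * φ t x * star (φ t y)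

/-- `(v * |φ|²)(t,x)`. -/
def direct (t : ℝ) (x : E3) : ℂ := ((∫ y, v (x - y) * ‖φ t y‖ ^ 2 : ℝ) : ℂ)

/- In the kernel notation
`g(t,x,y) = -Δ_x δ(x-y) + v(x-y) φ(t,x) conj φ(t,y) + (v * |φ|²)(t,x) δ(x-y)`.
The next three definitions are the kernels of `(g + Δ) k`, `k (g + Δ)ᵀ` and `k (g + Δ)`. -/

def gLeft (t : ℝ) (k : E3 × E3 → ℂ) (x y : E3) : ℂ :=
  (∫ z, exchange v φ t x z * k (z, y)) + direct v φ t x * k (x, y)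

def gTransposeRight (t : ℝ) (k : E3 × E3 → ℂ) (x y : E3) : ℂ :=
  (∫ z, k (x, z) * exchange v φ t y z) + k (x, y) * direct v φ t y

def gRight (t : ℝ) (k : E3 × E3 → ℂ) (x y : E3) : ℂ :=
  (∫ z, k (x, z) * exchange v φ t z y) + k (x, y) * direct v φ t y

end Coefficients

/-! ### The linear evolution operators `S` and `W`, in the sense of distributions -/

/-- Lebesgue measure on `[0,T]`. -/
abbrev timeMeasure (T : ℝ) : Measure ℝ := volume.restrict (Icc 0 T)

/-- `ψ ∈ C_c^∞((0,T) × ℝ³ × ℝ³)`. -/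
def IsTest (T : ℝ) (ψ : ℝ × E3 × E3 → ℂ) : Prop :=
  ContDiff ℝ (⊤ : ℕ∞) ψ ∧ HasCompactSupport ψ ∧ tsupport ψ ⊆ Ioo 0 T ×ˢ univ

def dt (ψ : ℝ × E3 × E3 → ℂ) (t : ℝ) (x y : E3) : ℂ := deriv (fun s => ψ (s, x, y)) t

def lapX (ψ : ℝ × E3 × E3 → ℂ) (t : ℝ) (x y : E3) : ℂ :=
  Laplacian.laplacian (fun x' => ψ (t, x', y)) x

def lapY (ψ : ℝ × E3 × E3 → ℂ) (t : ℝ) (x y : E3) : ℂ :=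
  Laplacian.laplacian (fun y' => ψ (t, x, y')) y

/-- `i ∂ₜ u + g u + u gᵀ = f` in the sense of distributions on `(0,T) × ℝ³ × ℝ³`. -/
def DistribS (T : ℝ) (v : E3 → ℝ) (φ : ℝ → E3 → ℂ) (u f : ℝ → Ker) : Prop :=
  ∀ ψ : ℝ × E3 × E3 → ℂ, IsTest T ψ →
    ∫ t, (∫ z : E3 × E3,
        (u t z * (-Complex.I * dt ψ t z.1 z.2 - lapX ψ t z.1 z.2 - lapY ψ t z.1 z.2)
          + (gLeft v φ t (u t) z.1 z.2 + gTransposeRight v φ t (u t) z.1 z.2)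
            * ψ (t, z.1, z.2))) ∂(timeMeasure T)
      = ∫ t, (∫ z : E3 × E3, f t z * ψ (t, z.1, z.2)) ∂(timeMeasure T)

/-- `i ∂ₜ a + [g, a] = f` in the sense of distributions on `(0,T) × ℝ³ × ℝ³`. -/
def DistribW (T : ℝ) (v : E3 → ℝ) (φ : ℝ → E3 → ℂ) (a f : ℝ → Ker) : Prop :=
  ∀ ψ : ℝ × E3 × E3 → ℂ, IsTest T ψ →
    ∫ t, (∫ z : E3 × E3,
        (a t z * (-Complex.I * dt ψ t z.1 z.2 - lapX ψ t z.1 z.2 + lapY ψ t z.1 z.2)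
          + (gLeft v φ t (a t) z.1 z.2 - gRight v φ t (a t) z.1 z.2)
            * ψ (t, z.1, z.2))) ∂(timeMeasure T)
      = ∫ t, (∫ z : E3 × E3, f t z * ψ (t, z.1, z.2)) ∂(timeMeasure T)

/-- The operator family `A` is given by the kernels `k ∈ L^e([0,T]) L²(dx dy)`. -/
def HasKernels (e : ℝ≥0∞) (T : ℝ) (A : ℝ → Op) (k : ℝ → Ker) : Prop :=
  MemLp k e (timeMeasure T) ∧ ∀ᵐ t ∂(timeMeasure T), op (k t) = A t

/-- `S(u) = A`, where `A ∈ L¹([0,T]) L²(dx dy)`. -/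
def EqS (T : ℝ) (v : E3 → ℝ) (φ : ℝ → E3 → ℂ) (u : ℝ → Ker) (A : ℝ → Op) : Prop :=
  ∃ f : ℝ → Ker, HasKernels 1 T A f ∧ DistribS T v φ u f

/-- `W(B) = A`, where `B ∈ L^∞([0,T]) L²(dx dy)` and `A ∈ L¹([0,T]) L²(dx dy)`. -/
def EqW (T : ℝ) (v : E3 → ℝ) (φ : ℝ → E3 → ℂ) (B A : ℝ → Op) : Prop :=
  ∃ b f : ℝ → Ker, HasKernels ∞ T B b ∧ HasKernels 1 T A f ∧ DistribW T v φ b f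

/-! ### The nonlinear expressions at a fixed time; `star` of a kernel is its complex conjugate -/

/-- `q = u ū`. -/
def qOp (u : Ker) : Op := op u * op (star u)

/-- `1 + p = √(1 + u ū)`. -/
def onePlusP (u : Ker) : Op := posSqrt (1 + qOp u)

def pOp (u : Ker) : Op := onePlusP u - 1

/-- `r = (1 + p)⁻¹`. -/
def rOp (u : Ker) : Op := Ring.inverse (onePlusP u)

/-- `F = m ū (1 + p) - (1 + p) u m̄`. -/
def FOp (u m : Ker) : Op :=
  op m * op (star u) * onePlusP u - onePlusP u * op u * op (star m)

/-- `γ : [0,1] → ℂ` is a closed piecewise `C¹` curve in the domain `ℂ \ (-∞,-1]` of the principal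
branch of `√(1+z)`, which avoids the set `σ` and winds once counterclockwise around each of its
points. -/
structure IsContourAround (γ : ℝ → ℂ) (σ : Set ℂ) : Prop where
  continuousOn : ContinuousOn γ (Icc 0 1)
  closed : γ 0 = γ 1
  piecewise : ∃ B : Finset ℝ, ∀ a b : ℝ, 0 ≤ a → a < b → b ≤ 1 → (∀ s ∈ B, s ∉ Ioo a b) →
    ContDiffOn ℝ 1 γ (Icc a b)
  mem_slitPlane : ∀ s ∈ Icc (0 : ℝ) 1, 1 + γ s ∈ Complex.slitPlane
  avoids : ∀ s ∈ Icc (0 : ℝ) 1, γ s ∉ σ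
  winding : ∀ l ∈ σ, ∫ s in (0 : ℝ)..1, deriv γ s / (γ s - l) = 2 * Real.pi * Complex.I

/-- `(2πi)⁻¹ ∫_γ (q - z)⁻¹ F (q - z)⁻¹ √(1+z) dz`. -/
def contourW (γ : ℝ → ℂ) (q F : Op) : Op :=
  (2 * Real.pi * Complex.I)⁻¹ • ∫ s in (0 : ℝ)..1,
    (deriv γ s * (1 + γ s) ^ (1 / 2 : ℂ)) •
      (Ring.inverse (q - algebraMap ℂ Op (γ s)) * F * Ring.inverse (q - algebraMap ℂ Op (γ s)))

/-- `(1 + p) m + (P + u m̄) r u`. -/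
def quasilinearRHS (u m : Ker) (P : Op) : Op :=
  onePlusP u * op m + (P + op u * op (star m)) * rOp u * op u

/-- `(1 + p) m + ½ [P, r] u + ½ (r m ū + u m̄ r) u`. -/
def commutatorRHS (u m : Ker) (P : Op) : Op :=
  onePlusP u * op m + (1 / 2 : ℂ) • ((P * rOp u - rOp u * P) * op u)
    + (1 / 2 : ℂ) • ((rOp u * op m * op (star u) + op u * op (star m) * rOp u) * op u)

/-! ### The equations -/

section Equations

variable (T : ℝ) (v : E3 → ℝ) (φ : ℝ → E3 → ℂ)

/-- `S(u) = (1 + p) m + (W(p) + u m̄) r u`. -/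
def QuasilinearEq (u : ℝ → Ker) : Prop :=
  ∃ P : ℝ → Op, EqW T v φ (fun t => pOp (u t)) P ∧
    EqS T v φ u fun t => quasilinearRHS (u t) (mKer v φ t) (P t)

/-- `S(u) = (1 + p) m + ½ [W(p), r] u + ½ (r m ū + u m̄ r) u`. -/
def CommutatorEq (u : ℝ → Ker) : Prop :=
  ∃ P : ℝ → Op, EqW T v φ (fun t => pOp (u t)) P ∧
    EqS T v φ u fun t => commutatorRHS (u t) (mKer v φ t) (P t)

/-- The contour integral that replaces `W(p)`. -/
def WGamma (u : ℝ → Ker) (Γ : ℝ → ℝ → ℂ) (t : ℝ) : Op :=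
  contourW (Γ t) (qOp (u t)) (FOp (u t) (mKer v φ t))

/-- `S(u) = (1 + p) m + ½ [W, r] u + ½ (r m ū + u m̄ r) u`. -/
def SemilinearEq (u : ℝ → Ker) (Γ : ℝ → ℝ → ℂ) : Prop :=
  EqS T v φ u fun t => commutatorRHS (u t) (mKer v φ t) (WGamma v φ u Γ t)

/-- `sh(k) = k + k k̄ k / 3! + ⋯`. -/
def sh (k : Ker) : Op :=
  ∑' n : ℕ, ((Nat.factorial (2 * n + 1) : ℂ)⁻¹) • ((op k * op (star k)) ^ n * op k)

/-- `ch(k) = 1 + k k̄ / 2! + ⋯`. -/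
def ch (k : Ker) : Op :=
  ∑' n : ℕ, ((Nat.factorial (2 * n) : ℂ)⁻¹) • (op k * op (star k)) ^ n

/-- The equation `S(u) - (1 + p) m = (W(p) + u m̄) (1 + p)⁻¹ u` for the pair excitation kernel `k`,
where `1 + p = ch(k)` and `u` is the kernel of `sh(k)`. -/
def PairEq (k u : ℝ → Ker) : Prop :=
  ∃ P A : ℝ → Op, EqW T v φ (fun t => ch (k t) - 1) P ∧ EqS T v φ u A ∧
    ∀ᵐ t ∂(timeMeasure T), A t - ch (k t) * op (mKer v φ t)
      = (P t + op (u t) * op (star (mKer v φ t))) * Ring.inverse (ch (k t)) * op (u t)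

end Equations

end

end PairExcitation

open PairExcitation

namespace PairExcitation

noncomputable section

open Filter Topology TopologicalSpace

/-! ### The Hilbert-Schmidt calculus of kernels -/

/-! Write c = 1 + p, r = c⁻¹, f = S(u), x = W(p), so that c ≥ 1 and c² = 1 + uū. Two differential
identities, and algebra, give the theorem. Since g is self-adjoint, W is a derivation and W(uū) = fū
- u f̄ (`SEq.wEq_mul_star`); here f is symmetric because u is, so f̄ = f* as operators.
Differentiating c² = 1 + q then shows that x solves the Sylvester equation cx + xc = W(q)
(`WEq.sqrt`). As c ≥ 1, such an equation has at most one solution (`sylvester_unique`), and the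
solution is skew-adjoint when the right-hand side is (`sylvester_star`).

Algebra. If f is the right-hand side of (1), then r uū = c - r turns fū - u f̄ = cx + xc into rx +
xr = r m ū - u m̄ r, and multiplying by c from both sides gives cx + xc = F
(`commutator_of_quasilinear`). Hence W(q) = F. Under this relation (x + u m̄) r equals ½[x, r] + ½(r
m ū + u m̄ r) (`quasilinear_eq_commutator`), which is (2). Conversely, under (2) the defect z = rx +
xr - (r m ū - u m̄ r) satisfies z c² + c² z = 0 (`commutator_balance`), so z = 0 by uniqueness for
c², and (1) returns. For (3), the contour integral is the solution Y of cY + Yc = F (`contourW_eq`).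
The same computation with Y in place of x gives fū - u f̄ = cY + Yc, while the chain rule gives fū -
u f̄ = cx + xc; so x = Y and (3) is (2). The integrability of W(p) comes from the chain rule and
need not be assumed in (3).

The contour integral. The orthogonal complement, in the Hilbert space of kernels, of all commutators
[p, Y] consists of kernels commuting with p. On commutators the integral reduces to the functional
calculus of √(1+z)(q-z)⁻¹, on the commutant to that of √(1+z)(q-z)⁻²; both scalar integrals have
explicit primitives in √(1+z), apart from a winding number term.

Analysis. The identities must hold for weak solutions, for which Δu is not defined. For the product
rule (`TensEq.mul`) the product ab is paired with an elementary tensor of smooth functions; this is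
an L² pairing, in the middle variable, of two curves solving dual equations. After mollification the
generator is bounded and its two contributions cancel exactly, so the limit involves only the
sources (`Regularizer.weakDeriv_bpair`). For the square root, p is the Hilbert-Schmidt limit of the
iteration p ↦ p + α(q - 2p - p²) started at 0. Each iterate is a polynomial in q, so the product
rule gives W of it as the formally differentiated iterate (`WEq.iterates`), and these converge to
the solution of the Sylvester equation. The step size α is uniform in t because u is essentially
bounded.

The statement about the pair excitation kernel only needs ch(k) = √(1 + sh(k) sh(k)*), proved in
`sqrt_one_add_sinh_sq`. -/

theorem op_coe (k : Ker) (f : L2) : op k f =ᵐ[volume] fun x => ∫ y, k (x, y) * f y :=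
  (Ker.memLp_apply k f).coeFn_toLp

theorem Ker.ae_ae {P : E3 × E3 → Prop} (h : ∀ᵐ z : E3 × E3, P z) :
    ∀ᵐ x : E3, ∀ᵐ y : E3, P (x, y) :=
  Measure.ae_ae_of_ae_prod (μ := (volume : Measure E3)) (ν := (volume : Measure E3)) h

theorem ae_swap {P : E3 × E3 → Prop} (h : ∀ᵐ z : E3 × E3, P z) : ∀ᵐ z : E3 × E3, P z.swap :=
  (Measure.measurePreserving_swap (μ := (volume : Measure E3))
    (ν := (volume : Measure E3))).quasiMeasurePreserving.ae h

theorem op_add (k l : Ker) : op (k + l) = op k + op l := by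
  ext1 f
  refine Lp.ext ?_
  filter_upwards [op_coe (k + l) f, op_coe k f, op_coe l f, Lp.coeFn_add (op k f) (op l f),
    Ker.memLp_slice k, Ker.memLp_slice l, Ker.ae_ae (Lp.coeFn_add k l)] with x h1 h2 h3 h4 h5 h6 h7
  have hk : Integrable (fun y => k (x, y) * f y) volume := h5.integrable_mul (Lp.memLp f)
  have hl : Integrable (fun y => l (x, y) * f y) volume := h6.integrable_mul (Lp.memLp f)
  rw [add_apply, h4, Pi.add_apply, h1, h2, h3, ← integral_add hk hl]
  refine integral_congr_ae ?_
  filter_upwards [h7] with y hy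
  rw [hy, Pi.add_apply, add_mul]

theorem op_smul (c : ℂ) (k : Ker) : op (c • k) = c • op k := by
  ext1 f
  refine Lp.ext ?_
  filter_upwards [op_coe (c • k) f, op_coe k f, Lp.coeFn_smul c (op k f),
    Ker.ae_ae (Lp.coeFn_smul c k)] with x h1 h2 h4 h7
  rw [smul_apply, h4, Pi.smul_apply, h1, h2, smul_eq_mul,
    ← integral_const_mul]
  refine integral_congr_ae ?_
  filter_upwards [h7] with y hy
  rw [hy, Pi.smul_apply, smul_eq_mul, mul_assoc]

theorem norm_op_le (k : Ker) : ‖op k‖ ≤ ‖k‖ :=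
  LinearMap.mkContinuous_norm_le _ (norm_nonneg _) _

/-- `op` as a continuous linear map. -/
def opL : Ker →L[ℂ] Op :=
  LinearMap.mkContinuous ⟨⟨op, op_add⟩, op_smul⟩ 1 fun k => by
    simpa using norm_op_le k

@[simp] theorem opL_apply (k : Ker) : opL k = op k := rfl

theorem op_sub (k l : Ker) : op (k - l) = op k - op l := map_sub opL k l
theorem op_zero : op 0 = 0 := map_zero opL

/-- The bilinear pairing `∫ f g` on a complex `L²` space. -/
def bpair {α : Type*} [MeasureSpace α] :
    Lp ℂ 2 (volume : Measure α) →L[ℂ] Lp ℂ 2 (volume : Measure α) →L[ℂ] ℂ :=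
  (ContinuousLinearMap.mul ℂ ℂ).lpPairing volume 2 2

theorem bpair_apply {α : Type*} [MeasureSpace α] (f g : Lp ℂ 2 (volume : Measure α)) :
    bpair f g = ∫ x, f x * g x := by
  simp [bpair, ContinuousLinearMap.lpPairing_eq_integral]

theorem bpair_comm {α : Type*} [MeasureSpace α] (f g : Lp ℂ 2 (volume : Measure α)) :
    bpair f g = bpair g f := by
  simp [bpair_apply, mul_comm]

theorem bpair_star {α : Type*} [MeasureSpace α] (f g : Lp ℂ 2 (volume : Measure α)) :
    bpair (star f) g = inner ℂ f g := by
  rw [bpair_apply, L2.inner_def]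
  refine integral_congr_ae ?_
  filter_upwards [Lp.coeFn_star f] with x hx
  rw [hx, RCLike.inner_apply, Pi.star_apply, mul_comm]; rfl

theorem norm_star_Lp {α : Type*} [MeasureSpace α] (f : Lp ℂ 2 (volume : Measure α)) :
    ‖star f‖ = ‖f‖ := by
  rw [Lp.norm_def, Lp.norm_def]
  congr 1
  refine eLpNorm_congr_norm_ae ?_
  filter_upwards [Lp.coeFn_star f] with x hx
  rw [hx, Pi.star_apply, norm_star]

theorem star_add_Lp {α : Type*} [MeasureSpace α] (f g : Lp ℂ 2 (volume : Measure α)) :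
    star (f + g) = star f + star g := by
  refine Lp.ext ?_
  filter_upwards [Lp.coeFn_star (f + g), Lp.coeFn_star f, Lp.coeFn_star g, Lp.coeFn_add f g,
    Lp.coeFn_add (star f) (star g)] with x h1 h2 h3 h4 h5
  rw [h1, h5, Pi.star_apply, h4, Pi.add_apply, Pi.add_apply, h2, h3, star_add]
  rfl

theorem star_smul_Lp {α : Type*} [MeasureSpace α] (c : ℂ) (f : Lp ℂ 2 (volume : Measure α)) :
    star (c • f) = star c • star f := by
  refine Lp.ext ?_
  filter_upwards [Lp.coeFn_star (c • f), Lp.coeFn_star f, Lp.coeFn_smul c f,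
    Lp.coeFn_smul (star c) (star f)] with x h1 h2 h3 h4
  rw [h1, h4, Pi.star_apply, h3, Pi.smul_apply, Pi.smul_apply, h2, star_smul]
  rfl

/-- Complex conjugation on a complex `L²` space. -/
def conjL {α : Type*} [MeasureSpace α] :
    Lp ℂ 2 (volume : Measure α) →ₗᵢ⋆[ℂ] Lp ℂ 2 (volume : Measure α) where
  toFun := star
  map_add' := star_add_Lp
  map_smul' c f := star_smul_Lp c f
  norm_map' := norm_star_Lp

@[simp] theorem conjL_apply {α : Type*} [MeasureSpace α] (f : Lp ℂ 2 (volume : Measure α)) :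
    conjL f = star f := rfl

theorem eq_zero_of_bpair {α : Type*} [MeasureSpace α] {f : Lp ℂ 2 (volume : Measure α)}
    (h : ∀ g, bpair g f = 0) : f = 0 := by
  rw [← inner_self_eq_zero (𝕜 := ℂ), ← bpair_star]
  exact h _

instance : SecondCountableTopology L2 :=
  haveI : Fact ((2 : ℝ≥0∞) ≠ ∞) := ⟨by norm_num⟩
  inferInstance

instance : SecondCountableTopology Ker :=
  haveI : SFinite (volume : Measure (E3 × E3)) :=
    inferInstanceAs (SFinite ((volume : Measure E3).prod (volume : Measure E3)))
  haveI : Fact ((2 : ℝ≥0∞) ≠ ∞) := ⟨by norm_num⟩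
  inferInstance

/-- A countable dense family of test functions gives a single null set of x off which the slice k(x,
·) annihilates the whole family, hence vanishes. Injectivity is what allows kernel identities to be
checked as operator identities throughout. -/
theorem op_injective : Function.Injective op := by
  suffices h : ∀ k : Ker, op k = 0 → k = 0 by
    intro k l hkl
    rw [← sub_eq_zero]
    exact h _ (by rw [op_sub, hkl, sub_self])
  intro k hk
  have h1 : ∀ᵐ x : E3, ∀ n, ∫ y, k (x, y) * TopologicalSpace.denseSeq L2 n y = 0 := by
    rw [ae_all_iff]
    intro n
    have := op_coe k (TopologicalSpace.denseSeq L2 n)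
    rw [hk] at this
    filter_upwards [this, Lp.coeFn_zero ℂ 2 (volume : Measure E3)] with x hx h0
    rw [← hx]
    exact h0
  have h2 : ∀ᵐ x : E3, ∀ᵐ y : E3, k (x, y) = 0 := by
    filter_upwards [h1, Ker.memLp_slice k] with x hx hm
    have h3 : ∀ g : L2, bpair g (hm.toLp _) = 0 := by
      have hc : Continuous fun g : L2 => bpair g (hm.toLp _) :=
        (bpair.flip (hm.toLp _)).continuous
      refine fun g => congrFun (hc.ext_on (TopologicalSpace.denseRange_denseSeq L2)
        continuous_const ?_) g
      rintro _ ⟨n, rfl⟩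
      simp only
      rw [bpair_comm, bpair_apply, ← hx n]
      refine integral_congr_ae ?_
      filter_upwards [hm.coeFn_toLp] with y hy
      rw [hy]
    have h4 := eq_zero_of_bpair h3
    have h5 := hm.coeFn_toLp
    rw [h4] at h5
    filter_upwards [h5, Lp.coeFn_zero ℂ 2 (volume : Measure E3)] with y h6 h7
    rw [← h6, h7]; rfl
  have hm : AEStronglyMeasurable k ((volume : Measure E3).prod (volume : Measure E3)) :=
    Lp.aestronglyMeasurable k
  have h3 : ∫⁻ x, ∫⁻ y, ‖k (x, y)‖ₑ ^ (2 : ℝ) = 0 := by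
    rw [lintegral_congr_ae (g := fun _ => 0), lintegral_zero]
    filter_upwards [h2] with x hx
    rw [lintegral_congr_ae (g := fun _ => 0), lintegral_zero]
    filter_upwards [hx] with y hy
    simp [hy]
  rw [Ker.lintegral_slice] at h3
  simpa using h3

/-! #### Elementary tensors -/

theorem memLp_tens (f g : L2) :
    MemLp (fun z : E3 × E3 => f z.1 * g z.2) 2 (volume : Measure (E3 × E3)) := by
  have hf : AEStronglyMeasurable f volume := Lp.aestronglyMeasurable f
  have hg : AEStronglyMeasurable g volume := Lp.aestronglyMeasurable g
  have hm : AEStronglyMeasurable (fun z : E3 × E3 => f z.1 * g z.2) volume :=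
    hf.comp_fst.mul hg.comp_snd
  rw [memLp_two_iff_integrable_sq_norm hm]
  have hf2 := (memLp_two_iff_integrable_sq_norm hf).1 (Lp.memLp f)
  have hg2 := (memLp_two_iff_integrable_sq_norm hg).1 (Lp.memLp g)
  refine (hf2.mul_prod hg2).congr (Eventually.of_forall fun z => ?_)
  simp [mul_pow]

/-- The kernel `f(x) g(y)`. -/
def tens (f g : L2) : Ker := (memLp_tens f g).toLp _

theorem tens_coe (f g : L2) : tens f g =ᵐ[volume] fun z => f z.1 * g z.2 :=
  (memLp_tens f g).coeFn_toLp

theorem norm_tens (f g : L2) : ‖tens f g‖ = ‖f‖ * ‖g‖ := by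
  have key : ∀ {α : Type} [MeasureSpace α] (k : Lp ℂ 2 (volume : Measure α)),
      ‖k‖ ^ 2 = ∫ x, ‖k x‖ ^ 2 := by
    intro α _ k
    have := inner_self_eq_norm_sq_to_K (𝕜 := ℂ) k
    rw [L2.inner_def] at this
    have h2 : (∫ x, inner ℂ (k x) (k x)) = ((∫ x, ‖k x‖ ^ 2 : ℝ) : ℂ) := by
      rw [← integral_complex_ofReal]
      refine integral_congr_ae (Eventually.of_forall fun x => ?_)
      simp only [inner_self_eq_norm_sq_to_K]
      push_cast; rfl
    rw [h2] at this
    exact Complex.ofReal_injective (by push_cast; exact this.symm)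
  have h : ‖tens f g‖ ^ 2 = (‖f‖ * ‖g‖) ^ 2 := by
    rw [key, mul_pow, key f, key g, ← integral_prod_mul]
    refine integral_congr_ae ?_
    filter_upwards [tens_coe f g] with z hz
    rw [hz, norm_mul, mul_pow]
  exact (sq_eq_sq₀ (norm_nonneg _) (by positivity)).1 h

theorem quasi_fst : Measure.QuasiMeasurePreserving (Prod.fst : E3 × E3 → E3) volume volume :=
  Measure.quasiMeasurePreserving_fst
theorem quasi_snd : Measure.QuasiMeasurePreserving (Prod.snd : E3 × E3 → E3) volume volume :=
  Measure.quasiMeasurePreserving_snd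

/-- `tens` as a continuous bilinear map. -/
def tensL : L2 →L[ℂ] L2 →L[ℂ] Ker :=
  LinearMap.mkContinuous₂ (LinearMap.mk₂ ℂ tens
    (by
      intro f f' g
      refine Lp.ext ?_
      filter_upwards [tens_coe (f + f') g, tens_coe f g, tens_coe f' g,
        Lp.coeFn_add (tens f g) (tens f' g), quasi_fst.ae (Lp.coeFn_add f f')] with z h1 h2 h3 h4 h5
      rw [h1, h4, Pi.add_apply, h2, h3, h5, Pi.add_apply, add_mul])
    (by
      intro c f g
      refine Lp.ext ?_
      filter_upwards [tens_coe (c • f) g, tens_coe f g,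
        Lp.coeFn_smul c (tens f g), quasi_fst.ae (Lp.coeFn_smul c f)] with z h1 h2 h4 h5
      rw [h1, h4, Pi.smul_apply, h2, h5, Pi.smul_apply, smul_eq_mul, smul_eq_mul, mul_assoc])
    (by
      intro f g g'
      refine Lp.ext ?_
      filter_upwards [tens_coe f (g + g'), tens_coe f g, tens_coe f g',
        Lp.coeFn_add (tens f g) (tens f g'), quasi_snd.ae (Lp.coeFn_add g g')] with z h1 h2 h3 h4 h5
      rw [h1, h4, Pi.add_apply, h2, h3, h5, Pi.add_apply, mul_add])
    (by
      intro c f g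
      refine Lp.ext ?_
      filter_upwards [tens_coe f (c • g), tens_coe f g,
        Lp.coeFn_smul c (tens f g), quasi_snd.ae (Lp.coeFn_smul c g)] with z h1 h2 h4 h5
      rw [h1, h4, Pi.smul_apply, h2, h5, Pi.smul_apply, smul_eq_mul, smul_eq_mul]
      ring))
    1 (by
      intro f g
      rw [one_mul]
      exact (norm_tens f g).le)

@[simp] theorem tensL_apply (f g : L2) : tensL f g = tens f g := rfl

theorem op_tens (f g h : L2) : op (tens f g) h = bpair g h • f := by
  refine Lp.ext ?_
  filter_upwards [op_coe (tens f g) h, Lp.coeFn_smul (bpair g h) f,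
    Ker.ae_ae (tens_coe f g)] with x h1 h2 h3
  rw [h1, h2, Pi.smul_apply, bpair_apply, smul_eq_mul, mul_comm, ← integral_const_mul]
  refine integral_congr_ae ?_
  filter_upwards [h3] with y hy
  rw [hy]; ring

theorem bpair_tens (k : Ker) (f g : L2) : bpair k (tens f g) = bpair f (op k g) := by
  rw [bpair_apply, bpair_apply]
  have hi : Integrable (fun z : E3 × E3 => k z * (f z.1 * g z.2)) volume :=
    (Lp.memLp k).integrable_mul (memLp_tens f g)
  have h1 : ∫ z : E3 × E3, k z * tens f g z = ∫ z : E3 × E3, k z * (f z.1 * g z.2) := by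
    refine integral_congr_ae ?_
    filter_upwards [tens_coe f g] with z hz
    rw [hz]
  rw [h1]
  refine (integral_prod (μ := (volume : Measure E3)) (ν := (volume : Measure E3)) _ hi).trans ?_
  refine integral_congr_ae ?_
  filter_upwards [op_coe k g] with x hx
  rw [hx, ← integral_const_mul]
  refine integral_congr_ae (Eventually.of_forall fun y => ?_)
  simp only; ring

/-- Density is used in one factor at a time, so a dense set of one-variable functions suffices; no
density of their tensors in the kernel space has to be known beforehand. -/
theorem eq_zero_of_bpair_tens {S : Set L2} (hS : Dense S) {k : Ker}
    (h : ∀ f ∈ S, ∀ g ∈ S, bpair k (tens f g) = 0) : k = 0 := by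
  have h1 : ∀ f ∈ S, ∀ g, bpair k (tens f g) = 0 := fun f hf g =>
    congrFun (((bpair k).comp (tensL f)).continuous.ext_on hS
      (continuous_const (y := (0 : ℂ))) (h f hf)) g
  have h2 : ∀ f g, bpair k (tens f g) = 0 := fun f g =>
    congrFun (((bpair k).comp (tensL.flip g)).continuous.ext_on hS
      (continuous_const (y := (0 : ℂ))) (fun f hf => h1 f hf g)) f
  apply op_injective
  rw [op_zero]
  ext1 g
  refine eq_zero_of_bpair fun f => ?_
  rw [← bpair_tens, h2]

/-- Two continuous linear maps on kernels agree if they agree on elementary tensors with factors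
in a dense set. -/
theorem Ker.clm_ext_tens {F : Type*} [NormedAddCommGroup F] [NormedSpace ℂ F] {S : Set L2}
    (hS : Dense S) {A B : Ker →L[ℂ] F} (h : ∀ f ∈ S, ∀ g ∈ S, A (tens f g) = B (tens f g)) :
    A = B := by
  have hd : (Submodule.span ℂ {k | ∃ f ∈ S, ∃ g ∈ S, k = tens f g}).topologicalClosure = ⊤ := by
    rw [Submodule.topologicalClosure_eq_top_iff, Submodule.eq_bot_iff]
    intro k hk
    rw [Submodule.mem_orthogonal'] at hk
    have : star k = 0 := eq_zero_of_bpair_tens hS fun f hf g hg => by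
      rw [bpair_star]
      exact hk _ (Submodule.subset_span ⟨f, hf, g, hg, rfl⟩)
    rw [← star_star k, this]
    exact map_zero (conjL (α := E3 × E3))
  have hd' : Dense (Submodule.span ℂ {k | ∃ f ∈ S, ∃ g ∈ S, k = tens f g} : Set Ker) :=
    Submodule.dense_iff_topologicalClosure_eq_top.2 hd
  refine ContinuousLinearMap.ext_on hd' ?_
  rintro _ ⟨f, hf, g, hg, rfl⟩
  exact h f hf g hg

theorem Ker.clm_ext {F : Type*} [NormedAddCommGroup F] [NormedSpace ℂ F]
    {A B : Ker →L[ℂ] F} (h : ∀ f g, A (tens f g) = B (tens f g)) : A = B :=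
  Ker.clm_ext_tens dense_univ fun f _ g _ => h f g

/-! #### Transposition and adjoints of kernels -/

theorem measurePreserving_swap_E3 :
    MeasurePreserving (Prod.swap : E3 × E3 → E3 × E3) volume volume :=
  Measure.measurePreserving_swap (μ := (volume : Measure E3)) (ν := (volume : Measure E3))

/-- The kernel `k(y,x)`. -/
def tr : Ker →ₗᵢ[ℂ] Ker := Lp.compMeasurePreservingₗᵢ ℂ Prod.swap measurePreserving_swap_E3

theorem tr_coe (k : Ker) : tr k =ᵐ[volume] fun z => k z.swap :=
  Lp.coeFn_compMeasurePreserving k measurePreserving_swap_E3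

@[simp] theorem tr_tr (k : Ker) : tr (tr k) = k := by
  refine Lp.ext ?_
  filter_upwards [tr_coe (tr k), ae_swap (tr_coe k)] with z h1 h2
  rw [h1, h2, Prod.swap_swap]

theorem tr_star (k : Ker) : tr (star k) = star (tr k) := by
  refine Lp.ext ?_
  filter_upwards [tr_coe (star k), tr_coe k, Lp.coeFn_star (tr k),
    ae_swap (Lp.coeFn_star k)] with z h1 h2 h3 h4
  rw [h1, h3, h4, Pi.star_apply, Pi.star_apply, h2]

theorem tr_tens (f g : L2) : tr (tens f g) = tens g f := by
  refine Lp.ext ?_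
  filter_upwards [tr_coe (tens f g), tens_coe g f, ae_swap (tens_coe f g)] with z h1 h2 h3
  rw [h1, h2, h3, Prod.fst_swap, Prod.snd_swap, mul_comm]

theorem bpair_tr (k l : Ker) : bpair (tr k) l = bpair k (tr l) := by
  rw [bpair_apply, bpair_apply]
  rw [← measurePreserving_swap_E3.integral_comp MeasurableEquiv.prodComm.measurableEmbedding
    (fun z => k z * tr l z)]
  refine integral_congr_ae ?_
  filter_upwards [tr_coe k, ae_swap (tr_coe l)] with z h1 h2
  rw [h1, h2, Prod.swap_swap]

theorem isSymm_iff {k : Ker} : IsSymm k ↔ tr k = k := by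
  constructor
  · intro h
    refine Lp.ext ?_
    filter_upwards [tr_coe k, h] with z h1 h2
    rw [h1, h2]
  · intro h
    have := tr_coe k
    rw [h] at this
    filter_upwards [this] with z hz
    exact hz.symm

theorem bpair_op (k : Ker) (f g : L2) : bpair f (op k g) = bpair (op (tr k) f) g := by
  rw [← bpair_tens, bpair_comm (op (tr k) f), ← bpair_tens, bpair_tr, tr_tens]

theorem star_op (k : Ker) (f : L2) : star (op k f) = op (star k) (star f) := by
  refine Lp.ext ?_
  filter_upwards [Lp.coeFn_star (op k f), op_coe k f, op_coe (star k) (star f),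
    Ker.ae_ae (Lp.coeFn_star k)] with x h1 h2 h3 h4
  rw [h1, h3, Pi.star_apply, h2]
  refine (integral_conj (f := fun y => k (x, y) * f y)).symm.trans ?_
  refine integral_congr_ae ?_
  filter_upwards [h4, Lp.coeFn_star f] with y h5 h6
  rw [h5, h6, Pi.star_apply, Pi.star_apply, map_mul]; rfl

theorem op_adjoint (k : Ker) : op (star (tr k)) = star (op k) := by
  rw [ContinuousLinearMap.star_eq_adjoint, ContinuousLinearMap.eq_adjoint_iff]
  intro f g
  rw [← bpair_star, ← bpair_star, star_op, star_star, ← bpair_op]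

/-! #### Composition of kernels -/

theorem Ker.memLp_slice_left (k : Ker) :
    ∀ᵐ y : E3, MemLp (fun x => k (x, y)) 2 (volume : Measure E3) := by
  filter_upwards [Ker.memLp_slice (tr k), Ker.ae_ae (tr_coe k)] with y h1 h2
  exact h1.ae_eq h2

theorem Ker.lintegral_slice_left (k : Ker) :
    ∫⁻ y, ∫⁻ x, ‖k (x, y)‖ₑ ^ (2 : ℝ) = ‖k‖ₑ ^ (2 : ℝ) := by
  rw [← Ker.lintegral_slice]
  refine lintegral_lintegral_swap ?_
  exact (((Lp.stronglyMeasurable k).comp_measurable measurable_swap).enorm.pow_const _).aemeasurable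

/-- The kernel `∫ a(x,w) b(w,y) dw` of a composition. -/
def compFun (a b : Ker) (z : E3 × E3) : ℂ := ∫ w, a (z.1, w) * b (w, z.2)

/-- Cauchy-Schwarz in the middle variable bounds the square by a function of x times a function of
y, and Tonelli factors the double integral. -/
theorem eLpNorm_compFun_le (a b : Ker) : eLpNorm (compFun a b) 2 volume ≤ ‖a‖ₑ * ‖b‖ₑ := by
  have ha : Measurable fun x => ∫⁻ w, ‖a (x, w)‖ₑ ^ (2 : ℝ) :=
    ((Lp.stronglyMeasurable a).enorm.pow_const _).lintegral_prod_right'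
  have hb : Measurable fun y => ∫⁻ w, ‖b (w, y)‖ₑ ^ (2 : ℝ) :=
    (((Lp.stronglyMeasurable b).comp_measurable measurable_swap).enorm.pow_const
      _).lintegral_prod_right'
  have h1 : ∫⁻ z : E3 × E3, ‖compFun a b z‖ₑ ^ (2 : ℝ) ≤ (‖a‖ₑ * ‖b‖ₑ) ^ (2 : ℝ) := by
    rw [ENNReal.mul_rpow_of_nonneg _ _ (by norm_num), ← Ker.lintegral_slice a,
      ← Ker.lintegral_slice_left b]
    refine le_trans (lintegral_mono fun z => ?_) (lintegral_prod_mul ha.aemeasurable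
      hb.aemeasurable).le
    refine Ker.enorm_integral_sq_le _ _ ?_ ?_
    · exact ((Lp.stronglyMeasurable a).comp_measurable measurable_prodMk_left).aestronglyMeasurable
    · exact ((Lp.stronglyMeasurable b).comp_measurable measurable_prodMk_right).aestronglyMeasurable
  rw [eLpNorm_eq_lintegral_rpow_enorm_toReal (by norm_num) (by norm_num)]
  refine (ENNReal.rpow_le_rpow h1 (by norm_num)).trans (le_of_eq ?_)
  rw [← ENNReal.rpow_mul]
  norm_num

theorem memLp_compFun (a b : Ker) : MemLp (compFun a b) 2 volume := by
  refine ⟨StronglyMeasurable.aestronglyMeasurable ?_, (eLpNorm_compFun_le a b).trans_lt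
    (ENNReal.mul_lt_top enorm_lt_top enorm_lt_top)⟩
  refine StronglyMeasurable.integral_prod_right'
    (f := fun p : (E3 × E3) × E3 => a (p.1.1, p.2) * b (p.2, p.1.2)) ?_
  exact ((Lp.stronglyMeasurable a).comp_measurable (by fun_prop)).mul
    ((Lp.stronglyMeasurable b).comp_measurable (by fun_prop))

/-- Composition of kernels. -/
def kmul (a b : Ker) : Ker := (memLp_compFun a b).toLp _

theorem kmul_coe (a b : Ker) : kmul a b =ᵐ[volume] compFun a b := (memLp_compFun a b).coeFn_toLp

theorem norm_kmul_le (a b : Ker) : ‖kmul a b‖ ≤ ‖a‖ * ‖b‖ := by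
  rw [kmul, Lp.norm_toLp]
  refine ENNReal.toReal_le_of_le_ofReal (by positivity) ?_
  rw [ENNReal.ofReal_mul (norm_nonneg _), ofReal_norm, ofReal_norm]
  exact eLpNorm_compFun_le a b

theorem op_kmul (a b : Ker) : op (kmul a b) = op a * op b := by
  ext1 f
  refine Lp.ext ?_
  filter_upwards [op_coe (kmul a b) f, op_coe a (op b f), Ker.ae_ae (kmul_coe a b),
    Ker.memLp_slice a] with x h1 h2 h3 h4
  rw [h1, mul_apply_eq_comp, h2]
  -- The Fubini hypothesis holds for almost every x: the integrand is the L² function b times the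
  -- elementary tensor of the slice a(x, ·) with f.
  have hi : Integrable (fun z : E3 × E3 => a (x, z.1) * b z * f z.2)
      ((volume : Measure E3).prod volume) := by
    have := (Lp.memLp b).integrable_mul (memLp_tens (h4.toLp _) f)
    refine this.congr ?_
    filter_upwards [quasi_fst.ae h4.coeFn_toLp] with z hz
    simp only [Pi.mul_apply]
    rw [hz]; ring
  calc ∫ y, kmul a b (x, y) * f y = ∫ y, ∫ w, a (x, w) * b (w, y) * f y := by
        refine integral_congr_ae ?_
        filter_upwards [h3] with y hy
        rw [hy, compFun, ← integral_mul_const]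
    _ = ∫ w, ∫ y, a (x, w) * b (w, y) * f y := (integral_integral_swap hi).symm
    _ = ∫ w, a (x, w) * op b f w := by
        refine integral_congr_ae ?_
        filter_upwards [op_coe b f] with w hw
        rw [hw, ← integral_const_mul]
        refine integral_congr_ae (Eventually.of_forall fun y => ?_)
        simp only; ring

/-- `kmul` as a continuous bilinear map. -/
def kmulL : Ker →L[ℂ] Ker →L[ℂ] Ker :=
  LinearMap.mkContinuous₂ (LinearMap.mk₂ ℂ kmul
    (fun a a' b => op_injective (by simp only [op_kmul, op_add, add_mul]))
    (fun c a b => op_injective (by simp only [op_kmul, op_smul, smul_mul_assoc]))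
    (fun a b b' => op_injective (by simp only [op_kmul, op_add, mul_add]))
    (fun c a b => op_injective (by simp only [op_kmul, op_smul, mul_smul_comm])))
    1 (fun a b => by rw [one_mul]; exact norm_kmul_le a b)

@[simp] theorem kmulL_apply (a b : Ker) : kmulL a b = kmul a b := rfl

theorem kmul_assoc (a b c : Ker) : kmul (kmul a b) c = kmul a (kmul b c) :=
  op_injective (by simp only [op_kmul, mul_assoc])

theorem kmul_add (a b c : Ker) : kmul a (b + c) = kmul a b + kmul a c := map_add (kmulL a) b c
theorem add_kmul (a b c : Ker) : kmul (a + b) c = kmul a c + kmul b c :=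
  map_add (kmulL.flip c) a b
theorem kmul_sub (a b c : Ker) : kmul a (b - c) = kmul a b - kmul a c := map_sub (kmulL a) b c
theorem sub_kmul (a b c : Ker) : kmul (a - b) c = kmul a c - kmul b c :=
  map_sub (kmulL.flip c) a b
theorem kmul_smul (c : ℂ) (a b : Ker) : kmul a (c • b) = c • kmul a b := map_smul (kmulL a) c b
theorem smul_kmul (c : ℂ) (a b : Ker) : kmul (c • a) b = c • kmul a b :=
  map_smul (kmulL.flip b) c a

theorem star_kmul (a b : Ker) : star (kmul a b) = kmul (star a) (star b) := by
  refine op_injective (ContinuousLinearMap.ext fun f => ?_)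
  rw [← star_star f, ← star_op, op_kmul, op_kmul, mul_apply_eq_comp,
    mul_apply_eq_comp, star_op, star_op]

theorem tr_kmul (a b : Ker) : tr (kmul a b) = kmul (tr b) (tr a) := by
  have h : star (tr (kmul a b)) = star (kmul (tr b) (tr a)) := by
    refine op_injective ?_
    rw [op_adjoint, star_kmul, op_kmul, op_kmul, star_mul, op_adjoint, op_adjoint]
  rw [← star_star (tr (kmul a b)), h, star_star]

theorem kmul_tens (a : Ker) (f g : L2) : kmul a (tens f g) = tens (op a f) g := by
  refine op_injective (ContinuousLinearMap.ext fun h => ?_)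
  rw [op_kmul, mul_apply_eq_comp, op_tens, op_tens, map_smul]

theorem tens_kmul (a : Ker) (f g : L2) : kmul (tens f g) a = tens f (op (tr a) g) := by
  refine op_injective (ContinuousLinearMap.ext fun h => ?_)
  rw [op_kmul, mul_apply_eq_comp, op_tens, op_tens, bpair_op]

theorem bpair_kmul_right (a b t : Ker) : bpair (kmul a b) t = bpair a (kmul t (tr b)) := by
  have h : bpair (kmul a b) = (bpair a).comp (kmulL.flip (tr b)) := by
    refine Ker.clm_ext fun f g => ?_
    change _ = bpair a (kmul (tens f g) (tr b))
    rw [tens_kmul, bpair_tens, bpair_tens, tr_tr, op_kmul]; rfl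
  rw [h]; rfl

theorem bpair_kmul_left (a b t : Ker) : bpair (kmul a b) t = bpair b (kmul (tr a) t) := by
  have h : bpair (kmul a b) = (bpair b).comp (kmulL (tr a)) := by
    refine Ker.clm_ext fun f g => ?_
    change _ = bpair b (kmul (tr a) (tens f g))
    rw [kmul_tens, bpair_tens, bpair_tens, op_kmul, mul_apply_eq_comp, bpair_op]
  rw [h]; rfl

/-! #### Operator norm bounds -/

/-- The squared Hilbert-Schmidt norm is the integral over y of the squared L² norms of the columns,
so an operator applied to each column costs only its operator norm. -/
theorem Ker.norm_le_of_slices {X Y : Ker} (A : Op)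
    (h : ∀ᵐ y : E3, ∀ f : L2, (f =ᵐ[volume] fun x => X (x, y)) → A f =ᵐ[volume] fun x => Y (x, y)) :
    ‖Y‖ ≤ ‖A‖ * ‖X‖ := by
  have key : ∀ f : L2, ∫⁻ x, ‖f x‖ₑ ^ (2 : ℝ) = ‖f‖ₑ ^ (2 : ℝ) := by
    intro f
    rw [Lp.enorm_def, eLpNorm_eq_lintegral_rpow_enorm_toReal (by norm_num) (by norm_num),
      ← ENNReal.rpow_mul]
    norm_num
  have h1 : ‖Y‖ₑ ^ (2 : ℝ) ≤ (‖A‖ₑ * ‖X‖ₑ) ^ (2 : ℝ) := by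
    rw [ENNReal.mul_rpow_of_nonneg _ _ (by norm_num), ← Ker.lintegral_slice_left,
      ← Ker.lintegral_slice_left, ← lintegral_const_mul' _ _
        (ENNReal.rpow_ne_top_of_nonneg (by norm_num) enorm_ne_top)]
    refine lintegral_mono_ae ?_
    filter_upwards [h, Ker.memLp_slice_left X] with y hy hX
    have h2 := hX.coeFn_toLp
    have h3 := hy _ h2
    have h4 : ∫⁻ x, ‖X (x, y)‖ₑ ^ (2 : ℝ) = ‖hX.toLp _‖ₑ ^ (2 : ℝ) := by
      rw [← key]
      exact lintegral_congr_ae (h2.mono fun x hx => by simp only [hx])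
    have h5 : ∫⁻ x, ‖Y (x, y)‖ₑ ^ (2 : ℝ) = ‖A (hX.toLp _)‖ₑ ^ (2 : ℝ) := by
      rw [← key]
      exact lintegral_congr_ae (h3.mono fun x hx => by simp only [hx])
    rw [h4, h5, ← ENNReal.mul_rpow_of_nonneg _ _ (by norm_num)]
    refine ENNReal.rpow_le_rpow ?_ (by norm_num)
    exact A.le_opENorm _
  have h2 : ‖Y‖ₑ ≤ ‖A‖ₑ * ‖X‖ₑ := (ENNReal.rpow_le_rpow_iff (by norm_num)).1 h1
  rw [← ofReal_norm, ← ofReal_norm, ← ofReal_norm, ← ENNReal.ofReal_mul (norm_nonneg _)] at h2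
  exact (ENNReal.ofReal_le_ofReal_iff (by positivity)).1 h2

/-- The identity is not Hilbert-Schmidt, so c + a has no kernel; bounding by its operator norm
rather than by |c| + ‖a‖ is what later makes the Sylvester iteration a contraction. -/
theorem norm_smul_add_kmul_le (c : ℂ) (a X : Ker) :
    ‖c • X + kmul a X‖ ≤ ‖c • (1 : Op) + op a‖ * ‖X‖ := by
  refine Ker.norm_le_of_slices _ ?_
  have h1 := Ker.ae_ae (ae_swap (Lp.coeFn_add (c • X) (kmul a X)))
  have h2 := Ker.ae_ae (ae_swap (Lp.coeFn_smul c X))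
  have h3 := Ker.ae_ae (ae_swap (kmul_coe a X))
  filter_upwards [h1, h2, h3] with y h1 h2 h3 f hf
  have h4 : (c • (1 : Op) + op a) f = c • f + op a f := rfl
  rw [h4]
  filter_upwards [h1, h2, h3, Lp.coeFn_add (c • f) (op a f), Lp.coeFn_smul c f, op_coe a f, hf]
    with x h1 h2 h3 h5 h6 h7 h8
  simp only [Prod.swap_prod_mk] at h1 h2 h3
  rw [h5, h1, Pi.add_apply, Pi.add_apply, h6, h2, h7, h3, Pi.smul_apply, Pi.smul_apply, h8,
    compFun]
  congr 1
  refine integral_congr_ae ?_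
  filter_upwards [hf] with w hw
  rw [hw]

/-- The kernel of the adjoint operator. -/
def adj (k : Ker) : Ker := star (tr k)

theorem op_adj (k : Ker) : op (adj k) = star (op k) := op_adjoint k

theorem norm_adj (k : Ker) : ‖adj k‖ = ‖k‖ := by
  rw [adj, norm_star_Lp, LinearIsometry.norm_map]

theorem norm_smul_add_kmul_le' (c : ℂ) (a X : Ker) :
    ‖c • X + kmul X a‖ ≤ ‖c • (1 : Op) + op a‖ * ‖X‖ := by
  have h : adj (c • X + kmul X a) = star c • adj X + kmul (adj a) (adj X) := by
    refine op_injective ?_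
    simp only [op_adj, op_add, op_smul, op_kmul, star_add, star_smul, star_mul]
  rw [← norm_adj (c • X + kmul X a), h, ← norm_adj X]
  refine (norm_smul_add_kmul_le _ _ _).trans_eq ?_
  rw [op_adj, ← norm_star (c • (1 : Op) + op a), star_add, star_smul, star_one]

/-! ### Algebra of the square root in a `C⋆`-algebra -/

section Abstract

variable {A : Type*} [CStarAlgebra A] {c r u m x : A}

theorem mul_mul_inv_aux (hrc : r * c = 1) (hcc : c * c = 1 + u * star u) :
    r * (u * star u) = c - r := by
  have h1 : u * star u = c * c - 1 := by rw [hcc]; abel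
  rw [h1, mul_sub, ← mul_assoc, hrc, one_mul, mul_one]

/-- Sandwiching the Sylvester equation with `r = c⁻¹`. -/
theorem sylvester_iff {a : A} (hcr : c * r = 1) (hrc : r * c = 1) {b : A} :
    c * x + x * c = a * c - c * b ↔ r * x + x * r = r * a - b * r := by
  constructor
  · intro h
    have h1 : r * (c * x + x * c) * r = r * (a * c - c * b) * r := by rw [h]
    have e1 : r * (c * x + x * c) * r = (r * c) * x * r + r * x * (c * r) := by noncomm_ring
    have e2 : r * (a * c - c * b) * r = r * a * (c * r) - (r * c) * b * r := by noncomm_ring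
    rw [e1, e2, hcr, hrc, one_mul, mul_one, mul_one, one_mul] at h1
    rw [← h1, add_comm]
  · intro h
    have h1 : c * (r * x + x * r) * c = c * (r * a - b * r) * c := by rw [h]
    have e1 : c * (r * x + x * r) * c = (c * r) * x * c + c * x * (r * c) := by noncomm_ring
    have e2 : c * (r * a - b * r) * c = (c * r) * a * c - c * b * (r * c) := by noncomm_ring
    rw [e1, e2, hcr, hrc, one_mul, mul_one, mul_one, one_mul] at h1
    rw [← h1, add_comm]

/-- With r(uū) = c - r one finds fū = c m ū + (x + u m̄)(c - r), and its adjoint gives u f̄. In the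
difference the terms cx + xc, c m ū and u m̄ c all cancel against the hypothesis, and what is left
is the equation sandwiched between two factors r. -/
theorem commutator_of_quasilinear (hs : star c = c) (hrs : star r = r) (hrc : r * c = 1)
    (hcr : c * r = 1) (hcc : c * c = 1 + u * star u) (hx : star x = -x) {f : A}
    (hf : f = c * m + (x + u * star m) * r * u)
    (hg : f * star u - u * star f = c * x + x * c) :
    c * x + x * c = m * star u * c - c * (u * star m) := by
  rw [sylvester_iff hcr hrc]
  have e1 : f * star u = c * (m * star u) + (x + u * star m) * (c - r) := by
    rw [hf, ← mul_mul_inv_aux hrc hcc]; noncomm_ring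
  have e2 : u * star f = u * star m * c + (c - r) * (-x + m * star u) := by
    have : u * star f = star (f * star u) := by rw [star_mul, star_star]
    rw [this, e1]
    simp only [star_add, star_mul, star_sub, star_star, hs, hrs, hx]
  rw [e1, e2] at hg
  rw [← sub_eq_zero] at hg ⊢
  rw [← neg_eq_zero, ← hg]
  noncomm_ring

/-- The sandwiched Sylvester equation lets r y be replaced by rx + xr + br, after which the sum of
the two brackets is twice (x + b)r. -/
theorem quasilinear_eq_commutator {y : A} {b : A} (h : r * x + x * r = r * y - b * r) :
    (x + b) * r * u = (1 / 2 : ℂ) • ((x * r - r * x) * u) + (1 / 2 : ℂ) • ((r * y + b * r) * u) := by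
  have h1 : x * r - r * x + (r * y + b * r) = (2 : ℂ) • ((x + b) * r) := by
    have : r * y = r * x + x * r + b * r := by rw [h]; abel
    rw [this, two_smul]; noncomm_ring
  rw [← smul_add, ← add_mul, h1, smul_mul_assoc, smul_smul]
  norm_num

/-- Here f comes from the commutator form and no Sylvester equation is assumed. The failure z of
that equation enters the balance only through z c² + c² z, an expression that vanishes only for z =
0. -/
theorem commutator_balance (hs : star c = c) (hrs : star r = r) (hrc : r * c = 1)
    (hcr : c * r = 1) (hcc : c * c = 1 + u * star u) (hx : star x = -x) {f : A}
    (hf : f = c * m + (1 / 2 : ℂ) • ((x * r - r * x) * u)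
      + (1 / 2 : ℂ) • ((r * m * star u + u * star m * r) * u)) {z : A}
    (hz : z = r * x + x * r - (r * (m * star u) - u * star m * r)) :
    f * star u - u * star f = c * x + x * c - (1 / 2 : ℂ) • (z * (c * c) + (c * c) * z) := by
  set a := m * star u with ha
  have ha' : u * star m = star a := by rw [ha, star_mul, star_star]
  rw [ha'] at hz
  have e1 : f * star u = c * a + (1 / 2 : ℂ) • ((x * r - r * x + (r * a + star a * r))
      * (c * c - 1)) := by
    have h1 : u * star u = c * c - 1 := by rw [hcc]; abel
    rw [hf, ← h1, ha', ha]
    simp only [add_mul, smul_mul_assoc, smul_add, mul_assoc]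
    abel
  have e2 : u * star f = star a * c + (1 / 2 : ℂ) • ((c * c - 1)
      * (x * r - r * x + (r * a + star a * r))) := by
    have : u * star f = star (f * star u) := by rw [star_mul, star_star]
    rw [this, e1]
    simp only [star_add, star_mul, star_sub, star_star, hs, hrs, hx, star_smul, star_one]
    have h2 : star (1 / 2 : ℂ) = 1 / 2 := by simp
    rw [h2]
    congr 2
    noncomm_ring
  -- The bracket is written in two ways: with r on the right, to be absorbed by c² from the right,
  -- and with r on the left, to be absorbed from the left. The defect z appears with opposite signs.
  have h3 : x * r - r * x + (r * a + star a * r) = (2 : ℂ) • (x * r + star a * r) - z := by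
    rw [hz, two_smul]; abel
  have h4 : x * r - r * x + (r * a + star a * r) = (2 : ℂ) • (r * a - r * x) + z := by
    rw [hz, two_smul]; abel
  have e3 : (x * r - r * x + (r * a + star a * r)) * (c * c)
      = (2 : ℂ) • (x * c + star a * c) - z * (c * c) := by
    have : (x * r + star a * r) * (c * c) = x * (r * c) * c + star a * (r * c) * c := by
      noncomm_ring
    rw [h3, sub_mul, smul_mul_assoc, this, hrc, mul_one, mul_one]
  have e4 : (c * c) * (x * r - r * x + (r * a + star a * r))
      = (2 : ℂ) • (c * a - c * x) + (c * c) * z := by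
    have : (c * c) * (r * a - r * x) = c * (c * r) * a - c * (c * r) * x := by
      noncomm_ring
    rw [h4, mul_add, mul_smul_comm, this, hcr, mul_one]
  rw [e1, e2, mul_sub, sub_mul, e3, e4, mul_one, one_mul]
  have e5 : ∀ y : A, (1 / 2 : ℂ) • (2 : ℂ) • y = y := fun y => by rw [smul_smul]; norm_num
  simp only [smul_sub, smul_add, e5]
  abel

/-! #### Hyperbolic series -/

theorem hasSum_cosh (b : A) :
    HasSum (fun n : ℕ => ((Nat.factorial (2 * n) : ℂ)⁻¹) • (b * b) ^ n)
      ((1 / 2 : ℂ) • (NormedSpace.exp b + NormedSpace.exp (-b))) := by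
  have h1 := NormedSpace.exp_series_hasSum_exp' (𝕂 := ℂ) b
  have h2 := NormedSpace.exp_series_hasSum_exp' (𝕂 := ℂ) (-b)
  have h3 := (h1.add h2).const_smul (1 / 2 : ℂ)
  have hinj : Function.Injective (fun n : ℕ => 2 * n) := fun a b h => by
    simpa using h
  rw [← hinj.hasSum_iff] at h3
  · convert! h3 using 2 with n
    simp only [Function.comp_apply]
    rw [(even_two_mul n).neg_pow, ← two_smul ℂ, smul_smul, pow_mul, pow_two]
    norm_num
  · intro n hn
    have : Odd n := by
      rw [← Nat.not_even_iff_odd]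
      rintro ⟨k, hk⟩
      exact hn ⟨k, by simp only; omega⟩
    rw [this.neg_pow, smul_neg, add_neg_cancel, smul_zero]

theorem hasSum_sinh (b : A) :
    HasSum (fun n : ℕ => ((Nat.factorial (2 * n + 1) : ℂ)⁻¹) • ((b * b) ^ n * b))
      ((1 / 2 : ℂ) • (NormedSpace.exp b - NormedSpace.exp (-b))) := by
  have h1 := NormedSpace.exp_series_hasSum_exp' (𝕂 := ℂ) b
  have h2 := NormedSpace.exp_series_hasSum_exp' (𝕂 := ℂ) (-b)
  have h3 := (h1.sub h2).const_smul (1 / 2 : ℂ)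
  have hinj : Function.Injective (fun n : ℕ => 2 * n + 1) := fun a b h => by
    simpa using h
  rw [← hinj.hasSum_iff] at h3
  · convert! h3 using 2 with n
    simp only [Function.comp_apply]
    rw [(odd_two_mul_add_one n).neg_pow, smul_neg, sub_neg_eq_add, ← two_smul ℂ, smul_smul,
      pow_succ, pow_mul, pow_two]
    norm_num
  · intro n hn
    have : Even n := by
      rw [← Nat.not_odd_iff_even]
      rintro ⟨k, hk⟩
      exact hn ⟨k, by simp only; omega⟩
    rw [this.neg_pow, sub_self, smul_zero]

/-- The even entire function sinh(√b)/√b as a power series in b; it is the factor by which sh(k)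
differs from k. -/
theorem summable_sinhc (b : A) :
    Summable fun n : ℕ => ((Nat.factorial (2 * n + 1) : ℂ)⁻¹) • b ^ n := by
  refine Summable.of_norm_bounded (NormedSpace.norm_expSeries_summable' (𝕂 := ℂ) b) fun n => ?_
  rw [norm_smul, norm_smul]
  refine mul_le_mul_of_nonneg_right ?_ (norm_nonneg _)
  simp only [norm_inv, Complex.norm_natCast]
  have : Nat.factorial n ≤ Nat.factorial (2 * n + 1) := Nat.factorial_le (by omega)
  have h0 : (0 : ℝ) < Nat.factorial n := by positivity
  gcongr

end Abstract

/-! ### Positivity: Sylvester equations, the square root iteration, hyperbolic functions -/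

section CStar

variable {A : Type*} [CStarAlgebra A] [PartialOrder A] [StarOrderedRing A]

/-- If cz = -zc then z commutes with c², hence with its positive square root c. The two relations
give 2cz = 0, and c is invertible. -/
theorem sylvester_unique {c z : A} (hc : 0 ≤ c) (hu : IsUnit c) (h : c * z + z * c = 0) :
    z = 0 := by
  have h1 : c * z = -(z * c) := eq_neg_of_add_eq_zero_left h
  have h2 : Commute (c * c) z := by
    change c * c * z = z * (c * c)
    rw [mul_assoc, h1, mul_neg, ← mul_assoc, h1, neg_mul, neg_neg, mul_assoc]
  have h3 : Commute c z := by
    have := h2.cfcₙ_nnreal (f := NNReal.sqrt)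
    have h4 : CFC.sqrt (c * c) = c := CFC.sqrt_mul_self c hc
    rw [CFC.sqrt] at h4
    rwa [h4] at this
  rw [← h3.eq, ← two_smul ℂ] at h
  have h5 : c * z = 0 := by simpa using h
  exact (hu.mul_right_eq_zero).1 h5

theorem sylvester_star {c x g : A} (hc : 0 ≤ c) (hu : IsUnit c) (h : c * x + x * c = g)
    (hg : star g = -g) : star x = -x := by
  have hs : star c = c := (IsSelfAdjoint.of_nonneg hc).star_eq
  have h1 := congrArg star h
  rw [star_add, star_mul, star_mul, hs, hg, ← h] at h1
  refine eq_neg_of_add_eq_zero_left (sylvester_unique hc hu ?_)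
  rw [mul_add, add_mul]
  calc c * star x + c * x + (star x * c + x * c)
      = (star x * c + c * star x) + (c * x + x * c) := by abel
    _ = 0 := by rw [h1]; abel

theorem one_le_sqrt {q : A} (hq : 0 ≤ q) : 1 ≤ CFC.sqrt (1 + q) := by
  have h := CFC.monotone_sqrt (A := A) (le_add_of_nonneg_right hq : (1 : A) ≤ 1 + q)
  simpa using h

theorem isUnit_of_one_le {c : A} (h : 1 ≤ c) : IsUnit c :=
  CStarAlgebra.isUnit_of_le 1 h

/-- From 1 ≤ d ≤ c ≤ C and αC ≤ ½ the element ½ - αd lies between 0 and ½ - α in the operator order.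
-/
theorem norm_half_sub_smul_le {c d : A} {α C : ℝ} (hα : 0 ≤ α) (hα2 : α * C ≤ 1 / 2)
    (hα1 : α ≤ 1 / 2) (hc : c ≤ algebraMap ℝ A C) (h1 : 1 ≤ d) (hd : d ≤ c) :
    ‖(1 / 2 : ℂ) • (1 : A) - (α : ℂ) • d‖ ≤ 1 / 2 - α := by
  have e : (1 / 2 : ℂ) • (1 : A) - (α : ℂ) • d = (1 / 2 : ℝ) • (1 : A) - α • d := by
    rw [← Complex.coe_smul, ← Complex.coe_smul]; norm_num
  have h0 : (0 : A) ≤ 1 := zero_le_one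
  have hn : 0 ≤ (1 / 2 : ℝ) • (1 : A) - α • d := by
    rw [sub_nonneg]
    calc α • d ≤ α • algebraMap ℝ A C := smul_le_smul_of_nonneg_left (hd.trans hc) hα
      _ = (α * C) • (1 : A) := by rw [Algebra.algebraMap_eq_smul_one, smul_smul]
      _ ≤ (1 / 2 : ℝ) • (1 : A) := smul_le_smul_of_nonneg_right hα2 h0
  rw [e, CStarAlgebra.norm_le_iff_le_algebraMap _ (by linarith) hn]
  · rw [Algebra.algebraMap_eq_smul_one, sub_smul]
    exact sub_le_sub_left (smul_le_smul_of_nonneg_left h1 hα) _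

/-- The iteration `c ↦ c + α (a - c²)`, started at `1`, for the square root of `a`. -/
def sqrtIter (α : ℝ) (a : A) : ℕ → A
  | 0 => 1
  | n + 1 => sqrtIter α a n + (α : ℂ) • (a - sqrtIter α a n * sqrtIter α a n)

/-- All iterates d commute with c, so c minus the next iterate factors as (c - d)(1 - α(c + d)).
Both factors are positive because 2αC ≤ 1, and the iteration increases from 1 without passing c. -/
theorem sqrtIter_mem {c : A} {α C : ℝ} (hα : 0 ≤ α) (hα2 : α * C ≤ 1 / 2)
    (hc1 : 1 ≤ c) (hc : c ≤ algebraMap ℝ A C) (n : ℕ) :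
    Commute c (sqrtIter α (c * c) n) ∧ 1 ≤ sqrtIter α (c * c) n ∧ sqrtIter α (c * c) n ≤ c := by
  have h0 : (0 : A) ≤ 1 := zero_le_one
  induction n with
  | zero => exact ⟨Commute.one_right c, le_refl _, hc1⟩
  | succ n ih =>
    obtain ⟨h1, h2, h3⟩ := ih
    set d := sqrtIter α (c * c) n with hd
    have hs : sqrtIter α (c * c) (n + 1) = d + α • (c * c - d * d) := by
      rw [sqrtIter, Complex.coe_smul]
    have hf : c * c - d * d = (c - d) * (c + d) := by
      rw [sub_mul, mul_add, mul_add, h1.eq]; abel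
    have hcom : Commute (c - d) (c + d) :=
      ((Commute.refl c).add_right h1).sub_left (h1.symm.add_right (Commute.refl d))
    rw [hs]
    refine ⟨?_, ?_, ?_⟩
    · exact h1.add_right ((((Commute.refl c).mul_right (Commute.refl c)).sub_right
        (h1.mul_right h1)).smul_right α)
    · refine h2.trans (le_add_of_nonneg_right (smul_nonneg hα ?_))
      rw [hf]
      exact Commute.mul_nonneg (sub_nonneg.2 h3)
        (add_nonneg (h0.trans hc1) (h0.trans h2)) hcom
    · rw [← sub_nonneg]
      have e : c - (d + α • (c * c - d * d)) = (c - d) * (1 - α • (c + d)) := by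
        rw [hf, mul_sub, mul_one, mul_smul_comm]; abel
      rw [e]
      refine Commute.mul_nonneg (sub_nonneg.2 h3) ?_
        ((Commute.one_right _).sub_right (hcom.smul_right α))
      rw [sub_nonneg]
      calc α • (c + d) ≤ α • (algebraMap ℝ A C + algebraMap ℝ A C) :=
            smul_le_smul_of_nonneg_left (add_le_add hc (h3.trans hc)) hα
        _ = (α * C + α * C) • (1 : A) := by
            rw [Algebra.algebraMap_eq_smul_one, ← add_smul, smul_smul, mul_add]
        _ ≤ (1 : ℝ) • (1 : A) := smul_le_smul_of_nonneg_right (by linarith) h0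
        _ = 1 := one_smul _ _

/-! #### Hyperbolic functions -/

theorem exp_nonneg_of_isSelfAdjoint {b : A} (hb : IsSelfAdjoint b) :
    0 ≤ NormedSpace.exp b := by
  let _ : NormedAlgebra ℚ A := NormedAlgebra.restrictScalars ℚ ℂ A
  have hb2 : IsSelfAdjoint ((1 / 2 : ℝ) • b) := (IsSelfAdjoint.all _).smul hb
  have h1 : NormedSpace.exp b
      = NormedSpace.exp ((1 / 2 : ℝ) • b) * NormedSpace.exp ((1 / 2 : ℝ) • b) := by
    rw [← NormedSpace.exp_add_of_commute (Commute.refl _), ← add_smul]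
    norm_num
  rw [h1]
  nth_rewrite 1 [← hb2.star_eq]
  rw [← NormedSpace.star_exp]
  exact star_mul_self_nonneg _

/-- `ch = √(1 + sh sh*)`, where `ch` and `sh` are given by their power series. -/
theorem sqrt_one_add_sinh_sq (k : A) :
    CFC.sqrt (1 + (∑' n : ℕ, ((Nat.factorial (2 * n + 1) : ℂ)⁻¹) • ((k * star k) ^ n * k))
      * star (∑' n : ℕ, ((Nat.factorial (2 * n + 1) : ℂ)⁻¹) • ((k * star k) ^ n * k)))
      = ∑' n : ℕ, ((Nat.factorial (2 * n) : ℂ)⁻¹) • (k * star k) ^ n := by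
  let _ : NormedAlgebra ℚ A := NormedAlgebra.restrictScalars ℚ ℂ A
  -- With b² = kk*, the series for sh(k) is g k with g = sinh(b)/b, self-adjoint and commuting with
  -- b. Hence sh(k) sh(k)* = g b² g = sinh(b)², and ch(k) is cosh(b).
  set b := CFC.sqrt (k * star k) with hb
  have hbb : b * b = k * star k := CFC.sqrt_mul_sqrt_self _ (mul_star_self_nonneg k)
  have hbs : IsSelfAdjoint b := IsSelfAdjoint.of_nonneg (CFC.sqrt_nonneg _)
  set g := ∑' n : ℕ, ((Nat.factorial (2 * n + 1) : ℂ)⁻¹) • (b * b) ^ n with hg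
  have hgs : HasSum (fun n : ℕ => ((Nat.factorial (2 * n + 1) : ℂ)⁻¹) • (b * b) ^ n) g :=
    (summable_sinhc (b * b)).hasSum
  have hsh : (∑' n : ℕ, ((Nat.factorial (2 * n + 1) : ℂ)⁻¹) • ((k * star k) ^ n * k)) = g * k := by
    have := hgs.mul_right k
    simp only [smul_mul_assoc, hbb] at this
    exact this.tsum_eq
  have hgb : g * b = (1 / 2 : ℂ) • (NormedSpace.exp b - NormedSpace.exp (-b)) := by
    have := hgs.mul_right b
    simp only [smul_mul_assoc] at this
    exact this.unique (hasSum_sinh b)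
  have hbg : b * g = g * b := by
    have h1 := hgs.mul_right b
    have h2 := hgs.mul_left b
    have h3 : ∀ n : ℕ, b * (b * b) ^ n = (b * b) ^ n * b := fun n =>
      (((Commute.refl b).mul_right (Commute.refl b)).pow_right n).eq
    simp only [smul_mul_assoc, mul_smul_comm, h3] at h1 h2
    exact h2.unique h1
  have hgstar : star g = g := by
    have h1 := hgs.star
    simp only [star_smul, star_pow, star_mul, hbs.star_eq] at h1
    have h2 : ∀ n : ℕ, star ((n : ℂ)⁻¹) = (n : ℂ)⁻¹ := fun n => by simp
    simp only [h2] at h1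
    exact h1.unique hgs
  rw [hsh]
  have hch := (hasSum_cosh b).tsum_eq
  rw [hbb] at hch
  rw [hch]
  refine CFC.sqrt_unique ?_ ?_
  · have e1 : g * k * star (g * k) = (g * b) * (g * b) := by
      rw [star_mul, hgstar]
      calc g * k * (star k * g) = g * (k * star k) * g := by noncomm_ring
        _ = g * b * (b * g) := by rw [← hbb]; noncomm_ring
        _ = _ := by rw [hbg]
    have hp : NormedSpace.exp b * NormedSpace.exp (-b) = 1 := by
      rw [← NormedSpace.exp_add_of_commute (Commute.neg_right (Commute.refl b)), add_neg_cancel,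
        NormedSpace.exp_zero]
    have hm : NormedSpace.exp (-b) * NormedSpace.exp b = 1 := by
      rw [← NormedSpace.exp_add_of_commute (Commute.neg_left (Commute.refl b)), neg_add_cancel,
        NormedSpace.exp_zero]
    rw [e1, hgb]
    simp only [smul_mul_assoc, mul_smul_comm, smul_smul, add_mul, mul_add, sub_mul, mul_sub, hp, hm,
      smul_add, smul_sub]
    -- The unit is split into four quarters, matching the cross terms of e^b and e^(-b) in cosh² -
    -- sinh² = 1.
    have : (1 : A) = ((1 / 2 * (1 / 2) : ℂ)) • (1 : A) + ((1 / 2 * (1 / 2) : ℂ)) • (1 : A)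
      + (((1 / 2 * (1 / 2) : ℂ)) • (1 : A) + ((1 / 2 * (1 / 2) : ℂ)) • (1 : A)) := by
      rw [← add_smul, ← add_smul]; norm_num
    nth_rewrite 3 [this]
    abel
  · have h1 := exp_nonneg_of_isSelfAdjoint hbs
    have h2 := exp_nonneg_of_isSelfAdjoint hbs.neg
    have : (1 / 2 : ℂ) • (NormedSpace.exp b + NormedSpace.exp (-b))
        = (1 / 2 : ℝ) • (NormedSpace.exp b + NormedSpace.exp (-b)) := by
      rw [← Complex.coe_smul]; norm_num
    rw [this]
    exact smul_nonneg (by norm_num) (add_nonneg h1 h2)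

end CStar

/-! ### Square roots and Sylvester equations for kernels -/

section Iteration

/-- The term X is shared equally between the two sides, giving (½ - α(1 + a))X + X(½ - α(1 + b));
each half contracts by ½ - α. The two multipliers may differ, which is needed to compare consecutive
iterates. -/
theorem norm_sylvester_step_le {c : Op} {α C : ℝ} (hα : 0 ≤ α) (hα2 : α * C ≤ 1 / 2)
    (hα1 : α ≤ 1 / 2) (hc : c ≤ algebraMap ℝ Op C) {a b : Ker} (ha1 : 1 ≤ 1 + op a)
    (ha : 1 + op a ≤ c) (hb1 : 1 ≤ 1 + op b) (hb : 1 + op b ≤ c) (X : Ker) :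
    ‖X - (α : ℂ) • ((2 : ℂ) • X + kmul a X + kmul X b)‖ ≤ (1 - 2 * α) * ‖X‖ := by
  have e : X - (α : ℂ) • ((2 : ℂ) • X + kmul a X + kmul X b)
      = ((1 / 2 - α : ℂ) • X + kmul (-(α : ℂ) • a) X)
        + ((1 / 2 - α : ℂ) • X + kmul X (-(α : ℂ) • b)) := by
    rw [smul_kmul, kmul_smul]
    module
  have key : ∀ d : Ker, 1 ≤ 1 + op d → 1 + op d ≤ c →
      ‖(1 / 2 - α : ℂ) • (1 : Op) + op (-(α : ℂ) • d)‖ ≤ 1 / 2 - α := by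
    intro d h1 h2
    have h3 := norm_half_sub_smul_le hα hα2 hα1 hc h1 h2
    convert! h3 using 2
    rw [op_smul]
    module
  rw [e]
  calc _ ≤ _ := norm_add_le _ _
    _ ≤ (1 / 2 - α) * ‖X‖ + (1 / 2 - α) * ‖X‖ := by
        refine add_le_add ((norm_smul_add_kmul_le _ _ _).trans ?_)
          ((norm_smul_add_kmul_le' _ _ _).trans ?_)
        · exact mul_le_mul_of_nonneg_right (key a ha1 ha) (norm_nonneg _)
        · exact mul_le_mul_of_nonneg_right (key b hb1 hb) (norm_nonneg _)
    _ = (1 - 2 * α) * ‖X‖ := by ring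

/-- The iteration for the kernel `p` with `1 + p = √(1 + q)`. -/
def pIter (α : ℝ) (q : Ker) : ℕ → Ker
  | 0 => 0
  | n + 1 => pIter α q n + (α : ℂ) • (q - (2 : ℂ) • pIter α q n - kmul (pIter α q n) (pIter α q n))

/-- The iteration for the solution of `2 X + p X + X p = F`. -/
def xIter (α : ℝ) (q F : Ker) : ℕ → Ker
  | 0 => 0
  | n + 1 => xIter α q F n + (α : ℂ) • (F - ((2 : ℂ) • xIter α q F n
      + kmul (pIter α q n) (xIter α q F n) + kmul (xIter α q F n) (pIter α q n)))

theorem op_pIter {c : Op} (α : ℝ) {q : Ker} (hq : c * c = 1 + op q) (n : ℕ) :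
    1 + op (pIter α q n) = sqrtIter α (c * c) n := by
  induction n with
  | zero => simp [pIter, sqrtIter, op_zero]
  | succ n ih =>
    rw [sqrtIter, ← ih, pIter, op_add, op_smul, op_sub, op_sub, op_smul, op_kmul, hq, add_assoc]
    congr 3
    rw [two_smul]; noncomm_ring

variable {c : Op} {α C : ℝ} {q : Ker}

theorem pIter_mem (hα : 0 ≤ α) (hα2 : α * C ≤ 1 / 2) (hc1 : 1 ≤ c) (hc : c ≤ algebraMap ℝ Op C)
    (hq : c * c = 1 + op q) (n : ℕ) : 1 ≤ 1 + op (pIter α q n) ∧ 1 + op (pIter α q n) ≤ c := by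
  rw [op_pIter α hq]
  exact (sqrtIter_mem hα hα2 hc1 hc n).2

/-- The quadratic term telescopes as p'² - p² = p'(p' - p) + (p' - p)p, so consecutive differences
obey a Sylvester step with the two iterates as multipliers, without using that they commute. -/
theorem norm_pIter_succ_sub_le (hα : 0 ≤ α) (hα2 : α * C ≤ 1 / 2) (hα1 : α ≤ 1 / 2) (hc1 : 1 ≤ c)
    (hc : c ≤ algebraMap ℝ Op C) (hq : c * c = 1 + op q) (n : ℕ) :
    ‖pIter α q (n + 1) - pIter α q n‖ ≤ α * ‖q‖ * (1 - 2 * α) ^ n := by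
  induction n with
  | zero =>
    have h0 : kmul 0 0 = (0 : Ker) := map_zero (kmulL 0)
    simp only [pIter, h0, smul_zero, sub_zero, zero_add, pow_zero, mul_one]
    rw [norm_smul, Complex.norm_real, Real.norm_of_nonneg hα]
  | succ n ih =>
    obtain ⟨h1, h2⟩ := pIter_mem hα hα2 hc1 hc hq n
    obtain ⟨h3, h4⟩ := pIter_mem hα hα2 hc1 hc hq (n + 1)
    set d := pIter α q (n + 1) - pIter α q n with hd
    have e : pIter α q (n + 1 + 1) - pIter α q (n + 1) = d - (α : ℂ) • ((2 : ℂ) • d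
        + kmul (pIter α q (n + 1)) d + kmul d (pIter α q n)) := by
      rw [pIter, add_sub_cancel_left, hd, kmul_sub, sub_kmul]
      nth_rewrite 4 [pIter]
      module
    rw [e]
    refine (norm_sylvester_step_le hα hα2 hα1 hc h3 h4 h1 h2 d).trans ?_
    calc (1 - 2 * α) * ‖d‖ ≤ (1 - 2 * α) * (α * ‖q‖ * (1 - 2 * α) ^ n) :=
          mul_le_mul_of_nonneg_left ih (by linarith)
      _ = _ := by ring

/-- The iterates converge geometrically in Hilbert-Schmidt norm. Since c - 1 is not yet known to
have a kernel, the limit is identified by a separate convergence in operator norm. -/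
theorem exists_kernel_sqrt (hα : 0 < α) (hα2 : α * C ≤ 1 / 2) (hα1 : α ≤ 1 / 2) (hc1 : 1 ≤ c)
    (hc : c ≤ algebraMap ℝ Op C) (hq : c * c = 1 + op q) :
    ∃ p : Ker, op p = c - 1 ∧ ∀ n, ‖pIter α q n - p‖ ≤ ‖q‖ / 2 * (1 - 2 * α) ^ n := by
  have hθ : 1 - 2 * α < 1 := by linarith
  have hd : ∀ n, dist (pIter α q n) (pIter α q (n + 1)) ≤ α * ‖q‖ * (1 - 2 * α) ^ n := fun n => by
    rw [dist_comm, dist_eq_norm]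
    exact norm_pIter_succ_sub_le hα.le hα2 hα1 hc1 hc hq n
  obtain ⟨p, hp⟩ := cauchySeq_tendsto_of_complete (cauchySeq_of_le_geometric _ _ hθ hd)
  refine ⟨p, ?_, fun n => ?_⟩
  · have h1 : Tendsto (fun n => op (pIter α q n)) atTop (𝓝 (op p)) :=
      (opL.continuous.tendsto p).comp hp
    -- The same splitting into halves, now in the operator algebra: the error for the next iterate
    -- is (½ - αc)(c - d) + (c - d)(½ - αd).
    have h2 : ∀ n, ‖c - sqrtIter α (c * c) n‖ ≤ ‖c - 1‖ * (1 - 2 * α) ^ n := by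
      intro n
      induction n with
      | zero => simp [sqrtIter]
      | succ n ih =>
        obtain ⟨-, h3, h4⟩ := sqrtIter_mem hα.le hα2 hc1 hc n
        set d := sqrtIter α (c * c) n with hdd
        have e : c - sqrtIter α (c * c) (n + 1) = ((1 / 2 : ℂ) • (1 : Op) - (α : ℂ) • c) * (c - d)
            + (c - d) * ((1 / 2 : ℂ) • (1 : Op) - (α : ℂ) • d) := by
          rw [sqrtIter, ← hdd]
          simp only [sub_mul, mul_sub, smul_mul_assoc, mul_smul_comm, one_mul, mul_one]
          module
        have h5 := norm_half_sub_smul_le hα.le hα2 hα1 hc hc1 le_rfl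
        have h6 := norm_half_sub_smul_le hα.le hα2 hα1 hc h3 h4
        rw [e]
        calc _ ≤ _ := norm_add_le _ _
          _ ≤ (1 / 2 - α) * ‖c - d‖ + ‖c - d‖ * (1 / 2 - α) :=
              add_le_add ((norm_mul_le _ _).trans (mul_le_mul_of_nonneg_right h5 (norm_nonneg _)))
                ((norm_mul_le _ _).trans (mul_le_mul_of_nonneg_left h6 (norm_nonneg _)))
          _ = (1 - 2 * α) * ‖c - d‖ := by ring
          _ ≤ (1 - 2 * α) * (‖c - 1‖ * (1 - 2 * α) ^ n) :=
              mul_le_mul_of_nonneg_left ih (by linarith)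
          _ = _ := by ring
    have h3 : Tendsto (fun n => sqrtIter α (c * c) n) atTop (𝓝 c) := by
      rw [tendsto_iff_norm_sub_tendsto_zero]
      refine squeeze_zero (fun _ => norm_nonneg _) (fun n => ?_)
        (by simpa using (tendsto_pow_atTop_nhds_zero_of_lt_one (by linarith) hθ).const_mul ‖c - 1‖)
      rw [norm_sub_rev]
      exact h2 n
    have h4 : Tendsto (fun n => op (pIter α q n)) atTop (𝓝 (c - 1)) := by
      refine (h3.sub_const 1).congr fun n => ?_
      rw [← op_pIter α hq, add_sub_cancel_left]
    exact tendsto_nhds_unique h1 h4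
  · have h := dist_le_of_le_geometric_of_tendsto _ _ hθ hd hp n
    rw [dist_eq_norm] at h
    refine h.trans (le_of_eq ?_)
    field_simp
    ring

theorem norm_pIter_le (hα : 0 < α) (hα2 : α * C ≤ 1 / 2) (hα1 : α ≤ 1 / 2) (hc1 : 1 ≤ c)
    (hc : c ≤ algebraMap ℝ Op C) (hq : c * c = 1 + op q) (n : ℕ) : ‖pIter α q n‖ ≤ ‖q‖ := by
  obtain ⟨p, -, hp⟩ := exists_kernel_sqrt hα hα2 hα1 hc1 hc hq
  have h0 := hp 0
  simp only [pIter, zero_sub, norm_neg, pow_zero, mul_one] at h0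
  have hn := hp n
  have h1 : (1 - 2 * α) ^ n ≤ 1 := pow_le_one₀ (by linarith) (by linarith)
  have h2 : ‖q‖ / 2 * (1 - 2 * α) ^ n ≤ ‖q‖ / 2 :=
    mul_le_of_le_one_right (by positivity) h1
  calc ‖pIter α q n‖ = ‖(pIter α q n - p) + p‖ := by rw [sub_add_cancel]
    _ ≤ ‖pIter α q n - p‖ + ‖p‖ := norm_add_le _ _
    _ ≤ ‖q‖ := by linarith

theorem norm_xIter_le (hα : 0 < α) (hα2 : α * C ≤ 1 / 2) (hα1 : α ≤ 1 / 2) (hc1 : 1 ≤ c)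
    (hc : c ≤ algebraMap ℝ Op C) (hq : c * c = 1 + op q) (F : Ker) (n : ℕ) :
    ‖xIter α q F n‖ ≤ ‖F‖ / 2 := by
  induction n with
  | zero => simp only [xIter, norm_zero]; positivity
  | succ n ih =>
    obtain ⟨h1, h2⟩ := pIter_mem hα.le hα2 hc1 hc hq n
    have e : xIter α q F (n + 1) = (xIter α q F n - (α : ℂ) • ((2 : ℂ) • xIter α q F n
      + kmul (pIter α q n) (xIter α q F n) + kmul (xIter α q F n) (pIter α q n)))
      + (α : ℂ) • F := by
      rw [xIter]; module
    rw [e]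
    calc _ ≤ _ := norm_add_le _ _
      _ ≤ (1 - 2 * α) * ‖xIter α q F n‖ + α * ‖F‖ := by
          refine add_le_add (norm_sylvester_step_le hα.le hα2 hα1 hc h1 h2 h1 h2 _) (le_of_eq ?_)
          rw [norm_smul, Complex.norm_real, Real.norm_of_nonneg hα.le]
      _ ≤ (1 - 2 * α) * (‖F‖ / 2) + α * ‖F‖ := by
          gcongr; linarith
      _ = ‖F‖ / 2 := by ring

/-- Banach's fixed point theorem for X ↦ X + α(F - 2X - pX - Xp), which contracts by 1 - 2α in
Hilbert-Schmidt norm. -/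
theorem exists_sylvester_kernel (hα : 0 < α) (hα2 : α * C ≤ 1 / 2) (hα1 : α ≤ 1 / 2)
    (hc1 : 1 ≤ c) (hc : c ≤ algebraMap ℝ Op C) {p : Ker} (hp : op p = c - 1) (F : Ker) :
    ∃ X : Ker, (2 : ℂ) • X + kmul p X + kmul X p = F := by
  have hp1 : 1 + op p = c := by rw [hp]; abel
  have h1 : 1 ≤ 1 + op p := by rwa [hp1]
  have h2 : 1 + op p ≤ c := hp1.le
  set T : Ker → Ker := fun X => X - (α : ℂ) • ((2 : ℂ) • X + kmul p X + kmul X p) + (α : ℂ) • F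
    with hT
  have hcon : ContractingWith (1 - 2 * α).toNNReal T := by
    refine ⟨by rw [Real.toNNReal_lt_one]; linarith,
      LipschitzWith.of_dist_le_mul fun X Y => ?_⟩
    rw [dist_eq_norm, dist_eq_norm, Real.coe_toNNReal _ (by linarith)]
    have e : T X - T Y = (X - Y) - (α : ℂ) • ((2 : ℂ) • (X - Y) + kmul p (X - Y)
        + kmul (X - Y) p) := by
      simp only [hT]
      rw [kmul_sub, sub_kmul]; module
    rw [e]
    exact norm_sylvester_step_le hα.le hα2 hα1 hc h1 h2 h1 h2 _
  have hfix := hcon.fixedPoint_isFixedPt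
  refine ⟨hcon.fixedPoint T, ?_⟩
  set X := hcon.fixedPoint T
  have h3 : (α : ℂ) • (F - ((2 : ℂ) • X + kmul p X + kmul X p)) = 0 := by
    have h4 : T X - X = 0 := sub_eq_zero.2 hfix
    rw [← h4]
    simp only [hT]; module
  have h5 : (α : ℂ) ≠ 0 := by exact_mod_cast hα.ne'
  exact (sub_eq_zero.1 ((smul_eq_zero.1 h3).resolve_left h5)).symm

/-- The error contracts by θ at each step but is forced by p_n - p, which decays at the same rate
θ^n; this resonance produces the term n θ^n. -/
theorem tendsto_xIter (hα : 0 < α) (hα2 : α * C ≤ 1 / 2) (hα1 : α < 1 / 2) (hc1 : 1 ≤ c)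
    (hc : c ≤ algebraMap ℝ Op C) (hq : c * c = 1 + op q) {p F X : Ker} (hp : op p = c - 1)
    (hX : (2 : ℂ) • X + kmul p X + kmul X p = F) :
    Tendsto (xIter α q F) atTop (𝓝 X) := by
  obtain ⟨p', hp', hpn⟩ := exists_kernel_sqrt hα hα2 hα1.le hc1 hc hq
  obtain rfl : p' = p := op_injective (hp'.trans hp.symm)
  set θ := 1 - 2 * α with hθ
  -- The bound divides by θ, which is why α must be strictly below ½ here.
  have hθ0 : 0 < θ := by rw [hθ]; linarith
  have hθ1 : θ < 1 := by rw [hθ]; linarith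
  have hb : ∀ n : ℕ, ‖X - xIter α q F n‖ ≤ ‖X‖ * θ ^ n + α * ‖q‖ * ‖X‖ / θ * (n * θ ^ n) := by
    intro n
    induction n with
    | zero => simp [xIter]
    | succ n ih =>
      obtain ⟨h1, h2⟩ := pIter_mem hα.le hα2 hc1 hc hq n
      set Y := xIter α q F n with hY
      set P := pIter α q n with hP
      have e : X - xIter α q F (n + 1) = ((X - Y) - (α : ℂ) • ((2 : ℂ) • (X - Y)
          + kmul P (X - Y) + kmul (X - Y) P)) + (α : ℂ) • (kmul (P - p') X + kmul X (P - p')) := by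
        rw [xIter, ← hY, ← hP]
        nth_rewrite 1 [← hX]
        simp only [kmul_sub, sub_kmul]
        module
      rw [e]
      calc _ ≤ _ := norm_add_le _ _
        _ ≤ θ * ‖X - Y‖ + α * (‖P - p'‖ * ‖X‖ + ‖X‖ * ‖P - p'‖) := by
            refine add_le_add (norm_sylvester_step_le hα.le hα2 hα1.le hc h1 h2 h1 h2 _) ?_
            rw [norm_smul, Complex.norm_real, Real.norm_of_nonneg hα.le]
            refine mul_le_mul_of_nonneg_left ((norm_add_le _ _).trans ?_) hα.le
            exact add_le_add (norm_kmul_le _ _) (norm_kmul_le _ _)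
        _ ≤ θ * (‖X‖ * θ ^ n + α * ‖q‖ * ‖X‖ / θ * (n * θ ^ n))
            + α * (‖q‖ / 2 * θ ^ n * ‖X‖ + ‖X‖ * (‖q‖ / 2 * θ ^ n)) := by
            have := hpn n
            gcongr
        _ = _ := by
            push_cast
            field_simp
            ring
  rw [tendsto_iff_norm_sub_tendsto_zero]
  have h0 : Tendsto (fun n : ℕ => ‖X‖ * θ ^ n + α * ‖q‖ * ‖X‖ / θ * (n * θ ^ n)) atTop (𝓝 0) := by
    have h1 := (tendsto_pow_atTop_nhds_zero_of_lt_one hθ0.le hθ1).const_mul ‖X‖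
    have h2 := (tendsto_self_mul_const_pow_of_lt_one hθ0.le hθ1).const_mul (α * ‖q‖ * ‖X‖ / θ)
    simpa using h1.add h2
  refine squeeze_zero (fun _ => norm_nonneg _) (fun n => ?_) h0
  rw [norm_sub_rev]
  exact hb n

end Iteration

/-! ### Contour integrals -/

section Contour

/-- The principal root lies in the open right half plane, so √(1+z) + w stays in the slit plane for
Re w > 0 and its logarithm can serve as a primitive along the contour. -/
theorem re_cpow_half_pos {z : ℂ} (hz : z ∈ Complex.slitPlane) : 0 < (z ^ (1 / 2 : ℂ)).re := by
  rw [one_div, Complex.cpow_inv_two_re]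
  refine Real.sqrt_pos.2 (div_pos ?_ two_pos)
  rcases hz with h | h
  · have := norm_nonneg z
    linarith
  · have := Complex.abs_re_lt_norm.2 h
    have := neg_abs_le z.re
    linarith

theorem cpow_half_mul_self (z : ℂ) : z ^ (1 / 2 : ℂ) * z ^ (1 / 2 : ℂ) = z := by
  have := Complex.cpow_nat_inv_pow z (n := 2) (by norm_num)
  rw [pow_two] at this
  simpa [one_div] using this

theorem hasDerivAt_cpow_half {z : ℂ} (hz : 1 + z ∈ Complex.slitPlane) :
    HasDerivAt (fun z : ℂ => (1 + z) ^ (1 / 2 : ℂ)) (1 / (2 * (1 + z) ^ (1 / 2 : ℂ))) z := by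
  have h1 : HasDerivAt (fun z : ℂ => 1 + z) 1 z := (hasDerivAt_id z).const_add 1
  have h2 := h1.cpow_const (c := (1 / 2 : ℂ)) hz
  convert! h2 using 1
  have hne : (1 + z) ≠ 0 := Complex.slitPlane_ne_zero hz
  have hs : (1 + z) ^ (1 / 2 : ℂ) ≠ 0 := by
    intro h
    have := re_cpow_half_pos hz
    rw [h] at this
    simp at this
  rw [Complex.cpow_sub _ _ hne, Complex.cpow_one]
  nth_rewrite 3 [← cpow_half_mul_self (1 + z)]
  field_simp

variable {γ : ℝ → ℂ} {σ : Set ℂ}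

theorem exists_eps_disjoint (B : Finset ℝ) (t : ℝ) :
    ∃ ε > 0, ∀ s ∈ B, s ≠ t → ε ≤ |s - t| := by
  have h1 : IsClosed ((B.erase t : Finset ℝ) : Set ℝ) := (B.erase t).finite_toSet.isClosed
  have h2 : t ∉ ((B.erase t : Finset ℝ) : Set ℝ) := by simp
  obtain ⟨ε, hε, h⟩ := Metric.mem_nhds_iff.1 (h1.isOpen_compl.mem_nhds h2)
  refine ⟨ε, hε, fun s hs hst => ?_⟩
  by_contra hlt
  have h3 : s ∈ Metric.ball t ε := by
    rw [Metric.mem_ball, Real.dist_eq]; exact not_le.1 hlt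
  exact h h3 (by simp [hs, hst])

theorem exists_bound_deriv_Ioo {a b : ℝ} (hab : a < b) (h : ContDiffOn ℝ 1 γ (Icc a b)) :
    ∃ M, ∀ s ∈ Ioo a b, ‖deriv γ s‖ ≤ M := by
  have hc : ContinuousOn (derivWithin γ (Icc a b)) (Icc a b) :=
    h.continuousOn_derivWithin (uniqueDiffOn_Icc hab) le_rfl
  obtain ⟨M, hM⟩ := isCompact_Icc.exists_bound_of_continuousOn hc
  refine ⟨M, fun s hs => ?_⟩
  rw [← derivWithin_of_mem_nhds (Icc_mem_nhds hs.1 hs.2)]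
  exact hM s (Ioo_subset_Icc_self hs)

/-- Inside a smooth piece the derivative agrees with the one-sided derivative, continuous up to the
ends. At a break point, and at 0 and 1, `deriv` may be unrelated to the pieces, but it is a single
value and goes into the maximum. -/
theorem IsContourAround.exists_bound_deriv (h : IsContourAround γ σ) :
    ∃ M, ∀ s ∈ Icc (0 : ℝ) 1, ‖deriv γ s‖ ≤ M := by
  suffices hI : ∃ M, ∀ s ∈ Icc (0 : ℝ) 1, s ∈ Ioo (0 : ℝ) 1 → ‖deriv γ s‖ ≤ M by
    obtain ⟨M, hM⟩ := hI
    refine ⟨max M (max ‖deriv γ 0‖ ‖deriv γ 1‖), fun s hs => ?_⟩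
    rcases hs.1.eq_or_lt with h0 | h0
    · rw [← h0]
      exact (le_max_left _ _).trans (le_max_right _ _)
    rcases hs.2.eq_or_lt with h1 | h1
    · rw [h1]
      exact (le_max_right _ _).trans (le_max_right _ _)
    · exact (hM s hs ⟨h0, h1⟩).trans (le_max_left _ _)
  obtain ⟨B, hB⟩ := h.piecewise
  -- Boundedness is local on a compact interval: near each t at most one break point matters, namely
  -- t itself, so the two sides of t are smooth pieces.
  refine isCompact_Icc.induction_on
    (p := fun S => ∃ M, ∀ s ∈ S, s ∈ Ioo (0 : ℝ) 1 → ‖deriv γ s‖ ≤ M) ⟨0, by simp⟩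
    (fun s t hst ⟨M, hM⟩ => ⟨M, fun x hx => hM x (hst hx)⟩)
    (fun s t ⟨M, hM⟩ ⟨N, hN⟩ => ⟨max M N, ?_⟩) fun t ht => ?_
  · rintro x (hx | hx) hx'
    · exact (hM x hx hx').trans (le_max_left _ _)
    · exact (hN x hx hx').trans (le_max_right _ _)
  · obtain ⟨ε, hε, hd⟩ := exists_eps_disjoint B t
    have hR : ∃ M, ∀ s ∈ Ioo t (min 1 (t + ε)), ‖deriv γ s‖ ≤ M := by
      by_cases h1 : t < min 1 (t + ε)
      · refine exists_bound_deriv_Ioo h1 (hB _ _ ht.1 h1 (min_le_left _ _) fun s hs hs' => ?_)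
        have h2 := hd s hs hs'.1.ne'
        rw [abs_of_pos (sub_pos.2 hs'.1)] at h2
        have := hs'.2.trans_le (min_le_right _ _)
        linarith
      · exact ⟨0, fun s hs => absurd (hs.1.trans hs.2) h1⟩
    have hL : ∃ M, ∀ s ∈ Ioo (max 0 (t - ε)) t, ‖deriv γ s‖ ≤ M := by
      by_cases h1 : max 0 (t - ε) < t
      · refine exists_bound_deriv_Ioo h1 (hB _ _ (le_max_left _ _) h1 ht.2 fun s hs hs' => ?_)
        have h2 := hd s hs hs'.2.ne
        rw [abs_of_neg (sub_neg.2 hs'.2)] at h2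
        have := (le_max_right _ _).trans_lt hs'.1
        linarith
      · exact ⟨0, fun s hs => absurd (hs.1.trans hs.2) h1⟩
    obtain ⟨M, hM⟩ := hR
    obtain ⟨N, hN⟩ := hL
    refine ⟨Ioo (t - ε) (t + ε), ?_, max (max M N) ‖deriv γ t‖, ?_⟩
    · exact mem_nhdsWithin_of_mem_nhds (Ioo_mem_nhds (by linarith) (by linarith))
    · rintro s ⟨h1, h2⟩ ⟨h3, h4⟩
      rcases lt_trichotomy s t with hst | rfl | hst
      · exact (hN s ⟨max_lt h3 h1, hst⟩).trans ((le_max_right _ _).trans (le_max_left _ _))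
      · exact le_max_right _ _
      · exact (hM s ⟨hst, lt_min h4 h2⟩).trans ((le_max_left _ _).trans (le_max_left _ _))

theorem IsContourAround.exists_hasDerivAt (h : IsContourAround γ σ) :
    ∃ B : Set ℝ, B.Countable ∧ ∀ s ∈ Ioo (0 : ℝ) 1 \ B, HasDerivAt γ (deriv γ s) s := by
  obtain ⟨B, hB⟩ := h.piecewise
  refine ⟨B, B.countable_toSet, fun s hs => ?_⟩
  obtain ⟨ε, hε, hd⟩ := exists_eps_disjoint B s
  have h1 : max 0 (s - ε) < s := max_lt hs.1.1 (by linarith)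
  have h2 : s < min 1 (s + ε) := lt_min hs.1.2 (by linarith)
  have h3 := hB (max 0 (s - ε)) (min 1 (s + ε)) (le_max_left _ _) (h1.trans h2) (min_le_left _ _)
    (fun b hb hb' => by
      have h4 : b ≠ s := fun h => hs.2 (h ▸ hb)
      have h5 := hd b hb h4
      have h6 := (le_max_right _ _).trans_lt hb'.1
      have h7 := hb'.2.trans_le (min_le_right _ _)
      have : |b - s| < ε := abs_lt.2 ⟨by linarith, by linarith⟩
      linarith)
  have h4 : DifferentiableWithinAt ℝ γ (Icc (max 0 (s - ε)) (min 1 (s + ε))) s :=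
    h3.differentiableOn (by norm_num) s ⟨h1.le, h2.le⟩
  exact (h4.differentiableAt (Icc_mem_nhds h1 h2)).hasDerivAt

theorem IsContourAround.integrableOn_smul (h : IsContourAround γ σ) {E : Type*}
    [NormedAddCommGroup E] [NormedSpace ℂ E] {g : ℝ → E}
    (hg : ContinuousOn g (Icc 0 1)) :
    IntegrableOn (fun s => deriv γ s • g s) (Icc 0 1) volume := by
  obtain ⟨M, hM⟩ := h.exists_bound_deriv
  obtain ⟨N, hN⟩ := isCompact_Icc.exists_bound_of_continuousOn hg
  refine Integrable.of_bound ?_ (M * N) ?_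
  · exact ((measurable_deriv γ).aestronglyMeasurable).smul (hg.aestronglyMeasurable measurableSet_Icc)
  · refine ae_restrict_of_forall_mem measurableSet_Icc fun s hs => ?_
    rw [norm_smul]
    exact mul_le_mul (hM s hs) (hN s hs) (norm_nonneg _) ((norm_nonneg _).trans (hM s hs))

theorem IsContourAround.intervalIntegrable_smul (h : IsContourAround γ σ) {E : Type*}
    [NormedAddCommGroup E] [NormedSpace ℂ E] {g : ℝ → E}
    (hg : ContinuousOn g (Icc 0 1)) :
    IntervalIntegrable (fun s => deriv γ s • g s) volume 0 1 := by
  rw [intervalIntegrable_iff_integrableOn_Icc_of_le zero_le_one]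
  exact h.integrableOn_smul hg

/-- The fundamental theorem of calculus off a countable set suffices, as G ∘ γ is continuous and
differentiable away from the break points; the curve is closed, so the boundary terms cancel. -/
theorem IsContourAround.integral_primitive (h : IsContourAround γ σ) {G g : ℂ → ℂ}
    (hG : ∀ s ∈ Icc (0 : ℝ) 1, HasDerivAt G (g (γ s)) (γ s))
    (hg : ContinuousOn (fun s => g (γ s)) (Icc 0 1)) :
    ∫ s in (0 : ℝ)..1, deriv γ s * g (γ s) = 0 := by
  obtain ⟨B, hBc, hB⟩ := h.exists_hasDerivAt
  have h1 := integral_eq_of_hasDerivAt_off_countable_of_le (fun s => G (γ s))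
    (fun s => deriv γ s * g (γ s)) zero_le_one hBc
    (fun s hs => (hG s hs).continuousAt.comp_continuousWithinAt (h.continuousOn s hs))
    (fun s hs => by
      have := (hG s (Ioo_subset_Icc_self hs.1)).comp_of_eq s (hB s hs) rfl
      rwa [mul_comm] at this)
    (h.intervalIntegrable_smul hg)
  rw [h1, h.closed, sub_self]

theorem IsContourAround.continuousOn_sqrt (h : IsContourAround γ σ) :
    ContinuousOn (fun s => (1 + γ s) ^ (1 / 2 : ℂ)) (Icc 0 1) := fun s hs =>
  (hasDerivAt_cpow_half (h.mem_slitPlane s hs)).continuousAt.comp_continuousWithinAt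
    (h.continuousOn s hs)

variable {w : ℂ}

theorem sqrt_add_mem (hw : 0 < w.re) {z : ℂ} (hz : 1 + z ∈ Complex.slitPlane) :
    (1 + z) ^ (1 / 2 : ℂ) + w ∈ Complex.slitPlane := by
  left
  have := re_cpow_half_pos hz
  rw [Complex.add_re]
  linarith

theorem sqrt_ne_zero {z : ℂ} (hz : 1 + z ∈ Complex.slitPlane) : (1 + z) ^ (1 / 2 : ℂ) ≠ 0 := by
  intro h
  have := re_cpow_half_pos hz
  rw [h] at this
  simp at this

theorem IsContourAround.ne_of_mem (h : IsContourAround γ σ) (hσ : w * w - 1 ∈ σ) {s : ℝ}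
    (hs : s ∈ Icc (0 : ℝ) 1) : γ s - (w * w - 1) ≠ 0 := by
  intro h0
  exact h.avoids s hs (by rwa [sub_eq_zero.1 h0])

/-- With s = √(1+z), so z = s² - 1, partial fractions split s/(w² - s²) into -w/(s² - w²) - 1/(s +
w). The first term counts the winding, the second has the primitive 2s - 2w log(s + w). -/
theorem IsContourAround.integral_resolvent (h : IsContourAround γ σ) (hw : 0 < w.re)
    (hσ : w * w - 1 ∈ σ) :
    ∫ s in (0 : ℝ)..1, deriv γ s * ((1 + γ s) ^ (1 / 2 : ℂ) * (w * w - 1 - γ s)⁻¹)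
      = -(2 * Real.pi * Complex.I) * w := by
  have hc := h.continuousOn_sqrt
  have hcS : ContinuousOn (fun s => 1 / ((1 + γ s) ^ (1 / 2 : ℂ) + w)) (Icc 0 1) :=
    continuousOn_const.div (hc.add continuousOn_const) fun s hs =>
      Complex.slitPlane_ne_zero (sqrt_add_mem hw (h.mem_slitPlane s hs))
  have hcR : ContinuousOn (fun s => (γ s - (w * w - 1))⁻¹) (Icc 0 1) :=
    (h.continuousOn.sub continuousOn_const).inv₀ fun s hs => h.ne_of_mem hσ hs
  have h1 : ∫ s in (0 : ℝ)..1, deriv γ s * (1 / ((1 + γ s) ^ (1 / 2 : ℂ) + w)) = 0 := by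
    refine h.integral_primitive (G := fun z => 2 * (1 + z) ^ (1 / 2 : ℂ)
      - 2 * w * Complex.log ((1 + z) ^ (1 / 2 : ℂ) + w))
      (g := fun z => 1 / ((1 + z) ^ (1 / 2 : ℂ) + w)) (fun s hs => ?_) hcS
    have hz := h.mem_slitPlane s hs
    have hd := hasDerivAt_cpow_half hz
    have hl := (hd.add_const w).clog (sqrt_add_mem hw hz)
    convert! (hd.const_mul 2).sub (hl.const_mul (2 * w)) using 1
    have e1 := sqrt_ne_zero hz
    have e2 := Complex.slitPlane_ne_zero (sqrt_add_mem hw hz)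
    field_simp
    ring
  have h2 := h.winding _ hσ
  have e : ∀ s ∈ uIcc (0 : ℝ) 1, deriv γ s * ((1 + γ s) ^ (1 / 2 : ℂ) * (w * w - 1 - γ s)⁻¹)
      = -w * (deriv γ s / (γ s - (w * w - 1)))
        - deriv γ s * (1 / ((1 + γ s) ^ (1 / 2 : ℂ) + w)) := by
    intro s hs
    rw [uIcc_of_le zero_le_one] at hs
    have hz := h.mem_slitPlane s hs
    have e2 := Complex.slitPlane_ne_zero (sqrt_add_mem hw hz)
    have e3 := h.ne_of_mem hσ hs
    have e5 := cpow_half_mul_self (1 + γ s)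
    set r := (1 + γ s) ^ (1 / 2 : ℂ)
    have e6 : γ s = r * r - 1 := by rw [e5]; ring
    have e7 : r * r - 1 - (w * w - 1) = (r - w) * (r + w) := by ring
    have e8 : w * w - 1 - (r * r - 1) = -((r - w) * (r + w)) := by ring
    rw [e6, e7] at e3
    have e9 := left_ne_zero_of_mul e3
    rw [e6, e7, e8]
    field_simp
    ring
  rw [intervalIntegral.integral_congr e, intervalIntegral.integral_sub,
    intervalIntegral.integral_const_mul, h1, h2]
  · ring
  · simpa [div_eq_mul_inv] using (h.intervalIntegrable_smul hcR).const_mul (-w)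
  · exact h.intervalIntegrable_smul hcS

/-- The double pole is removed by subtracting the derivative of a multiple of s/(z - (w² - 1)),
where s = √(1+z). There remain the winding form and -1/(s(s + w)), whose primitive is -2 log(s + w).
-/
theorem IsContourAround.integral_resolvent_sq (h : IsContourAround γ σ) (hw : 0 < w.re)
    (hσ : w * w - 1 ∈ σ) :
    ∫ s in (0 : ℝ)..1, deriv γ s * ((1 + γ s) ^ (1 / 2 : ℂ)
        * ((w * w - 1 - γ s)⁻¹ * (w * w - 1 - γ s)⁻¹ * (2 * w)))
      = 2 * Real.pi * Complex.I := by
  have hc := h.continuousOn_sqrt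
  have hcS : ContinuousOn (fun s => 1 / ((1 + γ s) ^ (1 / 2 : ℂ)
      * ((1 + γ s) ^ (1 / 2 : ℂ) + w))) (Icc 0 1) :=
    continuousOn_const.div (hc.mul (hc.add continuousOn_const)) fun s hs =>
      mul_ne_zero (sqrt_ne_zero (h.mem_slitPlane s hs))
        (Complex.slitPlane_ne_zero (sqrt_add_mem hw (h.mem_slitPlane s hs)))
  have hcR : ContinuousOn (fun s => (γ s - (w * w - 1))⁻¹) (Icc 0 1) :=
    (h.continuousOn.sub continuousOn_const).inv₀ fun s hs => h.ne_of_mem hσ hs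
  set g : ℂ → ℂ := fun z => (1 + z) ^ (1 / 2 : ℂ) * (z - (w * w - 1))⁻¹ * (z - (w * w - 1))⁻¹
    - 1 / (2 * (1 + z) ^ (1 / 2 : ℂ)) * (z - (w * w - 1))⁻¹ with hg
  have hcg : ContinuousOn (fun s => g (γ s)) (Icc 0 1) := by
    refine ((hc.mul hcR).mul hcR).sub ((continuousOn_const.div (continuousOn_const.mul hc)
      fun s hs => ?_).mul hcR)
    exact mul_ne_zero two_ne_zero (sqrt_ne_zero (h.mem_slitPlane s hs))
  have h1 : ∫ s in (0 : ℝ)..1, deriv γ s * g (γ s) = 0 := by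
    refine h.integral_primitive (G := fun z => -((1 + z) ^ (1 / 2 : ℂ) / (z - (w * w - 1))))
      (fun s hs => ?_) hcg
    have hz := h.mem_slitPlane s hs
    have hd := hasDerivAt_cpow_half hz
    have e3 := h.ne_of_mem hσ hs
    convert! (hd.div ((hasDerivAt_id (γ s)).sub_const (w * w - 1)) e3).neg using 1
    have e1 := sqrt_ne_zero hz
    simp only [hg, id]
    field_simp
    ring
  have h1' : ∫ s in (0 : ℝ)..1, deriv γ s * (1 / ((1 + γ s) ^ (1 / 2 : ℂ)
      * ((1 + γ s) ^ (1 / 2 : ℂ) + w))) = 0 := by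
    refine h.integral_primitive (G := fun z => 2 * Complex.log ((1 + z) ^ (1 / 2 : ℂ) + w))
      (g := fun z => 1 / ((1 + z) ^ (1 / 2 : ℂ) * ((1 + z) ^ (1 / 2 : ℂ) + w)))
      (fun s hs => ?_) hcS
    have hz := h.mem_slitPlane s hs
    have hl := ((hasDerivAt_cpow_half hz).add_const w).clog (sqrt_add_mem hw hz)
    convert! hl.const_mul 2 using 1
    have e1 := sqrt_ne_zero hz
    have e2 := Complex.slitPlane_ne_zero (sqrt_add_mem hw hz)
    field_simp
  have h2 := h.winding _ hσ
  have e : ∀ s ∈ uIcc (0 : ℝ) 1, deriv γ s * ((1 + γ s) ^ (1 / 2 : ℂ)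
        * ((w * w - 1 - γ s)⁻¹ * (w * w - 1 - γ s)⁻¹ * (2 * w)))
      = 2 * w * (deriv γ s * g (γ s)) + deriv γ s / (γ s - (w * w - 1))
        - deriv γ s * (1 / ((1 + γ s) ^ (1 / 2 : ℂ) * ((1 + γ s) ^ (1 / 2 : ℂ) + w))) := by
    intro s hs
    rw [uIcc_of_le zero_le_one] at hs
    have hz := h.mem_slitPlane s hs
    have e1 := sqrt_ne_zero hz
    have e2 := Complex.slitPlane_ne_zero (sqrt_add_mem hw hz)
    have e3 := h.ne_of_mem hσ hs
    have e5 := cpow_half_mul_self (1 + γ s)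
    simp only [hg]
    set r := (1 + γ s) ^ (1 / 2 : ℂ)
    have e6 : γ s = r * r - 1 := by rw [e5]; ring
    have e7 : r * r - 1 - (w * w - 1) = (r - w) * (r + w) := by ring
    have e8 : w * w - 1 - (r * r - 1) = -((r - w) * (r + w)) := by ring
    rw [e6, e7] at e3
    have e9 := left_ne_zero_of_mul e3
    rw [e6, e7, e8]
    field_simp
    ring
  rw [intervalIntegral.integral_congr e, intervalIntegral.integral_sub,
    intervalIntegral.integral_add, intervalIntegral.integral_const_mul, h1, h1', h2]
  · ring
  · exact (h.intervalIntegrable_smul hcg).const_mul (2 * w)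
  · simpa [div_eq_mul_inv] using h.intervalIntegrable_smul hcR
  · exact ((h.intervalIntegrable_smul hcg).const_mul (2 * w)).add
      (by simpa [div_eq_mul_inv] using h.intervalIntegrable_smul hcR)
  · exact h.intervalIntegrable_smul hcS

end Contour

/-! ### Contour integrals of resolvents through the functional calculus of c -/

section ContourOperator

variable {γ : ℝ → ℂ}

/-- The curve's derivative is only bounded and measurable, so joint continuity is required of g
alone; the product is then an integrable curve of continuous functions on the spectrum. -/
theorem IsContourAround.integral_cfc {σ : Set ℂ} (h : IsContourAround γ σ) {A : Type*}
    [CStarAlgebra A] {c : A} (hc : IsStarNormal c) {g : ℝ → ℂ → ℂ}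
    (hg : ContinuousOn (Function.uncurry g) (Icc 0 1 ×ˢ spectrum ℂ c)) :
    ∫ s in (0 : ℝ)..1, deriv γ s • cfc (g s) c
      = cfc (fun w => ∫ s in (0 : ℝ)..1, deriv γ s * g s w) c := by
  have hgs : ∀ s ∈ Icc (0 : ℝ) 1, ContinuousOn (g s) (spectrum ℂ c) := fun s hs =>
    hg.comp (Continuous.prodMk_right s).continuousOn fun _ hz => ⟨hs, hz⟩
  obtain ⟨M, hM⟩ := h.exists_bound_deriv
  obtain ⟨N, hN⟩ := (isCompact_Icc.prod (spectrum.isCompact (𝕜 := ℂ) c)).exists_bound_of_continuousOn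
    hg
  simp only [intervalIntegral.integral_of_le zero_le_one, ← integral_Icc_eq_integral_Ioc]
  have hcont : ∀ᵐ s ∂(volume.restrict (Icc (0 : ℝ) 1)),
      ContinuousOn (fun w => deriv γ s * g s w) (spectrum ℂ c) :=
    ae_restrict_of_forall_mem measurableSet_Icc fun s hs => continuousOn_const.mul (hgs s hs)
  have hint : IntegrableOn (fun s => ContinuousMap.mkD ((spectrum ℂ c).domRestrict
      (fun w => deriv γ s * g s w)) 0) (Icc (0 : ℝ) 1) volume := by
    constructor
    · have h1 := ContinuousMap.aeStronglyMeasurable_restrict_mkD_restrict_of_uncurry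
        (μ := volume) measurableSet_Icc g (0 : C(spectrum ℂ c, ℂ)) hg
      have h2 := ((measurable_deriv γ).aestronglyMeasurable
        (μ := volume.restrict (Icc (0 : ℝ) 1))).smul h1
      refine h2.congr (ae_restrict_of_forall_mem measurableSet_Icc fun s hs => ?_)
      ext w
      have hcs : ContinuousOn (fun w => deriv γ s * g s w) (spectrum ℂ c) :=
        continuousOn_const.mul (hgs s hs)
      have e1 := ContinuousMap.mkD_apply_of_continuousOn (g := 0) hcs (x := w)
      have e2 := ContinuousMap.mkD_apply_of_continuousOn (g := 0) (hgs s hs) (x := w)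
      rw [e1]
      change deriv γ s • (ContinuousMap.mkD ((spectrum ℂ c).domRestrict (g s)) 0) w = _
      rw [e2]
      rfl
    · refine ContinuousMap.hasFiniteIntegral_mkD_restrict_of_bound _ _ hcont (fun _ => M * N)
        (hasFiniteIntegral_const _) (ae_restrict_of_forall_mem measurableSet_Icc
          fun s hs w hw => ?_)
      rw [norm_mul]
      exact mul_le_mul (hM s hs) (hN (s, w) ⟨hs, hw⟩) (norm_nonneg _)
        ((norm_nonneg _).trans (hM s hs))
  have key := cfc_setIntegral' (fun s w => deriv γ s * g s w) c hcont hint hc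
  rw [key]
  refine setIntegral_congr_fun measurableSet_Icc fun s hs => ?_
  exact (cfc_const_mul (deriv γ s) (g s) c (hgs s hs)).symm

section

variable {A : Type*} [CStarAlgebra A] {c : A}

theorem cfc_mul_self_sub (hc : IsStarNormal c) (z : ℂ) :
    cfc (fun w : ℂ => w * w - 1 - z) c = c * c - 1 - algebraMap ℂ A z := by
  rw [cfc_sub (fun w : ℂ => w * w - 1) (fun _ => z) c, cfc_sub (fun w : ℂ => w * w) (fun _ => 1) c,
    cfc_mul (fun w : ℂ => w) (fun w => w) c, cfc_id' ℂ c, cfc_const _ c, cfc_const _ c, map_one]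

theorem mul_self_sub_one_mem_spectrum (hc : IsStarNormal c) {w : ℂ} (hw : w ∈ spectrum ℂ c) :
    w * w - 1 ∈ spectrum ℂ (c * c - 1) := by
  have h := cfc_mul_self_sub hc 0
  simp only [sub_zero, map_zero] at h
  rw [← h, cfc_map_spectrum (fun w : ℂ => w * w - 1) c]
  exact ⟨w, hw, rfl⟩

theorem IsContourAround.inverse_eq_cfc (h : IsContourAround γ (spectrum ℂ (c * c - 1)))
    (hc : IsStarNormal c) {s : ℝ} (hs : s ∈ Icc (0 : ℝ) 1) :
    Ring.inverse (c * c - 1 - algebraMap ℂ A (γ s)) = cfc (fun w : ℂ => (w * w - 1 - γ s)⁻¹) c := by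
  rw [← cfc_mul_self_sub hc]
  refine (cfc_inv (fun w : ℂ => w * w - 1 - γ s) c ?_).symm
  intro w hw h0
  exact h.avoids s hs (by rw [← sub_eq_zero.1 h0]; exact mul_self_sub_one_mem_spectrum hc hw)

theorem IsContourAround.isUnit (h : IsContourAround γ (spectrum ℂ (c * c - 1)))
    {s : ℝ} (hs : s ∈ Icc (0 : ℝ) 1) : IsUnit (c * c - 1 - algebraMap ℂ A (γ s)) := by
  have h1 := h.avoids s hs
  rw [spectrum.notMem_iff] at h1
  rw [← neg_sub]
  exact h1.neg

theorem IsContourAround.continuousOn_inverse (h : IsContourAround γ (spectrum ℂ (c * c - 1))) :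
    ContinuousOn (fun s => Ring.inverse (c * c - 1 - algebraMap ℂ A (γ s))) (Icc 0 1) := by
  intro s hs
  obtain ⟨x, hx⟩ := h.isUnit hs
  have h1 : ContinuousAt Ring.inverse (c * c - 1 - algebraMap ℂ A (γ s)) := by
    rw [← hx]
    exact NormedRing.inverse_continuousAt x
  refine ContinuousAt.comp_continuousWithinAt (f := fun s => c * c - 1 - algebraMap ℂ A (γ s)) h1 ?_
  exact continuousWithinAt_const.sub
    ((continuous_algebraMap ℂ A).continuousAt.comp_continuousWithinAt (h.continuousOn s hs))

theorem continuousOn_resolvent_fun (h : IsContourAround γ (spectrum ℂ (c * c - 1)))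
    (hc : IsStarNormal c) :
    ContinuousOn (fun p : ℝ × ℂ => (p.2 * p.2 - 1 - γ p.1)⁻¹) (Icc 0 1 ×ˢ spectrum ℂ c) := by
  refine ContinuousOn.inv₀ ?_ ?_
  · exact (by fun_prop : ContinuousOn (fun p : ℝ × ℂ => p.2 * p.2 - 1) _).sub
      (h.continuousOn.comp continuousOn_fst fun p hp => hp.1)
  · rintro ⟨s, w⟩ ⟨hs, hw⟩ h0
    exact h.avoids s hs (by
      rw [← sub_eq_zero.1 h0]; exact mul_self_sub_one_mem_spectrum hc hw)

theorem continuousOn_sqrt_fst {σ : Set ℂ} (h : IsContourAround γ σ) (S : Set ℂ) :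
    ContinuousOn (fun p : ℝ × ℂ => (1 + γ p.1) ^ (1 / 2 : ℂ)) (Icc 0 1 ×ˢ S) :=
  h.continuousOn_sqrt.comp continuousOn_fst fun _ hp => hp.1

theorem cfc_resolvent_sq {g : ℂ → ℂ} (hn : IsStarNormal c) (hg : ContinuousOn g (spectrum ℂ c))
    (a : ℂ) : cfc (fun w => a * (g w * g w * (2 * w))) c = a • (cfc g c * cfc g c * ((2 : ℂ) • c)) := by
  have h2 : ContinuousOn (fun w : ℂ => 2 * w) (spectrum ℂ c) := by fun_prop
  have h3 : ContinuousOn (fun w => g w * g w) (spectrum ℂ c) := hg.mul hg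
  rw [cfc_const_mul a (fun w => g w * g w * (2 * w)) c (h3.mul h2),
    cfc_mul (fun w => g w * g w) (fun w => 2 * w) c h3 h2, cfc_mul g g c hg hg,
    cfc_const_mul_id 2 c]

theorem IsContourAround.continuousOn_resolvent (h : IsContourAround γ (spectrum ℂ (c * c - 1)))
    (hn : IsStarNormal c) {s : ℝ} (hs : s ∈ Icc (0 : ℝ) 1) :
    ContinuousOn (fun w : ℂ => (w * w - 1 - γ s)⁻¹) (spectrum ℂ c) :=
  ContinuousOn.inv₀ (by fun_prop) fun w hw h0 => h.avoids s hs (by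
    rw [← sub_eq_zero.1 h0]; exact mul_self_sub_one_mem_spectrum hn hw)

theorem IsContourAround.smul_inverse (h : IsContourAround γ (spectrum ℂ (c * c - 1)))
    (hn : IsStarNormal c) {s : ℝ} (hs : s ∈ Icc (0 : ℝ) 1) :
    (deriv γ s * (1 + γ s) ^ (1 / 2 : ℂ)) • Ring.inverse (c * c - 1 - algebraMap ℂ A (γ s))
      = deriv γ s • cfc (fun w => (1 + γ s) ^ (1 / 2 : ℂ) * (w * w - 1 - γ s)⁻¹) c := by
  have e := cfc_const_mul ((1 + γ s) ^ (1 / 2 : ℂ)) _ c (h.continuousOn_resolvent hn hs)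
  rw [mul_smul, h.inverse_eq_cfc hn hs, e]

theorem IsContourAround.smul_inverse_sq (h : IsContourAround γ (spectrum ℂ (c * c - 1)))
    (hn : IsStarNormal c) {s : ℝ} (hs : s ∈ Icc (0 : ℝ) 1) :
    (deriv γ s * (1 + γ s) ^ (1 / 2 : ℂ)) • (Ring.inverse (c * c - 1 - algebraMap ℂ A (γ s))
        * Ring.inverse (c * c - 1 - algebraMap ℂ A (γ s)) * ((2 : ℂ) • c))
      = deriv γ s • cfc (fun w => (1 + γ s) ^ (1 / 2 : ℂ)
        * ((w * w - 1 - γ s)⁻¹ * (w * w - 1 - γ s)⁻¹ * (2 * w))) c := by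
  have e := cfc_resolvent_sq hn (h.continuousOn_resolvent hn hs) ((1 + γ s) ^ (1 / 2 : ℂ))
  rw [mul_smul, h.inverse_eq_cfc hn hs, e]

variable [PartialOrder A] [StarOrderedRing A]

/-- This identifies a spectral value w of c with the principal value of √(1+λ) at λ = w² - 1, as the
scalar contour integrals require. -/
theorem re_pos_of_mem_spectrum (hc : 0 ≤ c) (hu : IsUnit c) {w : ℂ} (hw : w ∈ spectrum ℂ c) :
    0 < w.re := by
  have hsa : IsSelfAdjoint c := IsSelfAdjoint.of_nonneg hc
  have h1 : w = w.re := hsa.mem_spectrum_eq_re hw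
  have h2 : w.re ∈ spectrum ℝ c := by
    rw [← spectrum.algebraMap_mem_iff ℂ]
    change (w.re : ℂ) ∈ _
    rwa [← h1]
  refine lt_of_le_of_ne (spectrum_nonneg_of_nonneg hc h2) fun h0 => ?_
  rw [← h0] at h2
  exact spectrum.zero_notMem ℝ hu h2

theorem IsContourAround.integral_inverse (h : IsContourAround γ (spectrum ℂ (c * c - 1)))
    (hc : 0 ≤ c) (hu : IsUnit c) :
    ∫ s in (0 : ℝ)..1, (deriv γ s * (1 + γ s) ^ (1 / 2 : ℂ)) •
      Ring.inverse (c * c - 1 - algebraMap ℂ A (γ s)) = -((2 * Real.pi * Complex.I) • c) := by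
  have hn : IsStarNormal c := (IsSelfAdjoint.of_nonneg hc).isStarNormal
  have hcont := continuousOn_resolvent_fun h hn
  have hsq : ContinuousOn (fun p : ℝ × ℂ => (1 + γ p.1) ^ (1 / 2 : ℂ))
      (Icc 0 1 ×ˢ spectrum ℂ c) := continuousOn_sqrt_fst h _
  have h1 := h.integral_cfc hn (g := fun s w => (1 + γ s) ^ (1 / 2 : ℂ) * (w * w - 1 - γ s)⁻¹)
    (hsq.mul hcont)
  have h2 : cfc (fun w => ∫ s in (0 : ℝ)..1, deriv γ s *
      ((1 + γ s) ^ (1 / 2 : ℂ) * (w * w - 1 - γ s)⁻¹)) c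
      = cfc (fun w => -(2 * Real.pi * Complex.I) * w) c :=
    cfc_congr fun w hw => h.integral_resolvent (re_pos_of_mem_spectrum hc hu hw)
      (mul_self_sub_one_mem_spectrum hn hw)
  rw [h2, cfc_const_mul_id _ c, neg_smul] at h1
  rw [← h1]
  refine intervalIntegral.integral_congr fun s hs => ?_
  exact h.smul_inverse hn (by rwa [uIcc_of_le zero_le_one] at hs)

theorem IsContourAround.integral_inverse_sq (h : IsContourAround γ (spectrum ℂ (c * c - 1)))
    (hc : 0 ≤ c) (hu : IsUnit c) :
    ∫ s in (0 : ℝ)..1, (deriv γ s * (1 + γ s) ^ (1 / 2 : ℂ)) •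
      (Ring.inverse (c * c - 1 - algebraMap ℂ A (γ s))
        * Ring.inverse (c * c - 1 - algebraMap ℂ A (γ s)) * ((2 : ℂ) • c))
      = (2 * Real.pi * Complex.I) • (1 : A) := by
  have hn : IsStarNormal c := (IsSelfAdjoint.of_nonneg hc).isStarNormal
  have hcont := continuousOn_resolvent_fun h hn
  have hsq : ContinuousOn (fun p : ℝ × ℂ => (1 + γ p.1) ^ (1 / 2 : ℂ))
      (Icc 0 1 ×ˢ spectrum ℂ c) := continuousOn_sqrt_fst h _
  have hG : ContinuousOn (Function.uncurry fun (s : ℝ) (w : ℂ) => (1 + γ s) ^ (1 / 2 : ℂ)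
      * ((w * w - 1 - γ s)⁻¹ * (w * w - 1 - γ s)⁻¹ * (2 * w))) (Icc 0 1 ×ˢ spectrum ℂ c) := by
    have h2w : ContinuousOn (fun p : ℝ × ℂ => 2 * p.2) (Icc 0 1 ×ˢ spectrum ℂ c) := by fun_prop
    exact hsq.mul ((hcont.mul hcont).mul h2w)
  have h1 := h.integral_cfc hn hG
  have h2 : cfc (fun w => ∫ s in (0 : ℝ)..1, deriv γ s * ((1 + γ s) ^ (1 / 2 : ℂ)
      * ((w * w - 1 - γ s)⁻¹ * (w * w - 1 - γ s)⁻¹ * (2 * w)))) c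
      = cfc (fun _ => 2 * Real.pi * Complex.I) c :=
    cfc_congr fun w hw => h.integral_resolvent_sq (re_pos_of_mem_spectrum hc hu hw)
      (mul_self_sub_one_mem_spectrum hn hw)
  rw [h2, cfc_const _ c, Algebra.algebraMap_eq_smul_one] at h1
  rw [← h1]
  refine intervalIntegral.integral_congr fun s hs => ?_
  exact h.smul_inverse_sq hn (by rwa [uIcc_of_le zero_le_one] at hs)

end

end ContourOperator

theorem commute_inverse_left {R : Type*} [Ring R] {a b : R} (ha : IsUnit a) (h : Commute a b) :
    Commute (Ring.inverse a) b := by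
  obtain ⟨x, rfl⟩ := ha
  rw [Ring.inverse_unit]
  exact h.units_inv_left

/-! ### The resolvent sandwich on the commutant of c and on commutators -/

section ContourSylvester

variable {γ : ℝ → ℂ} {A : Type*} [CStarAlgebra A] {c : A}

/-- The integral is taken in the space of bounded maps on the algebra and then evaluated.
Boundedness makes the set on which the contour formula holds closed. -/
theorem IsContourAround.exists_clm (h : IsContourAround γ (spectrum ℂ (c * c - 1))) :
    ∃ J : A →L[ℂ] A, ∀ F, J F = ∫ s in (0 : ℝ)..1, (deriv γ s * (1 + γ s) ^ (1 / 2 : ℂ)) •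
      (Ring.inverse (c * c - 1 - algebraMap ℂ A (γ s)) * F
        * Ring.inverse (c * c - 1 - algebraMap ℂ A (γ s))) := by
  have hc : ContinuousOn (fun s => (1 + γ s) ^ (1 / 2 : ℂ) •
      ((ContinuousLinearMap.mul ℂ A).flip (Ring.inverse (c * c - 1 - algebraMap ℂ A (γ s)))).comp
        (ContinuousLinearMap.mul ℂ A (Ring.inverse (c * c - 1 - algebraMap ℂ A (γ s)))))
      (Icc 0 1) := by
    refine h.continuousOn_sqrt.smul (ContinuousOn.clm_comp ?_ ?_)
    · exact ((ContinuousLinearMap.mul ℂ A).flip.continuous.comp_continuousOn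
        h.continuousOn_inverse)
    · exact ((ContinuousLinearMap.mul ℂ A).continuous.comp_continuousOn h.continuousOn_inverse)
  refine ⟨_, fun F => (ContinuousLinearMap.intervalIntegral_apply
    (h.intervalIntegrable_smul hc) F).trans ?_⟩
  refine intervalIntegral.integral_congr fun s _ => ?_
  simp [mul_smul, mul_assoc]

variable [PartialOrder A] [StarOrderedRing A]

/-- If x commutes with c, the resolvents can be moved together and the integrand becomes the squared
resolvent times 2c, applied to x. -/
theorem IsContourAround.integral_of_commute (h : IsContourAround γ (spectrum ℂ (c * c - 1)))
    (hc : 0 ≤ c) (hu : IsUnit c) {x : A} (hx : c * x = x * c) :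
    ∫ s in (0 : ℝ)..1, (deriv γ s * (1 + γ s) ^ (1 / 2 : ℂ)) •
      (Ring.inverse (c * c - 1 - algebraMap ℂ A (γ s)) * (c * x + x * c)
        * Ring.inverse (c * c - 1 - algebraMap ℂ A (γ s))) = (2 * Real.pi * Complex.I) • x := by
  have h1 := h.integral_inverse_sq hc hu
  have hint : IntervalIntegrable (fun s => (deriv γ s * (1 + γ s) ^ (1 / 2 : ℂ)) •
      (Ring.inverse (c * c - 1 - algebraMap ℂ A (γ s))
        * Ring.inverse (c * c - 1 - algebraMap ℂ A (γ s)) * ((2 : ℂ) • c))) volume 0 1 := by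
    simp only [mul_smul]
    exact h.intervalIntegrable_smul (h.continuousOn_sqrt.smul
      ((h.continuousOn_inverse.mul h.continuousOn_inverse).mul continuousOn_const))
  have h2 := ((ContinuousLinearMap.mul ℂ A).flip x).intervalIntegral_comp_comm hint
  rw [h1] at h2
  simp only [ContinuousLinearMap.flip_apply, ContinuousLinearMap.mul_apply', smul_mul_assoc,
    one_mul] at h2
  rw [← h2]
  refine intervalIntegral.integral_congr fun s hs => ?_
  congr 1
  have hxc : Commute c x := hx
  have h4 : Commute (c * c - 1 - algebraMap ℂ A (γ s)) x :=
    ((hxc.mul_left hxc).sub_left (Commute.one_left x)).sub_left (Algebra.commutes _ _)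
  have h5 : Commute (c * c - 1 - algebraMap ℂ A (γ s)) c :=
    (((Commute.refl c).mul_left (Commute.refl c)).sub_left (Commute.one_left c)).sub_left
      (Algebra.commutes _ _)
  have hi := h.isUnit (by rwa [uIcc_of_le zero_le_one] at hs)
  have h6 := commute_inverse_left hi h4
  have h7 := commute_inverse_left hi h5
  simp only [← hx, two_smul, mul_add, add_mul]
  have : Ring.inverse (c * c - 1 - algebraMap ℂ A (γ s)) * (c * x)
      * Ring.inverse (c * c - 1 - algebraMap ℂ A (γ s))
      = Ring.inverse (c * c - 1 - algebraMap ℂ A (γ s))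
      * Ring.inverse (c * c - 1 - algebraMap ℂ A (γ s)) * c * x := by
    rw [mul_assoc, mul_assoc c, ← h6.eq, ← mul_assoc c, ← h7.eq]
    simp only [mul_assoc]
  rw [this]

/-- For x = [c, y] one has cx + xc = [c², y] = [Q, y] with Q = c² - 1 - z, and Q⁻¹[Q, y]Q⁻¹ = yQ⁻¹ -
Q⁻¹y is linear in the resolvent. -/
theorem IsContourAround.integral_of_commutator (h : IsContourAround γ (spectrum ℂ (c * c - 1)))
    (hc : 0 ≤ c) (hu : IsUnit c) (y : A) :
    ∫ s in (0 : ℝ)..1, (deriv γ s * (1 + γ s) ^ (1 / 2 : ℂ)) •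
      (Ring.inverse (c * c - 1 - algebraMap ℂ A (γ s)) * (c * (c * y - y * c) + (c * y - y * c) * c)
        * Ring.inverse (c * c - 1 - algebraMap ℂ A (γ s)))
      = (2 * Real.pi * Complex.I) • (c * y - y * c) := by
  have h1 := h.integral_inverse hc hu
  have hint : IntervalIntegrable (fun s => (deriv γ s * (1 + γ s) ^ (1 / 2 : ℂ)) •
      Ring.inverse (c * c - 1 - algebraMap ℂ A (γ s))) volume 0 1 := by
    simp only [mul_smul]
    exact h.intervalIntegrable_smul (h.continuousOn_sqrt.smul h.continuousOn_inverse)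
  have h4 := (ContinuousLinearMap.mul ℂ A y
    - (ContinuousLinearMap.mul ℂ A).flip y).intervalIntegral_comp_comm hint
  rw [h1] at h4
  simp only [sub_apply, ContinuousLinearMap.flip_apply,
    ContinuousLinearMap.mul_apply'] at h4
  calc _ = _ := ?_
    _ = _ := h4
    _ = _ := by
      rw [mul_neg, neg_mul, mul_smul_comm, smul_mul_assoc, smul_sub]; abel
  refine intervalIntegral.integral_congr fun s hs => ?_
  rw [uIcc_of_le zero_le_one] at hs
  simp only [smul_mul_assoc, mul_smul_comm, ← smul_sub]
  congr 1
  have hi := h.isUnit hs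
  set Q := c * c - 1 - algebraMap ℂ A (γ s) with hQ
  have h5 : c * (c * y - y * c) + (c * y - y * c) * c = Q * y - y * Q := by
    rw [hQ, sub_mul _ _ y, mul_sub y, ← Algebra.commutes (γ s) y]
    noncomm_ring
  rw [h5, mul_sub, sub_mul, ← mul_assoc, Ring.inverse_mul_cancel _ hi, one_mul, mul_assoc, mul_assoc,
    Ring.mul_inverse_cancel _ hi, mul_one]

end ContourSylvester

/-! ### Inverting the Sylvester operator on Hilbert-Schmidt kernels -/

theorem inner_kmul_left {p : Ker} (hp : IsSelfAdjoint (op p)) (x y : Ker) :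
    inner ℂ (kmul p y) x = inner ℂ y (kmul p x) := by
  have h : adj p = p := op_injective (by rw [op_adj]; exact hp)
  rw [← bpair_star, ← bpair_star, star_kmul, bpair_kmul_left, tr_star]
  exact congrArg (fun a => bpair (star y) (kmul a x)) h

theorem inner_kmul_right {p : Ker} (hp : IsSelfAdjoint (op p)) (x y : Ker) :
    inner ℂ (kmul y p) x = inner ℂ y (kmul x p) := by
  have h : adj p = p := op_injective (by rw [op_adj]; exact hp)
  rw [← bpair_star, ← bpair_star, star_kmul, bpair_kmul_right, tr_star]
  exact congrArg (fun a => bpair (star y) (kmul x a)) h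

/-- The kernels for which the formula holds form a closed subspace containing every commutator [p,
Y]. As Y ↦ [p, Y] is symmetric for the Hilbert-Schmidt inner product, a kernel orthogonal to that
subspace commutes with p; it then belongs to the subspace by the commuting case and is orthogonal to
itself. No spectral decomposition of p is needed. -/
theorem contourW_eq {γ : ℝ → ℂ} {p : Ker} {c : Op} (hcp : c = 1 + op p) (h1 : 1 ≤ c)
    (h : IsContourAround γ (spectrum ℂ (c * c - 1))) (X : Ker) :
    contourW γ (c * c - 1) (c * op X + op X * c) = op X := by
  have hu : IsUnit c := isUnit_of_one_le h1
  have h0 : 0 ≤ c := zero_le_one.trans h1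
  have hp : IsSelfAdjoint (op p) := by
    have h2 : op p = c - 1 := by rw [hcp]; abel
    rw [h2]
    exact (IsSelfAdjoint.of_nonneg h0).sub (IsSelfAdjoint.one Op)
  obtain ⟨J, hJ⟩ := h.exists_clm
  let L : Ker →L[ℂ] Op := J.comp (((ContinuousLinearMap.mul ℂ Op) c
    + (ContinuousLinearMap.mul ℂ Op).flip c).comp opL) - (2 * Real.pi * Complex.I : ℂ) • opL
  have hL : ∀ Y, L Y = J (c * op Y + op Y * c) - (2 * Real.pi * Complex.I : ℂ) • op Y :=
    fun Y => rfl
  have hclosed : IsClosed (LinearMap.ker L.toLinearMap : Set Ker) := L.isClosed_ker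
  have : CompleteSpace (LinearMap.ker L.toLinearMap) := hclosed.completeSpace_coe
  have htop : LinearMap.ker L.toLinearMap = ⊤ := by
    rw [← Submodule.orthogonal_eq_bot_iff, Submodule.eq_bot_iff]
    intro x hx
    have hrange : ∀ Y, kmul p Y - kmul Y p ∈ LinearMap.ker L.toLinearMap := by
      intro Y
      change L _ = 0
      have e : op (kmul p Y - kmul Y p) = c * op Y - op Y * c := by
        rw [op_sub, op_kmul, op_kmul, hcp]; noncomm_ring
      rw [hL, e, hJ, h.integral_of_commutator h0 hu, sub_self]
    -- Testing orthogonality against the double commutator [p, [p, x]] and moving one commutator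
    -- across gives ‖[p, x]‖² = 0.
    have hk : kmul p x - kmul x p = 0 := by
      have h3 := Submodule.inner_right_of_mem_orthogonal (hrange (kmul p x - kmul x p)) hx
      rw [inner_sub_left, inner_kmul_left hp, inner_kmul_right hp, ← inner_sub_right,
        inner_self_eq_zero] at h3
      exact h3
    have hx2 : x ∈ LinearMap.ker L.toLinearMap := by
      change L x = 0
      have e : c * op x = op x * c := by
        have h4 := congrArg op hk
        rw [op_sub, op_kmul, op_kmul, op_zero, sub_eq_zero] at h4
        rw [hcp, add_mul, mul_add, h4, one_mul, mul_one]
      rw [hL, hJ, h.integral_of_commute h0 hu e, sub_self]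
    exact inner_self_eq_zero.1 (Submodule.inner_right_of_mem_orthogonal hx2 hx)
  have hX : L X = 0 := by
    have : X ∈ LinearMap.ker L.toLinearMap := by rw [htop]; trivial
    exact this
  rw [hL, hJ, sub_eq_zero] at hX
  refine (congrArg ((2 * Real.pi * Complex.I : ℂ)⁻¹ • ·) hX).trans ?_
  simp only [smul_smul]
  rw [inv_mul_cancel₀ Complex.two_pi_I_ne_zero, one_smul]

/-! ### Primitives of integrable vector-valued functions -/

section Primitive

variable {E F G : Type*} [NormedAddCommGroup E] [NormedSpace ℝ E]
  [NormedAddCommGroup F] [NormedSpace ℝ F]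
  [NormedAddCommGroup G] [NormedSpace ℝ G]

theorem continuous_primitive_of_integrable {f : ℝ → E} (hf : Integrable f) :
    Continuous fun t => ∫ s in (0 : ℝ)..t, f s :=
  intervalIntegral.continuous_primitive (fun _ _ => hf.intervalIntegrable) 0

theorem norm_primitive_le {f : ℝ → E} (hf : Integrable f) {t : ℝ} :
    ‖∫ s in (0 : ℝ)..t, f s‖ ≤ ∫ s, ‖f s‖ :=
  intervalIntegral.norm_integral_le_integral_norm_uIoc.trans
    (setIntegral_le_integral hf.norm (Eventually.of_forall fun _ => norm_nonneg _))

theorem integrable_bilin_bounded (B : E →L[ℝ] F →L[ℝ] G) {f : ℝ → E} {g : ℝ → F}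
    {μ : Measure ℝ} (hf : Integrable f μ) (hg : AEStronglyMeasurable g μ) {M : ℝ}
    (hM : ∀ᵐ t ∂μ, ‖g t‖ ≤ M) :
    Integrable (fun t => B (f t) (g t)) μ := by
  refine (hf.norm.const_mul (‖B‖ * M)).mono'
    (B.aestronglyMeasurable_comp₂ hf.aestronglyMeasurable hg) ?_
  filter_upwards [hM] with t ht
  calc _ ≤ ‖B‖ * ‖f t‖ * ‖g t‖ := B.le_opNorm₂ _ _
    _ ≤ ‖B‖ * ‖f t‖ * M := by gcongr
    _ = _ := by ring

/-- Both sides are linear in f and bounded by a constant times its L¹ norm, so the identity extends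
from the dense set of continuous integrable functions. The second factor is held fixed and
continuous. -/
theorem primitive_bilin_of_continuous (B : E →L[ℝ] F →L[ℝ] G) {Y : ℝ → F} {g : ℝ → F}
    (hY : Continuous Y) (hg : Integrable g) {T : ℝ} (hT : 0 ≤ T)
    (h : ∀ f : ℝ → E, Continuous f → Integrable f →
      ∫ t in (0 : ℝ)..T, (B (f t) (Y t) + B (∫ s in (0 : ℝ)..t, f s) (g t))
        = B (∫ t in (0 : ℝ)..T, f t) (Y T)) {f : ℝ → E} (hf : Integrable f) :
    ∫ t in (0 : ℝ)..T, (B (f t) (Y t) + B (∫ s in (0 : ℝ)..t, f s) (g t))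
        = B (∫ t in (0 : ℝ)..T, f t) (Y T) := by
  obtain ⟨M, hM⟩ := (isCompact_Icc (a := (0 : ℝ)) (b := T)).exists_bound_of_continuousOn
    hY.continuousOn
  have hM0 : 0 ≤ M := (norm_nonneg _).trans (hM 0 ⟨le_rfl, hT⟩)
  have hMI : ∀ᵐ t ∂(volume.restrict (Ioc 0 T)), ‖Y t‖ ≤ M :=
    ae_restrict_of_forall_mem measurableSet_Ioc fun t ht => hM t (Ioc_subset_Icc_self ht)
  have hi : ∀ d : ℝ → E, Integrable d → IntervalIntegrable (fun t => B (d t) (Y t)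
      + B (∫ s in (0 : ℝ)..t, d s) (g t)) volume 0 T := by
    intro d hd
    rw [intervalIntegrable_iff_integrableOn_Ioc_of_le hT]
    refine Integrable.add (integrable_bilin_bounded B hd.restrict
      hY.aestronglyMeasurable hMI) ?_
    exact integrable_bilin_bounded B.flip hg.restrict
      (continuous_primitive_of_integrable hd).aestronglyMeasurable
      (Eventually.of_forall fun t => norm_primitive_le hd)
  set K := ‖B‖ * M + ‖B‖ * (∫ t, ‖g t‖) + ‖B‖ * M with hK
  have key : ∀ d : ℝ → E, Integrable d →
      ‖(∫ t in (0 : ℝ)..T, (B (d t) (Y t) + B (∫ s in (0 : ℝ)..t, d s) (g t)))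
        - B (∫ t in (0 : ℝ)..T, d t) (Y T)‖ ≤ K * ∫ t, ‖d t‖ := by
    intro d hd
    refine (norm_sub_le _ _).trans ?_
    have h1 : ‖B (∫ t in (0 : ℝ)..T, d t) (Y T)‖ ≤ ‖B‖ * M * ∫ t, ‖d t‖ := by
      calc _ ≤ ‖B‖ * ‖∫ t in (0 : ℝ)..T, d t‖ * ‖Y T‖ := B.le_opNorm₂ _ _
        _ ≤ ‖B‖ * (∫ t, ‖d t‖) * M := by
          gcongr
          · exact norm_primitive_le hd
          · exact hM T ⟨hT, le_rfl⟩
        _ = _ := by ring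
    have h2 : ‖∫ t in (0 : ℝ)..T, (B (d t) (Y t) + B (∫ s in (0 : ℝ)..t, d s) (g t))‖
        ≤ (‖B‖ * M + ‖B‖ * (∫ t, ‖g t‖)) * ∫ t, ‖d t‖ := by
      rw [intervalIntegral.integral_of_le hT]
      have hb : Integrable (fun t => ‖B‖ * M * ‖d t‖ + ‖B‖ * (∫ t, ‖d t‖) * ‖g t‖) volume :=
        (hd.norm.const_mul _).add (hg.norm.const_mul _)
      calc _ ≤ ∫ t in Ioc 0 T, (‖B‖ * M * ‖d t‖ + ‖B‖ * (∫ t, ‖d t‖) * ‖g t‖) := by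
            refine norm_integral_le_of_norm_le hb.restrict ?_
            filter_upwards [hMI] with t ht
            refine (norm_add_le _ _).trans (add_le_add ?_ ?_)
            · calc _ ≤ ‖B‖ * ‖d t‖ * ‖Y t‖ := B.le_opNorm₂ _ _
                _ ≤ ‖B‖ * ‖d t‖ * M := by gcongr
                _ = _ := by ring
            · refine (B.le_opNorm₂ _ _).trans ?_
              gcongr
              exact norm_primitive_le hd
        _ ≤ ∫ t, (‖B‖ * M * ‖d t‖ + ‖B‖ * (∫ t, ‖d t‖) * ‖g t‖) :=
            setIntegral_le_integral hb (Eventually.of_forall fun t => by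
              have : 0 ≤ ∫ t, ‖d t‖ := integral_nonneg fun t => norm_nonneg (d t)
              simp only [Pi.zero_apply]
              positivity)
        _ = _ := by
          rw [integral_add (hd.norm.const_mul _) (hg.norm.const_mul _), integral_const_mul,
            integral_const_mul]
          ring
    rw [hK]
    linarith
  rw [← sub_eq_zero, ← norm_le_zero_iff]
  refine le_of_forall_pos_le_add fun ε hε => ?_
  have hK0 : 0 ≤ K := by
    have : 0 ≤ ∫ t, ‖g t‖ := integral_nonneg fun t => norm_nonneg (g t)
    positivity
  -- The tolerance is divided by K + 1 rather than K, since K may vanish.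
  obtain ⟨f', -, hf'1, hf'2, hf'3⟩ := hf.exists_hasCompactSupport_integral_sub_le
    (ε := ε / (K + 1)) (by positivity)
  have h3 := key (fun t => f t - f' t) (hf.sub hf'3)
  have h4 := h f' hf'2 hf'3
  have e1 : ∀ t, ∫ s in (0 : ℝ)..t, (f s - f' s)
      = (∫ s in (0 : ℝ)..t, f s) - ∫ s in (0 : ℝ)..t, f' s := fun t =>
    intervalIntegral.integral_sub hf.intervalIntegrable hf'3.intervalIntegrable
  have e2 : ∫ t in (0 : ℝ)..T, (B (f t - f' t) (Y t) + B (∫ s in (0 : ℝ)..t, (f s - f' s)) (g t))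
      = (∫ t in (0 : ℝ)..T, (B (f t) (Y t) + B (∫ s in (0 : ℝ)..t, f s) (g t)))
        - ∫ t in (0 : ℝ)..T, (B (f' t) (Y t) + B (∫ s in (0 : ℝ)..t, f' s) (g t)) := by
    rw [← intervalIntegral.integral_sub (hi f hf) (hi f' hf'3)]
    refine intervalIntegral.integral_congr fun t _ => ?_
    simp only [e1, map_sub, sub_apply]
    abel
  rw [e2, e1, h4, map_sub, sub_apply, sub_sub_sub_cancel_right] at h3
  refine h3.trans ?_
  rw [zero_add]
  calc K * ∫ t, ‖f t - f' t‖ ≤ K * (ε / (K + 1)) := by gcongr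
    _ ≤ ε := by
      rw [mul_div_assoc', div_le_iff₀ (by positivity)]
      nlinarith

variable [CompleteSpace E] [CompleteSpace F] [CompleteSpace G]

/-- For continuous densities this is the classical product rule. Continuity is then removed from f
with g fixed, and afterwards from g by the same argument applied to the flipped bilinear map. -/
theorem primitive_bilin_zero (B : E →L[ℝ] F →L[ℝ] G) {f : ℝ → E} {g : ℝ → F}
    (hf : Integrable f) (hg : Integrable g) {T : ℝ} (hT : 0 ≤ T) :
    ∫ t in (0 : ℝ)..T, (B (f t) (∫ s in (0 : ℝ)..t, g s) + B (∫ s in (0 : ℝ)..t, f s) (g t))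
        = B (∫ t in (0 : ℝ)..T, f t) (∫ t in (0 : ℝ)..T, g t) := by
  have h1 : ∀ g : ℝ → F, Continuous g → Integrable g →
      ∫ t in (0 : ℝ)..T, (B (f t) (∫ s in (0 : ℝ)..t, g s) + B (∫ s in (0 : ℝ)..t, f s) (g t))
        = B (∫ t in (0 : ℝ)..T, f t) (∫ t in (0 : ℝ)..T, g t) := by
    intro g hgc hgi
    refine primitive_bilin_of_continuous B (continuous_primitive_of_integrable hgi) hgi hT
      (fun f hfc hfi => ?_) hf
    have hd : ∀ t, HasDerivAt (fun t => B (∫ s in (0 : ℝ)..t, f s) (∫ s in (0 : ℝ)..t, g s))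
        (B (f t) (∫ s in (0 : ℝ)..t, g s) + B (∫ s in (0 : ℝ)..t, f s) (g t)) t := by
      intro t
      have hF : HasDerivAt (fun t => ∫ s in (0 : ℝ)..t, f s) (f t) t :=
        hfc.integral_hasStrictDerivAt 0 t |>.hasDerivAt
      have hG : HasDerivAt (fun t => ∫ s in (0 : ℝ)..t, g s) (g t) t :=
        hgc.integral_hasStrictDerivAt 0 t |>.hasDerivAt
      have := B.hasFDerivAt_of_bilinear hF.hasFDerivAt hG.hasFDerivAt
      have h2 := this.hasDerivAt
      simp at h2
      rwa [add_comm]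
    rw [intervalIntegral.integral_eq_sub_of_hasDerivAt (fun t _ => hd t)]
    · simp
    · have c1 := continuous_primitive_of_integrable hfi
      have c2 := continuous_primitive_of_integrable hgi
      exact ((B.continuous₂.comp (hfc.prodMk c2)).add
        (B.continuous₂.comp (c1.prodMk hgc))).intervalIntegrable 0 T
  have h2 := primitive_bilin_of_continuous (f := g) B.flip (continuous_primitive_of_integrable hf) hf hT
    (fun g hgc hgi => by
      rw [ContinuousLinearMap.flip_apply, ← h1 g hgc hgi]
      exact intervalIntegral.integral_congr fun t _ => add_comm _ _) hg
  rw [ContinuousLinearMap.flip_apply] at h2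
  rw [← h2]
  exact intervalIntegral.integral_congr fun t _ => add_comm _ _

theorem primitive_bilin (B : E →L[ℝ] F →L[ℝ] G) {f : ℝ → E} {g : ℝ → F}
    (hf : Integrable f) (hg : Integrable g) {T : ℝ} (hT : 0 ≤ T) (x : E) (y : F) :
    ∫ t in (0 : ℝ)..T, (B (f t) (y + ∫ s in (0 : ℝ)..t, g s)
        + B (x + ∫ s in (0 : ℝ)..t, f s) (g t))
      = B (x + ∫ t in (0 : ℝ)..T, f t) (y + ∫ t in (0 : ℝ)..T, g t) - B x y := by
  have h1 := primitive_bilin_zero B hf hg hT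
  have i1 : IntervalIntegrable (fun t => B (f t) (∫ s in (0 : ℝ)..t, g s)
      + B (∫ s in (0 : ℝ)..t, f s) (g t)) volume 0 T :=
    ((integrable_bilin_bounded B hf (continuous_primitive_of_integrable hg).aestronglyMeasurable
      (Eventually.of_forall fun t => norm_primitive_le hg)).add
      (integrable_bilin_bounded B.flip hg
        (continuous_primitive_of_integrable hf).aestronglyMeasurable
        (Eventually.of_forall fun t => norm_primitive_le hf))).intervalIntegrable
  have i2 : IntervalIntegrable (fun t => B.flip y (f t)) volume 0 T :=
    ((B.flip y).integrable_comp hf).intervalIntegrable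
  have i3 : IntervalIntegrable (fun t => B x (g t)) volume 0 T :=
    ((B x).integrable_comp hg).intervalIntegrable
  have h2 := (B.flip y).intervalIntegral_comp_comm (hf.intervalIntegrable (a := 0) (b := T))
  have h3 := (B x).intervalIntegral_comp_comm (hg.intervalIntegrable (a := 0) (b := T))
  rw [ContinuousLinearMap.flip_apply] at h2
  calc _ = ∫ t in (0 : ℝ)..T, ((B (f t) (∫ s in (0 : ℝ)..t, g s)
      + B (∫ s in (0 : ℝ)..t, f s) (g t)) + B.flip y (f t) + B x (g t)) := by
        refine intervalIntegral.integral_congr fun t _ => ?_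
        simp only [map_add, add_apply, ContinuousLinearMap.flip_apply]
        abel
    _ = _ := by
      rw [intervalIntegral.integral_add (i1.add i2) i3, intervalIntegral.integral_add i1 i2, h1, h2,
        h3]
      simp only [map_add, add_apply]
      abel

end Primitive

/-! ### Weak time derivatives -/

section WeakDeriv

variable {E F G : Type*} [NormedAddCommGroup E] [NormedSpace ℝ E]
  [NormedAddCommGroup F] [NormedSpace ℝ F]
  [NormedAddCommGroup G] [NormedSpace ℝ G]

/-- `χ ∈ C_c^∞((0,T))`. -/
def IsTimeTest (T : ℝ) (χ : ℝ → ℝ) : Prop :=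
  ContDiff ℝ (⊤ : ℕ∞) χ ∧ HasCompactSupport χ ∧ tsupport χ ⊆ Ioo 0 T

/-- `∂ₜ x = y` in the sense of distributions on `(0,T)`. -/
def WeakDeriv (T : ℝ) (x y : ℝ → E) : Prop :=
  ∀ χ : ℝ → ℝ, IsTimeTest T χ →
    ∫ t, deriv χ t • x t ∂(timeMeasure T) = -∫ t, χ t • y t ∂(timeMeasure T)

theorem IsTimeTest.continuous {T : ℝ} {χ : ℝ → ℝ} (h : IsTimeTest T χ) : Continuous χ :=
  h.1.continuous

theorem IsTimeTest.continuous_deriv {T : ℝ} {χ : ℝ → ℝ} (h : IsTimeTest T χ) :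
    Continuous (deriv χ) := h.1.continuous_deriv (by simp)

theorem IsTimeTest.exists_bound {T : ℝ} {χ : ℝ → ℝ} (h : IsTimeTest T χ) :
    ∃ M, ∀ t, ‖χ t‖ ≤ M ∧ ‖deriv χ t‖ ≤ M := by
  obtain ⟨M, hM⟩ := h.2.1.exists_bound_of_continuous h.continuous
  obtain ⟨N, hN⟩ := h.2.1.deriv.exists_bound_of_continuous h.continuous_deriv
  exact ⟨max M N, fun t => ⟨(hM t).trans (le_max_left _ _), (hN t).trans (le_max_right _ _)⟩⟩

theorem IsTimeTest.integrable_smul {T : ℝ} {χ : ℝ → ℝ} (h : IsTimeTest T χ) {x : ℝ → E}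
    (hx : Integrable x (timeMeasure T)) : Integrable (fun t => χ t • x t) (timeMeasure T) := by
  obtain ⟨M, hM⟩ := h.exists_bound
  exact hx.bdd_smul M h.continuous.aestronglyMeasurable
    (Eventually.of_forall fun t => (hM t).1)

theorem IsTimeTest.integrable_deriv_smul {T : ℝ} {χ : ℝ → ℝ} (h : IsTimeTest T χ) {x : ℝ → E}
    (hx : Integrable x (timeMeasure T)) :
    Integrable (fun t => deriv χ t • x t) (timeMeasure T) := by
  obtain ⟨M, hM⟩ := h.exists_bound
  exact hx.bdd_smul M h.continuous_deriv.aestronglyMeasurable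
    (Eventually.of_forall fun t => (hM t).2)

theorem integral_timeMeasure {T : ℝ} (hT : 0 ≤ T) (x : ℝ → E) :
    ∫ t, x t ∂(timeMeasure T) = ∫ t in (0 : ℝ)..T, x t := by
  rw [intervalIntegral.integral_of_le hT, ← integral_Icc_eq_integral_Ioc]

theorem WeakDeriv.congr {T : ℝ} {x x' y y' : ℝ → E} (h : WeakDeriv T x y)
    (hx : x =ᵐ[timeMeasure T] x') (hy : y =ᵐ[timeMeasure T] y') : WeakDeriv T x' y' := by
  intro χ hχ
  have h1 := h χ hχ
  rw [integral_congr_ae (hx.mono fun t ht => by simp only [ht] :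
    (fun t => deriv χ t • x t) =ᵐ[timeMeasure T] fun t => deriv χ t • x' t),
    integral_congr_ae (hy.mono fun t ht => by simp only [ht] :
    (fun t => χ t • y t) =ᵐ[timeMeasure T] fun t => χ t • y' t)] at h1
  exact h1

variable [CompleteSpace E] [CompleteSpace F] [CompleteSpace G]

theorem IsTimeTest.integral_primitive {T : ℝ} (hT : 0 ≤ T) {χ : ℝ → ℝ} (h : IsTimeTest T χ)
    {f : ℝ → E} (hf : Integrable f) (x : E) :
    ∫ t, (deriv χ t • (x + ∫ s in (0 : ℝ)..t, f s) + χ t • f t) ∂(timeMeasure T) = 0 := by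
  have h0 : χ 0 = 0 := image_eq_zero_of_notMem_tsupport fun h' => (h.2.2 h').1.ne rfl
  have hT0 : χ T = 0 := image_eq_zero_of_notMem_tsupport fun h' => (h.2.2 h').2.ne rfl
  have hd : Integrable (deriv χ) := h.continuous_deriv.integrable_of_hasCompactSupport h.2.1.deriv
  have hprim : ∀ t, ∫ s in (0 : ℝ)..t, deriv χ s = χ t := fun t => by
    rw [intervalIntegral.integral_deriv_eq_sub (fun s _ => (h.1.differentiable (by simp)) s)
      (h.continuous_deriv.intervalIntegrable _ _), h0, sub_zero]
  have h1 := primitive_bilin (ContinuousLinearMap.lsmul ℝ ℝ : ℝ →L[ℝ] E →L[ℝ] E) hd hf hT 0 x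
  simp only [hprim, zero_add, hT0, ContinuousLinearMap.lsmul_apply, zero_smul, sub_zero] at h1
  rw [integral_timeMeasure hT, h1]

theorem IsTimeTest.integral_primitive_bilin {T : ℝ} (hT : 0 ≤ T) {χ : ℝ → ℝ}
    (h : IsTimeTest T χ) (B : E →L[ℝ] F →L[ℝ] G) {f : ℝ → E} {g : ℝ → F} (hf : Integrable f)
    (hg : Integrable g) (x : E) (y : F) :
    ∫ t, (deriv χ t • B (x + ∫ s in (0 : ℝ)..t, f s) (y + ∫ s in (0 : ℝ)..t, g s)
      + χ t • (B (f t) (y + ∫ s in (0 : ℝ)..t, g s) + B (x + ∫ s in (0 : ℝ)..t, f s) (g t)))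
      ∂(timeMeasure T) = 0 := by
  have hk : Integrable fun t => B (f t) (y + ∫ s in (0 : ℝ)..t, g s)
      + B (x + ∫ s in (0 : ℝ)..t, f s) (g t) := by
    refine (integrable_bilin_bounded B hf (continuous_const.add
      (continuous_primitive_of_integrable hg)).aestronglyMeasurable
      (M := ‖y‖ + ∫ s, ‖g s‖) (Eventually.of_forall fun t => ?_)).add
      (integrable_bilin_bounded B.flip hg (continuous_const.add
      (continuous_primitive_of_integrable hf)).aestronglyMeasurable
      (M := ‖x‖ + ∫ s, ‖f s‖) (Eventually.of_forall fun t => ?_))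
    · exact (norm_add_le _ _).trans (add_le_add_right (norm_primitive_le hg) _)
    · exact (norm_add_le _ _).trans (add_le_add_right (norm_primitive_le hf) _)
  rw [← h.integral_primitive hT hk (B x y)]
  refine setIntegral_congr_fun measurableSet_Icc fun t ht => ?_
  rw [primitive_bilin B hf hg ht.1, add_sub_cancel]

theorem exists_timeTest {T : ℝ} (hT : 0 < T) : ∃ η, IsTimeTest T η ∧ ∫ t, η t = 1 := by
  let b : ContDiffBump (T / 2) := ⟨T / 8, T / 4, by positivity, by linarith⟩
  refine ⟨b.normed volume, ⟨b.contDiff_normed, b.hasCompactSupport_normed, ?_⟩,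
    b.integral_normed⟩
  rw [b.tsupport_normed_eq, Real.closedBall_eq_Icc]
  intro t ht
  change t ∈ Icc (T / 2 - T / 4) (T / 2 + T / 4) at ht
  exact ⟨by linarith [ht.1], by linarith [ht.2]⟩

theorem IsTimeTest.primitive {T : ℝ} {ζ : ℝ → ℝ} (h : IsTimeTest T ζ) (h0 : ∫ t, ζ t = 0) :
    IsTimeTest T (fun t => ∫ s in (0 : ℝ)..t, ζ s) ∧
      deriv (fun t => ∫ s in (0 : ℝ)..t, ζ s) = ζ := by
  have hd : ∀ t, HasDerivAt (fun t => ∫ s in (0 : ℝ)..t, ζ s) (ζ t) t := fun t =>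
    (h.continuous.integral_hasStrictDerivAt 0 t).hasDerivAt
  have hderiv : deriv (fun t => ∫ s in (0 : ℝ)..t, ζ s) = ζ := funext fun t => (hd t).deriv
  refine ⟨?_, hderiv⟩
  have hcd : ContDiff ℝ (⊤ : ℕ∞) (fun t => ∫ s in (0 : ℝ)..t, ζ s) := by
    rw [contDiff_infty_iff_deriv, hderiv]
    exact ⟨fun t => (hd t).differentiableAt, h.1⟩
  by_cases hne : (tsupport ζ).Nonempty
  · obtain ⟨a, ha, ha'⟩ := h.2.1.isCompact.exists_isLeast hne
    obtain ⟨b, hb, hb'⟩ := h.2.1.isCompact.exists_isGreatest hne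
    have hz : ∀ t, t < a ∨ b < t → ζ t = 0 := by
      intro t ht
      refine image_eq_zero_of_notMem_tsupport fun ht' => ?_
      rcases ht with ht | ht
      · exact (ha' ht').not_gt ht
      · exact (hb' ht').not_gt ht
    have hi : Integrable ζ := h.continuous.integrable_of_hasCompactSupport h.2.1
    have hout : ∀ t, t ∉ Icc a b → ∫ s in (0 : ℝ)..t, ζ s = 0 := by
      intro t ht
      rw [mem_Icc, not_and_or, not_le, not_le] at ht
      rcases ht with ht | ht
      · refine intervalIntegral.integral_zero_ae (Eventually.of_forall fun s hs => hz s (Or.inl ?_))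
        have h1 := hs.2
        exact h1.trans_lt (max_lt (h.2.2 ha).1 ht)
      · rw [← intervalIntegral.integral_Iic_sub_Iic hi.integrableOn hi.integrableOn]
        rw [← integral_add_compl (measurableSet_Iic (a := t)) hi] at h0
        have e1 : ∫ s in Iic (0 : ℝ), ζ s = 0 := setIntegral_eq_zero_of_forall_eq_zero fun s hs =>
          hz s (Or.inl (lt_of_le_of_lt hs (h.2.2 ha).1))
        have e2 : ∫ s in (Iic t)ᶜ, ζ s = 0 := setIntegral_eq_zero_of_forall_eq_zero fun s hs =>
          hz s (Or.inr (ht.trans (not_le.1 hs)))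
        rw [e2, add_zero] at h0
        rw [e1, h0, sub_zero]
    have hsub : tsupport (fun t => ∫ s in (0 : ℝ)..t, ζ s) ⊆ Icc a b :=
      closure_minimal (fun t ht => by_contra fun h' => ht (hout t h')) isClosed_Icc
    exact ⟨hcd, HasCompactSupport.of_support_subset_isCompact isCompact_Icc
      (subset_closure.trans hsub), hsub.trans fun t ht =>
        ⟨(h.2.2 ha).1.trans_le ht.1, ht.2.trans_lt (h.2.2 hb).2⟩⟩
  · have hz : ζ = 0 := by
      rw [not_nonempty_iff_eq_empty, tsupport_eq_empty_iff] at hne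
      exact hne
    have hz' : (fun t => ∫ s in (0 : ℝ)..t, ζ s) = 0 := by
      funext t
      simp [hz]
    rw [hz', ← hz]
    exact h

/-- A test function is a derivative of a test function exactly when its integral vanishes. Fixing η₀
of integral one, every η differs from a multiple of η₀ by such a derivative, and the constant is the
η₀-average of w. -/
theorem ae_const_of_weakDeriv_zero {T : ℝ} (hT : 0 < T) {w : ℝ → E}
    (hw : Integrable w (timeMeasure T))
    (h : ∀ χ, IsTimeTest T χ → ∫ t, deriv χ t • w t ∂(timeMeasure T) = 0) :
    ∃ w₀, ∀ᵐ t ∂(timeMeasure T), w t = w₀ := by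
  obtain ⟨η₀, hη₀, hη₀1⟩ := exists_timeTest hT
  refine ⟨∫ t, η₀ t • w t ∂(timeMeasure T), ?_⟩
  set w₀ := ∫ t, η₀ t • w t ∂(timeMeasure T) with hw₀
  have hsupp : ∀ η : ℝ → ℝ, IsTimeTest T η → ∫ t, η t ∂(timeMeasure T) = ∫ t, η t := by
    intro η hη
    refine setIntegral_eq_integral_of_forall_compl_eq_zero fun t ht => ?_
    exact image_eq_zero_of_notMem_tsupport fun h' => ht (Ioo_subset_Icc_self (hη.2.2 h'))
  have key : ∀ η : ℝ → ℝ, IsTimeTest T η → ∫ t, η t • (w t - w₀) ∂(timeMeasure T) = 0 := by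
    intro η hη
    have hζ : IsTimeTest T (fun t => η t - (∫ s, η s) * η₀ t) := by
      refine ⟨hη.1.sub (contDiff_const.mul hη₀.1), hη.2.1.sub hη₀.2.1.mul_left, ?_⟩
      refine (tsupport_sub _ _).trans (union_subset hη.2.2 ?_)
      exact (tsupport_mul_subset_right (f := fun _ => ∫ s, η s) (g := η₀)).trans hη₀.2.2
    have hi : Integrable η := hη.continuous.integrable_of_hasCompactSupport hη.2.1
    have hi₀ : Integrable η₀ := hη₀.continuous.integrable_of_hasCompactSupport hη₀.2.1
    have hζ0 : ∫ t, (η t - (∫ s, η s) * η₀ t) = 0 := by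
      rw [integral_sub hi (hi₀.const_mul _), integral_const_mul, hη₀1, mul_one, sub_self]
    obtain ⟨h1, h2⟩ := hζ.primitive hζ0
    have h3 := h _ h1
    rw [h2] at h3
    simp only [sub_smul, mul_smul] at h3
    rw [integral_sub (hη.integrable_smul hw) ((hη₀.integrable_smul hw).fun_smul _),
      integral_smul] at h3
    simp only [smul_sub]
    rw [integral_sub (hη.integrable_smul hw) (hi.restrict.smul_const w₀), integral_smul_const,
      hsupp η hη]
    exact h3
  have hloc : LocallyIntegrableOn (fun t => w t - w₀) (Ioo 0 T) volume := by
    have : IntegrableOn (fun t => w t - w₀) (Icc 0 T) volume :=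
      Integrable.sub hw (integrable_const _)
    exact (this.mono_set Ioo_subset_Icc_self).locallyIntegrableOn
  have h1 := isOpen_Ioo.ae_eq_zero_of_integral_contDiff_smul_eq_zero hloc fun η h1 h2 h3 => by
    rw [← key η ⟨h1, h2, h3⟩]
    refine (setIntegral_eq_integral_of_forall_compl_eq_zero fun t ht => ?_).symm
    rw [image_eq_zero_of_notMem_tsupport fun h' => ht (Ioo_subset_Icc_self (h3 h')), zero_smul]
  rw [timeMeasure, ← restrict_Ioo_eq_restrict_Icc, ae_restrict_iff' measurableSet_Ioo]
  filter_upwards [h1] with t ht ht'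
  exact sub_eq_zero.1 (ht ht')

/-- Every weakly differentiable curve is almost everywhere absolutely continuous, so the Leibniz
rule reduces to products of primitives. -/
theorem WeakDeriv.eq_primitive {T : ℝ} (hT : 0 < T) {x y : ℝ → E} (h : WeakDeriv T x y)
    (hx : Integrable x (timeMeasure T)) (hy : Integrable y (timeMeasure T)) :
    ∃ x₀, ∀ᵐ t ∂(timeMeasure T), x t = x₀ + ∫ s in (0 : ℝ)..t, (Icc 0 T).indicator y s := by
  have hi : Integrable ((Icc 0 T).indicator y) := (integrable_indicator_iff measurableSet_Icc).2 hy
  have hP : Integrable (fun t => ∫ s in (0 : ℝ)..t, (Icc 0 T).indicator y s) (timeMeasure T) :=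
    (continuous_primitive_of_integrable hi).continuousOn.integrableOn_compact isCompact_Icc
  obtain ⟨w₀, hw₀⟩ := ae_const_of_weakDeriv_zero hT (hx.sub hP) fun χ hχ => by
    have h1 := h χ hχ
    have h2 := hχ.integral_primitive hT.le hi 0
    simp only [zero_add] at h2
    rw [integral_add (hχ.integrable_deriv_smul hP)
      (hχ.integrable_smul hi.restrict)] at h2
    have h3 : ∫ t, χ t • (Icc 0 T).indicator y t ∂(timeMeasure T)
        = ∫ t, χ t • y t ∂(timeMeasure T) :=
      setIntegral_congr_fun measurableSet_Icc fun t ht => by simp only [indicator_of_mem ht]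
    simp only [Pi.sub_apply, smul_sub]
    rw [integral_sub (hχ.integrable_deriv_smul hx) (hχ.integrable_deriv_smul hP), h1, ← h3,
      eq_neg_of_add_eq_zero_left h2, sub_self]
  refine ⟨w₀, hw₀.mono fun t ht => ?_⟩
  rw [← ht]
  simp

/-- The Leibniz rule for weak derivatives. -/
theorem WeakDeriv.bilin {T : ℝ} (hT : 0 < T) (B : E →L[ℝ] F →L[ℝ] G) {x f : ℝ → E} {y g : ℝ → F}
    (h : WeakDeriv T x f) (h' : WeakDeriv T y g)
    (hx : Integrable x (timeMeasure T)) (hf : Integrable f (timeMeasure T))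
    (hy : Integrable y (timeMeasure T)) (hg : Integrable g (timeMeasure T)) :
    WeakDeriv T (fun t => B (x t) (y t)) (fun t => B (f t) (y t) + B (x t) (g t)) := by
  obtain ⟨x₀, hx₀⟩ := h.eq_primitive hT hx hf
  obtain ⟨y₀, hy₀⟩ := h'.eq_primitive hT hy hg
  have hf' : Integrable ((Icc 0 T).indicator f) := (integrable_indicator_iff measurableSet_Icc).2 hf
  have hg' : Integrable ((Icc 0 T).indicator g) := (integrable_indicator_iff measurableSet_Icc).2 hg
  set X := fun t => x₀ + ∫ s in (0 : ℝ)..t, (Icc 0 T).indicator f s with hX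
  set Y := fun t => y₀ + ∫ s in (0 : ℝ)..t, (Icc 0 T).indicator g s with hY
  have hXc : Continuous X := continuous_const.add (continuous_primitive_of_integrable hf')
  have hYc : Continuous Y := continuous_const.add (continuous_primitive_of_integrable hg')
  have hXb : ∀ t, ‖X t‖ ≤ ‖x₀‖ + ∫ s, ‖(Icc 0 T).indicator f s‖ := fun t =>
    (norm_add_le _ _).trans (add_le_add_right (norm_primitive_le hf') _)
  have hYb : ∀ t, ‖Y t‖ ≤ ‖y₀‖ + ∫ s, ‖(Icc 0 T).indicator g s‖ := fun t =>
    (norm_add_le _ _).trans (add_le_add_right (norm_primitive_le hg') _)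
  have main : WeakDeriv T (fun t => B (X t) (Y t)) (fun t => B ((Icc 0 T).indicator f t) (Y t)
      + B (X t) ((Icc 0 T).indicator g t)) := by
    intro χ hχ
    have h1 := hχ.integral_primitive_bilin hT.le B hf' hg' x₀ y₀
    rw [integral_add] at h1
    · exact eq_neg_of_add_eq_zero_left h1
    · refine hχ.integrable_deriv_smul ?_
      exact (B.continuous₂.comp (hXc.prodMk hYc)).continuousOn.integrableOn_compact isCompact_Icc
    · refine hχ.integrable_smul (Integrable.add ?_ ?_)
      · exact integrable_bilin_bounded B hf'.restrict hYc.aestronglyMeasurable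
          (Eventually.of_forall hYb)
      · exact integrable_bilin_bounded B.flip hg'.restrict hXc.aestronglyMeasurable
          (Eventually.of_forall hXb)
  refine main.congr ?_ ?_
  · filter_upwards [hx₀, hy₀] with t h1 h2
    rw [h1, h2]
  · filter_upwards [hx₀, hy₀, ae_restrict_mem measurableSet_Icc] with t h1 h2 ht
    rw [h1, h2, indicator_of_mem ht, indicator_of_mem ht]

end WeakDeriv

/-! ### Dual weak evolution equations -/

theorem tendsto_bilin {E F G ι : Type*} [NormedAddCommGroup E] [NormedSpace ℂ E]
    [NormedAddCommGroup F] [NormedSpace ℂ F] [NormedAddCommGroup G] [NormedSpace ℂ G]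
    (B : E →L[ℂ] F →L[ℂ] G) {l : Filter ι} {f : ι → E} {g : ι → F} {x : E} {y : F}
    (hf : Tendsto f l (𝓝 x)) (hg : Tendsto g l (𝓝 y)) :
    Tendsto (fun n => B (f n) (g n)) l (𝓝 (B x y)) :=
  (B.continuous₂.tendsto (x, y)).comp (hf.prodMk_nhds hg)

section Duality

variable {α : Type*} [MeasureSpace α]

theorem eq_of_bpair_dense {S : Set (Lp ℂ 2 (volume : Measure α))} (hS : Dense S)
    {f g : Lp ℂ 2 (volume : Measure α)} (h : ∀ e ∈ S, bpair f e = bpair g e) : f = g := by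
  rw [← sub_eq_zero]
  refine eq_zero_of_bpair fun e => ?_
  have h1 : bpair f = bpair g := ContinuousLinearMap.ext fun e => by
    have := Continuous.ext_on hS (bpair f).continuous (bpair g).continuous h
    exact congrFun this e
  rw [map_sub, bpair_comm e f, bpair_comm e g, h1, sub_self]

/-- A vector-valued weak derivative may be tested by a separating set of functionals, because they
commute with the time integrals. -/
theorem weakDeriv_of_bpair {T : ℝ} {S : Set (Lp ℂ 2 (volume : Measure α))}
    (hS : ∀ f, (∀ e ∈ S, bpair f e = 0) → f = 0)
    {x y : ℝ → Lp ℂ 2 (volume : Measure α)}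
    (hx : Integrable x (timeMeasure T)) (hy : Integrable y (timeMeasure T))
    (h : ∀ e ∈ S, WeakDeriv T (fun t => bpair (x t) e) (fun t => bpair (y t) e)) :
    WeakDeriv T x y := by
  intro χ hχ
  rw [← sub_eq_zero]
  refine hS _ fun e he => ?_
  rw [map_sub, sub_apply, sub_eq_zero]
  have h1 := h e he χ hχ
  let L : Lp ℂ 2 (volume : Measure α) →L[ℝ] ℂ := (bpair.flip e).restrictScalars ℝ
  have hL : ∀ f, bpair f e = L f := fun f => rfl
  simp only [hL] at h1 ⊢
  rw [map_neg, ← L.integral_comp_comm (hχ.integrable_deriv_smul hx),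
    ← L.integral_comp_comm (hχ.integrable_smul hy)]
  simpa only [map_smul] using h1

/-- Regularizing operators `J` such that `(J e, B e)` is in the graph `G` of the generator. -/
structure Regularizer (G : Set (Lp ℂ 2 (volume : Measure α) × Lp ℂ 2 (volume : Measure α)))
    (J B : ℕ → Lp ℂ 2 (volume : Measure α) →L[ℂ] Lp ℂ 2 (volume : Measure α)) : Prop where
  symm_left : ∀ n x y, bpair (J n x) y = bpair x (J n y)
  symm_right : ∀ n x y, bpair (B n x) y = bpair x (B n y)
  comm : ∀ n x, J n (B n x) = B n (J n x)
  norm_le : ∀ n x, ‖J n x‖ ≤ ‖x‖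
  tendsto : ∀ x, Tendsto (fun n => J n x) atTop (𝓝 x)
  exists_separating : ∃ S : Set (Lp ℂ 2 (volume : Measure α)),
    (∀ f, (∀ e ∈ S, bpair f e = 0) → f = 0) ∧ ∀ n, ∀ e ∈ S, (J n e, B n e) ∈ G

variable {G : Set (Lp ℂ 2 (volume : Measure α) × Lp ℂ 2 (volume : Measure α))}
  {J B : ℕ → Lp ℂ 2 (volume : Measure α) →L[ℂ] Lp ℂ 2 (volume : Measure α)}

theorem norm_bpair_le (f g : Lp ℂ 2 (volume : Measure α)) :
    ‖bpair f g‖ ≤ ‖f‖ * ‖g‖ := by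
  rw [← star_star f, bpair_star, norm_star_Lp]
  exact norm_inner_le_norm _ _

theorem integrable_bpair {T : ℝ} {x y : ℝ → Lp ℂ 2 (volume : Measure α)}
    (hx : Integrable x (timeMeasure T)) (hy : MemLp y ∞ (timeMeasure T)) :
    Integrable (fun t => bpair (x t) (y t)) (timeMeasure T) := by
  refine integrable_bilin_bounded (bpair.bilinearRestrictScalars ℝ) hx hy.1
    (M := (eLpNorm y ∞ (timeMeasure T)).toReal) ?_
  filter_upwards [ae_le_eLpNormEssSup (f := y) (μ := timeMeasure T)] with t ht
  rw [eLpNorm_exponent_top, ← toReal_enorm]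
  exact ENNReal.toReal_mono (by simpa using hy.2.ne) ht

theorem MemLp.integrable_time {E : Type*} [NormedAddCommGroup E] {T : ℝ} {x : ℝ → E}
    (hx : MemLp x ∞ (timeMeasure T)) : Integrable x (timeMeasure T) :=
  hx.integrable le_top

theorem tendsto_integral_bpair (hR : Regularizer G J B) {T : ℝ} {χ : ℝ → ℝ} (hχ : Continuous χ)
    {M : ℝ} (hM : ∀ t, ‖χ t‖ ≤ M) {x y : ℝ → Lp ℂ 2 (volume : Measure α)}
    (hx : Integrable x (timeMeasure T)) (hy : MemLp y ∞ (timeMeasure T)) :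
    Tendsto (fun n => ∫ t, χ t • bpair (J n (x t)) (J n (y t)) ∂(timeMeasure T)) atTop
      (𝓝 (∫ t, χ t • bpair (x t) (y t) ∂(timeMeasure T))) := by
  have hM0 : 0 ≤ M := (norm_nonneg _).trans (hM 0)
  have hxy : Integrable (fun t => M * (‖x t‖ * ‖y t‖)) (timeMeasure T) := by
    refine Integrable.const_mul ?_ M
    have := integrable_bilin_bounded (ContinuousLinearMap.mul ℝ ℝ) hx.norm hy.1.norm
      (M := (eLpNorm y ∞ (timeMeasure T)).toReal) (by
        filter_upwards [ae_le_eLpNormEssSup (f := y) (μ := timeMeasure T)] with t ht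
        rw [eLpNorm_exponent_top, norm_norm, ← toReal_enorm]
        exact ENNReal.toReal_mono (by simpa using hy.2.ne) ht)
    simpa using this
  refine tendsto_integral_of_dominated_convergence _ (fun n => ?_) hxy (fun n => ?_) ?_
  · exact hχ.aestronglyMeasurable.smul (bpair.aestronglyMeasurable_comp₂
      ((J n).continuous.comp_aestronglyMeasurable hx.1)
      ((J n).continuous.comp_aestronglyMeasurable hy.1))
  · refine Eventually.of_forall fun t => ?_
    rw [norm_smul]
    refine mul_le_mul (hM t) ((norm_bpair_le _ _).trans ?_) (norm_nonneg _) hM0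
    exact mul_le_mul (hR.norm_le n _) (hR.norm_le n _) (norm_nonneg _) (norm_nonneg _)
  · refine Eventually.of_forall fun t => Tendsto.const_smul ?_ _
    exact tendsto_bilin bpair (hR.tendsto (x t)) (hR.tendsto (y t))

theorem integrable_source {T : ℝ} (s : ℂ) {a a₁ : ℝ → Lp ℂ 2 (volume : Measure α)}
    (ha : Integrable a (timeMeasure T)) (ha₁ : Integrable a₁ (timeMeasure T)) (n : ℕ) :
    Integrable (fun t => (-Complex.I) • (s • B n (a t) + J n (a₁ t))) (timeMeasure T) :=
  Integrable.fun_smul _ ((((B n).integrable_comp ha).fun_smul s).add ((J n).integrable_comp ha₁))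

/-- Testing on J e in the domain and moving J and B back by symmetry gives an equation for J a whose
generator term B a is an honest L² vector. The scalar s distinguishes the equation from its dual. -/
theorem Regularizer.weakDeriv (hR : Regularizer G J B) {T : ℝ} (s : ℂ)
    {a a₁ : ℝ → Lp ℂ 2 (volume : Measure α)}
    (ha : Integrable a (timeMeasure T)) (ha₁ : Integrable a₁ (timeMeasure T))
    (h : ∀ e e', (e, e') ∈ G → WeakDeriv T (fun t => bpair (a t) e)
      fun t => -Complex.I * (s * bpair (a t) e' + bpair (a₁ t) e)) (n : ℕ) :
    WeakDeriv T (fun t => J n (a t)) fun t => (-Complex.I) • (s • B n (a t) + J n (a₁ t)) := by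
  obtain ⟨S, hS, hG⟩ := hR.exists_separating
  refine weakDeriv_of_bpair hS ((J n).integrable_comp ha)
    (integrable_source s ha ha₁ n) fun e he => ?_
  have h1 := h _ _ (hG n e he)
  simp only [← hR.symm_left, ← hR.symm_right] at h1
  simpa only [map_add, map_smul, add_apply, smul_apply, smul_eq_mul] using h1

/-- If `a` and `b` solve dual equations then `∫ a b` has the expected time derivative. -/
theorem Regularizer.weakDeriv_bpair (hR : Regularizer G J B) {T : ℝ} (hT : 0 < T)
    {a a₁ b b₁ : ℝ → Lp ℂ 2 (volume : Measure α)}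
    (ha : MemLp a ∞ (timeMeasure T)) (ha₁ : Integrable a₁ (timeMeasure T))
    (hb : MemLp b ∞ (timeMeasure T)) (hb₁ : Integrable b₁ (timeMeasure T))
    (h : ∀ e e', (e, e') ∈ G → WeakDeriv T (fun t => bpair (a t) e)
      fun t => -Complex.I * (bpair (a t) e' + bpair (a₁ t) e))
    (h' : ∀ e e', (e, e') ∈ G → WeakDeriv T (fun t => bpair (b t) e)
      fun t => -Complex.I * (-bpair (b t) e' + bpair (b₁ t) e)) :
    WeakDeriv T (fun t => bpair (a t) (b t))
      fun t => -Complex.I * (bpair (a₁ t) (b t) + bpair (a t) (b₁ t)) := by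
  have hai := MemLp.integrable_time ha
  have hbi := MemLp.integrable_time hb
  have key : ∀ n, WeakDeriv T (fun t => bpair (J n (a t)) (J n (b t)))
      fun t => -Complex.I * (bpair (J n (a₁ t)) (J n (b t)) + bpair (J n (a t)) (J n (b₁ t))) := by
    intro n
    have h1 := hR.weakDeriv 1 hai ha₁ (by simpa using h) n
    have h2 := hR.weakDeriv (-1) hbi hb₁ (by simpa using h') n
    have h3 := h1.bilin hT (bpair.bilinearRestrictScalars ℝ) h2 ((J n).integrable_comp hai)
      (integrable_source 1 hai ha₁ n) ((J n).integrable_comp hbi) (integrable_source (-1) hbi hb₁ n)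
    refine h3.congr (Eventually.of_forall fun t => rfl) (Eventually.of_forall fun t => ?_)
    change bpair ((-Complex.I) • ((1 : ℂ) • B n (a t) + J n (a₁ t))) (J n (b t))
      + bpair (J n (a t)) ((-Complex.I) • ((-1 : ℂ) • B n (b t) + J n (b₁ t))) = _
    -- The generator cancels exactly for every n, before any limit: J and B are symmetric and
    -- commute.
    have e : bpair (B n (a t)) (J n (b t)) = bpair (J n (a t)) (B n (b t)) := by
      rw [hR.symm_right, hR.symm_left, hR.comm]
    simp only [map_add, map_smul, add_apply, smul_apply, smul_eq_mul, e]
    ring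
  intro χ hχ
  obtain ⟨M, hM⟩ := hχ.exists_bound
  -- Only terms free of the unbounded generator remain, and these converge by domination since ‖J‖ ≤
  -- 1. The third one pairs b₁ with a in reversed order, so that the integrable curve stands first.
  have l1 := tendsto_integral_bpair hR hχ.continuous_deriv (fun t => (hM t).2) hai hb
  have l2 := tendsto_integral_bpair hR hχ.continuous (fun t => (hM t).1) ha₁ hb
  have l3 := tendsto_integral_bpair hR hχ.continuous (fun t => (hM t).1) hb₁ ha
  have hJ : ∀ n, ∀ x : ℝ → Lp ℂ 2 (volume : Measure α), MemLp x ∞ (timeMeasure T) →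
      MemLp (fun t => J n (x t)) ∞ (timeMeasure T) := fun n x hx => (J n).comp_memLp' hx
  have e : ∀ (x y : ℝ → Lp ℂ 2 (volume : Measure α)), (Integrable x (timeMeasure T)) →
      Integrable y (timeMeasure T) → ∀ (a b : ℝ → Lp ℂ 2 (volume : Measure α)),
      MemLp a ∞ (timeMeasure T) → MemLp b ∞ (timeMeasure T) →
      -∫ t, χ t • (-Complex.I * (bpair (x t) (b t) + bpair (a t) (y t))) ∂(timeMeasure T)
      = Complex.I * ((∫ t, χ t • bpair (x t) (b t) ∂(timeMeasure T))
        + ∫ t, χ t • bpair (y t) (a t) ∂(timeMeasure T)) := by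
    intro x y hx hy a b ha hb
    rw [← integral_add (hχ.integrable_smul (integrable_bpair hx hb))
      (hχ.integrable_smul (integrable_bpair hy ha)), ← integral_const_mul, ← integral_neg]
    refine integral_congr_ae (Eventually.of_forall fun t => ?_)
    simp only [Complex.real_smul, bpair_comm (a t)]
    ring
  rw [e a₁ b₁ ha₁ hb₁ a b ha hb]
  refine tendsto_nhds_unique l1 (((l2.add l3).const_mul Complex.I).congr fun n => ?_)
  rw [← e _ _ ((J n).integrable_comp ha₁) ((J n).integrable_comp hb₁) _ _ (hJ n a ha) (hJ n b hb)]
  exact (key n χ hχ).symm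

end Duality

/-! ### Convolution operators on `L²` -/

section Convolution

instance : (volume : Measure (E3 × E3)).IsAddHaarMeasure :=
  inferInstanceAs ((volume : Measure E3).prod (volume : Measure E3)).IsAddHaarMeasure

variable {V : Type*} [NormedAddCommGroup V]
  [MeasureSpace V] [BorelSpace V] [SecondCountableTopology V]
  [(volume : Measure V).IsAddHaarMeasure]

/-- Translation `(transL w f)(x) = f(x - w)`. -/
def transL (w : V) : Lp ℂ 2 (volume : Measure V) →ₗᵢ[ℂ] Lp ℂ 2 (volume : Measure V) :=
  Lp.compMeasurePreservingₗᵢ ℂ (fun x => x - w) (measurePreserving_sub_right volume w)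

theorem transL_coe (w : V) (f : Lp ℂ 2 (volume : Measure V)) :
    transL w f =ᵐ[volume] fun x => f (x - w) :=
  Lp.coeFn_compMeasurePreserving f (measurePreserving_sub_right volume w)

theorem transL_transL (w w' : V) (f : Lp ℂ 2 (volume : Measure V)) :
    transL w (transL w' f) = transL (w' + w) f := by
  refine Lp.ext ?_
  have h := (measurePreserving_sub_right (volume : Measure V) w).quasiMeasurePreserving.ae
    (transL_coe w' f)
  filter_upwards [transL_coe w (transL w' f), transL_coe (w' + w) f, h] with x h1 h2 h3
  rw [h1, h2, h3]
  congr 1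
  abel

theorem transL_zero (f : Lp ℂ 2 (volume : Measure V)) : transL 0 f = f := by
  refine Lp.ext ?_
  filter_upwards [transL_coe 0 f] with x h1
  rw [h1, sub_zero]

theorem bpair_transL (w : V) (f g : Lp ℂ 2 (volume : Measure V)) :
    bpair (transL w f) g = bpair f (transL (-w) g) := by
  rw [bpair_apply, bpair_apply, ← integral_sub_right_eq_self (fun x => f x * transL (-w) g x) w]
  refine integral_congr_ae ?_
  have h := (measurePreserving_sub_right (volume : Measure V) w).quasiMeasurePreserving.ae
    (transL_coe (-w) g)
  filter_upwards [transL_coe w f, h] with x h1 h2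
  rw [h1, h2]
  congr 2
  abel

variable [LocallyCompactSpace V]

theorem continuous_transL (f : Lp ℂ 2 (volume : Measure V)) : Continuous fun w => transL w f := by
  let g : V → C(V, V) := fun w => ⟨fun x => x - w, by fun_prop⟩
  have hg : Continuous g := ContinuousMap.continuous_of_continuous_uncurry _ (by
    change Continuous fun p : V × V => p.2 - p.1
    fun_prop)
  exact Continuous.compMeasurePreservingLp (f := fun _ => f) continuous_const hg
    (fun w => measurePreserving_sub_right volume w) (by norm_num)

theorem integrable_transL {ρ : V → ℂ} (hρ : Integrable ρ) (f : Lp ℂ 2 (volume : Measure V)) :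
    Integrable fun w => ρ w • transL w f := by
  refine (hρ.norm.mul_const ‖f‖).mono'
    (hρ.1.smul (continuous_transL f).aestronglyMeasurable) (Eventually.of_forall fun w => ?_)
  rw [norm_smul, LinearIsometry.norm_map]

/-- The operator of convolution with an integrable function. -/
def convL (ρ : V → ℂ) (hρ : Integrable ρ) :
    Lp ℂ 2 (volume : Measure V) →L[ℂ] Lp ℂ 2 (volume : Measure V) :=
  LinearMap.mkContinuous
    { toFun := fun f => ∫ w, ρ w • transL w f
      map_add' := fun f g => by
        rw [← integral_add (integrable_transL hρ f) (integrable_transL hρ g)]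
        simp only [map_add, smul_add]
      map_smul' := fun c f => by
        rw [RingHom.id_apply, ← integral_smul]
        simp only [map_smul, smul_comm c] }
    (∫ w, ‖ρ w‖) fun f => by
      refine (norm_integral_le_integral_norm _).trans_eq ?_
      simp only [norm_smul, LinearIsometry.norm_map]
      rw [integral_mul_const]

variable {ρ ρ' : V → ℂ} {hρ : Integrable ρ} {hρ' : Integrable ρ'}

theorem convL_apply (f : Lp ℂ 2 (volume : Measure V)) :
    convL ρ hρ f = ∫ w, ρ w • transL w f := rfl

theorem norm_convL_le (f : Lp ℂ 2 (volume : Measure V)) :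
    ‖convL ρ hρ f‖ ≤ (∫ w, ‖ρ w‖) * ‖f‖ := by
  refine (norm_integral_le_integral_norm _).trans_eq ?_
  simp only [norm_smul, LinearIsometry.norm_map]
  rw [integral_mul_const]

theorem bpair_convL (f g : Lp ℂ 2 (volume : Measure V)) :
    bpair (convL ρ hρ f) g = ∫ w, ρ w * bpair (transL w f) g := by
  have h := (bpair.flip g).integral_comp_comm (integrable_transL hρ f)
  rw [ContinuousLinearMap.flip_apply] at h
  rw [convL_apply, ← h]
  simp

theorem bpair_convL_symm (he : ∀ w, ρ (-w) = ρ w) (f g : Lp ℂ 2 (volume : Measure V)) :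
    bpair (convL ρ hρ f) g = bpair f (convL ρ hρ g) := by
  rw [bpair_comm f, bpair_convL, bpair_convL, ← integral_neg_eq_self]
  refine integral_congr_ae (Eventually.of_forall fun w => ?_)
  simp only [he]
  rw [bpair_transL, neg_neg, bpair_comm]

theorem convL_transL (w : V) (f : Lp ℂ 2 (volume : Measure V)) :
    convL ρ hρ (transL w f) = transL w (convL ρ hρ f) := by
  have h := (transL w).toContinuousLinearMap.integral_comp_comm (integrable_transL hρ f)
  rw [convL_apply, convL_apply]
  refine Eq.trans ?_ h
  refine integral_congr_ae (Eventually.of_forall fun w' => ?_)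
  simp only [LinearIsometry.coe_toContinuousLinearMap, map_smul, transL_transL, add_comm]

theorem convL_comm (f : Lp ℂ 2 (volume : Measure V)) :
    convL ρ hρ (convL ρ' hρ' f) = convL ρ' hρ' (convL ρ hρ f) := by
  have h := (convL ρ hρ).integral_comp_comm (integrable_transL hρ' f)
  rw [convL_apply (hρ := hρ'), ← h, convL_apply (hρ := hρ')]
  simp only [map_smul, convL_transL]

theorem tendsto_convL {ρ : ℕ → V → ℂ} {hρ : ∀ n, Integrable (ρ n)} {r : ℕ → ℝ}
    (hr : Tendsto r atTop (𝓝 0)) (hsupp : ∀ n w, ρ n w ≠ 0 → ‖w‖ ≤ r n)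
    (h1 : ∀ n, ∫ w, ‖ρ n w‖ = 1) (h2 : ∀ n, ∫ w, ρ n w = 1) (f : Lp ℂ 2 (volume : Measure V)) :
    Tendsto (fun n => convL (ρ n) (hρ n) f) atTop (𝓝 f) := by
  rw [Metric.tendsto_atTop]
  intro ε hε
  have hc := (continuous_transL f).tendsto 0
  rw [transL_zero] at hc
  obtain ⟨δ, hδ, hδ'⟩ := Metric.tendsto_nhds_nhds.1 hc (ε / 2) (by positivity)
  obtain ⟨N, hN⟩ := (Metric.tendsto_atTop.1 hr) δ hδ
  refine ⟨N, fun n hn => ?_⟩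
  have hrn : r n < δ := (le_abs_self _).trans_lt (by simpa using hN n hn)
  have e : convL (ρ n) (hρ n) f - f = ∫ w, ρ n w • (transL w f - f) := by
    simp only [smul_sub]
    rw [integral_sub (integrable_transL (hρ n) f) ((hρ n).smul_const f), integral_smul_const, h2 n,
      one_smul]
    rfl
  rw [dist_eq_norm, e]
  calc _ ≤ ∫ w, ‖ρ n w‖ * (ε / 2) := by
        refine norm_integral_le_of_norm_le ((hρ n).norm.mul_const _)
          (Eventually.of_forall fun w => ?_)
        rw [norm_smul]
        by_cases hw : ρ n w = 0
        · simp [hw]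
        · refine mul_le_mul_of_nonneg_left ?_ (norm_nonneg _)
          have := hδ' (x := w) (by simpa using (hsupp n w hw).trans_lt hrn)
          rw [dist_eq_norm] at this
          exact this.le
    _ = ε / 2 := by rw [integral_mul_const, h1 n, one_mul]
    _ < ε := by linarith

/-- Functions with a smooth compactly supported representative. -/
def smoothSet (V : Type*) [NormedAddCommGroup V] [NormedSpace ℝ V] [MeasureSpace V] :
    Set (Lp ℂ 2 (volume : Measure V)) :=
  {e | ∃ f : V → ℂ, e =ᵐ[volume] f ∧ HasCompactSupport f ∧ ContDiff ℝ (⊤ : ℕ∞) f}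

variable [NormedSpace ℝ V] [FiniteDimensional ℝ V]

theorem dense_smoothSet : Dense (smoothSet V) :=
  Lp.dense_hasCompactSupport_contDiff (by norm_num)

/-- The Bochner integral of translates defines convolution only as an L² vector. On smooth compactly
supported inputs it is matched with the pointwise convolution by pairing with test functions and
applying Fubini. -/
theorem convL_coe (hc : Continuous ρ) (hs : HasCompactSupport ρ) {e : Lp ℂ 2 (volume : Measure V)}
    {f : V → ℂ} (hef : e =ᵐ[volume] f) (hf : Continuous f) (hfs : HasCompactSupport f) :
    convL ρ hρ e =ᵐ[volume] convolution f ρ (ContinuousLinearMap.mul ℝ ℂ) volume := by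
  have hcont : Continuous (convolution f ρ (ContinuousLinearMap.mul ℝ ℂ) volume) :=
    hs.continuous_convolution_right _ hf.locallyIntegrable hc
  have hcs : HasCompactSupport (convolution f ρ (ContinuousLinearMap.mul ℝ ℂ) volume) :=
    hfs.convolution _ hs
  have hm : MemLp (convolution f ρ (ContinuousLinearMap.mul ℝ ℂ) volume) 2 volume :=
    hcont.memLp_of_hasCompactSupport hcs
  suffices h : convL ρ hρ e = hm.toLp _ by rw [h]; exact hm.coeFn_toLp
  refine eq_of_bpair_dense dense_smoothSet ?_
  rintro k ⟨g, hkg, hgs, hg⟩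
  rw [bpair_convL]
  have e1 : ∀ w, bpair (transL w e) k = ∫ x, f (x - w) * g x := by
    intro w
    rw [bpair_apply]
    refine integral_congr_ae ?_
    have h := (measurePreserving_sub_right (volume : Measure V) w).quasiMeasurePreserving.ae hef
    filter_upwards [transL_coe w e, hkg, h] with x h1 h2 h3
    rw [h1, h2, h3]
  have e2 : bpair (hm.toLp _) k
      = ∫ x, (∫ w, f (x - w) * ρ w) * g x := by
    rw [bpair_apply]
    refine integral_congr_ae ?_
    filter_upwards [hm.coeFn_toLp, hkg] with x h1 h2
    rw [h1, h2, convolution_eq_swap]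
    rfl
  rw [e2]
  simp only [e1, ← integral_const_mul, ← integral_mul_const]
  rw [integral_integral_swap_of_hasCompactSupport]
  · refine integral_congr_ae (Eventually.of_forall fun x => ?_)
    refine integral_congr_ae (Eventually.of_forall fun w => ?_)
    simp only
    ring
  · have := hg.continuous
    fun_prop
  · refine HasCompactSupport.intro (hs.isCompact.prod hgs.isCompact) ?_
    rintro ⟨w, x⟩ hwx
    rw [mem_prod, not_and_or] at hwx
    rcases hwx with h | h
    · simp [image_eq_zero_of_notMem_tsupport h]
    · simp [image_eq_zero_of_notMem_tsupport h]

end Convolution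

/-! ### The Laplacian on smooth compactly supported functions -/

section SmoothLaplacian

/-- `f ∈ C_c^∞(ℝ³)`. -/
def IsBump (f : E3 → ℂ) : Prop := ContDiff ℝ (⊤ : ℕ∞) f ∧ HasCompactSupport f

/-- Coordinate derivatives. -/
def pderiv3 (i : Fin 3) (f : E3 → ℂ) (x : E3) : ℂ :=
  fderiv ℝ f x (EuclideanSpace.basisFun (Fin 3) ℝ i)

theorem laplacian_eq_sum {f : E3 → ℂ} (hf : ContDiff ℝ (⊤ : ℕ∞) f) :
    Laplacian.laplacian f = fun x => ∑ i, pderiv3 i (pderiv3 i f) x := by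
  rw [InnerProductSpace.laplacian_eq_iteratedFDeriv_orthonormalBasis f
    (EuclideanSpace.basisFun (Fin 3) ℝ)]
  funext x
  refine Finset.sum_congr rfl fun i _ => ?_
  rw [iteratedFDeriv_two_apply]
  have h : DifferentiableAt ℝ (fderiv ℝ f) x :=
    (hf.fderiv_right (m := ((⊤ : ℕ∞) : WithTop ℕ∞)) (by simp)).differentiable (by simp) x
  have h2 := fderiv_clm_apply (𝕜 := ℝ) h (differentiableAt_const
    (EuclideanSpace.basisFun (Fin 3) ℝ i))
  change _ = fderiv ℝ (fun y => fderiv ℝ f y (EuclideanSpace.basisFun (Fin 3) ℝ i)) x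
    (EuclideanSpace.basisFun (Fin 3) ℝ i)
  rw [h2]
  simp

theorem IsBump.pderiv3 {f : E3 → ℂ} (hf : IsBump f) (i : Fin 3) : IsBump (pderiv3 i f) :=
  ⟨(hf.1.fderiv_right (m := ((⊤ : ℕ∞) : WithTop ℕ∞)) (by simp)).clm_apply contDiff_const,
    hf.2.fderiv_apply ℝ _⟩

theorem IsBump.continuous {f : E3 → ℂ} (hf : IsBump f) : Continuous f := hf.1.continuous

theorem IsBump.integrable {f : E3 → ℂ} (hf : IsBump f) : Integrable f :=
  hf.continuous.integrable_of_hasCompactSupport hf.2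

theorem IsBump.memLp {f : E3 → ℂ} (hf : IsBump f) : MemLp f 2 volume :=
  hf.continuous.memLp_of_hasCompactSupport hf.2

theorem IsBump.differentiable {f : E3 → ℂ} (hf : IsBump f) : Differentiable ℝ f :=
  hf.1.differentiable (by simp)

theorem IsBump.star {f : E3 → ℂ} (hf : IsBump f) : IsBump (fun x => star (f x)) :=
  ⟨Complex.conjCLE.contDiff.comp hf.1, hf.2.comp_left (g := starRingEnd ℂ) (map_zero _)⟩

theorem pderiv3_star {f : E3 → ℂ} (i : Fin 3) :
    pderiv3 i (fun x => star (f x)) = fun x => star (pderiv3 i f x) := by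
  funext x
  have h := Complex.conjCLE.comp_fderiv (f := f) (x := x)
  change fderiv ℝ (Complex.conjCLE ∘ f) x _ = _
  rw [h]
  rfl

theorem IsBump.laplacian {f : E3 → ℂ} (hf : IsBump f) : IsBump (Laplacian.laplacian f) := by
  rw [laplacian_eq_sum hf.1]
  constructor
  · exact ContDiff.sum fun i _ => ((hf.pderiv3 i).pderiv3 i).1
  · simp only [Fin.sum_univ_three]
    exact (((hf.pderiv3 0).pderiv3 0).2.add ((hf.pderiv3 1).pderiv3 1).2).add
      ((hf.pderiv3 2).pderiv3 2).2

theorem IsBump.integral_mul_pderiv3 {f g : E3 → ℂ} (hf : IsBump f) (hg : IsBump g) (i : Fin 3) :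
    ∫ x, f x * PairExcitation.pderiv3 i g x = -∫ x, PairExcitation.pderiv3 i f x * g x := by
  have hi : ∀ {a b : E3 → ℂ}, IsBump a → IsBump b → Integrable fun x => a x * b x := fun ha hb =>
    (ha.continuous.mul hb.continuous).integrable_of_hasCompactSupport ha.2.mul_right
  exact integral_mul_fderiv_eq_neg_fderiv_mul_of_integrable (hi (hf.pderiv3 i) hg)
    (hi hf (hg.pderiv3 i)) (hi hf hg) (fun x _ => hf.differentiable x)
    (fun x _ => hg.differentiable x)

/-- The Laplacian is symmetric. -/
theorem IsBump.integral_mul_laplacian {f g : E3 → ℂ} (hf : IsBump f) (hg : IsBump g) :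
    ∫ x, f x * Laplacian.laplacian g x = ∫ x, Laplacian.laplacian f x * g x := by
  rw [laplacian_eq_sum hf.1, laplacian_eq_sum hg.1]
  simp only [Finset.mul_sum, Finset.sum_mul]
  have hi : ∀ {a b : E3 → ℂ}, IsBump a → IsBump b → Integrable fun x => a x * b x := fun ha hb =>
    (ha.continuous.mul hb.continuous).integrable_of_hasCompactSupport ha.2.mul_right
  rw [integral_finsetSum _ fun i _ => hi hf ((hg.pderiv3 i).pderiv3 i),
    integral_finsetSum _ fun i _ => hi ((hf.pderiv3 i).pderiv3 i) hg]
  refine Finset.sum_congr rfl fun i _ => ?_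
  rw [hf.integral_mul_pderiv3 (hg.pderiv3 i) i, ← neg_eq_iff_eq_neg.2
    ((hf.pderiv3 i).integral_mul_pderiv3 hg i)]

theorem IsBump.conv {f g : E3 → ℂ} (hf : IsBump f) (hg : IsBump g) :
    IsBump (convolution f g (ContinuousLinearMap.mul ℝ ℂ) volume) :=
  ⟨hg.2.contDiff_convolution_right _ hf.continuous.locallyIntegrable hg.1, hf.2.convolution _ hg.2⟩

theorem IsBump.pderiv3_conv {f g : E3 → ℂ} (hf : IsBump f) (hg : IsBump g) (i : Fin 3) :
    PairExcitation.pderiv3 i (convolution f g (ContinuousLinearMap.mul ℝ ℂ) volume)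
      = convolution f (PairExcitation.pderiv3 i g) (ContinuousLinearMap.mul ℝ ℂ) volume := by
  funext x
  have h := hg.2.hasFDerivAt_convolution_right (ContinuousLinearMap.mul ℝ ℂ)
    (hf.continuous.locallyIntegrable (μ := volume)) (hg.1.of_le (by simp)) x
  have hc : Continuous (fderiv ℝ g) := hg.1.continuous_fderiv (by simp)
  change fderiv ℝ _ x _ = _
  rw [h.fderiv, convolution_precompR_apply _ hf.continuous.locallyIntegrable (hg.2.fderiv ℝ) hc]
  rfl

theorem IsBump.laplacian_conv {f g : E3 → ℂ} (hf : IsBump f) (hg : IsBump g) :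
    Laplacian.laplacian (convolution f g (ContinuousLinearMap.mul ℝ ℂ) volume)
      = convolution f (Laplacian.laplacian g) (ContinuousLinearMap.mul ℝ ℂ) volume := by
  rw [laplacian_eq_sum (hf.conv hg).1, laplacian_eq_sum hg.1]
  funext x
  simp only [hf.pderiv3_conv hg, hf.pderiv3_conv (hg.pderiv3 _)]
  simp only [convolution_def, ContinuousLinearMap.mul_apply', Finset.mul_sum]
  rw [integral_finsetSum]
  intro i _
  exact ((hg.pderiv3 i).pderiv3 i).2.convolutionExists_right (ContinuousLinearMap.mul ℝ ℂ)
    hf.continuous.locallyIntegrable ((hg.pderiv3 i).pderiv3 i).continuous x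

theorem pderiv3_neg {f : E3 → ℂ} {s : ℂ} (h : ∀ x, f (-x) = s * f x) (hf : Differentiable ℝ f)
    (i : Fin 3) (x : E3) : pderiv3 i f (-x) = -s * pderiv3 i f x := by
  have h2 : HasFDerivAt (fun y => f (-y)) ((fderiv ℝ f (-x)).comp (-ContinuousLinearMap.id ℝ E3)) x :=
    ((hf (-x)).hasFDerivAt).comp x (hasFDerivAt_id x).neg
  have h3 : HasFDerivAt (fun y => s * f y) (s • fderiv ℝ f x) x :=
    (hf x).hasFDerivAt.const_mul s
  simp only [h] at h2
  have h4 := congrArg (fun L => L (EuclideanSpace.basisFun (Fin 3) ℝ i)) (h2.unique h3)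
  simp only [ContinuousLinearMap.comp_apply, neg_apply, ContinuousLinearMap.id_apply, map_neg,
    smul_apply, smul_eq_mul] at h4
  rw [pderiv3, pderiv3, neg_mul, ← h4, neg_neg]

theorem IsBump.laplacian_even {f : E3 → ℂ} (hf : IsBump f) (h : ∀ x, f (-x) = f x) (x : E3) :
    Laplacian.laplacian f (-x) = Laplacian.laplacian f x := by
  rw [laplacian_eq_sum hf.1]
  refine Finset.sum_congr rfl fun i _ => ?_
  have h1 := pderiv3_neg (s := 1) (by simpa using h) hf.differentiable i
  have h2 := pderiv3_neg h1 (hf.pderiv3 i).differentiable i x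
  simpa using h2

/-- `e'` is the Laplacian of `e ∈ C_c^∞(ℝ³)`. -/
def IsLap (e e' : L2) : Prop :=
  ∃ f : E3 → ℂ, IsBump f ∧ e =ᵐ[volume] f ∧ e' =ᵐ[volume] Laplacian.laplacian f

theorem IsLap.star {e e' : L2} (h : IsLap e e') : IsLap (star e) (star e') := by
  obtain ⟨f, hf, h1, h2⟩ := h
  refine ⟨_, hf.star, ?_, ?_⟩
  · filter_upwards [Lp.coeFn_star e, h1] with x h3 h4
    rw [h3, Pi.star_apply, h4]
  · filter_upwards [Lp.coeFn_star e', h2] with x h3 h4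
    rw [h3, Pi.star_apply, h4, laplacian_eq_sum hf.1, laplacian_eq_sum hf.star.1]
    simp only [pderiv3_star, star_sum]

/-- The domain `C_c^∞(ℝ³)` of the Laplacian. -/
def lapDomain : Set L2 := {e | ∃ e', IsLap e e'}

theorem dense_lapDomain : Dense lapDomain := by
  refine (dense_smoothSet (V := E3)).mono ?_
  rintro e ⟨f, h1, h2, h3⟩
  have hf : IsBump f := ⟨h3, h2⟩
  exact ⟨hf.laplacian.memLp.toLp _, f, hf, h1, hf.laplacian.memLp.coeFn_toLp⟩

/-- The Laplacian of f * ρ falls on the mollifier, so it is given by an operator bounded on L² that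
does not involve derivatives of f. -/
theorem IsLap.convL {ρ : E3 → ℂ} (hρ : IsBump ρ) {e e' : L2} (h : IsLap e e') :
    IsLap (convL ρ hρ.integrable e) (convL (Laplacian.laplacian ρ) hρ.laplacian.integrable e) := by
  obtain ⟨f, hf, h1, -⟩ := h
  refine ⟨_, hf.conv hρ, convL_coe hρ.continuous hρ.2 h1 hf.continuous hf.2, ?_⟩
  rw [hf.laplacian_conv hρ]
  exact convL_coe hρ.laplacian.continuous hρ.laplacian.2 h1 hf.continuous hf.2

end SmoothLaplacian

/-! ### Regularization by convolution -/

section Mollifier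

/-- Smooth bumps shrinking to the origin. -/
def bumpAt (n : ℕ) : ContDiffBump (0 : E3) where
  rIn := 1 / (2 * (n + 1))
  rOut := 1 / (n + 1)
  rIn_pos := by positivity
  rIn_lt_rOut := by
    apply one_div_lt_one_div_of_lt <;> linarith [(Nat.cast_nonneg n : (0 : ℝ) ≤ n)]

/-- A smooth approximate identity. -/
def mollifier (n : ℕ) (x : E3) : ℂ := ((bumpAt n).normed volume x : ℝ)

theorem isBump_mollifier (n : ℕ) : IsBump (mollifier n) :=
  ⟨Complex.ofRealCLM.contDiff.comp (bumpAt n).contDiff_normed,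
    (bumpAt n).hasCompactSupport_normed.comp_left (g := ((↑) : ℝ → ℂ)) Complex.ofReal_zero⟩

theorem mollifier_neg (n : ℕ) (x : E3) : mollifier n (-x) = mollifier n x := by
  rw [mollifier, mollifier, ContDiffBump.normed_neg]

theorem norm_mollifier (n : ℕ) (x : E3) : ‖mollifier n x‖ = (bumpAt n).normed volume x := by
  rw [mollifier, Complex.norm_real, Real.norm_of_nonneg ((bumpAt n).nonneg_normed x)]

theorem integral_mollifier (n : ℕ) : ∫ x, mollifier n x = 1 := by
  have h := integral_complex_ofReal (μ := (volume : Measure E3)) (f := (bumpAt n).normed volume)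
  rw [(bumpAt n).integral_normed, Complex.ofReal_one] at h
  exact h

theorem integral_norm_mollifier (n : ℕ) : ∫ x, ‖mollifier n x‖ = 1 := by
  simp only [norm_mollifier, (bumpAt n).integral_normed]

theorem norm_le_of_mollifier_ne_zero {n : ℕ} {x : E3} (h : mollifier n x ≠ 0) :
    ‖x‖ ≤ 1 / (n + 1) := by
  have h1 : x ∈ Function.support ((bumpAt n).normed (volume : Measure E3)) := by
    intro h2
    exact h (by rw [mollifier, h2, Complex.ofReal_zero])
  rw [ContDiffBump.support_normed_eq, mem_ball_zero_iff] at h1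
  exact h1.le

/-- Mollification in one variable, with generator τΔ. Evenness of the mollifier, inherited by its
Laplacian, makes J and B symmetric for the bilinear pairing. -/
theorem regularizer_L2 (τ : ℂ) :
    Regularizer {p : L2 × L2 | ∃ e', IsLap p.1 e' ∧ p.2 = τ • e'}
      (fun n => convL (mollifier n) (isBump_mollifier n).integrable)
      (fun n => τ • convL (Laplacian.laplacian (mollifier n))
        (isBump_mollifier n).laplacian.integrable) where
  symm_left n x y := bpair_convL_symm (mollifier_neg n) x y
  symm_right n x y := by
    simp only [smul_apply, map_smul]
    rw [bpair_convL_symm ((isBump_mollifier n).laplacian_even (mollifier_neg n))]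
  comm n x := by
    simp only [smul_apply, map_smul]
    rw [convL_comm]
  norm_le n x := by
    refine (norm_convL_le x).trans_eq ?_
    rw [integral_norm_mollifier, one_mul]
  tendsto x := tendsto_convL tendsto_one_div_add_atTop_nhds_zero_nat
    (fun n w hw => norm_le_of_mollifier_ne_zero hw) integral_norm_mollifier integral_mollifier x
  exists_separating := by
    refine ⟨lapDomain, fun f hf => eq_of_bpair_dense dense_lapDomain fun e he => ?_, ?_⟩
    · rw [hf e he, map_zero, zero_apply]
    · rintro n e ⟨e', he⟩
      exact ⟨_, he.convL (isBump_mollifier n), rfl⟩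

/-- The tensor product of two functions. -/
def tensFun (ρ ρ' : E3 → ℂ) (z : E3 × E3) : ℂ := ρ z.1 * ρ' z.2

theorem integrable_tensFun {ρ ρ' : E3 → ℂ} (hρ : Integrable ρ) (hρ' : Integrable ρ') :
    Integrable (tensFun ρ ρ') := hρ.mul_prod hρ'

theorem transL_tens (w w' : E3) (f g : L2) :
    transL (w, w') (tens f g) = tens (transL w f) (transL w' g) := by
  refine Lp.ext ?_
  have h := (measurePreserving_sub_right (volume : Measure (E3 × E3))
    (w, w')).quasiMeasurePreserving.ae (tens_coe f g)
  filter_upwards [transL_coe (w, w') (tens f g), tens_coe (transL w f) (transL w' g), h,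
    quasi_fst.ae (transL_coe w f), quasi_snd.ae (transL_coe w' g)] with z h1 h2 h3 h4 h5
  rw [h1, h2, h3, h4, h5]
  rfl

theorem convL_tens {ρ ρ' : E3 → ℂ} (hρ : Integrable ρ) (hρ' : Integrable ρ') (f g : L2) :
    convL (tensFun ρ ρ') (integrable_tensFun hρ hρ') (tens f g)
      = tens (convL ρ hρ f) (convL ρ' hρ' g) := by
  have hi := integrable_transL (integrable_tensFun hρ hρ') (tens f g)
  rw [convL_apply]
  have h1 : ∫ w, tensFun ρ ρ' w • transL w (tens f g)
      = ∫ w, ∫ w', tensFun ρ ρ' (w, w') • transL (w, w') (tens f g) :=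
    integral_prod (μ := (volume : Measure E3)) (ν := (volume : Measure E3)) _ hi
  rw [h1]
  have h2 : ∀ w, ∫ w', tensFun ρ ρ' (w, w') • transL (w, w') (tens f g)
      = tensL.flip (convL ρ' hρ' g) (ρ w • transL w f) := by
    intro w
    have h3 := (tensL (ρ w • transL w f)).integral_comp_comm (integrable_transL hρ' g)
    rw [ContinuousLinearMap.flip_apply, convL_apply, ← h3]
    refine integral_congr_ae (Eventually.of_forall fun w' => ?_)
    simp only [map_smul, smul_apply, tensL_apply, transL_tens, tensFun, smul_smul]
    rw [mul_comm]
  simp only [h2]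
  rw [ContinuousLinearMap.integral_comp_comm _ (integrable_transL hρ f)]
  rfl

/-- Mollification in both variables with the same bump. A tensor mollifier sends elementary tensors
to elementary tensors, so the domain in G can be kept to tensors of smooth functions. -/
theorem regularizer_Ker (σ τ : ℂ) :
    Regularizer {p : Ker × Ker | ∃ e e' g g', IsLap e e' ∧ IsLap g g' ∧ p.1 = tens e g ∧
        p.2 = σ • tens e' g + τ • tens e g'}
      (fun n => convL (tensFun (mollifier n) (mollifier n))
        (integrable_tensFun (isBump_mollifier n).integrable (isBump_mollifier n).integrable))
      (fun n => σ • convL (tensFun (Laplacian.laplacian (mollifier n)) (mollifier n))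
          (integrable_tensFun (isBump_mollifier n).laplacian.integrable
            (isBump_mollifier n).integrable)
        + τ • convL (tensFun (mollifier n) (Laplacian.laplacian (mollifier n)))
          (integrable_tensFun (isBump_mollifier n).integrable
            (isBump_mollifier n).laplacian.integrable)) where
  symm_left n x y := bpair_convL_symm (fun w => by
    simp only [tensFun, Prod.fst_neg, Prod.snd_neg, mollifier_neg]) x y
  symm_right n x y := by
    have hl := (isBump_mollifier n).laplacian_even (mollifier_neg n)
    simp only [smul_apply, map_smul, add_apply, map_add]
    rw [bpair_convL_symm, bpair_convL_symm]
    · exact fun w => by simp only [tensFun, Prod.fst_neg, Prod.snd_neg, mollifier_neg, hl]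
    · exact fun w => by simp only [tensFun, Prod.fst_neg, Prod.snd_neg, mollifier_neg, hl]
  comm n x := by
    simp only [smul_apply, map_smul, add_apply, map_add]
    congr 2
    · exact convL_comm x
    · exact convL_comm x
  norm_le n x := by
    refine (norm_convL_le x).trans_eq ?_
    simp only [tensFun, norm_mul]
    have h := integral_prod_mul (μ := (volume : Measure E3)) (ν := (volume : Measure E3))
      (fun x => ‖mollifier n x‖) (fun x => ‖mollifier n x‖)
    rw [integral_norm_mollifier, one_mul] at h
    exact (congrArg (· * ‖x‖) h).trans (one_mul _)
  tendsto x := by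
    refine tendsto_convL tendsto_one_div_add_atTop_nhds_zero_nat (fun n w hw => ?_)
      (fun n => ?_) (fun n => ?_) x
    · have h1 := mul_ne_zero_iff.1 hw
      exact max_le (norm_le_of_mollifier_ne_zero h1.1) (norm_le_of_mollifier_ne_zero h1.2)
    · simp only [tensFun, norm_mul]
      have h := integral_prod_mul (μ := (volume : Measure E3)) (ν := (volume : Measure E3))
        (fun x => ‖mollifier n x‖) (fun x => ‖mollifier n x‖)
      rw [integral_norm_mollifier, one_mul] at h
      exact h
    · simp only [tensFun]
      have h := integral_prod_mul (μ := (volume : Measure E3)) (ν := (volume : Measure E3))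
        (fun x => mollifier n x) (fun x => mollifier n x)
      rw [integral_mollifier, one_mul] at h
      exact h
  exists_separating := by
    refine ⟨{k | ∃ e ∈ lapDomain, ∃ g ∈ lapDomain, k = tens e g}, fun f hf =>
      eq_zero_of_bpair_tens dense_lapDomain fun e he g hg => hf _ ⟨e, he, g, hg, rfl⟩, ?_⟩
    rintro n k ⟨e, ⟨e', he⟩, g, ⟨g', hg⟩, rfl⟩
    refine ⟨_, _, _, _, he.convL (isBump_mollifier n), hg.convL (isBump_mollifier n),
      convL_tens _ _ _ _, ?_⟩
    simp only [smul_apply, add_apply]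
    congr 2
    · exact convL_tens _ _ _ _
    · exact convL_tens _ _ _ _

end Mollifier

/-! ### Linear operations and limits for weak derivatives -/

section WeakDerivAlgebra

variable {E : Type*} [NormedAddCommGroup E] [NormedSpace ℝ E] {T : ℝ}

theorem WeakDeriv.add {x x' y y' : ℝ → E} (h : WeakDeriv T x y) (h' : WeakDeriv T x' y')
    (hx : Integrable x (timeMeasure T)) (hy : Integrable y (timeMeasure T))
    (hx' : Integrable x' (timeMeasure T)) (hy' : Integrable y' (timeMeasure T)) :
    WeakDeriv T (fun t => x t + x' t) (fun t => y t + y' t) := by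
  intro χ hχ
  simp only [smul_add]
  rw [integral_add (hχ.integrable_deriv_smul hx) (hχ.integrable_deriv_smul hx'),
    integral_add (hχ.integrable_smul hy) (hχ.integrable_smul hy'), h χ hχ, h' χ hχ, neg_add]

theorem WeakDeriv.const_mul {x y : ℝ → ℂ} (h : WeakDeriv T x y) (c : ℂ) :
    WeakDeriv T (fun t => c * x t) (fun t => c * y t) := by
  intro χ hχ
  simp only [Complex.real_smul, mul_left_comm _ c]
  rw [integral_const_mul, integral_const_mul]
  have h1 := h χ hχ
  simp only [Complex.real_smul] at h1
  rw [h1, mul_neg]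

theorem WeakDeriv.conj {x y : ℝ → ℂ} (h : WeakDeriv T x y) :
    WeakDeriv T (fun t => star (x t)) (fun t => star (y t)) := by
  intro χ hχ
  have h1 := congrArg (starRingEnd ℂ) (h χ hχ)
  rw [map_neg, ← integral_conj, ← integral_conj] at h1
  simpa [Complex.real_smul] using h1

theorem WeakDeriv.of_tendsto {x y : ℝ → E} {xs ys : ℕ → ℝ → E}
    (h : ∀ n, WeakDeriv T (xs n) (ys n)) {B C : ℝ → ℝ}
    (hB : Integrable B (timeMeasure T)) (hC : Integrable C (timeMeasure T))
    (hxm : ∀ n, AEStronglyMeasurable (xs n) (timeMeasure T))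
    (hym : ∀ n, AEStronglyMeasurable (ys n) (timeMeasure T))
    (hxB : ∀ n, ∀ᵐ t ∂(timeMeasure T), ‖xs n t‖ ≤ B t)
    (hyC : ∀ n, ∀ᵐ t ∂(timeMeasure T), ‖ys n t‖ ≤ C t)
    (hx : ∀ᵐ t ∂(timeMeasure T), Tendsto (fun n => xs n t) atTop (𝓝 (x t)))
    (hy : ∀ᵐ t ∂(timeMeasure T), Tendsto (fun n => ys n t) atTop (𝓝 (y t))) :
    WeakDeriv T x y := by
  intro χ hχ
  obtain ⟨M, hM⟩ := hχ.exists_bound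
  have hM0 : 0 ≤ M := (norm_nonneg _).trans (hM 0).1
  have l1 : Tendsto (fun n => ∫ t, deriv χ t • xs n t ∂(timeMeasure T)) atTop
      (𝓝 (∫ t, deriv χ t • x t ∂(timeMeasure T))) := by
    refine tendsto_integral_of_dominated_convergence _
      (fun n => hχ.continuous_deriv.aestronglyMeasurable.smul (hxm n)) (hB.const_mul M)
      (fun n => (hxB n).mono fun t ht => ?_) (hx.mono fun t ht => ht.const_smul _)
    rw [norm_smul]
    exact mul_le_mul (hM t).2 ht (norm_nonneg _) hM0
  have l2 : Tendsto (fun n => ∫ t, χ t • ys n t ∂(timeMeasure T)) atTop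
      (𝓝 (∫ t, χ t • y t ∂(timeMeasure T))) := by
    refine tendsto_integral_of_dominated_convergence _
      (fun n => hχ.continuous.aestronglyMeasurable.smul (hym n)) (hC.const_mul M)
      (fun n => (hyC n).mono fun t ht => ?_) (hy.mono fun t ht => ht.const_smul _)
    rw [norm_smul]
    exact mul_le_mul (hM t).1 ht (norm_nonneg _) hM0
  exact tendsto_nhds_unique l1 (l2.neg.congr fun n => (h n χ hχ).symm)

theorem ae_eq_zero_of_timeTest [CompleteSpace E] {w : ℝ → E} (hw : Integrable w (timeMeasure T))
    (h : ∀ χ, IsTimeTest T χ → ∫ t, χ t • w t ∂(timeMeasure T) = 0) :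
    ∀ᵐ t ∂(timeMeasure T), w t = 0 := by
  have hloc : LocallyIntegrableOn w (Ioo 0 T) volume := by
    have : IntegrableOn w (Icc 0 T) volume := hw
    exact (this.mono_set Ioo_subset_Icc_self).locallyIntegrableOn
  have h1 := isOpen_Ioo.ae_eq_zero_of_integral_contDiff_smul_eq_zero hloc fun η h1 h2 h3 => by
    rw [← h η ⟨h1, h2, h3⟩]
    refine (setIntegral_eq_integral_of_forall_compl_eq_zero fun t ht => ?_).symm
    rw [image_eq_zero_of_notMem_tsupport fun h' => ht (Ioo_subset_Icc_self (h3 h')), zero_smul]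
  rw [timeMeasure, ← restrict_Ioo_eq_restrict_Icc, ae_restrict_iff' measurableSet_Ioo]
  exact h1

end WeakDerivAlgebra

/-! ### The free equation, tested on elementary tensors -/

section TensEq

variable {T : ℝ} {σ τ : ℂ} {a h : ℝ → Ker}

/-- `i ∂ₜ a - σ Δ_x a - τ Δ_y a = h`, tested on elementary tensors. -/
def TensEq (T : ℝ) (σ τ : ℂ) (a h : ℝ → Ker) : Prop :=
  ∀ e e' g g', IsLap e e' → IsLap g g' →
    WeakDeriv T (fun t => bpair (a t) (tens e g)) fun t =>
      -Complex.I * (σ * bpair (a t) (tens e' g) + τ * bpair (a t) (tens e g')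
        + bpair (h t) (tens e g))

theorem integrable_bpair_const (ha : Integrable a (timeMeasure T)) (k : Ker) :
    Integrable (fun t => bpair (a t) k) (timeMeasure T) := (bpair.flip k).integrable_comp ha

theorem integrable_tensEq_source (ha : Integrable a (timeMeasure T))
    (hh : Integrable h (timeMeasure T)) (e e' g g' : L2) :
    Integrable (fun t => -Complex.I * (σ * bpair (a t) (tens e' g) + τ * bpair (a t) (tens e g')
        + bpair (h t) (tens e g))) (timeMeasure T) :=
  ((((integrable_bpair_const ha _).const_mul σ).add
    ((integrable_bpair_const ha _).const_mul τ)).add (integrable_bpair_const hh _)).const_mul _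

theorem TensEq.congr {a' h' : ℝ → Ker} (H : TensEq T σ τ a h) (ha : a =ᵐ[timeMeasure T] a')
    (hh : h =ᵐ[timeMeasure T] h') : TensEq T σ τ a' h' := by
  intro e e' g g' he hg
  refine (H e e' g g' he hg).congr (ha.mono fun t ht => ?_) ?_
  · simp only [ht]
  · filter_upwards [ha, hh] with t h1 h2
    simp only [h1, h2]

theorem TensEq.add {a' h' : ℝ → Ker} (H : TensEq T σ τ a h) (H' : TensEq T σ τ a' h')
    (ha : Integrable a (timeMeasure T)) (hh : Integrable h (timeMeasure T))
    (ha' : Integrable a' (timeMeasure T)) (hh' : Integrable h' (timeMeasure T)) :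
    TensEq T σ τ (fun t => a t + a' t) (fun t => h t + h' t) := by
  intro e e' g g' he hg
  refine ((H e e' g g' he hg).add (H' e e' g g' he hg) (integrable_bpair_const ha _)
    (integrable_tensEq_source ha hh _ _ _ _) (integrable_bpair_const ha' _)
    (integrable_tensEq_source ha' hh' _ _ _ _)).congr (Eventually.of_forall fun t => ?_)
    (Eventually.of_forall fun t => ?_)
  · simp only [map_add, add_apply]
  · simp only [map_add, add_apply]
    ring

theorem TensEq.smul (H : TensEq T σ τ a h) (c : ℂ) :
    TensEq T σ τ (fun t => c • a t) (fun t => c • h t) := by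
  intro e e' g g' he hg
  refine ((H e e' g g' he hg).const_mul c).congr (Eventually.of_forall fun t => ?_)
    (Eventually.of_forall fun t => ?_)
  · simp only [map_smul, smul_apply, smul_eq_mul]
  · simp only [map_smul, smul_apply, smul_eq_mul]
    ring

theorem star_tens (f g : L2) : star (tens f g) = tens (star f) (star g) := by
  refine Lp.ext ?_
  filter_upwards [Lp.coeFn_star (tens f g), tens_coe f g, tens_coe (star f) (star g),
    quasi_fst.ae (Lp.coeFn_star f), quasi_snd.ae (Lp.coeFn_star g)] with z h1 h2 h3 h4 h5
  rw [h1, Pi.star_apply, h2, h3, h4, h5, star_mul', Pi.star_apply, Pi.star_apply]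

theorem bpair_star_star (k l : Ker) : bpair (star k) (star l) = star (bpair k l) := by
  rw [bpair_star, bpair_comm k l, ← star_star l, bpair_star, star_star]
  exact (inner_conj_symm _ _).symm

/-- Conjugation reverses the sign of i∂ₜ. Multiplying through by -1 restores it and flips the signs
of both Laplacians and of the source. -/
theorem TensEq.conj (H : TensEq T σ τ a h) :
    TensEq T (-star σ) (-star τ) (fun t => star (a t)) (fun t => -star (h t)) := by
  intro e e' g g' he hg
  refine ((H _ _ _ _ he.star hg.star).conj).congr (Eventually.of_forall fun t => ?_)
    (Eventually.of_forall fun t => ?_)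
  · beta_reduce
    rw [← bpair_star_star, star_tens, star_star, star_star]
  · simp only [star_mul', star_add, ← bpair_star_star, star_tens, star_star, map_neg, neg_apply,
      star_neg, Complex.star_def, Complex.conj_I]
    ring

theorem TensEq.transpose (H : TensEq T σ τ a h) :
    TensEq T τ σ (fun t => tr (a t)) (fun t => tr (h t)) := by
  intro e e' g g' he hg
  refine (H _ _ _ _ hg he).congr (Eventually.of_forall fun t => ?_)
    (Eventually.of_forall fun t => ?_)
  · beta_reduce
    rw [bpair_tr, tr_tens]
  · simp only [bpair_tr, tr_tens]
    ring

/-- The right-hand side is determined by the solution. -/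
theorem TensEq.unique {h' : ℝ → Ker} (H : TensEq T σ τ a h) (H' : TensEq T σ τ a h')
    (ha : Integrable a (timeMeasure T))
    (hh : Integrable h (timeMeasure T)) (hh' : Integrable h' (timeMeasure T)) :
    h =ᵐ[timeMeasure T] h' := by
  have key := ae_eq_zero_of_timeTest (hh.sub hh') fun χ hχ => ?_
  · exact key.mono fun t ht => sub_eq_zero.1 ht
  · refine eq_zero_of_bpair_tens dense_lapDomain fun e ⟨e', he⟩ g ⟨g', hg⟩ => ?_
    have h1 := (H _ _ _ _ he hg) χ hχ
    rw [(H' _ _ _ _ he hg) χ hχ, neg_inj, ← sub_eq_zero, ← integral_sub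
      (hχ.integrable_smul (integrable_tensEq_source ha hh' _ _ _ _))
      (hχ.integrable_smul (integrable_tensEq_source ha hh _ _ _ _))] at h1
    let L : Ker →L[ℝ] ℂ := (bpair.flip (tens e g)).restrictScalars ℝ
    change L _ = 0
    rw [← L.integral_comp_comm (hχ.integrable_smul (hh.sub hh'))]
    have h2 : ∀ t, L (χ t • (h - h') t) = -Complex.I *
        (χ t • (-Complex.I * (σ * bpair (a t) (tens e' g) + τ * bpair (a t) (tens e g')
          + bpair (h' t) (tens e g)))
        - χ t • (-Complex.I * (σ * bpair (a t) (tens e' g) + τ * bpair (a t) (tens e g')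
          + bpair (h t) (tens e g)))) := by
      intro t
      rw [map_smul, Pi.sub_apply, map_sub]
      change χ t • (bpair (h t) (tens e g) - bpair (h' t) (tens e g)) = _
      simp only [Complex.real_smul]
      linear_combination ((χ t : ℂ) * (bpair (h t) (tens e g) - bpair (h' t) (tens e g)))
        * Complex.I_mul_I
    simp only [h2]
    rw [integral_const_mul, h1, mul_zero]

theorem bpair_op_left (k : Ker) (f e : L2) : bpair (op (tr k) f) e = bpair k (tens f e) := by
  rw [bpair_tens, bpair_op]

theorem bpair_op_right (k : Ker) (g e : L2) : bpair (op k g) e = bpair k (tens e g) := by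
  rw [bpair_tens, bpair_comm]

/-- `op (k t) f` as a continuous linear map in `k`. -/
def opApply (f : L2) : Ker →L[ℂ] L2 := (ContinuousLinearMap.apply ℂ L2 f).comp opL

@[simp] theorem opApply_apply (f : L2) (k : Ker) : opApply f k = op k f := rfl

theorem memLp_tr {e : ℝ≥0∞} (ha : MemLp a e (timeMeasure T)) :
    MemLp (fun t => tr (a t)) e (timeMeasure T) := tr.toContinuousLinearMap.comp_memLp' ha

/-- The product rule. -/
theorem TensEq.mul {b k : ℝ → Ker} {ρ : ℂ} (hT : 0 < T) (H : TensEq T σ τ a h)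
    (H' : TensEq T (-τ) ρ b k)
    (ha : MemLp a ∞ (timeMeasure T)) (hh : Integrable h (timeMeasure T))
    (hb : MemLp b ∞ (timeMeasure T)) (hk : Integrable k (timeMeasure T)) :
    TensEq T σ ρ (fun t => kmul (a t) (b t)) (fun t => kmul (h t) (b t) + kmul (a t) (k t)) := by
  intro f f' g g' hf hg
  have hai := MemLp.integrable_time ha
  have hbi := MemLp.integrable_time hb
  have htr : ∀ {x : ℝ → Ker} (e : L2), Integrable x (timeMeasure T) →
      Integrable (fun t => op (tr (x t)) e) (timeMeasure T) := fun e hx =>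
    (opApply e).integrable_comp (tr.toContinuousLinearMap.integrable_comp hx)
  have hop : ∀ {x : ℝ → Ker} (e : L2), Integrable x (timeMeasure T) →
      Integrable (fun t => op (x t) e) (timeMeasure T) := fun e hx =>
    (opApply e).integrable_comp hx
  -- The pairing of ab with f ⊗ g is the L² pairing of aᵀf with bg. In the middle variable a carries
  -- τΔ and b carries -τΔ, which are dual; the outer Laplacians act on the fixed smooth f and g and
  -- join the sources.
  have key := (regularizer_L2 τ).weakDeriv_bpair hT
    (a := fun t => op (tr (a t)) f) (a₁ := fun t => op (tr (h t)) f + σ • op (tr (a t)) f')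
    (b := fun t => op (b t) g) (b₁ := fun t => op (k t) g + ρ • op (b t) g')
    ((opApply f).comp_memLp' (memLp_tr ha)) ((htr f hh).add ((htr f' hai).fun_smul σ))
    ((opApply g).comp_memLp' hb) ((hop g hk).add ((hop g' hbi).fun_smul ρ)) ?_ ?_
  · refine key.congr (Eventually.of_forall fun t => ?_) (Eventually.of_forall fun t => ?_)
    · simp only [bpair_op_left, bpair_tens, op_kmul, mul_apply_eq_comp]
    · simp only [map_add, map_smul, add_apply, smul_apply, smul_eq_mul, bpair_op_left, bpair_tens,
        op_kmul, mul_apply_eq_comp]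
      ring
  · rintro e e' ⟨e'', he, rfl⟩
    refine (H f f' e e'' hf he).congr (Eventually.of_forall fun t => ?_)
      (Eventually.of_forall fun t => ?_)
    · simp only [bpair_op_left]
    · simp only [map_add, map_smul, add_apply, smul_apply, smul_eq_mul, bpair_op_left]
      ring
  · rintro e e' ⟨e'', he, rfl⟩
    refine (H' e e'' g g' he hg).congr (Eventually.of_forall fun t => ?_)
      (Eventually.of_forall fun t => ?_)
    · simp only [bpair_op_right]
    · simp only [map_add, map_smul, add_apply, smul_apply, smul_eq_mul, bpair_op_right]
      ring

theorem TensEq.of_tendsto {as hs : ℕ → ℝ → Ker} (H : ∀ n, TensEq T σ τ (as n) (hs n))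
    {B C : ℝ → ℝ} (hB : Integrable B (timeMeasure T)) (hC : Integrable C (timeMeasure T))
    (ham : ∀ n, AEStronglyMeasurable (as n) (timeMeasure T))
    (hhm : ∀ n, AEStronglyMeasurable (hs n) (timeMeasure T))
    (haB : ∀ n, ∀ᵐ t ∂(timeMeasure T), ‖as n t‖ ≤ B t)
    (hhC : ∀ n, ∀ᵐ t ∂(timeMeasure T), ‖hs n t‖ ≤ C t)
    (ha : ∀ᵐ t ∂(timeMeasure T), Tendsto (fun n => as n t) atTop (𝓝 (a t)))
    (hh : ∀ᵐ t ∂(timeMeasure T), Tendsto (fun n => hs n t) atTop (𝓝 (h t))) :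
    TensEq T σ τ a h := by
  intro e e' g g' he hg
  have hm : ∀ {x : ℝ → Ker} (k : Ker), AEStronglyMeasurable x (timeMeasure T) →
      AEStronglyMeasurable (fun t => bpair (x t) k) (timeMeasure T) := fun k hx =>
    (bpair.flip k).continuous.comp_aestronglyMeasurable hx
  have hl : ∀ {x : ℕ → Ker} {y : Ker} (k : Ker), Tendsto x atTop (𝓝 y) →
      Tendsto (fun n => bpair (x n) k) atTop (𝓝 (bpair y k)) := fun k hx =>
    ((bpair.flip k).continuous.tendsto _).comp hx
  refine WeakDeriv.of_tendsto (fun n => H n e e' g g' he hg)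
    (hB.mul_const ‖tens e g‖)
    ((hB.mul_const (‖σ‖ * ‖tens e' g‖ + ‖τ‖ * ‖tens e g'‖)).add (hC.mul_const ‖tens e g‖))
    (fun n => hm _ (ham n)) (fun n => ?_) (fun n => ?_) (fun n => ?_) ?_ ?_
  · exact ((((hm _ (ham n)).const_mul σ).add ((hm _ (ham n)).const_mul τ)).add
      (hm _ (hhm n))).const_mul _
  · filter_upwards [haB n] with t ht
    exact (norm_bpair_le _ _).trans (by gcongr)
  · filter_upwards [haB n, hhC n] with t ht ht'
    rw [norm_mul, norm_neg, Complex.norm_I, one_mul]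
    refine (norm_add₃_le).trans ?_
    rw [norm_mul, norm_mul]
    simp only [Pi.add_apply]
    have h1 := (norm_bpair_le (as n t) (tens e' g)).trans
      (mul_le_mul_of_nonneg_right ht (norm_nonneg _))
    have h2 := (norm_bpair_le (as n t) (tens e g')).trans
      (mul_le_mul_of_nonneg_right ht (norm_nonneg _))
    have h3 := (norm_bpair_le (hs n t) (tens e g)).trans
      (mul_le_mul_of_nonneg_right ht' (norm_nonneg _))
    have h4 := mul_le_mul_of_nonneg_left h1 (norm_nonneg σ)
    have h5 := mul_le_mul_of_nonneg_left h2 (norm_nonneg τ)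
    linarith
  · exact ha.mono fun t ht => hl _ ht
  · filter_upwards [ha, hh] with t h1 h2
    exact ((((hl _ h1).const_mul σ).add ((hl _ h1).const_mul τ)).add (hl _ h2)).const_mul _

end TensEq

/-! ### Curves of kernels given by functions of `(t, x, y)` -/

section Curves

/-- In a second countable metric space every open set is a countable union of balls, so only the
distances to fixed points have to be measurable. -/
theorem measurable_of_dist {S E : Type*} [MeasurableSpace S] [PseudoMetricSpace E]
    [SecondCountableTopology E] [MeasurableSpace E] [BorelSpace E] {f : S → E}
    (h : ∀ l, Measurable fun s => dist (f s) l) : Measurable f := by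
  refine measurable_of_isOpen fun U hU => ?_
  rcases isEmpty_or_nonempty E with hE | hE
  · rw [Set.eq_empty_of_isEmpty U]; simp
  have hU' : U = ⋃ n : ℕ, ⋃ q : ℚ, ⋃ _ : Metric.ball (denseSeq E n) q ⊆ U,
      Metric.ball (denseSeq E n) q := by
    refine Subset.antisymm (fun x hx => ?_) ?_
    · obtain ⟨ε, hε, hεU⟩ := Metric.isOpen_iff.1 hU x hx
      obtain ⟨q, hq0, hq⟩ := exists_rat_btwn (show (0 : ℝ) < ε / 2 by positivity)
      obtain ⟨n, hn⟩ := (denseRange_denseSeq E).exists_dist_lt x hq0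
      simp only [mem_iUnion]
      refine ⟨n, q, fun y hy => hεU ?_, hn⟩
      have h1 : dist y (denseSeq E n) < q := hy
      rw [Metric.mem_ball]
      calc dist y x ≤ dist y (denseSeq E n) + dist (denseSeq E n) x := dist_triangle _ _ _
        _ < q + q := add_lt_add h1 (by rwa [dist_comm])
        _ < ε := by linarith
    · exact iUnion_subset fun n => iUnion_subset fun q => iUnion_subset fun hq => hq
  rw [hU']
  simp only [preimage_iUnion]
  refine MeasurableSet.iUnion fun n => MeasurableSet.iUnion fun q => MeasurableSet.iUnion fun _ => ?_
  exact measurableSet_lt (h (denseSeq E n)) measurable_const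

theorem enorm_toLp_sq {k : E3 × E3 → ℂ} (hk : MemLp k 2 volume) :
    ‖hk.toLp k‖ₑ ^ (2 : ℝ) = ∫⁻ z, ‖k z‖ₑ ^ (2 : ℝ) := by
  rw [Lp.enorm_toLp, eLpNorm_eq_lintegral_rpow_enorm_toReal (by norm_num) (by norm_num),
    ← ENNReal.rpow_mul]
  norm_num

theorem memLp_two_iff {k : E3 × E3 → ℂ} (hk : AEStronglyMeasurable k volume) :
    MemLp k 2 volume ↔ ∫⁻ z, ‖k z‖ₑ ^ (2 : ℝ) < ∞ := by
  rw [MemLp, and_iff_right hk,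
    eLpNorm_lt_top_iff_lintegral_rpow_enorm_lt_top (by norm_num) (by norm_num)]
  norm_num

theorem toKer_of_memLp {k : E3 × E3 → ℂ} (hk : MemLp k 2 volume) : toKer k = hk.toLp k :=
  dif_pos hk

theorem toKer_coe {k : E3 × E3 → ℂ} (hk : MemLp k 2 volume) : toKer k =ᵐ[volume] k := by
  rw [toKer_of_memLp hk]
  exact hk.coeFn_toLp

theorem toKer_congr {k l : E3 × E3 → ℂ} (h : k =ᵐ[volume] l) : toKer k = toKer l := by
  by_cases hk : MemLp k 2 volume
  · rw [toKer_of_memLp hk, toKer_of_memLp ((memLp_congr_ae h).1 hk)]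
    exact MemLp.toLp_congr _ _ h
  · rw [toKer, toKer, dif_neg hk, dif_neg fun hl => hk ((memLp_congr_ae h).2 hl)]

instance : MeasurableSpace Ker := borel Ker
instance : BorelSpace Ker := ⟨rfl⟩

/-- The distance to a fixed kernel is measurable in the parameter by Tonelli; the parameters with a
slice outside L² form a measurable set, on which the value is 0. -/
theorem measurable_toKer {S : Type*} [MeasurableSpace S] {F : S → E3 × E3 → ℂ}
    (hF : Measurable (Function.uncurry F)) : Measurable fun s => toKer (F s) := by
  have hFs : ∀ s, AEStronglyMeasurable (F s) volume := fun s =>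
    (hF.comp measurable_prodMk_left).aestronglyMeasurable
  have hset : MeasurableSet {s | MemLp (F s) 2 volume} := by
    simp only [memLp_two_iff (hFs _)]
    have : Measurable fun s => ∫⁻ z, ‖F s z‖ₑ ^ (2 : ℝ) :=
      Measurable.lintegral_prod_right' (f := fun p : S × (E3 × E3) => ‖F p.1 p.2‖ₑ ^ (2 : ℝ))
        (hF.enorm.pow_const _)
    exact measurableSet_lt this measurable_const
  refine measurable_of_dist fun l => ?_
  have hl : StronglyMeasurable (l : E3 × E3 → ℂ) := Lp.stronglyMeasurable l
  have hm : Measurable fun s => ((∫⁻ z, ‖F s z - l z‖ₑ ^ (2 : ℝ)) ^ (1 / 2 : ℝ)).toReal := by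
    refine ENNReal.measurable_toReal.comp (Measurable.pow_const ?_ _)
    exact Measurable.lintegral_prod_right'
      (f := fun p : S × (E3 × E3) => ‖F p.1 p.2 - l p.2‖ₑ ^ (2 : ℝ))
      ((hF.sub (hl.measurable.comp measurable_snd)).enorm.pow_const _)
  have e : (fun s => dist (toKer (F s)) l) = fun s => open Classical in
      if s ∈ {s | MemLp (F s) 2 volume} then
        ((∫⁻ z, ‖F s z - l z‖ₑ ^ (2 : ℝ)) ^ (1 / 2 : ℝ)).toReal else dist (0 : Ker) l := by
    funext s
    split_ifs with hs
    · have hs' : MemLp (F s) 2 volume := hs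
      have h1 : toKer (F s) - l = (hs'.sub (Lp.memLp l)).toLp _ := by
        rw [toKer_of_memLp hs', MemLp.toLp_sub hs' (Lp.memLp l), Lp.toLp_coeFn]
      rw [dist_eq_norm, h1, ← toReal_enorm]
      congr 1
      have h2 := enorm_toLp_sq (hs'.sub (Lp.memLp l))
      simp only [Pi.sub_apply] at h2
      rw [← h2, ← ENNReal.rpow_mul]
      norm_num
    · have hs' : ¬MemLp (F s) 2 volume := hs
      rw [toKer, dif_neg hs']
  rw [e]
  classical
  exact Measurable.ite hset hm measurable_const

/-- Continuous functions of `(t, x, y)` with compact support. -/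
def IsCC (F : ℝ × E3 × E3 → ℂ) : Prop := Continuous F ∧ HasCompactSupport F

/-- The curve `t ↦ F(t, ·, ·)` of kernels. -/
def curve (F : ℝ × E3 × E3 → ℂ) (t : ℝ) : Ker := toKer fun z => F (t, z.1, z.2)

theorem IsCC.slice {F : ℝ × E3 × E3 → ℂ} (hF : IsCC F) (t : ℝ) :
    Continuous (fun z : E3 × E3 => F (t, z)) ∧ HasCompactSupport fun z : E3 × E3 => F (t, z) := by
  refine ⟨hF.1.comp (Continuous.prodMk_right t), ?_⟩
  refine HasCompactSupport.intro (hF.2.isCompact.image continuous_snd) fun z hz => ?_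
  exact image_eq_zero_of_notMem_tsupport fun h => hz ⟨_, h, rfl⟩

theorem IsCC.memLp {F : ℝ × E3 × E3 → ℂ} (hF : IsCC F) (t : ℝ) :
    MemLp (fun z : E3 × E3 => F (t, z)) 2 volume :=
  (hF.slice t).1.memLp_of_hasCompactSupport (hF.slice t).2

theorem IsCC.curve_coe {F : ℝ × E3 × E3 → ℂ} (hF : IsCC F) (t : ℝ) :
    curve F t =ᵐ[volume] fun z => F (t, z) := toKer_coe (hF.memLp t)

theorem IsCC.memLp_curve {F : ℝ × E3 × E3 → ℂ} (hF : IsCC F) (T : ℝ) :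
    MemLp (curve F) ∞ (timeMeasure T) := by
  obtain ⟨M, hM⟩ := hF.2.exists_bound_of_continuous hF.1
  set K : Set (E3 × E3) := Prod.snd '' tsupport F with hK
  have hKc : IsCompact K := hF.2.isCompact.image continuous_snd
  have hM0 : 0 ≤ M := (norm_nonneg _).trans (hM 0)
  have hm : Measurable (curve F) := measurable_toKer (F := fun t z => F (t, z)) hF.1.measurable
  refine memLp_top_of_bound hm.aestronglyMeasurable
    (((ENNReal.ofReal M ^ (2 : ℝ) * volume K) ^ (1 / 2 : ℝ)).toReal)
    (Eventually.of_forall fun t => ?_)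
  rw [← toReal_enorm]
  refine ENNReal.toReal_mono ?_ ?_
  · exact ENNReal.rpow_ne_top_of_nonneg (by norm_num)
      (ENNReal.mul_ne_top (ENNReal.rpow_ne_top_of_nonneg (by norm_num) ENNReal.ofReal_ne_top)
        hKc.measure_lt_top.ne)
  · have h1 : ‖curve F t‖ₑ ^ (2 : ℝ) ≤ ENNReal.ofReal M ^ (2 : ℝ) * volume K := by
      rw [curve, toKer_of_memLp (hF.memLp t), enorm_toLp_sq]
      calc _ ≤ ∫⁻ z, K.indicator (fun _ => ENNReal.ofReal M ^ (2 : ℝ)) z := by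
            refine lintegral_mono fun z => ?_
            by_cases hz : z ∈ K
            · rw [indicator_of_mem hz]
              refine ENNReal.rpow_le_rpow ?_ (by norm_num)
              rw [← ofReal_norm]
              exact ENNReal.ofReal_le_ofReal (hM _)
            · have : F (t, z) = 0 := image_eq_zero_of_notMem_tsupport fun h => hz ⟨_, h, rfl⟩
              simp [this]
        _ = _ := by
          rw [lintegral_indicator_const hKc.measurableSet]
    have h2 := ENNReal.rpow_le_rpow h1 (show (0 : ℝ) ≤ 1 / 2 by norm_num)
    rwa [← ENNReal.rpow_mul, mul_one_div_cancel (by norm_num), ENNReal.rpow_one] at h2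

theorem IsCC.bpair_curve {F : ℝ × E3 × E3 → ℂ} (hF : IsCC F) (k : Ker) (t : ℝ) :
    bpair k (curve F t) = ∫ z, k z * F (t, z) := by
  rw [bpair_apply]
  refine integral_congr_ae ?_
  filter_upwards [hF.curve_coe t] with z hz
  rw [hz]

theorem IsCC.add {F G : ℝ × E3 × E3 → ℂ} (hF : IsCC F) (hG : IsCC G) :
    IsCC (fun p => F p + G p) := ⟨hF.1.add hG.1, hF.2.add hG.2⟩

theorem IsCC.const_mul {F : ℝ × E3 × E3 → ℂ} (hF : IsCC F) (c : ℂ) :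
    IsCC (fun p => c * F p) := ⟨continuous_const.mul hF.1, hF.2.mul_left⟩

end Curves

/-! ### Derivatives of test functions -/

section TestFunctions

variable {ψ : ℝ × E3 × E3 → ℂ}

/-- `ψ ∈ C_c^∞(ℝ × ℝ³ × ℝ³)`. -/
def IsSCC (ψ : ℝ × E3 × E3 → ℂ) : Prop := ContDiff ℝ (⊤ : ℕ∞) ψ ∧ HasCompactSupport ψ

/-- Directional derivative. -/
def dirDeriv (w : ℝ × E3 × E3) (ψ : ℝ × E3 × E3 → ℂ) (p : ℝ × E3 × E3) : ℂ := fderiv ℝ ψ p w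

theorem IsSCC.isCC (h : IsSCC ψ) : IsCC ψ := ⟨h.1.continuous, h.2⟩

theorem IsSCC.dirDeriv (h : IsSCC ψ) (w : ℝ × E3 × E3) : IsSCC (dirDeriv w ψ) :=
  ⟨(h.1.fderiv_right (m := ((⊤ : ℕ∞) : WithTop ℕ∞)) (by simp)).clm_apply contDiff_const,
    h.2.fderiv_apply ℝ _⟩

theorem IsSCC.differentiable (h : IsSCC ψ) : Differentiable ℝ ψ := h.1.differentiable (by simp)

theorem IsSCC.hasDerivAt (h : IsSCC ψ) (t : ℝ) (x y : E3) :
    HasDerivAt (fun s => ψ (s, x, y)) (PairExcitation.dirDeriv (1, 0, 0) ψ (t, x, y)) t := by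
  have h1 : HasDerivAt (fun s : ℝ => (s, x, y)) ((1 : ℝ), (0 : E3), (0 : E3)) t :=
    (hasDerivAt_id t).prodMk ((hasDerivAt_const t x).prodMk (hasDerivAt_const t y))
  exact (h.differentiable (t, x, y)).hasFDerivAt.comp_hasDerivAt t h1

theorem IsSCC.dt_eq (h : IsSCC ψ) :
    (fun p : ℝ × E3 × E3 => dt ψ p.1 p.2.1 p.2.2) = PairExcitation.dirDeriv (1, 0, 0) ψ :=
  funext fun p => (h.hasDerivAt p.1 p.2.1 p.2.2).deriv

theorem IsSCC.pderiv3_fst (h : IsSCC ψ) (i : Fin 3) (t : ℝ) (x y : E3) :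
    pderiv3 i (fun x' => ψ (t, x', y)) x
      = PairExcitation.dirDeriv (0, EuclideanSpace.basisFun (Fin 3) ℝ i, 0) ψ (t, x, y) := by
  have h1 : HasFDerivAt (fun x' : E3 => (t, x', y)) ((0 : E3 →L[ℝ] ℝ).prod
      ((ContinuousLinearMap.id ℝ E3).prod (0 : E3 →L[ℝ] E3))) x :=
    (hasFDerivAt_const t x).prodMk ((hasFDerivAt_id x).prodMk (hasFDerivAt_const y x))
  have h2 := (h.differentiable (t, x, y)).hasFDerivAt.comp x h1
  change fderiv ℝ (ψ ∘ fun x' => (t, x', y)) x _ = _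
  rw [h2.fderiv]
  rfl

theorem IsSCC.pderiv3_snd (h : IsSCC ψ) (i : Fin 3) (t : ℝ) (x y : E3) :
    pderiv3 i (fun y' => ψ (t, x, y')) y
      = PairExcitation.dirDeriv (0, 0, EuclideanSpace.basisFun (Fin 3) ℝ i) ψ (t, x, y) := by
  have h1 : HasFDerivAt (fun y' : E3 => (t, x, y')) ((0 : E3 →L[ℝ] ℝ).prod
      ((0 : E3 →L[ℝ] E3).prod (ContinuousLinearMap.id ℝ E3))) y :=
    (hasFDerivAt_const t y).prodMk ((hasFDerivAt_const x y).prodMk (hasFDerivAt_id y))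
  have h2 := (h.differentiable (t, x, y)).hasFDerivAt.comp y h1
  change fderiv ℝ (ψ ∘ fun y' => (t, x, y')) y _ = _
  rw [h2.fderiv]
  rfl

theorem IsSCC.isBump_fst (h : IsSCC ψ) (t : ℝ) (y : E3) : IsBump fun x => ψ (t, x, y) := by
  refine ⟨h.1.comp (contDiff_const.prodMk (contDiff_id.prodMk contDiff_const)), ?_⟩
  refine HasCompactSupport.intro
    (h.2.isCompact.image (continuous_fst.comp continuous_snd)) fun x hx => ?_
  exact image_eq_zero_of_notMem_tsupport fun h' => hx ⟨_, h', rfl⟩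

theorem IsSCC.isBump_snd (h : IsSCC ψ) (t : ℝ) (x : E3) : IsBump fun y => ψ (t, x, y) := by
  refine ⟨h.1.comp (contDiff_const.prodMk (contDiff_const.prodMk contDiff_id)), ?_⟩
  refine HasCompactSupport.intro
    (h.2.isCompact.image (continuous_snd.comp continuous_snd)) fun x hx => ?_
  exact image_eq_zero_of_notMem_tsupport fun h' => hx ⟨_, h', rfl⟩

theorem IsSCC.lapX_eq (h : IsSCC ψ) :
    (fun p : ℝ × E3 × E3 => lapX ψ p.1 p.2.1 p.2.2) = fun p => ∑ i,
      PairExcitation.dirDeriv (0, EuclideanSpace.basisFun (Fin 3) ℝ i, 0)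
        (PairExcitation.dirDeriv (0, EuclideanSpace.basisFun (Fin 3) ℝ i, 0) ψ) p := by
  funext ⟨t, x, y⟩
  rw [lapX, laplacian_eq_sum (h.isBump_fst t y).1]
  refine Finset.sum_congr rfl fun i _ => ?_
  have h1 : pderiv3 i (fun x' => ψ (t, x', y)) = fun x' =>
    PairExcitation.dirDeriv (0, EuclideanSpace.basisFun (Fin 3) ℝ i, 0) ψ (t, x', y) :=
      funext fun x' => h.pderiv3_fst i t x' y
  rw [h1, (h.dirDeriv _).pderiv3_fst]

theorem IsSCC.lapY_eq (h : IsSCC ψ) :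
    (fun p : ℝ × E3 × E3 => lapY ψ p.1 p.2.1 p.2.2) = fun p => ∑ i,
      PairExcitation.dirDeriv (0, 0, EuclideanSpace.basisFun (Fin 3) ℝ i)
        (PairExcitation.dirDeriv (0, 0, EuclideanSpace.basisFun (Fin 3) ℝ i) ψ) p := by
  funext ⟨t, x, y⟩
  rw [lapY, laplacian_eq_sum (h.isBump_snd t x).1]
  refine Finset.sum_congr rfl fun i _ => ?_
  have h1 : pderiv3 i (fun y' => ψ (t, x, y')) = fun y' =>
    PairExcitation.dirDeriv (0, 0, EuclideanSpace.basisFun (Fin 3) ℝ i) ψ (t, x, y') :=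
      funext fun y' => h.pderiv3_snd i t x y'
  rw [h1, (h.dirDeriv _).pderiv3_snd]

theorem IsSCC.dt_isCC (h : IsSCC ψ) : IsCC fun p => dt ψ p.1 p.2.1 p.2.2 := by
  rw [h.dt_eq]
  exact (h.dirDeriv _).isCC

theorem IsSCC.lapX_isCC (h : IsSCC ψ) : IsCC fun p => lapX ψ p.1 p.2.1 p.2.2 := by
  rw [h.lapX_eq]
  simp only [Fin.sum_univ_three]
  exact (((h.dirDeriv _).dirDeriv _).isCC.add ((h.dirDeriv _).dirDeriv _).isCC).add
    ((h.dirDeriv _).dirDeriv _).isCC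

theorem IsSCC.lapY_isCC (h : IsSCC ψ) : IsCC fun p => lapY ψ p.1 p.2.1 p.2.2 := by
  rw [h.lapY_eq]
  simp only [Fin.sum_univ_three]
  exact (((h.dirDeriv _).dirDeriv _).isCC.add ((h.dirDeriv _).dirDeriv _).isCC).add
    ((h.dirDeriv _).dirDeriv _).isCC

theorem IsCC.integrable_mul_tens {F : ℝ × E3 × E3 → ℂ} (hF : IsCC F) (t : ℝ) {f g : E3 → ℂ}
    (hf : Continuous f) (hg : Continuous g) :
    Integrable (fun z : E3 × E3 => F (t, z) * (f z.1 * g z.2)) := by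
  refine Continuous.integrable_of_hasCompactSupport ?_ ((hF.slice t).2.mul_right)
  exact (hF.slice t).1.mul ((hf.comp continuous_fst).mul (hg.comp continuous_snd))

theorem IsSCC.integral_lapX (h : IsSCC ψ) {f g : E3 → ℂ} (hf : IsBump f) (hg : IsBump g) (t : ℝ) :
    ∫ z : E3 × E3, ψ (t, z) * (Laplacian.laplacian f z.1 * g z.2)
      = ∫ z : E3 × E3, lapX ψ t z.1 z.2 * (f z.1 * g z.2) := by
  have h1 := integral_prod_symm (μ := (volume : Measure E3)) (ν := (volume : Measure E3)) _
    (h.isCC.integrable_mul_tens t hf.laplacian.continuous hg.continuous)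
  have h2 := integral_prod_symm (μ := (volume : Measure E3)) (ν := (volume : Measure E3)) _
    (h.lapX_isCC.integrable_mul_tens t hf.continuous hg.continuous)
  refine h1.trans (Eq.trans ?_ h2.symm)
  refine integral_congr_ae (Eventually.of_forall fun y => ?_)
  have h3 := (h.isBump_fst t y).integral_mul_laplacian hf
  simp only [← mul_assoc]
  rw [integral_mul_const, integral_mul_const, h3]
  rfl

theorem IsSCC.integral_lapY (h : IsSCC ψ) {f g : E3 → ℂ} (hf : IsBump f) (hg : IsBump g) (t : ℝ) :
    ∫ z : E3 × E3, ψ (t, z) * (f z.1 * Laplacian.laplacian g z.2)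
      = ∫ z : E3 × E3, lapY ψ t z.1 z.2 * (f z.1 * g z.2) := by
  have h1 := integral_prod (μ := (volume : Measure E3)) (ν := (volume : Measure E3)) _
    (h.isCC.integrable_mul_tens t hf.continuous hg.laplacian.continuous)
  have h2 := integral_prod (μ := (volume : Measure E3)) (ν := (volume : Measure E3)) _
    (h.lapY_isCC.integrable_mul_tens t hf.continuous hg.continuous)
  refine h1.trans (Eq.trans ?_ h2.symm)
  refine integral_congr_ae (Eventually.of_forall fun x => ?_)
  have h3 := (h.isBump_snd t x).integral_mul_laplacian hg
  simp only [mul_left_comm _ (f x)]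
  rw [integral_const_mul, integral_const_mul, h3]
  rfl

theorem IsSCC.integral_dt (h : IsSCC ψ) {T : ℝ} {χ : ℝ → ℝ} (hχ : IsTimeTest T χ)
    {f g : E3 → ℂ} (hf : Continuous f) (hg : Continuous g) :
    ∫ t, deriv χ t • (∫ z : E3 × E3, ψ (t, z) * (f z.1 * g z.2)) ∂(timeMeasure T)
      = -∫ t, χ t • (∫ z : E3 × E3, dt ψ t z.1 z.2 * (f z.1 * g z.2)) ∂(timeMeasure T) := by
  have hc : HasCompactSupport (fun t => (χ t : ℂ)) :=
    hχ.2.1.comp_left (g := ((↑) : ℝ → ℂ)) Complex.ofReal_zero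
  have hd : ∀ t, HasDerivAt (fun t => (χ t : ℂ)) ((deriv χ t : ℝ) : ℂ) t := fun t =>
    ((hχ.1.differentiable (by simp)) t).hasDerivAt.ofReal_comp
  have e1 : ∀ (η : ℝ → ℝ) (G : ℝ → ℂ), tsupport η ⊆ Ioo 0 T →
      ∫ t, η t • G t ∂(timeMeasure T) = ∫ t, η t • G t := by
    intro η G hη
    refine setIntegral_eq_integral_of_forall_compl_eq_zero fun t ht => ?_
    rw [image_eq_zero_of_notMem_tsupport fun h' => ht (Ioo_subset_Icc_self (hη h')), zero_smul]
  have swap : ∀ (η : ℝ → ℝ) (F : ℝ × E3 × E3 → ℂ), Continuous η → IsCC F →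
      ∫ t, η t • (∫ z : E3 × E3, F (t, z) * (f z.1 * g z.2))
        = ∫ z : E3 × E3, (∫ t, η t • F (t, z)) * (f z.1 * g z.2) := by
    intro η F hη hF
    simp only [← integral_smul, ← integral_mul_const]
    rw [integral_integral_swap_of_hasCompactSupport]
    · simp only [smul_mul_assoc]
    · refine (hη.comp continuous_fst).smul (hF.1.mul ?_)
      exact (hf.comp (continuous_fst.comp continuous_snd)).mul
        (hg.comp (continuous_snd.comp continuous_snd))
    · refine HasCompactSupport.intro hF.2.isCompact ?_
      rintro ⟨t, z⟩ hp
      simp [image_eq_zero_of_notMem_tsupport hp]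
  rw [e1 _ _ (tsupport_deriv_subset.trans hχ.2.2), e1 _ _ hχ.2.2,
    swap _ _ hχ.continuous_deriv h.isCC, swap _ (fun p => dt ψ p.1 p.2.1 p.2.2) hχ.continuous h.dt_isCC, ← integral_neg]
  refine integral_congr_ae (Eventually.of_forall fun z => ?_)
  simp only [← neg_mul]
  congr 1
  have hcs : HasCompactSupport fun t => ψ (t, z) := by
    refine HasCompactSupport.intro (h.2.isCompact.image continuous_fst) fun t ht => ?_
    exact image_eq_zero_of_notMem_tsupport fun h' => ht ⟨_, h', rfl⟩
  have hcψ : Continuous fun t => ψ (t, z) := h.1.continuous.comp (Continuous.prodMk_left z)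
  have hcd : Continuous fun t => dt ψ t z.1 z.2 := h.dt_isCC.1.comp (Continuous.prodMk_left z)
  have hχc : Continuous fun t => (χ t : ℂ) := Complex.continuous_ofReal.comp hχ.continuous
  have hχd : Continuous fun t => ((deriv χ t : ℝ) : ℂ) :=
    Complex.continuous_ofReal.comp hχ.continuous_deriv
  have hdψ : ∀ t, HasDerivAt (fun t => ψ (t, z)) (dt ψ t z.1 z.2) t := fun t => by
    have := h.hasDerivAt t z.1 z.2
    exact this.differentiableAt.hasDerivAt
  have h1 := integral_mul_deriv_eq_deriv_mul_of_integrable (u := fun t => ψ (t, z))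
    (v := fun t => (χ t : ℂ)) (fun t _ => hdψ t) (fun t _ => hd t)
    ((hcψ.mul hχd).integrable_of_hasCompactSupport hcs.mul_right)
    ((hcd.mul hχc).integrable_of_hasCompactSupport hc.mul_left)
    ((hcψ.mul hχc).integrable_of_hasCompactSupport hcs.mul_right)
  simp only [Complex.real_smul, mul_comm _ (ψ _), mul_comm _ (dt ψ _ _ _)]
  exact h1

end TestFunctions

/-! ### General test functions and elementary tensors -/

section Testing

variable {T : ℝ} {σ τ : ℂ} {a h : ℝ → Ker} {ψ : ℝ × E3 × E3 → ℂ}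

/-- `-i ∂ₜ ψ - σ Δ_x ψ - τ Δ_y ψ`. -/
def freeOp (σ τ : ℂ) (ψ : ℝ × E3 × E3 → ℂ) (p : ℝ × E3 × E3) : ℂ :=
  -Complex.I * dt ψ p.1 p.2.1 p.2.2 - σ * lapX ψ p.1 p.2.1 p.2.2 - τ * lapY ψ p.1 p.2.1 p.2.2

theorem IsSCC.freeOp (hψ : IsSCC ψ) (σ τ : ℂ) : IsCC (freeOp σ τ ψ) := by
  have h := (((hψ.dt_isCC.const_mul (-Complex.I)).add (hψ.lapX_isCC.const_mul (-σ))).add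
    (hψ.lapY_isCC.const_mul (-τ)))
  convert! h using 1
  funext p
  rw [PairExcitation.freeOp]
  ring

theorem IsTest.isSCC (hψ : IsTest T ψ) : IsSCC ψ := ⟨hψ.1, hψ.2.1⟩

theorem IsCC.bpair_curve_tens {F : ℝ × E3 × E3 → ℂ} (hF : IsCC F) {e g : L2} {f k : E3 → ℂ}
    (he : e =ᵐ[volume] f) (hg : g =ᵐ[volume] k) (t : ℝ) :
    bpair (curve F t) (tens e g) = ∫ z : E3 × E3, F (t, z) * (f z.1 * k z.2) := by
  rw [bpair_apply]
  refine integral_congr_ae ?_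
  filter_upwards [hF.curve_coe t, tens_coe e g, quasi_fst.ae he, quasi_snd.ae hg]
    with z h1 h2 h3 h4
  rw [h1, h2, h3, h4]

/-- A test function is itself a solution of the dual equation, with a bounded source. Testing
against ψ thus becomes a case of the pairing of dual solutions. -/
theorem IsSCC.weakDeriv_curve (hψ : IsSCC ψ) {e e' g g' : L2} (he : IsLap e e')
    (hg : IsLap g g') :
    WeakDeriv T (fun t => bpair (curve ψ t) (tens e g)) fun t =>
      -Complex.I * (-bpair (curve ψ t) (σ • tens e' g + τ • tens e g')
        + bpair (curve (fun p => -PairExcitation.freeOp σ τ ψ p) t) (tens e g)) := by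
  obtain ⟨f, hf, hf1, hf2⟩ := he
  obtain ⟨k, hk, hk1, hk2⟩ := hg
  have hD : IsCC fun p => -PairExcitation.freeOp σ τ ψ p :=
    ⟨(hψ.freeOp σ τ).1.neg, (hψ.freeOp σ τ).2.neg⟩
  intro χ hχ
  have h1 := hψ.integral_dt hχ hf.continuous hk.continuous
  convert! h1 using 1
  · refine integral_congr_ae (Eventually.of_forall fun t => ?_)
    simp only [hψ.isCC.bpair_curve_tens hf1 hk1]
  · congr 1
    refine integral_congr_ae (Eventually.of_forall fun t => ?_)
    simp only
    congr 1
    rw [map_add, map_smul, map_smul, hψ.isCC.bpair_curve_tens hf2 hk1,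
      hψ.isCC.bpair_curve_tens hf1 hk2, hD.bpair_curve_tens hf1 hk1, hψ.integral_lapX hf hk,
      hψ.integral_lapY hf hk]
    have i1 := hψ.dt_isCC.integrable_mul_tens t hf.continuous hk.continuous
    have i2 := hψ.lapX_isCC.integrable_mul_tens t hf.continuous hk.continuous
    have i3 := hψ.lapY_isCC.integrable_mul_tens t hf.continuous hk.continuous
    have e1 : ∫ z : E3 × E3, -PairExcitation.freeOp σ τ ψ (t, z) * (f z.1 * k z.2)
        = Complex.I * (∫ z : E3 × E3, dt ψ t z.1 z.2 * (f z.1 * k z.2))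
          + σ * (∫ z : E3 × E3, lapX ψ t z.1 z.2 * (f z.1 * k z.2))
          + τ * (∫ z : E3 × E3, lapY ψ t z.1 z.2 * (f z.1 * k z.2)) := by
      rw [← integral_const_mul, ← integral_const_mul, ← integral_const_mul,
        ← integral_add (i1.const_mul _) (i2.const_mul _),
        ← integral_add ((i1.const_mul _).fun_add (i2.const_mul _)) (i3.const_mul _)]
      refine integral_congr_ae (Eventually.of_forall fun z => ?_)
      simp only [PairExcitation.freeOp]
      ring
    rw [e1]
    simp only [smul_eq_mul]
    linear_combination -(∫ z : E3 × E3, dt ψ t z.1 z.2 * (f z.1 * k z.2)) * Complex.I_mul_I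

/-- The pairing identity is weak in time and needs a scalar test function; one that is flat on the
time support of ψ makes the boundary term vanish. -/
theorem IsTest.exists_cutoff (hT : 0 < T) (hψ : IsTest T ψ) :
    ∃ χ, IsTimeTest T χ ∧ ∀ t, (∃ z, (t, z) ∈ tsupport ψ) → χ t = 1 ∧ deriv χ t = 0 := by
  have hK : IsCompact (Prod.fst '' tsupport ψ) := hψ.2.1.isCompact.image continuous_fst
  by_cases hne : (Prod.fst '' tsupport ψ).Nonempty
  · obtain ⟨α, hα, hα'⟩ := hK.exists_isLeast hne
    obtain ⟨β, hβ, hβ'⟩ := hK.exists_isGreatest hne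
    have h0 : 0 < α := by
      obtain ⟨p, hp, rfl⟩ := hα
      exact (hψ.2.2 hp).1.1
    have h1 : β < T := by
      obtain ⟨p, hp, rfl⟩ := hβ
      exact (hψ.2.2 hp).1.2
    have hαβ : α ≤ β := hα' hβ
    set δ := min α (T - β) / 2 with hδ
    have hδ0 : 0 < δ := by
      have : 0 < min α (T - β) := lt_min h0 (by linarith)
      positivity
    have hδα : 2 * δ ≤ α := by rw [hδ]; linarith [min_le_left α (T - β)]
    have hδβ : 2 * δ ≤ T - β := by rw [hδ]; linarith [min_le_right α (T - β)]
    -- The bump equals 1 on [δ, T - δ], whose interior contains the time support since 2δ is at most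
    -- its distance to the endpoints, and is supported in [δ/2, T - δ/2].
    let b : ContDiffBump (T / 2) := ⟨T / 2 - δ, T / 2 - δ / 2, by linarith, by linarith⟩
    refine ⟨b, ⟨b.contDiff, b.hasCompactSupport, ?_⟩, ?_⟩
    · rw [b.tsupport_eq, Real.closedBall_eq_Icc]
      intro t ht
      change t ∈ Icc (T / 2 - (T / 2 - δ / 2)) (T / 2 + (T / 2 - δ / 2)) at ht
      exact ⟨by linarith [ht.1], by linarith [ht.2]⟩
    · rintro t ⟨z, hz⟩
      have ht : t ∈ Prod.fst '' tsupport ψ := ⟨_, hz, rfl⟩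
      have h3 : α ≤ t := hα' ht
      have h4 : t ≤ β := hβ' ht
      have hmem : t ∈ Metric.ball (T / 2) b.rIn := by
        rw [Real.ball_eq_Ioo]
        change t ∈ Ioo (T / 2 - (T / 2 - δ)) (T / 2 + (T / 2 - δ))
        exact ⟨by linarith, by linarith⟩
      have hev : (b : ℝ → ℝ) =ᶠ[𝓝 t] fun _ => 1 := by
        filter_upwards [Metric.isOpen_ball.mem_nhds hmem] with s hs
        exact b.one_of_mem_closedBall (Metric.ball_subset_closedBall hs)
      exact ⟨hev.eq_of_nhds, by rw [hev.deriv_eq]; simp⟩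
  · obtain ⟨η, hη, -⟩ := exists_timeTest hT
    exact ⟨η, hη, fun t ⟨z, hz⟩ => (hne ⟨t, _, hz, rfl⟩).elim⟩

/-- The equation holds for all test functions if it holds for elementary tensors. -/
theorem TensEq.integral_test (hT : 0 < T) (H : TensEq T σ τ a h) (ha : MemLp a ∞ (timeMeasure T))
    (hh : Integrable h (timeMeasure T)) (hψ : IsTest T ψ) :
    ∫ t, bpair (a t) (curve (freeOp σ τ ψ) t) ∂(timeMeasure T)
      = ∫ t, bpair (h t) (curve ψ t) ∂(timeMeasure T) := by
  have hS := hψ.isSCC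
  have hF := hS.freeOp σ τ
  have hD : IsCC fun p => -freeOp σ τ ψ p := ⟨hF.1.neg, hF.2.neg⟩
  have key := (regularizer_Ker σ τ).weakDeriv_bpair hT ha hh (hS.isCC.memLp_curve T)
    (MemLp.integrable_time (hD.memLp_curve T)) ?_ ?_
  -- Where ψ lives, χ = 1 and χ' = 0; elsewhere both pairings vanish. Hence the left side of the
  -- weak identity is 0 and χ can be dropped on the right.
  · obtain ⟨χ, hχ, hχ1⟩ := hψ.exists_cutoff hT
    have h1 := key χ hχ
    have hz : ∀ t, (¬∃ z, (t, z) ∈ tsupport ψ) → ∀ z, ψ (t, z) = 0 := fun t ht z =>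
      image_eq_zero_of_notMem_tsupport fun h' => ht ⟨z, h'⟩
    have hsub : Function.support (freeOp σ τ ψ) ⊆ tsupport ψ := by
      intro p hp
      by_contra hps
      refine hp ?_
      have hev : ψ =ᶠ[𝓝 p] fun _ => 0 := notMem_tsupport_iff_eventuallyEq.1 hps
      have d0 : ∀ (w : ℝ × E3 × E3) (q : ℝ × E3 × E3) (θ : ℝ × E3 × E3 → ℂ),
          θ =ᶠ[𝓝 q] (fun _ => 0) → dirDeriv w θ =ᶠ[𝓝 q] fun _ => 0 := by
        intro w q θ hθ
        refine hθ.eventuallyEq_nhds.mono fun r hr => ?_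
        simp only [dirDeriv, hr.fderiv_eq]
        simp
      have e1 := congrFun hS.dt_eq p
      have e2 := congrFun hS.lapX_eq p
      have e3 := congrFun hS.lapY_eq p
      have z1 : dt ψ p.1 p.2.1 p.2.2 = 0 := by rw [e1]; exact (d0 _ p ψ hev).eq_of_nhds
      have z2 : lapX ψ p.1 p.2.1 p.2.2 = 0 := by
        rw [e2]; exact Finset.sum_eq_zero fun i _ => (d0 _ p _ (d0 _ p ψ hev)).eq_of_nhds
      have z3 : lapY ψ p.1 p.2.1 p.2.2 = 0 := by
        rw [e3]; exact Finset.sum_eq_zero fun i _ => (d0 _ p _ (d0 _ p ψ hev)).eq_of_nhds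
      simp [freeOp, z1, z2, z3]
    have hz' : ∀ t, (¬∃ z, (t, z) ∈ tsupport ψ) → ∀ z, freeOp σ τ ψ (t, z) = 0 := fun t ht z =>
      by_contra fun h' => ht ⟨z, hsub h'⟩
    have l : ∫ t, deriv χ t • bpair (a t) (curve ψ t) ∂(timeMeasure T) = 0 := by
      refine integral_eq_zero_of_ae (Eventually.of_forall fun t => ?_)
      by_cases ht : ∃ z, (t, z) ∈ tsupport ψ
      · simp [(hχ1 t ht).2]
      · have : bpair (a t) (curve ψ t) = 0 := by
          rw [hS.isCC.bpair_curve]; simp [hz t ht]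
        simp [this]
    have hne : ∀ t, bpair (a t) (curve (fun p => -freeOp σ τ ψ p) t)
        = -bpair (a t) (curve (freeOp σ τ ψ) t) := by
      intro t
      rw [hD.bpair_curve, hF.bpair_curve, ← integral_neg]
      simp
    have r : ∫ t, χ t • (-Complex.I * (bpair (h t) (curve ψ t)
        + bpair (a t) (curve (fun p => -freeOp σ τ ψ p) t))) ∂(timeMeasure T)
        = ∫ t, -Complex.I * (bpair (h t) (curve ψ t)
          - bpair (a t) (curve (freeOp σ τ ψ) t)) ∂(timeMeasure T) := by
      refine integral_congr_ae (Eventually.of_forall fun t => ?_)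
      simp only [hne]
      by_cases ht : ∃ z, (t, z) ∈ tsupport ψ
      · rw [(hχ1 t ht).1, one_smul, sub_eq_add_neg]
      · have z1 : bpair (h t) (curve ψ t) = 0 := by
          rw [hS.isCC.bpair_curve]; simp [hz t ht]
        have z2 : bpair (a t) (curve (freeOp σ τ ψ) t) = 0 := by
          rw [hF.bpair_curve]; simp [hz' t ht]
        simp [z1, z2]
    rw [l, r, integral_const_mul, eq_comm, neg_eq_zero, mul_eq_zero, or_iff_right
      (neg_ne_zero.2 Complex.I_ne_zero), integral_sub (integrable_bpair hh (hS.isCC.memLp_curve T))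
      (integrable_bpair (MemLp.integrable_time ha) (hF.memLp_curve T)), sub_eq_zero] at h1
    exact h1.symm
  · rintro k k' ⟨e, e', g, g', he, hg, h1, h2⟩
    simp only at h1 h2
    subst h1 h2
    refine (H e e' g g' he hg).congr (Eventually.of_forall fun t => rfl)
      (Eventually.of_forall fun t => ?_)
    simp only [map_add, map_smul, smul_eq_mul]
  · rintro k k' ⟨e, e', g, g', he, hg, h1, h2⟩
    simp only at h1 h2
    subst h1 h2
    exact hS.weakDeriv_curve he hg

theorem isTest_tens {χ : ℝ → ℝ} (hχ : IsTimeTest T χ) {f k : E3 → ℂ} (hf : IsBump f)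
    (hk : IsBump k) : IsTest T (fun p => (χ p.1 : ℂ) * (f p.2.1 * k p.2.2)) := by
  have hsupp : ∀ p : ℝ × E3 × E3, p ∉ tsupport χ ×ˢ tsupport f ×ˢ tsupport k →
      (χ p.1 : ℂ) * (f p.2.1 * k p.2.2) = 0 := by
    rintro ⟨t, x, y⟩ hp
    simp only [mem_prod, not_and_or] at hp
    rcases hp with h | h | h <;> simp [image_eq_zero_of_notMem_tsupport h]
  have hK : IsCompact (tsupport χ ×ˢ tsupport f ×ˢ tsupport k) :=
    hχ.2.1.isCompact.prod (hf.2.isCompact.prod hk.2.isCompact)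
  refine ⟨?_, HasCompactSupport.intro hK hsupp, ?_⟩
  · refine ContDiff.mul (Complex.ofRealCLM.contDiff.comp (hχ.1.comp contDiff_fst)) ?_
    exact (hf.1.comp (contDiff_fst.comp contDiff_snd)).mul
      (hk.1.comp (contDiff_snd.comp contDiff_snd))
  · have : tsupport (fun p : ℝ × E3 × E3 => (χ p.1 : ℂ) * (f p.2.1 * k p.2.2))
        ⊆ tsupport χ ×ˢ tsupport f ×ˢ tsupport k :=
      closure_minimal (fun p hp => by_contra fun h' => hp (hsupp p h')) hK.isClosed
    exact this.trans (prod_mono hχ.2.2 (subset_univ _))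

theorem laplacian_const_mul {f : E3 → ℂ} (hf : IsBump f) (c : ℂ) (x : E3) :
    Laplacian.laplacian (fun y => c * f y) x = c * Laplacian.laplacian f x := by
  have h : ContDiffAt ℝ 2 f x := hf.1.contDiffAt.of_le (by norm_cast)
  exact InnerProductSpace.laplacian_smul c h

theorem freeOp_tens {χ : ℝ → ℝ} (hχ : IsTimeTest T χ) {f k : E3 → ℂ} (hf : IsBump f)
    (hk : IsBump k) (σ τ : ℂ) (t : ℝ) (x y : E3) :
    freeOp σ τ (fun p : ℝ × E3 × E3 => (χ p.1 : ℂ) * (f p.2.1 * k p.2.2)) (t, x, y)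
      = -Complex.I * (deriv χ t : ℝ) * (f x * k y)
        - χ t * (σ * (Laplacian.laplacian f x * k y) + τ * (f x * Laplacian.laplacian k y)) := by
  have d1 : deriv (fun s => (χ s : ℂ) * (f x * k y)) t = (deriv χ t : ℝ) * (f x * k y) := by
    have hd : HasDerivAt (fun s => (χ s : ℂ) * (f x * k y))
        (((deriv χ t : ℝ) : ℂ) * (f x * k y)) t :=
      (((hχ.1.differentiable (by simp)) t).hasDerivAt.ofReal_comp).mul_const _
    exact hd.deriv
  have d2 : Laplacian.laplacian (fun x' => (χ t : ℂ) * (f x' * k y)) x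
      = (χ t : ℂ) * (Laplacian.laplacian f x * k y) := by
    have : (fun x' => (χ t : ℂ) * (f x' * k y)) = fun x' => ((χ t : ℂ) * k y) * f x' := by
      funext x'; ring
    rw [this, laplacian_const_mul hf]
    ring
  have d3 : Laplacian.laplacian (fun y' => (χ t : ℂ) * (f x * k y')) y
      = (χ t : ℂ) * (f x * Laplacian.laplacian k y) := by
    have : (fun y' => (χ t : ℂ) * (f x * k y')) = fun y' => ((χ t : ℂ) * f x) * k y' := by
      funext x'; ring
    rw [this, laplacian_const_mul hk]
    ring
  simp only [freeOp, dt, lapX, lapY, d1, d2, d3]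
  ring

theorem integral_lin_three {c₁ c₂ c₃ : ℂ} {f₁ f₂ f₃ : ℝ → ℂ} {μ : Measure ℝ}
    (h₁ : Integrable f₁ μ) (h₂ : Integrable f₂ μ) (h₃ : Integrable f₃ μ) :
    ∫ t, (c₁ * f₁ t + c₂ * f₂ t + c₃ * f₃ t) ∂μ
      = c₁ * (∫ t, f₁ t ∂μ) + c₂ * (∫ t, f₂ t ∂μ) + c₃ * ∫ t, f₃ t ∂μ := by
  rw [integral_add ((h₁.const_mul c₁).fun_add (h₂.const_mul c₂)) (h₃.const_mul c₃),
    integral_add (h₁.const_mul c₁) (h₂.const_mul c₂), integral_const_mul, integral_const_mul,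
    integral_const_mul]

theorem curve_freeOp_tens {χ : ℝ → ℝ} (hχ : IsTimeTest T χ) {f k : E3 → ℂ} (hf : IsBump f)
    (hk : IsBump k) {e e' g g' : L2} (hf1 : e =ᵐ[volume] f)
    (hf2 : e' =ᵐ[volume] Laplacian.laplacian f) (hk1 : g =ᵐ[volume] k)
    (hk2 : g' =ᵐ[volume] Laplacian.laplacian k) (b : Ker) (t : ℝ) :
    bpair b (curve (freeOp σ τ fun p : ℝ × E3 × E3 => (χ p.1 : ℂ) * (f p.2.1 * k p.2.2)) t)
      = -Complex.I * ((deriv χ t : ℝ) * bpair b (tens e g))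
        + -σ * (χ t * bpair b (tens e' g)) + -τ * (χ t * bpair b (tens e g')) := by
  have hc : curve (freeOp σ τ fun p : ℝ × E3 × E3 => (χ p.1 : ℂ) * (f p.2.1 * k p.2.2)) t
      = (-Complex.I * (deriv χ t : ℝ)) • tens e g
        + ((-σ * χ t) • tens e' g + (-τ * χ t) • tens e g') := by
    refine Lp.ext ?_
    have m1 := Lp.coeFn_add ((-Complex.I * (deriv χ t : ℝ)) • tens e g)
      ((-σ * χ t) • tens e' g + (-τ * χ t) • tens e g')
    have m2 := Lp.coeFn_smul (-Complex.I * (deriv χ t : ℝ)) (tens e g)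
    have m4 := Lp.coeFn_add ((-σ * χ t) • tens e' g) ((-τ * χ t) • tens e g')
    have m5 := Lp.coeFn_smul (-σ * χ t) (tens e' g)
    have m6 := Lp.coeFn_smul (-τ * χ t) (tens e g')
    filter_upwards [((isTest_tens hχ hf hk).isSCC.freeOp σ τ).curve_coe t, m1, m2, m4, m5, m6,
      tens_coe e g, tens_coe e' g, tens_coe e g', quasi_fst.ae hf1, quasi_fst.ae hf2,
      quasi_snd.ae hk1, quasi_snd.ae hk2] with z c m1 m2 m4 m5 m6 t1 t2 t3 f1 f2 k1 k2
    rw [c, m1, Pi.add_apply, m2, Pi.smul_apply, m4, Pi.add_apply, m5, m6,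
      Pi.smul_apply, Pi.smul_apply, t1, t2, t3, f1, f2, k1, k2, ← Prod.mk.eta (p := z),
      freeOp_tens hχ hf hk]
    simp only [smul_eq_mul]
    ring
  rw [hc, map_add, map_add, map_smul, map_smul, map_smul]
  simp only [smul_eq_mul]
  ring

theorem curve_tens {χ : ℝ → ℝ} (hχ : IsTimeTest T χ) {f k : E3 → ℂ} (hf : IsBump f)
    (hk : IsBump k) {e g : L2} (hf1 : e =ᵐ[volume] f) (hk1 : g =ᵐ[volume] k) (b : Ker) (t : ℝ) :
    bpair b (curve (fun p : ℝ × E3 × E3 => (χ p.1 : ℂ) * (f p.2.1 * k p.2.2)) t)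
      = χ t * bpair b (tens e g) := by
  have hc : curve (fun p : ℝ × E3 × E3 => (χ p.1 : ℂ) * (f p.2.1 * k p.2.2)) t
      = (χ t : ℂ) • tens e g := by
    refine Lp.ext ?_
    filter_upwards [(isTest_tens hχ hf hk).isSCC.isCC.curve_coe t,
      Lp.coeFn_smul (χ t : ℂ) (tens e g), tens_coe e g,
      quasi_fst.ae hf1, quasi_snd.ae hk1] with z c m t1 f1 k1
    rw [c, m, Pi.smul_apply, t1, f1, k1]
    rfl
  rw [hc, map_smul, smul_eq_mul]

/-- Test functions χ(t) f(x) k(y) with smooth compactly supported factors are admissible, and for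
them the free operator acts factor by factor. -/
theorem tensEq_of_integral_test
    (H : ∀ ψ, IsTest T ψ → ∫ t, bpair (a t) (curve (freeOp σ τ ψ) t) ∂(timeMeasure T)
      = ∫ t, bpair (h t) (curve ψ t) ∂(timeMeasure T))
    (ha : Integrable a (timeMeasure T)) (hh : Integrable h (timeMeasure T)) :
    TensEq T σ τ a h := by
  intro e e' g g' he hg χ hχ
  obtain ⟨f, hf, hf1, hf2⟩ := he
  obtain ⟨k, hk, hk1, hk2⟩ := hg
  have h1 := H _ (isTest_tens hχ hf hk)
  have i1 := hχ.integrable_deriv_smul (integrable_bpair_const ha (tens e g))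
  have i2 := hχ.integrable_smul (integrable_bpair_const ha (tens e' g))
  have i3 := hχ.integrable_smul (integrable_bpair_const ha (tens e g'))
  have i4 := hχ.integrable_smul (integrable_bpair_const hh (tens e g))
  simp only [Complex.real_smul] at i1 i2 i3 i4 ⊢
  rw [integral_congr_ae (Eventually.of_forall fun t =>
      curve_freeOp_tens hχ hf hk hf1 hf2 hk1 hk2 (a t) t), integral_lin_three i1 i2 i3,
    integral_congr_ae (Eventually.of_forall fun t => curve_tens hχ hf hk hf1 hk1 (h t) t)] at h1
  have e2 : ∫ t, (χ t : ℂ) * (-Complex.I * (σ * bpair (a t) (tens e' g)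
      + τ * bpair (a t) (tens e g') + bpair (h t) (tens e g))) ∂(timeMeasure T)
      = (-Complex.I * σ) * (∫ t, χ t * bpair (a t) (tens e' g) ∂(timeMeasure T))
        + (-Complex.I * τ) * (∫ t, χ t * bpair (a t) (tens e g') ∂(timeMeasure T))
        + -Complex.I * ∫ t, χ t * bpair (h t) (tens e g) ∂(timeMeasure T) := by
    rw [← integral_lin_three i2 i3 i4]
    refine integral_congr_ae (Eventually.of_forall fun t => ?_)
    ring
  rw [e2]
  linear_combination Complex.I * h1
    + (∫ t, (deriv χ t : ℝ) * bpair (a t) (tens e g) ∂(timeMeasure T)) * Complex.I_mul_I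

end Testing

/-! ### Multiplication operators on kernels -/

section Multiplication

theorem memLp_mulFst {d : E3 → ℂ} (hd : AEStronglyMeasurable d volume) {C : ℝ}
    (hC : ∀ x, ‖d x‖ ≤ C) (a : Ker) : MemLp (fun z : E3 × E3 => d z.1 * a z) 2 volume := by
  refine MemLp.of_le_mul (c := C) (Lp.memLp a) ?_ (Eventually.of_forall fun z => ?_)
  · exact (hd.comp_quasiMeasurePreserving quasi_fst).mul (Lp.aestronglyMeasurable a)
  · rw [norm_mul]
    exact mul_le_mul_of_nonneg_right (hC _) (norm_nonneg _)

/-- Multiplication of a kernel by a function of its first variable. -/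
def mulFst (d : E3 → ℂ) (hd : AEStronglyMeasurable d volume) (C : ℝ) (hC : ∀ x, ‖d x‖ ≤ C) :
    Ker →L[ℂ] Ker :=
  LinearMap.mkContinuous
    { toFun := fun a => (memLp_mulFst hd hC a).toLp _
      map_add' := by
        intro a b
        rw [← MemLp.toLp_add]
        refine MemLp.toLp_congr _ _ ?_
        filter_upwards [Lp.coeFn_add a b] with z hz
        simp only [hz, Pi.add_apply, mul_add]
      map_smul' := by
        intro c a
        rw [RingHom.id_apply, ← MemLp.toLp_const_smul]
        refine MemLp.toLp_congr _ _ ?_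
        filter_upwards [Lp.coeFn_smul c a] with z hz
        simp only [hz, Pi.smul_apply, smul_eq_mul]
        ring }
    C (by
      intro a
      refine Lp.norm_le_mul_norm_of_ae_le_mul ?_
      filter_upwards [(memLp_mulFst hd hC a).coeFn_toLp] with z hz
      simp only [LinearMap.coe_mk, AddHom.coe_mk]
      rw [hz, norm_mul]
      exact mul_le_mul_of_nonneg_right (hC _) (norm_nonneg _))

variable {d : E3 → ℂ} {hd : AEStronglyMeasurable d volume} {C : ℝ} {hC : ∀ x, ‖d x‖ ≤ C}

theorem mulFst_coe (a : Ker) : mulFst d hd C hC a =ᵐ[volume] fun z => d z.1 * a z :=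
  (memLp_mulFst hd hC a).coeFn_toLp

theorem mulFst_eq_toKer (a : Ker) : mulFst d hd C hC a = toKer fun z => d z.1 * a z :=
  (toKer_of_memLp (memLp_mulFst hd hC a)).symm

theorem norm_mulFst_apply_le (a : Ker) : ‖mulFst d hd C hC a‖ ≤ C * ‖a‖ := by
  refine Lp.norm_le_mul_norm_of_ae_le_mul ?_
  filter_upwards [mulFst_coe (hd := hd) (hC := hC) a] with z hz
  rw [hz, norm_mul]
  exact mul_le_mul_of_nonneg_right (hC _) (norm_nonneg _)

theorem mulFst_kmul (a b : Ker) :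
    mulFst d hd C hC (kmul a b) = kmul (mulFst d hd C hC a) b := by
  refine Lp.ext ?_
  filter_upwards [mulFst_coe (hd := hd) (hC := hC) (kmul a b), kmul_coe a b,
    kmul_coe (mulFst d hd C hC a) b,
    quasi_fst.ae (Ker.ae_ae (mulFst_coe (hd := hd) (hC := hC) a))] with z h1 h2 h3 h4
  rw [h1, h2, h3, compFun, compFun, ← integral_const_mul]
  refine integral_congr_ae ?_
  filter_upwards [h4] with w hw
  rw [hw]
  ring

theorem adj_coe (a : Ker) : adj a =ᵐ[volume] fun z => star (a z.swap) := by
  filter_upwards [Lp.coeFn_star (tr a), tr_coe a] with z h1 h2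
  rw [adj, h1, Pi.star_apply, h2]

theorem adj_adj (a : Ker) : adj (adj a) = a := by
  rw [adj, adj, tr_star, tr_tr, star_star]

theorem adj_kmul (a b : Ker) : adj (kmul a b) = kmul (adj b) (adj a) := by
  rw [adj, tr_kmul, star_kmul, adj, adj]

/-- Multiplication by a real function is self-adjoint: applied to the right variable of a or to the
left variable of b, it acts on the same middle variable of the composition. -/
theorem kmul_adj_mulFst (hr : ∀ x, star (d x) = d x) (a b : Ker) :
    kmul (adj (mulFst d hd C hC (adj a))) b = kmul a (mulFst d hd C hC b) := by
  have e : adj (mulFst d hd C hC (adj a)) =ᵐ[volume] fun z => a z * d z.2 := by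
    filter_upwards [adj_coe (mulFst d hd C hC (adj a)),
      ae_swap (mulFst_coe (hd := hd) (hC := hC) (adj a)), ae_swap (adj_coe a)] with z h1 h2 h3
    rw [h1, h2, h3, Prod.swap_swap, star_mul, star_star, Prod.fst_swap, hr]
  refine Lp.ext ?_
  filter_upwards [kmul_coe (adj (mulFst d hd C hC (adj a))) b, kmul_coe a (mulFst d hd C hC b),
    quasi_fst.ae (Ker.ae_ae e),
    quasi_snd.ae (Ker.ae_ae (ae_swap (mulFst_coe (hd := hd) (hC := hC) b)))] with z h1 h2 h3 h4
  rw [h1, h2, compFun, compFun]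
  refine integral_congr_ae ?_
  filter_upwards [h3, h4] with w hw hw'
  simp only [Prod.swap_prod_mk] at hw'
  rw [hw, hw']
  ring

end Multiplication

/-! ### The coefficients -/

section Coefficients

variable {v : E3 → ℝ} {φ : E3 → ℂ}

theorem lintegral_sub_mul (f g : E3 → ℝ≥0∞) (hf : Measurable f) (hg : Measurable g) :
    ∫⁻ z : E3 × E3, f (z.1 - z.2) * g z.2 = (∫⁻ x, f x) * ∫⁻ x, g x := by
  have hm : Measurable fun z : E3 × E3 => f (z.1 - z.2) * g z.2 :=
    (hf.comp (measurable_fst.sub measurable_snd)).mul (hg.comp measurable_snd)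
  rw [Measure.volume_eq_prod, lintegral_prod_symm' _ hm]
  simp only
  have : ∀ y, ∫⁻ x, f (x - y) * g y = (∫⁻ x, f x) * g y := fun y => by
    have hm' : Measurable fun x => f (x - y) := hf.comp (measurable_id.sub_const y)
    rw [lintegral_mul_const _ hm', lintegral_sub_right_eq_self]
  simp only [this]
  rw [lintegral_const_mul _ hg]

theorem lintegral_sub_mul' (f g : E3 → ℝ≥0∞) (hf : Measurable f) (hg : Measurable g) :
    ∫⁻ z : E3 × E3, f (z.1 - z.2) * g z.1 = (∫⁻ x, f x) * ∫⁻ x, g x := by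
  have hm : Measurable fun z : E3 × E3 => f (z.1 - z.2) * g z.1 :=
    (hf.comp (measurable_fst.sub measurable_snd)).mul (hg.comp measurable_fst)
  rw [Measure.volume_eq_prod, lintegral_prod _ hm.aemeasurable]
  simp only
  have : ∀ x, ∫⁻ y, f (x - y) * g x = (∫⁻ x, f x) * g x := fun x => by
    have hm' : Measurable fun y => f (x - y) := hf.comp (measurable_const.sub measurable_id)
    rw [lintegral_mul_const _ hm', lintegral_sub_left_eq_self]
  simp only [this]
  rw [lintegral_const_mul _ hg]

/-- `‖v(x-y) φ(x) φ(y)‖²` is integrable. -/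
theorem lintegral_interaction_le (hv : Measurable v) (hφ : Measurable φ) :
    ∫⁻ z : E3 × E3, ‖v (z.1 - z.2)‖ₑ ^ (2 : ℝ) * (‖φ z.1‖ₑ ^ (2 : ℝ) * ‖φ z.2‖ₑ ^ (2 : ℝ))
      ≤ (∫⁻ x, ‖v x‖ₑ ^ (2 : ℝ)) * ((∫⁻ x, ‖φ x‖ₑ ^ (4 : ℝ)) + ∫⁻ x, ‖φ x‖ₑ ^ (4 : ℝ)) := by
  have h4 : ∀ a : ℝ≥0∞, a ^ (2 : ℝ) * a ^ (2 : ℝ) = a ^ (4 : ℝ) := fun a => by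
    rw [← ENNReal.rpow_add_of_nonneg _ _ (by norm_num) (by norm_num)]; norm_num
  -- This separates |φ(x)|²|φ(y)|² into fourth powers of one variable each; a translation then
  -- decouples v(x-y) from the remaining factor.
  have key : ∀ a b : ℝ≥0∞, a * b ≤ a * a + b * b := fun a b => by
    rcases le_total a b with h | h
    · exact (mul_le_mul_left h b).trans le_add_self
    · exact (mul_le_mul_right h a).trans le_self_add
  rw [mul_add]
  nth_rewrite 1 [← lintegral_sub_mul' _ _ (hv.enorm.pow_const _) (hφ.enorm.pow_const _)]
  rw [← lintegral_sub_mul _ _ (hv.enorm.pow_const _) (hφ.enorm.pow_const _), ← lintegral_add_left]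
  · refine lintegral_mono fun z => ?_
    rw [← mul_add, ← h4, ← h4]
    gcongr
    exact key _ _
  · exact ((hv.comp (measurable_fst.sub measurable_snd)).enorm.pow_const _).mul
      ((hφ.comp measurable_fst).enorm.pow_const _)

theorem lintegral_enorm_four : ∫⁻ x, ‖φ x‖ₑ ^ (4 : ℝ) = eLpNorm φ 4 volume ^ (4 : ℝ) := by
  rw [eLpNorm_eq_lintegral_rpow_enorm_toReal (by norm_num) (by norm_num), ← ENNReal.rpow_mul]
  norm_num

theorem lintegral_enorm_two : ∫⁻ x, ‖v x‖ₑ ^ (2 : ℝ) = eLpNorm v 2 volume ^ (2 : ℝ) := by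
  rw [eLpNorm_eq_lintegral_rpow_enorm_toReal (by norm_num) (by norm_num), ← ENNReal.rpow_mul]
  norm_num

theorem sq_mul_four (a b : ℝ≥0∞) :
    a ^ (2 : ℝ) * (b ^ (4 : ℝ) + b ^ (4 : ℝ)) ≤ (2 * a * b ^ 2) ^ (2 : ℝ) := by
  have e : b ^ (4 : ℝ) = (b ^ 2) ^ (2 : ℝ) := by
    rw [← ENNReal.rpow_natCast, ← ENNReal.rpow_mul]; norm_num
  rw [ENNReal.mul_rpow_of_nonneg _ _ (by norm_num), ENNReal.mul_rpow_of_nonneg _ _ (by norm_num),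
    ← two_mul, e]
  calc a ^ (2 : ℝ) * (2 * (b ^ 2) ^ (2 : ℝ)) = 2 * a ^ (2 : ℝ) * (b ^ 2) ^ (2 : ℝ) := by ring
    _ ≤ 2 ^ (2 : ℝ) * a ^ (2 : ℝ) * (b ^ 2) ^ (2 : ℝ) := by
      gcongr
      exact ENNReal.le_rpow_self_of_one_le (by norm_num) (by norm_num)

/-- A function dominated by the interaction kernel is square integrable. -/
theorem memLp_interaction (hv : Measurable v) (hφ : Measurable φ) (hv2 : eLpNorm v 2 volume < ∞)
    (hφ4 : eLpNorm φ 4 volume < ∞) {k : E3 × E3 → ℂ} (hk : AEStronglyMeasurable k volume)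
    (h : ∀ z, ‖k z‖ₑ = ‖v (z.1 - z.2)‖ₑ * (‖φ z.1‖ₑ * ‖φ z.2‖ₑ)) :
    MemLp k 2 volume ∧ ‖toKer k‖ₑ ≤ 2 * eLpNorm v 2 volume * eLpNorm φ 4 volume ^ 2 := by
  have hb : ∫⁻ z, ‖k z‖ₑ ^ (2 : ℝ)
      ≤ (2 * eLpNorm v 2 volume * eLpNorm φ 4 volume ^ 2) ^ (2 : ℝ) := by
    refine le_trans (le_trans (le_of_eq ?_) (lintegral_interaction_le hv hφ)) ?_
    · refine lintegral_congr fun z => ?_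
      rw [h, ENNReal.mul_rpow_of_nonneg _ _ (by norm_num),
        ENNReal.mul_rpow_of_nonneg _ _ (by norm_num)]
    · rw [lintegral_enorm_four, lintegral_enorm_two]
      exact sq_mul_four _ _
  have hm : MemLp k 2 volume := by
    rw [memLp_two_iff hk]
    exact hb.trans_lt (ENNReal.rpow_lt_top_of_nonneg (by norm_num)
      (ENNReal.mul_lt_top (ENNReal.mul_lt_top (by simp) hv2) (ENNReal.pow_lt_top hφ4)).ne)
  refine ⟨hm, ?_⟩
  rw [← enorm_toLp_sq hm] at hb
  rw [toKer_of_memLp hm]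
  exact (ENNReal.rpow_le_rpow_iff (by norm_num)).1 hb

/-- Cauchy-Schwarz for v against |φ|²: the direct potential is bounded in x by ‖v‖₂‖φ‖₄², hence a
bounded multiplier. -/
theorem enorm_direct_le (hv : Measurable v) (hφ : Measurable φ) (x : E3) :
    ‖((∫ y, v (x - y) * ‖φ y‖ ^ 2 : ℝ) : ℂ)‖ₑ
      ≤ eLpNorm v 2 volume * eLpNorm φ 4 volume ^ 2 := by
  have h1 := Ker.enorm_integral_sq_le (fun y => (v (x - y) : ℂ)) (fun y => ((‖φ y‖ ^ 2 : ℝ) : ℂ))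
    (Complex.measurable_ofReal.comp
      (hv.comp (measurable_const.sub measurable_id))).aestronglyMeasurable
    (Complex.measurable_ofReal.comp (hφ.norm.pow_const 2)).aestronglyMeasurable
  have e1 : ∫⁻ y, ‖(v (x - y) : ℂ)‖ₑ ^ (2 : ℝ) = eLpNorm v 2 volume ^ (2 : ℝ) := by
    rw [← lintegral_enorm_two, ← lintegral_sub_left_eq_self (fun y => ‖v y‖ₑ ^ (2 : ℝ)) x]
    simp only [enorm_eq_nnnorm, Complex.nnnorm_real]
  have e2 : ∫⁻ y, ‖((‖φ y‖ ^ 2 : ℝ) : ℂ)‖ₑ ^ (2 : ℝ) = (eLpNorm φ 4 volume ^ 2) ^ (2 : ℝ) := by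
    have : (eLpNorm φ 4 volume ^ 2) ^ (2 : ℝ) = eLpNorm φ 4 volume ^ (4 : ℝ) := by
      rw [← ENNReal.rpow_natCast, ← ENNReal.rpow_mul]; norm_num
    rw [this, ← lintegral_enorm_four]
    refine lintegral_congr fun y => ?_
    have h2 : ‖((‖φ y‖ ^ 2 : ℝ) : ℂ)‖ₑ = ‖φ y‖ₑ ^ 2 := by
      rw [← enorm_pow, enorm_eq_nnnorm, enorm_eq_nnnorm, Complex.nnnorm_real]
      congr 1
      ext
      simp
    rw [h2, ← ENNReal.rpow_natCast, ← ENNReal.rpow_mul]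
    norm_num
  rw [e1, e2, ← ENNReal.mul_rpow_of_nonneg _ _ (by norm_num),
    ENNReal.rpow_le_rpow_iff (by norm_num)] at h1
  convert h1 using 2
  rw [← integral_complex_ofReal]
  simp

end Coefficients

/-! ### The bounded part of the generator -/

section Generator

/-- Measurable coefficients for which the kernels are defined at every time. -/
structure RegularCoeff (T : ℝ) (v : E3 → ℝ) (φ : ℝ → E3 → ℂ) : Prop where
  meas_v : Measurable v
  even_v : ∀ x, v (-x) = v x
  norm_v : eLpNorm v 2 volume < ∞
  meas_φ : Measurable (Function.uncurry φ)
  norm_φ : ∀ t, eLpNorm (φ t) 4 volume < ∞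
  lintegral_φ : ∫⁻ t, eLpNorm (φ t) 4 volume ^ 2 ∂(timeMeasure T) < ∞

/-- Left multiplication by the kernels of a selfadjoint family, with time-integrable norm. -/
structure Generator (T : ℝ) (L : ℝ → Ker →L[ℂ] Ker) : Prop where
  mul_left : ∀ t a b, L t (kmul a b) = kmul (L t a) b
  self_adj : ∀ t a b, kmul (adj (L t (adj a))) b = kmul a (L t b)
  integrable : ∀ a, MemLp a ∞ (timeMeasure T) → Integrable (fun t => L t (a t)) (timeMeasure T)
  exists_bound : ∃ N, Integrable N (timeMeasure T) ∧ ∀ t, 0 ≤ N t ∧ ∀ a, ‖L t a‖ ≤ N t * ‖a‖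

variable {T : ℝ} {v : E3 → ℝ} {φ : ℝ → E3 → ℂ}

/-- The kernel `v(x-y) φ(t,x) conj φ(t,y)`. -/
def exKer (v : E3 → ℝ) (φ : ℝ → E3 → ℂ) (t : ℝ) : Ker := toKer fun z => exchange v φ t z.1 z.2

/-- `2 ‖v‖₂ ‖φ(t)‖₄²`. -/
def coeffBound (v : E3 → ℝ) (φ : ℝ → E3 → ℂ) (t : ℝ) : ℝ :=
  (2 * eLpNorm v 2 volume * eLpNorm (φ t) 4 volume ^ 2).toReal

theorem MemLp.ae_norm_le {E : Type*} [NormedAddCommGroup E] {a : ℝ → E}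
    (ha : MemLp a ∞ (timeMeasure T)) :
    ∀ᵐ t ∂(timeMeasure T), ‖a t‖ ≤ (eLpNorm a ∞ (timeMeasure T)).toReal := by
  filter_upwards [enorm_ae_le_eLpNormEssSup a (timeMeasure T)] with t ht
  rw [← toReal_enorm]
  exact ENNReal.toReal_mono ha.2.ne (by rwa [eLpNorm_exponent_top])

theorem aestronglyMeasurable_uncurry {G : Ker → ℝ → Ker}
    (hG : StronglyMeasurable (Function.uncurry G)) {a : ℝ → Ker}
    (ha : AEStronglyMeasurable a (timeMeasure T)) :
    AEStronglyMeasurable (fun t => G (a t) t) (timeMeasure T) := by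
  have hm : Measurable fun t => (ha.mk a t, t) :=
    ha.stronglyMeasurable_mk.measurable.prodMk measurable_id
  have h1 : StronglyMeasurable fun t => G (ha.mk a t) t := hG.comp_measurable hm
  refine h1.aestronglyMeasurable.congr ?_
  filter_upwards [ha.ae_eq_mk] with t ht
  rw [← ht]

theorem measurable_eLpNorm_slice (hφ : Measurable (Function.uncurry φ)) :
    Measurable fun t => eLpNorm (φ t) 4 volume := by
  have : ∀ t, eLpNorm (φ t) 4 volume = (∫⁻ x, ‖φ t x‖ₑ ^ (4 : ℝ)) ^ (1 / 4 : ℝ) := fun t => by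
    rw [eLpNorm_eq_lintegral_rpow_enorm_toReal (by norm_num) (by norm_num)]
    norm_num
  simp only [this]
  exact (Measurable.lintegral_prod_right' (f := fun p : ℝ × E3 => ‖φ p.1 p.2‖ₑ ^ (4 : ℝ))
    (hφ.enorm.pow_const _)).pow_const _

namespace RegularCoeff

theorem measurable_slice (H : RegularCoeff T v φ) (t : ℝ) : Measurable (φ t) := H.meas_φ.comp measurable_prodMk_left

theorem measurable_exchange (H : RegularCoeff T v φ) :
    Measurable fun p : ℝ × E3 × E3 => exchange v φ p.1 p.2.1 p.2.2 := by
  have hst : Measurable (star : ℂ → ℂ) := continuous_star.measurable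
  have h1 : Measurable fun p : ℝ × E3 × E3 => φ p.1 p.2.1 :=
    H.meas_φ.comp (measurable_fst.prodMk (measurable_fst.comp measurable_snd))
  have h2 : Measurable fun p : ℝ × E3 × E3 => φ p.1 p.2.2 :=
    H.meas_φ.comp (measurable_fst.prodMk (measurable_snd.comp measurable_snd))
  have h3 : Measurable fun p : ℝ × E3 × E3 => (v (p.2.1 - p.2.2) : ℂ) :=
    Complex.measurable_ofReal.comp (H.meas_v.comp
      ((measurable_fst.comp measurable_snd).sub (measurable_snd.comp measurable_snd)))
  exact (h3.mul h1).mul (hst.comp h2)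

theorem measurable_mKer_fun (H : RegularCoeff T v φ) : Measurable fun p : ℝ × E3 × E3 =>
    -((v (p.2.1 - p.2.2) : ℂ) * star (φ p.1 p.2.1) * star (φ p.1 p.2.2)) := by
  have hst : Measurable (star : ℂ → ℂ) := continuous_star.measurable
  have h1 : Measurable fun p : ℝ × E3 × E3 => φ p.1 p.2.1 :=
    H.meas_φ.comp (measurable_fst.prodMk (measurable_fst.comp measurable_snd))
  have h2 : Measurable fun p : ℝ × E3 × E3 => φ p.1 p.2.2 :=
    H.meas_φ.comp (measurable_fst.prodMk (measurable_snd.comp measurable_snd))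
  have h3 : Measurable fun p : ℝ × E3 × E3 => (v (p.2.1 - p.2.2) : ℂ) :=
    Complex.measurable_ofReal.comp (H.meas_v.comp
      ((measurable_fst.comp measurable_snd).sub (measurable_snd.comp measurable_snd)))
  exact ((h3.mul (hst.comp h1)).mul (hst.comp h2)).neg

theorem bound_lt_top (H : RegularCoeff T v φ) (t : ℝ) : 2 * eLpNorm v 2 volume * eLpNorm (φ t) 4 volume ^ 2 < ∞ :=
  ENNReal.mul_lt_top (ENNReal.mul_lt_top (by simp) H.norm_v) (ENNReal.pow_lt_top (H.norm_φ t))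

theorem norm_le_of_enorm_le (H : RegularCoeff T v φ) {E : Type*} [NormedAddCommGroup E] {t : ℝ} {x : E}
    (h : ‖x‖ₑ ≤ 2 * eLpNorm v 2 volume * eLpNorm (φ t) 4 volume ^ 2) :
    ‖x‖ ≤ coeffBound v φ t := by
  rw [← toReal_enorm]
  exact ENNReal.toReal_mono (H.bound_lt_top t).ne h

theorem memLp_exchange (H : RegularCoeff T v φ) (t : ℝ) : MemLp (fun z : E3 × E3 => exchange v φ t z.1 z.2) 2 volume ∧
    ‖exKer v φ t‖ₑ ≤ 2 * eLpNorm v 2 volume * eLpNorm (φ t) 4 volume ^ 2 := by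
  refine memLp_interaction H.meas_v (H.measurable_slice t) H.norm_v (H.norm_φ t)
    (H.measurable_exchange.comp measurable_prodMk_left).aestronglyMeasurable fun z => ?_
  rw [exchange, enorm_mul, enorm_mul, mul_assoc]
  simp [enorm_eq_nnnorm]

theorem memLp_mKer (H : RegularCoeff T v φ) (t : ℝ) : MemLp (fun z : E3 × E3 =>
      -((v (z.1 - z.2) : ℂ) * star (φ t z.1) * star (φ t z.2))) 2 volume ∧
    ‖mKer v φ t‖ₑ ≤ 2 * eLpNorm v 2 volume * eLpNorm (φ t) 4 volume ^ 2 := by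
  refine memLp_interaction H.meas_v (H.measurable_slice t) H.norm_v (H.norm_φ t)
    (H.measurable_mKer_fun.comp measurable_prodMk_left).aestronglyMeasurable fun z => ?_
  rw [enorm_neg, enorm_mul, enorm_mul, mul_assoc]
  simp [enorm_eq_nnnorm]

theorem exKer_coe (H : RegularCoeff T v φ) (t : ℝ) : exKer v φ t =ᵐ[volume] fun z => exchange v φ t z.1 z.2 :=
  toKer_coe (H.memLp_exchange t).1

theorem star_exchange (H : RegularCoeff T v φ) (t : ℝ) (x y : E3) : star (exchange v φ t x y) = exchange v φ t y x := by
  have : v (y - x) = v (x - y) := by rw [← H.even_v, neg_sub]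
  simp only [exchange, star_mul', star_star, this]
  rw [show star (v (x - y) : ℂ) = v (x - y) from Complex.conj_ofReal _]
  ring

theorem star_direct (_H : RegularCoeff T v φ) (t : ℝ) (x : E3) : star (direct v φ t x) = direct v φ t x :=
  Complex.conj_ofReal _

theorem adj_exKer (H : RegularCoeff T v φ) (t : ℝ) : adj (exKer v φ t) = exKer v φ t := by
  refine Lp.ext ?_
  filter_upwards [adj_coe (exKer v φ t), H.exKer_coe t, ae_swap (H.exKer_coe t)] with z h1 h2 h3
  rw [h1, h2, h3, H.star_exchange, Prod.fst_swap, Prod.snd_swap]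

theorem tr_mKer (H : RegularCoeff T v φ) (t : ℝ) : tr (mKer v φ t) = mKer v φ t := by
  have h := toKer_coe (H.memLp_mKer t).1
  rw [← mKer] at h
  refine Lp.ext ?_
  filter_upwards [tr_coe (mKer v φ t), h, ae_swap h] with z h1 h2 h3
  have : v (z.2 - z.1) = v (z.1 - z.2) := by rw [← H.even_v, neg_sub]
  rw [h1, h2, h3, Prod.fst_swap, Prod.snd_swap, this]
  ring

theorem integrable_coeffBound (H : RegularCoeff T v φ) : Integrable (coeffBound v φ) (timeMeasure T) := by
  refine integrable_toReal_of_lintegral_ne_top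
    (((measurable_eLpNorm_slice H.meas_φ).pow_const 2).const_mul _).aemeasurable ?_
  rw [lintegral_const_mul _ ((measurable_eLpNorm_slice H.meas_φ).pow_const 2)]
  exact (ENNReal.mul_lt_top (ENNReal.mul_lt_top (by simp) H.norm_v) H.lintegral_φ).ne

theorem integrable_mKer (H : RegularCoeff T v φ) : Integrable (mKer v φ) (timeMeasure T) := by
  refine Integrable.mono' H.integrable_coeffBound ?_
    (Eventually.of_forall fun t => H.norm_le_of_enorm_le (H.memLp_mKer t).2)
  have : Measurable (mKer v φ) := measurable_toKer H.measurable_mKer_fun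
  exact this.aestronglyMeasurable

theorem measurable_direct (H : RegularCoeff T v φ) : Measurable fun p : ℝ × E3 => direct v φ p.1 p.2 := by
  have hm : Measurable fun q : (ℝ × E3) × E3 => v (q.1.2 - q.2) * ‖φ q.1.1 q.2‖ ^ 2 := by
    refine (H.meas_v.comp ((measurable_snd.comp measurable_fst).sub measurable_snd)).mul ?_
    exact (H.meas_φ.comp ((measurable_fst.comp measurable_fst).prodMk
      measurable_snd)).norm.pow_const 2
  exact Complex.measurable_ofReal.comp
    (hm.stronglyMeasurable.integral_prod_right' (ν := volume)).measurable

theorem aesm_direct (H : RegularCoeff T v φ) (t : ℝ) : AEStronglyMeasurable (direct v φ t) volume :=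
  (H.measurable_direct.comp measurable_prodMk_left).aestronglyMeasurable

theorem norm_direct_le (H : RegularCoeff T v φ) (t : ℝ) (x : E3) : ‖direct v φ t x‖ ≤ coeffBound v φ t := by
  refine H.norm_le_of_enorm_le ((enorm_direct_le H.meas_v (H.measurable_slice t) x).trans ?_)
  rw [mul_assoc, two_mul]
  exact le_self_add

/-- `a ↦ (g + Δ) a`. -/
def gen (H : RegularCoeff T v φ) (t : ℝ) : Ker →L[ℂ] Ker :=
  kmulL (exKer v φ t)
    + mulFst (direct v φ t) (H.aesm_direct t) (coeffBound v φ t) (H.norm_direct_le t)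

theorem gen_apply (H : RegularCoeff T v φ) (t : ℝ) (a : Ker) : H.gen t a = kmul (exKer v φ t) a
    + mulFst (direct v φ t) (H.aesm_direct t) (coeffBound v φ t) (H.norm_direct_le t) a := rfl

theorem gen_coe (H : RegularCoeff T v φ) (t : ℝ) (a : Ker) :
    H.gen t a =ᵐ[volume] fun z => gLeft v φ t a z.1 z.2 := by
  rw [H.gen_apply]
  filter_upwards [Lp.coeFn_add (kmul (exKer v φ t) a)
      (mulFst (direct v φ t) (H.aesm_direct t) (coeffBound v φ t) (H.norm_direct_le t) a),
    kmul_coe (exKer v φ t) a, mulFst_coe (hd := H.aesm_direct t) (hC := H.norm_direct_le t) a,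
    quasi_fst.ae (Ker.ae_ae (H.exKer_coe t))] with z h1 h2 h3 h4
  rw [h1, Pi.add_apply, h2, h3, gLeft, compFun]
  congr 1
  refine integral_congr_ae ?_
  filter_upwards [h4] with w hw
  rw [hw]

theorem tr_gen_tr_coe (H : RegularCoeff T v φ) (t : ℝ) (a : Ker) :
    tr (H.gen t (tr a)) =ᵐ[volume] fun z => gTransposeRight v φ t a z.1 z.2 := by
  filter_upwards [tr_coe (H.gen t (tr a)), ae_swap (H.gen_coe t (tr a)),
    quasi_fst.ae (Ker.ae_ae (ae_swap (tr_coe a))), ae_swap (tr_coe a)] with z h1 h2 h3 h4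
  rw [h1, h2, gLeft, gTransposeRight, Prod.fst_swap, Prod.snd_swap]
  have h4' : tr a (z.2, z.1) = a (z.1, z.2) := h4
  rw [h4', mul_comm (direct v φ t z.2)]
  congr 1
  refine integral_congr_ae ?_
  filter_upwards [h3] with w hw
  have hw' : tr a (w, z.1) = a (z.1, w) := hw
  rw [hw', mul_comm]

theorem adj_gen_adj_coe (H : RegularCoeff T v φ) (t : ℝ) (a : Ker) :
    adj (H.gen t (adj a)) =ᵐ[volume] fun z => gRight v φ t a z.1 z.2 := by
  filter_upwards [adj_coe (H.gen t (adj a)), ae_swap (H.gen_coe t (adj a)),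
    quasi_fst.ae (Ker.ae_ae (ae_swap (adj_coe a))), ae_swap (adj_coe a)] with z h1 h2 h3 h4
  rw [h1, h2, gLeft, gRight, Prod.fst_swap, Prod.snd_swap]
  have h4' : adj a (z.2, z.1) = star (a (z.1, z.2)) := h4
  rw [h4', star_add, star_mul, star_star, H.star_direct]
  congr 1
  change starRingEnd ℂ _ = _
  rw [← integral_conj]
  refine integral_congr_ae ?_
  filter_upwards [h3] with w hw
  have hw' : adj a (w, z.1) = star (a (z.1, w)) := hw
  rw [hw', ← H.star_exchange t z.2 w, map_mul]
  simp [mul_comm]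

theorem norm_gen_apply_le (H : RegularCoeff T v φ) (t : ℝ) (a : Ker) : ‖H.gen t a‖ ≤ (2 * coeffBound v φ t) * ‖a‖ := by
  rw [H.gen_apply, two_mul, add_mul]
  refine (norm_add_le _ _).trans (add_le_add ((norm_kmul_le _ _).trans ?_) (norm_mulFst_apply_le a))
  exact mul_le_mul_of_nonneg_right (H.norm_le_of_enorm_le (H.memLp_exchange t).2) (norm_nonneg _)

theorem stronglyMeasurable_gen (H : RegularCoeff T v φ) :
    StronglyMeasurable (Function.uncurry fun (a : Ker) (t : ℝ) => H.gen t a) := by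
  refine stronglyMeasurable_uncurry_of_continuous_of_stronglyMeasurable
    (fun t => (H.gen t).continuous) fun a => ?_
  simp only [H.gen_apply]
  have h1 : Measurable (exKer v φ) := measurable_toKer H.measurable_exchange
  refine StronglyMeasurable.add ?_ ?_
  · exact (kmulL.flip a).continuous.comp_stronglyMeasurable h1.stronglyMeasurable
  · simp only [mulFst_eq_toKer]
    refine (measurable_toKer (F := fun t (z : E3 × E3) => direct v φ t z.1 * a z)
      ?_).stronglyMeasurable
    exact (H.measurable_direct.comp (measurable_fst.prodMk (measurable_fst.comp
      measurable_snd))).mul ((Lp.stronglyMeasurable a).measurable.comp measurable_snd)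

theorem generator (H : RegularCoeff T v φ) : Generator T H.gen where
  mul_left t a b := by
    rw [H.gen_apply, H.gen_apply, add_kmul, kmul_assoc, mulFst_kmul]
  self_adj t a b := by
    rw [H.gen_apply, H.gen_apply, kmul_add, ← kmul_adj_mulFst (H.star_direct t), ← kmul_assoc,
      ← add_kmul]
    congr 1
    rw [adj, map_add, star_add_Lp]
    congr 1
    change adj _ = _
    rw [adj_kmul, adj_adj, H.adj_exKer]
  integrable a ha := by
    refine Integrable.mono' ((H.integrable_coeffBound.const_mul 2).mul_const
      (eLpNorm a ∞ (timeMeasure T)).toReal) (aestronglyMeasurable_uncurry H.stronglyMeasurable_gen ha.1) ?_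
    filter_upwards [MemLp.ae_norm_le ha] with t ht
    refine (H.norm_gen_apply_le t (a t)).trans (mul_le_mul_of_nonneg_left ht ?_)
    exact mul_nonneg zero_le_two ENNReal.toReal_nonneg
  exists_bound := ⟨_, H.integrable_coeffBound.const_mul 2, fun t =>
    ⟨mul_nonneg zero_le_two ENNReal.toReal_nonneg, H.norm_gen_apply_le t⟩⟩

end RegularCoeff

end Generator

/-! ### The distributional equations in terms of the generator -/

section Distributional

variable {T : ℝ} {v v' : E3 → ℝ} {φ φ' : ℝ → E3 → ℂ} {a f h : ℝ → Ker} {σ τ : ℂ}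

theorem tensEq_iff (hT : 0 < T) (ha : MemLp a ∞ (timeMeasure T))
    (hh : Integrable h (timeMeasure T)) :
    TensEq T σ τ a h ↔ ∀ ψ, IsTest T ψ →
      ∫ t, bpair (a t) (curve (freeOp σ τ ψ) t) ∂(timeMeasure T)
        = ∫ t, bpair (h t) (curve ψ t) ∂(timeMeasure T) :=
  ⟨fun H _ hψ => H.integral_test hT ha hh hψ,
    fun H => tensEq_of_integral_test H (MemLp.integrable_time ha) hh⟩

theorem tensEq_sub_iff (hT : 0 < T) (ha : MemLp a ∞ (timeMeasure T))
    (hf : Integrable f (timeMeasure T)) (hh : Integrable h (timeMeasure T)) :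
    TensEq T σ τ a (fun t => f t - h t) ↔ ∀ ψ, IsTest T ψ →
      ∫ t, (bpair (a t) (curve (freeOp σ τ ψ) t) + bpair (h t) (curve ψ t)) ∂(timeMeasure T)
        = ∫ t, bpair (f t) (curve ψ t) ∂(timeMeasure T) := by
  rw [tensEq_iff hT ha (show Integrable (fun t => f t - h t) _ from hf.sub hh)]
  refine forall₂_congr fun ψ hψ => ?_
  have i1 := integrable_bpair (MemLp.integrable_time ha)
    ((hψ.isSCC.freeOp σ τ).memLp_curve T)
  have i2 := integrable_bpair hh (hψ.isSCC.isCC.memLp_curve T)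
  have i3 := integrable_bpair hf (hψ.isSCC.isCC.memLp_curve T)
  simp only [map_sub, sub_apply]
  rw [integral_add i1 i2, integral_sub i3 i2, eq_sub_iff_add_eq]

theorem integrable_mul_curve {F : ℝ × E3 × E3 → ℂ} (hF : IsCC F) (k : Ker) (t : ℝ) :
    Integrable (fun z => k z * F (t, z)) volume :=
  (Lp.memLp k).integrable_mul (hF.memLp t)

theorem integral_test_eq {ψ : ℝ × E3 × E3 → ℂ} (hψ : IsTest T ψ) {D : ℝ → E3 → E3 → ℂ}
    (hD : ∀ t x y, D t x y = freeOp σ τ ψ (t, x, y)) {G : E3 → E3 → ℂ} {k l : Ker}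
    (hl : l =ᵐ[volume] fun z => G z.1 z.2) (t : ℝ) :
    ∫ z : E3 × E3, (k z * D t z.1 z.2 + G z.1 z.2 * ψ (t, z.1, z.2))
      = bpair k (curve (freeOp σ τ ψ) t) + bpair l (curve ψ t) := by
  rw [(hψ.isSCC.freeOp σ τ).bpair_curve, hψ.isSCC.isCC.bpair_curve,
    ← integral_add (integrable_mul_curve (hψ.isSCC.freeOp σ τ) k t)
      (integrable_mul_curve hψ.isSCC.isCC l t)]
  refine integral_congr_ae ?_
  filter_upwards [hl] with z hz
  rw [hz, hD]

/-- `[g + Δ, a]`. -/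
def brW (L : ℝ → Ker →L[ℂ] Ker) (t : ℝ) (a : Ker) : Ker := L t a - adj (L t (adj a))

/-- `(g + Δ) a + a (g + Δ)ᵀ`. -/
def brS (L : ℝ → Ker →L[ℂ] Ker) (t : ℝ) (a : Ker) : Ker := L t a + tr (L t (tr a))

theorem memLp_adj {e : ℝ≥0∞} (ha : MemLp a e (timeMeasure T)) :
    MemLp (fun t => adj (a t)) e (timeMeasure T) := by
  have h := memLp_tr ha
  refine MemLp.of_le h (conjL.continuous.comp_aestronglyMeasurable h.1)
    (Eventually.of_forall fun t => le_of_eq ?_)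
  rw [adj, norm_star_Lp]

theorem Generator.integrable_brW {L : ℝ → Ker →L[ℂ] Ker} (hL : Generator T L)
    (ha : MemLp a ∞ (timeMeasure T)) : Integrable (fun t => brW L t (a t)) (timeMeasure T) := by
  refine (hL.integrable a ha).sub ?_
  exact memLp_one_iff_integrable.1 (memLp_adj (memLp_one_iff_integrable.2
    (hL.integrable _ (memLp_adj ha))))

theorem Generator.integrable_brS {L : ℝ → Ker →L[ℂ] Ker} (hL : Generator T L)
    (ha : MemLp a ∞ (timeMeasure T)) : Integrable (fun t => brS L t (a t)) (timeMeasure T) := by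
  refine (hL.integrable a ha).add ?_
  exact memLp_one_iff_integrable.1 (memLp_tr (memLp_one_iff_integrable.2
    (hL.integrable _ (memLp_tr ha))))

/-- The bounded part of g moves to the right-hand side, leaving the free equation. As g is
self-adjoint, right multiplication by g + Δ is the adjoint-conjugate of left multiplication. -/
theorem RegularCoeff.distribW_iff (H : RegularCoeff T v φ) (hT : 0 < T)
    (ha : MemLp a ∞ (timeMeasure T)) (hf : Integrable f (timeMeasure T)) :
    DistribW T v φ a f ↔ TensEq T 1 (-1) a (fun t => f t - brW H.gen t (a t)) := by
  rw [tensEq_sub_iff hT ha hf (H.generator.integrable_brW ha)]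
  refine forall₂_congr fun ψ hψ => ?_
  have e : ∀ t, brW H.gen t (a t) =ᵐ[volume] fun z =>
      gLeft v φ t (a t) z.1 z.2 - gRight v φ t (a t) z.1 z.2 := fun t => by
    filter_upwards [Lp.coeFn_sub (H.gen t (a t)) (adj (H.gen t (adj (a t)))),
      H.gen_coe t (a t), H.adj_gen_adj_coe t (a t)] with z h1 h2 h3
    rw [brW, h1, Pi.sub_apply, h2, h3]
  have e1 := fun t => integral_test_eq (σ := 1) (τ := -1) hψ
    (D := fun t x y => -Complex.I * dt ψ t x y - lapX ψ t x y + lapY ψ t x y)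
    (fun t x y => by simp only [freeOp]; ring)
    (G := fun x y => gLeft v φ t (a t) x y - gRight v φ t (a t) x y) (k := a t) (e t) t
  simp only [e1]
  have e2 := fun t => hψ.isSCC.isCC.bpair_curve (f t) t
  simp only [e2, Prod.mk.eta]

theorem RegularCoeff.distribS_iff (H : RegularCoeff T v φ) (hT : 0 < T)
    (ha : MemLp a ∞ (timeMeasure T)) (hf : Integrable f (timeMeasure T)) :
    DistribS T v φ a f ↔ TensEq T 1 1 a (fun t => f t - brS H.gen t (a t)) := by
  rw [tensEq_sub_iff hT ha hf (H.generator.integrable_brS ha)]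
  refine forall₂_congr fun ψ hψ => ?_
  have e : ∀ t, brS H.gen t (a t) =ᵐ[volume] fun z =>
      gLeft v φ t (a t) z.1 z.2 + gTransposeRight v φ t (a t) z.1 z.2 := fun t => by
    filter_upwards [Lp.coeFn_add (H.gen t (a t)) (tr (H.gen t (tr (a t)))),
      H.gen_coe t (a t), H.tr_gen_tr_coe t (a t)] with z h1 h2 h3
    rw [brS, h1, Pi.add_apply, h2, h3]
  have e1 := fun t => integral_test_eq (σ := 1) (τ := 1) hψ
    (D := fun t x y => -Complex.I * dt ψ t x y - lapX ψ t x y - lapY ψ t x y)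
    (fun t x y => by simp only [freeOp]; ring)
    (G := fun x y => gLeft v φ t (a t) x y + gTransposeRight v φ t (a t) x y) (k := a t) (e t) t
  simp only [e1]
  have e2 := fun t => hψ.isSCC.isCC.bpair_curve (f t) t
  simp only [e2, Prod.mk.eta]

/-! ### Reduction to regular coefficients -/

theorem ae_sub_left (h : v =ᵐ[volume] v') (x : E3) : ∀ᵐ y : E3, v (x - y) = v' (x - y) :=
  (Measure.measurePreserving_sub_left volume x).quasiMeasurePreserving.ae h

theorem ae_sub_right (h : v =ᵐ[volume] v') (y : E3) : ∀ᵐ x : E3, v (x - y) = v' (x - y) :=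
  (measurePreserving_sub_right volume y).quasiMeasurePreserving.ae h

theorem direct_congr (h : v =ᵐ[volume] v') : direct v φ = direct v' φ := by
  funext t x
  rw [direct, direct]
  congr 1
  refine integral_congr_ae ?_
  filter_upwards [ae_sub_left h x] with y hy
  rw [hy]

theorem gLeft_congr (h : v =ᵐ[volume] v') : gLeft v φ = gLeft v' φ := by
  funext t k x y
  rw [gLeft, gLeft, direct_congr h]
  congr 1
  refine integral_congr_ae ?_
  filter_upwards [ae_sub_left h x] with w hw
  rw [exchange, exchange, hw]

theorem gTransposeRight_congr (h : v =ᵐ[volume] v') :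
    gTransposeRight v φ = gTransposeRight v' φ := by
  funext t k x y
  rw [gTransposeRight, gTransposeRight, direct_congr h]
  congr 1
  refine integral_congr_ae ?_
  filter_upwards [ae_sub_left h y] with w hw
  rw [exchange, exchange, hw]

theorem gRight_congr (h : v =ᵐ[volume] v') : gRight v φ = gRight v' φ := by
  funext t k x y
  rw [gRight, gRight, direct_congr h]
  congr 1
  refine integral_congr_ae ?_
  filter_upwards [ae_sub_right h y] with w hw
  rw [exchange, exchange, hw]

theorem mKer_congr (h : v =ᵐ[volume] v') : mKer v φ = mKer v' φ := by
  funext t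
  refine toKer_congr ?_
  have : ∀ᵐ z : E3 × E3, v (z.1 - z.2) = v' (z.1 - z.2) :=
    (quasiMeasurePreserving_sub volume volume).ae h
  filter_upwards [this] with z hz
  rw [hz]

theorem distribW_congr_time (h : ∀ᵐ t ∂(timeMeasure T), φ t = φ' t) :
    DistribW T v φ a f ↔ DistribW T v φ' a f := by
  refine forall₂_congr fun ψ _ => Eq.congr_left (integral_congr_ae ?_)
  filter_upwards [h] with t ht
  simp only [gLeft, gRight, exchange, direct, ht]

theorem distribS_congr_time (h : ∀ᵐ t ∂(timeMeasure T), φ t = φ' t) :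
    DistribS T v φ a f ↔ DistribS T v φ' a f := by
  refine forall₂_congr fun ψ _ => Eq.congr_left (integral_congr_ae ?_)
  filter_upwards [h] with t ht
  simp only [gLeft, gTransposeRight, exchange, direct, ht]

/-- The hypotheses give v measurable only up to a null set and φ(t) in L⁴ only for almost every t. A
measurable representative of v is symmetrized to stay even, and φ is set to 0 at bad times, so that
the generator is a bounded operator at every t. -/
theorem exists_regularCoeff (hv : MemLp v 2 volume) (hv_even : ∀ x, v (-x) = v x)
    (hφ : Measurable (Function.uncurry φ))
    (hφ4 : ∫⁻ t, eLpNorm (φ t) 4 volume ^ 2 ∂(timeMeasure T) < ∞) :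
    ∃ v' φ', RegularCoeff T v' φ' ∧ v =ᵐ[volume] v' ∧ ∀ᵐ t ∂(timeMeasure T), φ t = φ' t := by
  classical
  let w := hv.1.mk v
  have hw : Measurable w := hv.1.stronglyMeasurable_mk.measurable
  have hvw : v =ᵐ[volume] w := hv.1.ae_eq_mk
  let v' : E3 → ℝ := fun x => (w x + w (-x)) / 2
  have hvv' : v =ᵐ[volume] v' := by
    have h2 : ∀ᵐ x : E3, v (-x) = w (-x) :=
      (Measure.measurePreserving_neg volume).quasiMeasurePreserving.ae hvw
    filter_upwards [hvw, h2] with x h1 h2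
    simp only [v', ← h1, ← h2, hv_even]
    ring
  have hs : MeasurableSet {t | eLpNorm (φ t) 4 volume < ∞} :=
    measurableSet_lt (measurable_eLpNorm_slice hφ) measurable_const
  let φ' : ℝ → E3 → ℂ := fun t x => if t ∈ {t | eLpNorm (φ t) 4 volume < ∞} then φ t x else 0
  have hφφ' : ∀ᵐ t ∂(timeMeasure T), φ t = φ' t := by
    filter_upwards [ae_lt_top ((measurable_eLpNorm_slice hφ).pow_const 2) hφ4.ne] with t ht
    have : t ∈ {t | eLpNorm (φ t) 4 volume < ∞} := by
      by_contra hc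
      have : eLpNorm (φ t) 4 volume = ∞ := not_lt_top_iff.1 hc
      simp [this] at ht
    funext x
    simp only [φ', if_pos this]
  refine ⟨v', φ', ⟨?_, fun x => ?_, ?_, ?_, fun t => ?_, ?_⟩, hvv', hφφ'⟩
  · exact (hw.add (hw.comp measurable_neg)).div_const 2
  · simp only [v', neg_neg, add_comm]
  · rw [← eLpNorm_congr_ae hvv']
    exact hv.2
  · exact Measurable.ite (hs.preimage measurable_fst) hφ measurable_const
  · by_cases ht : t ∈ {t | eLpNorm (φ t) 4 volume < ∞}
    · have : φ' t = φ t := by funext x; simp only [φ', if_pos ht]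
      rw [this]
      exact ht
    · have : φ' t = fun _ => 0 := by funext x; simp only [φ', if_neg ht]
      rw [this]
      simp
  · refine lt_of_eq_of_lt (lintegral_congr_ae ?_) hφ4
    filter_upwards [hφφ'] with t ht
    rw [ht]

/-- From here on only these properties of v and φ are used: a symmetric m and a family L that is
left multiplication by a self-adjoint operator with time-integrable norm. -/
theorem exists_generator (hT : 0 < T) (hv : MemLp v 2 volume) (hv_even : ∀ x, v (-x) = v x)
    (hφ : Measurable (Function.uncurry φ))
    (hφ4 : ∫⁻ t, eLpNorm (φ t) 4 volume ^ 2 ∂(timeMeasure T) < ∞) :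
    Integrable (mKer v φ) (timeMeasure T) ∧
    (∀ᵐ t ∂(timeMeasure T), tr (mKer v φ t) = mKer v φ t) ∧
    ∃ L, Generator T L ∧
      (∀ a f, MemLp a ∞ (timeMeasure T) → Integrable f (timeMeasure T) →
        (DistribW T v φ a f ↔ TensEq T 1 (-1) a (fun t => f t - brW L t (a t)))) ∧
      (∀ a f, MemLp a ∞ (timeMeasure T) → Integrable f (timeMeasure T) →
        (DistribS T v φ a f ↔ TensEq T 1 1 a (fun t => f t - brS L t (a t)))) := by
  obtain ⟨v', φ', H, hv', hφ'⟩ := exists_regularCoeff hv hv_even hφ hφ4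
  have hm : mKer v φ =ᵐ[timeMeasure T] mKer v' φ' := by
    rw [mKer_congr hv']
    filter_upwards [hφ'] with t ht
    simp only [mKer, ht]
  refine ⟨H.integrable_mKer.congr hm.symm, ?_, H.gen, H.generator, fun a f ha hf => ?_,
    fun a f ha hf => ?_⟩
  · filter_upwards [hm] with t ht
    rw [ht, H.tr_mKer]
  · rw [← H.distribW_iff hT ha hf, ← distribW_congr_time hφ']
    simp only [DistribW, gLeft_congr hv', gRight_congr hv']
  · rw [← H.distribS_iff hT ha hf, ← distribS_congr_time hφ']
    simp only [DistribS, gLeft_congr hv', gTransposeRight_congr hv']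

end Distributional

/-! ### Calculus for the equations `W(a) = h` and `S(u) = f` -/

section Calculus

variable {T : ℝ} {L : ℝ → Ker →L[ℂ] Ker} {a b h k u f : ℝ → Ker}

theorem memLp_kmul {e : ℝ≥0∞} (ha : MemLp a e (timeMeasure T)) (hb : MemLp b ∞ (timeMeasure T)) :
    MemLp (fun t => kmul (a t) (b t)) e (timeMeasure T) := by
  refine MemLp.of_le_mul (c := (eLpNorm b ∞ (timeMeasure T)).toReal) ha
    (kmulL.aestronglyMeasurable_comp₂ ha.1 hb.1) ?_
  filter_upwards [MemLp.ae_norm_le hb] with t ht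
  refine (norm_kmul_le _ _).trans ?_
  rw [mul_comm]
  exact mul_le_mul_of_nonneg_right ht (norm_nonneg _)

theorem memLp_kmul' {e : ℝ≥0∞} (ha : MemLp a ∞ (timeMeasure T)) (hb : MemLp b e (timeMeasure T)) :
    MemLp (fun t => kmul (a t) (b t)) e (timeMeasure T) := by
  refine MemLp.of_le_mul (c := (eLpNorm a ∞ (timeMeasure T)).toReal) hb
    (kmulL.aestronglyMeasurable_comp₂ ha.1 hb.1) ?_
  filter_upwards [MemLp.ae_norm_le ha] with t ht
  exact (norm_kmul_le _ _).trans (mul_le_mul_of_nonneg_right ht (norm_nonneg _))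

theorem memLp_star {e : ℝ≥0∞} (ha : MemLp a e (timeMeasure T)) :
    MemLp (fun t => star (a t)) e (timeMeasure T) :=
  MemLp.of_le ha (conjL.continuous.comp_aestronglyMeasurable ha.1)
    (Eventually.of_forall fun _ => (norm_star_Lp _).le)

theorem integrable_kmul (ha : Integrable a (timeMeasure T)) (hb : MemLp b ∞ (timeMeasure T)) :
    Integrable (fun t => kmul (a t) (b t)) (timeMeasure T) :=
  memLp_one_iff_integrable.1 (memLp_kmul (memLp_one_iff_integrable.2 ha) hb)

theorem integrable_kmul' (ha : MemLp a ∞ (timeMeasure T)) (hb : Integrable b (timeMeasure T)) :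
    Integrable (fun t => kmul (a t) (b t)) (timeMeasure T) :=
  memLp_one_iff_integrable.1 (memLp_kmul' ha (memLp_one_iff_integrable.2 hb))

theorem integrable_star (ha : Integrable a (timeMeasure T)) :
    Integrable (fun t => star (a t)) (timeMeasure T) :=
  memLp_one_iff_integrable.1 (memLp_star (memLp_one_iff_integrable.2 ha))

theorem star_sub_Lp (k l : Ker) : star (k - l) = star k - star l := map_sub conjL k l

theorem adj_smul (c : ℂ) (k : Ker) : adj (c • k) = star c • adj k := by
  rw [adj, map_smul, star_smul_Lp, adj]

theorem adj_add (k l : Ker) : adj (k + l) = adj k + adj l := by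
  rw [adj, map_add, star_add_Lp, adj, adj]

theorem brW_add (t : ℝ) (k l : Ker) : brW L t (k + l) = brW L t k + brW L t l := by
  simp only [brW, adj_add, map_add]
  abel

theorem brW_smul (t : ℝ) (c : ℂ) (k : Ker) : brW L t (c • k) = c • brW L t k := by
  simp only [brW, adj_smul, map_smul, star_star, smul_sub]

/-- The terms (k g) l and k (g l) cancel by self-adjointness of the generator, so the bracket is a
derivation. -/
theorem Generator.brW_kmul (hL : Generator T L) (t : ℝ) (k l : Ker) :
    brW L t (kmul k l) = kmul (brW L t k) l + kmul k (brW L t l) := by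
  simp only [brW, sub_kmul, kmul_sub, hL.mul_left, adj_kmul, adj_adj, hL.self_adj]
  abel

/-- `i ∂ₜ a + [g, a] = h`. -/
def WEq (T : ℝ) (L : ℝ → Ker →L[ℂ] Ker) (a h : ℝ → Ker) : Prop :=
  TensEq T 1 (-1) a fun t => h t - brW L t (a t)

/-- `i ∂ₜ u + g u + u gᵀ = f`. -/
def SEq (T : ℝ) (L : ℝ → Ker →L[ℂ] Ker) (u f : ℝ → Ker) : Prop :=
  TensEq T 1 1 u fun t => f t - brS L t (u t)

theorem WEq.congr {a' h' : ℝ → Ker} (H : WEq T L a h) (ha : a =ᵐ[timeMeasure T] a')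
    (hh : h =ᵐ[timeMeasure T] h') : WEq T L a' h' := by
  refine TensEq.congr H ha ?_
  filter_upwards [ha, hh] with t h1 h2
  rw [h1, h2]

theorem WEq.zero : WEq T L (fun _ => 0) (fun _ => 0) := by
  intro e e' g g' he hg χ hχ
  have h0 : adj (0 : Ker) = 0 := by
    have := adj_smul 0 (0 : Ker)
    simpa using this
  simp [brW, h0]

theorem WEq.add (hL : Generator T L) {a' h' : ℝ → Ker} (H : WEq T L a h) (H' : WEq T L a' h')
    (ha : MemLp a ∞ (timeMeasure T)) (hh : Integrable h (timeMeasure T))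
    (ha' : MemLp a' ∞ (timeMeasure T)) (hh' : Integrable h' (timeMeasure T)) :
    WEq T L (fun t => a t + a' t) (fun t => h t + h' t) := by
  refine (TensEq.add H H' (MemLp.integrable_time ha) (hh.sub (hL.integrable_brW ha))
    (MemLp.integrable_time ha') (hh'.sub (hL.integrable_brW ha'))).congr (ae_eq_refl _)
    (Eventually.of_forall fun t => ?_)
  simp only [brW_add]
  abel

theorem WEq.smul (H : WEq T L a h) (c : ℂ) :
    WEq T L (fun t => c • a t) (fun t => c • h t) := by
  refine (TensEq.smul H c).congr (ae_eq_refl _) (Eventually.of_forall fun t => ?_)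
  simp only [brW_smul, smul_sub]

theorem WEq.mul (hT : 0 < T) (hL : Generator T L) (H : WEq T L a h) (H' : WEq T L b k)
    (ha : MemLp a ∞ (timeMeasure T)) (hh : Integrable h (timeMeasure T))
    (hb : MemLp b ∞ (timeMeasure T)) (hk : Integrable k (timeMeasure T)) :
    WEq T L (fun t => kmul (a t) (b t)) (fun t => kmul (h t) (b t) + kmul (a t) (k t)) := by
  have H'' : TensEq T (-(-1)) (-1) b fun t => k t - brW L t (b t) := by
    rw [neg_neg]; exact H'
  refine (TensEq.mul hT H H'' ha (hh.sub (hL.integrable_brW ha)) hb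
    (hk.sub (hL.integrable_brW hb))).congr (ae_eq_refl _) (Eventually.of_forall fun t => ?_)
  simp only [hL.brW_kmul, sub_kmul, kmul_sub]
  abel

theorem WEq.unique (hL : Generator T L) {h' : ℝ → Ker} (H : WEq T L a h) (H' : WEq T L a h')
    (ha : MemLp a ∞ (timeMeasure T)) (hh : Integrable h (timeMeasure T))
    (hh' : Integrable h' (timeMeasure T)) : h =ᵐ[timeMeasure T] h' := by
  filter_upwards [TensEq.unique H H' (MemLp.integrable_time ha) (hh.sub (hL.integrable_brW ha))
    (hh'.sub (hL.integrable_brW ha))] with t ht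
  exact sub_left_injective ht

/-- If `u` is symmetric, so is `S(u)`. -/
theorem SEq.symm (hL : Generator T L) (H : SEq T L u f) (hu : MemLp u ∞ (timeMeasure T))
    (hf : Integrable f (timeMeasure T)) (hs : ∀ᵐ t ∂(timeMeasure T), tr (u t) = u t) :
    ∀ᵐ t ∂(timeMeasure T), tr (f t) = f t := by
  have hft : Integrable (fun t => tr (f t)) (timeMeasure T) :=
    memLp_one_iff_integrable.1 (memLp_tr (memLp_one_iff_integrable.2 hf))
  have H' : TensEq T 1 1 u fun t => tr (f t) - brS L t (u t) := by
    refine (TensEq.transpose H).congr hs ?_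
    filter_upwards [hs] with t ht
    simp only [brS, map_sub, map_add, tr_tr, ht, add_comm]
  filter_upwards [TensEq.unique H' H (MemLp.integrable_time hu)
    (hft.sub (hL.integrable_brS hu)) (hf.sub (hL.integrable_brS hu))] with t ht
  exact sub_left_injective ht

/-- `W(u ū) = S(u) ū - u conj S(u)`. -/
theorem SEq.wEq_mul_star (hT : 0 < T) (hL : Generator T L) (H : SEq T L u f)
    (hu : MemLp u ∞ (timeMeasure T)) (hf : Integrable f (timeMeasure T)) :
    WEq T L (fun t => kmul (u t) (star (u t)))
      (fun t => kmul (f t) (star (u t)) - kmul (u t) (star (f t))) := by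
  have hF : Integrable (fun t => f t - brS L t (u t)) (timeMeasure T) :=
    hf.sub (hL.integrable_brS hu)
  have H' : TensEq T (-1) (-1) (fun t => star (u t)) fun t => -star (f t - brS L t (u t)) := by
    have := TensEq.conj H
    rwa [star_one] at this
  refine (TensEq.mul hT H H' hu hF (memLp_star hu) (integrable_star hF).neg).congr (ae_eq_refl _)
    (Eventually.of_forall fun t => ?_)
  -- The term u gᵀ ū of S(u)ū equals the term u conj(gu) of u conj(S(u)), since gᵀ = ḡ. Their
  -- cancellation turns the two S brackets into one W bracket.
  have e1 : kmul (tr (L t (tr (u t)))) (star (u t)) = kmul (u t) (star (L t (u t))) := by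
    have h1 := congrArg star (hL.self_adj t (star (u t)) (u t))
    rw [star_kmul, star_kmul, star_star] at h1
    rw [← h1]
    simp only [adj, star_star, tr_star]
  have e2 : brW L t (kmul (u t) (star (u t)))
      = kmul (L t (u t)) (star (u t)) - kmul (u t) (star (tr (L t (tr (u t))))) := by
    rw [brW, hL.mul_left, adj_kmul, hL.mul_left, adj_kmul, adj_adj]
    simp only [adj, tr_star, star_star]
  beta_reduce
  rw [e2]
  simp only [brS, star_sub_Lp, star_add_Lp, sub_kmul, add_kmul, kmul_sub, kmul_add, neg_sub, e1]
  abel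

end Calculus

/-! ### The operators at a fixed time -/

section FixedTime

variable {u m : Ker}

/-- The kernel of a Hilbert-Schmidt operator. -/
def kerOf (A : Op) : Ker := Function.invFun op A

theorem kerOf_op (k : Ker) : kerOf (op k) = k := Function.leftInverse_invFun op_injective k

theorem op_star_of_symm (hs : tr u = u) : op (star u) = star (op u) := by
  rw [← op_adjoint, hs]

theorem op_kmul_star (u : Ker) : op (kmul u (star u)) = qOp u := op_kmul _ _

theorem qOp_eq (hs : tr u = u) : qOp u = op u * star (op u) := by
  rw [qOp, op_star_of_symm hs]

theorem qOp_nonneg (hs : tr u = u) : 0 ≤ qOp u := by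
  rw [qOp_eq hs]
  exact mul_star_self_nonneg _

theorem one_le_onePlusP (hs : tr u = u) : 1 ≤ onePlusP u := one_le_sqrt (qOp_nonneg hs)

theorem onePlusP_sq (hs : tr u = u) : onePlusP u * onePlusP u = 1 + qOp u :=
  CFC.sqrt_mul_sqrt_self _ (add_nonneg zero_le_one (qOp_nonneg hs))

theorem star_onePlusP (hs : tr u = u) : star (onePlusP u) = onePlusP u :=
  (IsSelfAdjoint.of_nonneg (zero_le_one.trans (one_le_onePlusP hs))).star_eq

theorem onePlusP_mul_rOp (hs : tr u = u) : onePlusP u * rOp u = 1 :=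
  Ring.mul_inverse_cancel _ (isUnit_of_one_le (one_le_onePlusP hs))

theorem rOp_mul_onePlusP (hs : tr u = u) : rOp u * onePlusP u = 1 :=
  Ring.inverse_mul_cancel _ (isUnit_of_one_le (one_le_onePlusP hs))

theorem star_rOp (hs : tr u = u) : star (rOp u) = rOp u := by
  have h1 : star (rOp u) * onePlusP u = 1 := by
    have := congrArg star (onePlusP_mul_rOp hs)
    rwa [star_mul, star_onePlusP hs, star_one] at this
  exact left_inv_eq_right_inv h1 (onePlusP_mul_rOp hs)

/-- From ‖c‖² = ‖1 + q‖ ≤ 1 + M² one gets ‖c‖ ≤ 1 + M². The bound is crude; what matters is that it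
depends only on M, so that one step size serves almost all times. -/
theorem onePlusP_le (hs : tr u = u) {M : ℝ} (hM : ‖u‖ ≤ M) :
    onePlusP u ≤ algebraMap ℝ Op (1 + M ^ 2) := by
  set c := onePlusP u with hc
  have hsa : IsSelfAdjoint c := star_onePlusP hs
  have h1 : ‖c‖ * ‖c‖ ≤ 1 + M ^ 2 := by
    rw [← CStarRing.norm_star_mul_self, hsa.star_eq, hc, onePlusP_sq hs, ← op_kmul_star]
    calc ‖1 + op (kmul u (star u))‖ ≤ ‖(1 : Op)‖ + ‖op (kmul u (star u))‖ := norm_add_le _ _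
      _ ≤ 1 + ‖u‖ * ‖star u‖ :=
        add_le_add ContinuousLinearMap.norm_id_le ((norm_op_le _).trans (norm_kmul_le _ _))
      _ ≤ 1 + M ^ 2 := by
        rw [norm_star_Lp, sq]
        have := (norm_nonneg u).trans hM
        gcongr
  have h2 : ‖c‖ ≤ 1 + M ^ 2 := by nlinarith [norm_nonneg c, sq_nonneg M, sq_nonneg (‖c‖ - 1)]
  exact (CStarAlgebra.norm_le_iff_le_algebraMap c (by positivity)
    (zero_le_one.trans (one_le_onePlusP hs))).1 h2

end FixedTime

/-! ### The chain rule for the square root -/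

section ChainRule

variable {T : ℝ} {L : ℝ → Ker →L[ℂ] Ker} {u F : ℝ → Ker} {α : ℝ}

theorem memLp_pIter {q : ℝ → Ker} (hq : MemLp q ∞ (timeMeasure T)) (n : ℕ) :
    MemLp (fun t => pIter α (q t) n) ∞ (timeMeasure T) := by
  induction n with
  | zero => simp only [pIter]; exact MemLp.zero'
  | succ n ih =>
    simp only [pIter]
    exact ih.add (((hq.sub (ih.const_smul (2 : ℂ))).sub (memLp_kmul ih ih)).const_smul (α : ℂ))

theorem integrable_xIter {q : ℝ → Ker} (hq : MemLp q ∞ (timeMeasure T))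
    (hF : Integrable F (timeMeasure T)) (n : ℕ) :
    Integrable (fun t => xIter α (q t) (F t) n) (timeMeasure T) := by
  induction n with
  | zero => simp only [xIter]; exact integrable_zero _ _ _
  | succ n ih =>
    simp only [xIter]
    exact ih.add ((hF.sub (((ih.smul (2 : ℂ)).add (integrable_kmul' (memLp_pIter hq n) ih)).add
      (integrable_kmul ih (memLp_pIter hq n)))).smul (α : ℂ))

/-- The iterates are built from q by sums, scalars and products, and `xIter` is the formal
derivative of `pIter`; the product rule does the rest by induction. -/
theorem WEq.iterates (hT : 0 < T) (hL : Generator T L) {q : ℝ → Ker} (H : WEq T L q F)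
    (hq : MemLp q ∞ (timeMeasure T)) (hF : Integrable F (timeMeasure T)) (n : ℕ) :
    WEq T L (fun t => pIter α (q t) n) (fun t => xIter α (q t) (F t) n) := by
  induction n with
  | zero => simp only [pIter, xIter]; exact WEq.zero
  | succ n ih =>
    have hp := memLp_pIter (α := α) hq n
    have hx := integrable_xIter (α := α) hq hF n
    have h1 := WEq.mul hT hL ih ih hp hx hp hx
    have h2 := (ih.smul (-2)).add hL (h1.smul (-1)) (hp.const_smul (-2 : ℂ)) (hx.smul (-2 : ℂ))
      ((memLp_kmul hp hp).const_smul (-1 : ℂ))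
      (((integrable_kmul hx hp).add (integrable_kmul' hp hx)).smul (-1 : ℂ))
    have m2 : MemLp (fun t => (-2 : ℂ) • pIter α (q t) n
        + (-1 : ℂ) • kmul (pIter α (q t) n) (pIter α (q t) n)) ∞
        (timeMeasure T) := (hp.const_smul (-2 : ℂ)).add ((memLp_kmul hp hp).const_smul (-1 : ℂ))
    have i2 := (hx.fun_smul (-2 : ℂ)).fun_add
      (((integrable_kmul hx hp).fun_add (integrable_kmul' hp hx)).fun_smul (-1 : ℂ))
    have h3 := H.add hL h2 hq hF m2 i2
    have h4 := ih.add hL (h3.smul (α : ℂ)) hp hx ((hq.add m2).const_smul (α : ℂ))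
      ((hF.add i2).smul (α : ℂ))
    refine h4.congr (Eventually.of_forall fun t => ?_) (Eventually.of_forall fun t => ?_)
    · simp only [pIter]
      module
    · simp only [xIter]
      module

theorem norm_brW_le {N : ℝ} {t : ℝ} (h : ∀ a, ‖L t a‖ ≤ N * ‖a‖) (a : Ker) :
    ‖brW L t a‖ ≤ 2 * N * ‖a‖ := by
  have h1 := h a
  have h2 := h (adj a)
  rw [norm_adj] at h2
  calc ‖brW L t a‖ ≤ ‖L t a‖ + ‖adj (L t (adj a))‖ := norm_sub_le _ _
    _ ≤ 2 * N * ‖a‖ := by rw [norm_adj]; linarith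

theorem continuous_brW (t : ℝ) : Continuous (brW L t) := by
  have h : Continuous adj := conjL.continuous.comp tr.continuous
  exact (L t).continuous.sub (h.comp ((L t).continuous.comp h))

/-- The choice α = 1/(4(1 + M²)) makes the product ¼ and α itself at most ¼. -/
theorem exists_stepsize (M : ℝ) : ∃ α : ℝ, 0 < α ∧ α * (1 + M ^ 2) ≤ 1 / 2 ∧ α < 1 / 2 := by
  have h : (0 : ℝ) < 1 + M ^ 2 := by positivity
  refine ⟨1 / (4 * (1 + M ^ 2)), by positivity, ?_, ?_⟩
  · rw [one_div, mul_inv, mul_assoc, inv_mul_cancel₀ h.ne']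
    norm_num
  · rw [div_lt_div_iff₀ (by positivity) (by norm_num)]
    nlinarith [sq_nonneg M]

theorem tendsto_pIter {u : Ker} (hs : tr u = u) {M α : ℝ} (hM : ‖u‖ ≤ M) (hα : 0 < α)
    (hα2 : α * (1 + M ^ 2) ≤ 1 / 2) (hα1 : α < 1 / 2) :
    op (kerOf (pOp u)) = pOp u ∧
      Tendsto (pIter α (kmul u (star u))) atTop (𝓝 (kerOf (pOp u))) := by
  have hq : onePlusP u * onePlusP u = 1 + op (kmul u (star u)) := by
    rw [op_kmul_star, onePlusP_sq hs]
  obtain ⟨p, hp, hpn⟩ := exists_kernel_sqrt hα hα2 hα1.le (one_le_onePlusP hs)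
    (onePlusP_le hs hM) hq
  have hk : kerOf (pOp u) = p := by rw [pOp, ← hp, kerOf_op]
  rw [hk]
  refine ⟨hp, ?_⟩
  rw [tendsto_iff_norm_sub_tendsto_zero]
  refine squeeze_zero (fun _ => norm_nonneg _) hpn ?_
  have := (tendsto_pow_atTop_nhds_zero_of_lt_one (r := 1 - 2 * α) (by linarith)
    (by linarith)).const_mul (‖kmul u (star u)‖ / 2)
  rwa [mul_zero] at this

/-- The kernel of p is picked at each time with no regularity in t; measurability and the bound by
‖q‖ are inherited from the iterates, which converge at almost every time with a common α. -/
theorem memLp_sqrt (hu : MemLp u ∞ (timeMeasure T))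
    (hs : ∀ᵐ t ∂(timeMeasure T), tr (u t) = u t) :
    MemLp (fun t => kerOf (pOp (u t))) ∞ (timeMeasure T) ∧
      ∀ᵐ t ∂(timeMeasure T), op (kerOf (pOp (u t))) = pOp (u t) := by
  obtain ⟨α, hα, hα2, hα1⟩ := exists_stepsize (eLpNorm u ∞ (timeMeasure T)).toReal
  have hq : MemLp (fun t => kmul (u t) (star (u t))) ∞ (timeMeasure T) :=
    memLp_kmul hu (memLp_star hu)
  have hlim : ∀ᵐ t ∂(timeMeasure T), op (kerOf (pOp (u t))) = pOp (u t) ∧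
      Tendsto (fun n => pIter α (kmul (u t) (star (u t))) n) atTop (𝓝 (kerOf (pOp (u t)))) := by
    filter_upwards [hs, MemLp.ae_norm_le hu] with t h1 h2
    exact tendsto_pIter h1 h2 hα hα2 hα1
  refine ⟨MemLp.of_le hq (aestronglyMeasurable_of_tendsto_ae atTop
    (fun n => (memLp_pIter (α := α) hq n).1) (hlim.mono fun t h => h.2)) ?_,
    hlim.mono fun t h => h.1⟩
  filter_upwards [hs, MemLp.ae_norm_le hu, hlim] with t h1 h2 h3
  refine le_of_tendsto h3.2.norm (Eventually.of_forall fun n => ?_)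
  exact norm_pIter_le hα hα2 hα1.le (one_le_onePlusP h1) (onePlusP_le h1 h2)
    (by rw [op_kmul_star, onePlusP_sq h1]) n

/-- If `W(q) = F`, then `W(p) = X`, where `X` is the solution of `(1 + p) X + X (1 + p) = F`. -/
theorem WEq.sqrt (hT : 0 < T) (hL : Generator T L) (hu : MemLp u ∞ (timeMeasure T))
    (hs : ∀ᵐ t ∂(timeMeasure T), tr (u t) = u t)
    (H : WEq T L (fun t => kmul (u t) (star (u t))) F) (hF : Integrable F (timeMeasure T)) :
    ∃ X, Integrable X (timeMeasure T) ∧ WEq T L (fun t => kerOf (pOp (u t))) X ∧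
      ∀ᵐ t ∂(timeMeasure T), onePlusP (u t) * op (X t) + op (X t) * onePlusP (u t) = op (F t) := by
  set M := (eLpNorm u ∞ (timeMeasure T)).toReal with hM
  obtain ⟨α, hα, hα2, hα1⟩ := exists_stepsize M
  have hq : MemLp (fun t => kmul (u t) (star (u t))) ∞ (timeMeasure T) :=
    memLp_kmul hu (memLp_star hu)
  have hsq : ∀ t, tr (u t) = u t →
      onePlusP (u t) * onePlusP (u t) = 1 + op (kmul (u t) (star (u t))) := fun t h => by
    rw [op_kmul_star, onePlusP_sq h]
  have hex : ∀ᵐ t ∂(timeMeasure T), ∃ X : Ker, (2 : ℂ) • X + kmul (kerOf (pOp (u t))) X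
      + kmul X (kerOf (pOp (u t))) = F t := by
    filter_upwards [hs, MemLp.ae_norm_le hu] with t h1 h2
    exact exists_sylvester_kernel hα hα2 hα1.le (one_le_onePlusP h1) (onePlusP_le h1 h2)
      (tendsto_pIter h1 h2 hα hα2 hα1).1 (F t)
  -- A solution is chosen separately at each time. Its measurability is recovered afterwards, as the
  -- limit of the measurable iterates.
  obtain ⟨X, hX⟩ := Filter.skolem.1 hex
  have hlim : ∀ᵐ t ∂(timeMeasure T), Tendsto (fun n => xIter α (kmul (u t) (star (u t))) (F t) n)
      atTop (𝓝 (X t)) := by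
    filter_upwards [hs, MemLp.ae_norm_le hu, hX] with t h1 h2 h3
    exact tendsto_xIter hα hα2 hα1 (one_le_onePlusP h1) (onePlusP_le h1 h2) (hsq t h1)
      (tendsto_pIter h1 h2 hα hα2 hα1).1 h3
  have hxn : ∀ n, ∀ᵐ t ∂(timeMeasure T),
      ‖xIter α (kmul (u t) (star (u t))) (F t) n‖ ≤ ‖F t‖ / 2 := fun n => by
    filter_upwards [hs, MemLp.ae_norm_le hu] with t h1 h2
    exact norm_xIter_le hα hα2 hα1.le (one_le_onePlusP h1) (onePlusP_le h1 h2) (hsq t h1) _ n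
  have hpn : ∀ n, ∀ᵐ t ∂(timeMeasure T),
      ‖pIter α (kmul (u t) (star (u t))) n‖ ≤ M * M := fun n => by
    filter_upwards [hs, MemLp.ae_norm_le hu] with t h1 h2
    refine (norm_pIter_le hα hα2 hα1.le (one_le_onePlusP h1) (onePlusP_le h1 h2)
      (hsq t h1) n).trans ((norm_kmul_le _ _).trans ?_)
    rw [norm_star_Lp]
    exact mul_le_mul h2 h2 (norm_nonneg _) (by rw [hM]; exact ENNReal.toReal_nonneg)
  have hXi : Integrable X (timeMeasure T) := by
    refine Integrable.mono' (hF.norm.div_const 2) (aestronglyMeasurable_of_tendsto_ae atTop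
      (fun n => (integrable_xIter (α := α) hq hF n).1) hlim) ?_
    filter_upwards [hlim, ae_all_iff.2 hxn] with t h1 h2
    exact le_of_tendsto h1.norm (Eventually.of_forall h2)
  refine ⟨X, hXi, ?_, ?_⟩
  · obtain ⟨N, hN, hLN⟩ := hL.exists_bound
    refine TensEq.of_tendsto (as := fun n t => pIter α (kmul (u t) (star (u t))) n)
      (fun n => WEq.iterates hT hL H hq hF n)
      -- The dominating functions: ‖q‖ ≤ M² bounds the iterates of p, half of ‖F‖ bounds those of X,
      -- and 2N bounds the bracket with the generator.
      (B := fun _ => M * M) (C := fun t => ‖F t‖ / 2 + 2 * N t * (M * M)) (integrable_const _)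
      ((hF.norm.div_const 2).add ((hN.const_mul 2).mul_const _))
      (fun n => (memLp_pIter (α := α) hq n).1)
      (fun n => ((integrable_xIter (α := α) hq hF n).sub
        (hL.integrable_brW (memLp_pIter (α := α) hq n))).1)
      hpn (fun n => ?_) ?_ ?_
    · filter_upwards [hpn n, hxn n] with t h1 h2
      refine (norm_sub_le _ _).trans (add_le_add h2 ((norm_brW_le (hLN t).2 _).trans ?_))
      exact mul_le_mul_of_nonneg_left h1 (mul_nonneg zero_le_two (hLN t).1)
    · filter_upwards [hs, MemLp.ae_norm_le hu] with t h1 h2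
      exact (tendsto_pIter h1 h2 hα hα2 hα1).2
    · filter_upwards [hs, MemLp.ae_norm_le hu, hlim] with t h1 h2 h3
      exact h3.sub (((continuous_brW t).tendsto _).comp (tendsto_pIter h1 h2 hα hα2 hα1).2)
  · filter_upwards [hs, MemLp.ae_norm_le hu, hX] with t h1 h2 h3
    have h4 := congrArg op h3
    have h5 : onePlusP (u t) = 1 + op (kerOf (pOp (u t))) := by
      rw [(tendsto_pIter h1 h2 hα hα2 hα1).1, pOp]; abel
    rw [op_add, op_add, op_smul, op_kmul, op_kmul] at h4
    rw [h5, ← h4, two_smul]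
    noncomm_ring

end ChainRule

/-! ### The equations at a fixed time -/

section FixedTimeAlgebra

variable {u m : Ker} {x f : Op}

theorem quasilinearRHS_eq (hm : tr m = m) (x : Op) : quasilinearRHS u m x
    = onePlusP u * op m + (x + op u * star (op m)) * rOp u * op u := by
  rw [quasilinearRHS, op_star_of_symm hm]

theorem commutatorRHS_eq (hs : tr u = u) (hm : tr m = m) (x : Op) : commutatorRHS u m x
    = onePlusP u * op m + (1 / 2 : ℂ) • ((x * rOp u - rOp u * x) * op u)
      + (1 / 2 : ℂ) • ((rOp u * op m * star (op u) + op u * star (op m) * rOp u) * op u) := by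
  rw [commutatorRHS, op_star_of_symm hm, op_star_of_symm hs]

theorem FOp_eq (hs : tr u = u) (hm : tr m = m) : FOp u m
    = op m * star (op u) * onePlusP u - onePlusP u * (op u * star (op m)) := by
  rw [FOp, op_star_of_symm hm, op_star_of_symm hs, mul_assoc (onePlusP u)]

theorem star_FOp (hs : tr u = u) (hm : tr m = m) : star (FOp u m) = -FOp u m := by
  rw [FOp_eq hs hm, star_sub, star_mul, star_mul, star_mul, star_mul, star_star, star_star,
    star_onePlusP hs, neg_sub]

theorem sylvester_of_quasilinear (hs : tr u = u) (hm : tr m = m) (hx : star x = -x)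
    (hf : f = quasilinearRHS u m x)
    (hg : f * star (op u) - op u * star f = onePlusP u * x + x * onePlusP u) :
    onePlusP u * x + x * onePlusP u = FOp u m := by
  rw [FOp_eq hs hm]
  exact commutator_of_quasilinear (star_onePlusP hs) (star_rOp hs) (rOp_mul_onePlusP hs)
    (onePlusP_mul_rOp hs) (by rw [onePlusP_sq hs, qOp_eq hs]) hx
    (hf.trans (quasilinearRHS_eq hm x)) hg

theorem quasilinearRHS_eq_commutatorRHS (hs : tr u = u) (hm : tr m = m)
    (h : onePlusP u * x + x * onePlusP u = FOp u m) :
    quasilinearRHS u m x = commutatorRHS u m x := by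
  rw [FOp_eq hs hm, sylvester_iff (onePlusP_mul_rOp hs) (rOp_mul_onePlusP hs)] at h
  rw [quasilinearRHS_eq hm, commutatorRHS_eq hs hm, quasilinear_eq_commutator h, add_assoc,
    mul_assoc (rOp u)]

theorem commutator_defect (hs : tr u = u) (hm : tr m = m) (hx : star x = -x)
    (hf : f = commutatorRHS u m x) :
    ∃ z, (z = 0 ↔ onePlusP u * x + x * onePlusP u = FOp u m) ∧
      f * star (op u) - op u * star f = onePlusP u * x + x * onePlusP u
        - (1 / 2 : ℂ) • (z * (onePlusP u * onePlusP u) + (onePlusP u * onePlusP u) * z) := by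
  refine ⟨_, ?_, commutator_balance (star_onePlusP hs) (star_rOp hs) (rOp_mul_onePlusP hs)
    (onePlusP_mul_rOp hs) (by rw [onePlusP_sq hs, qOp_eq hs]) hx
    (hf.trans (commutatorRHS_eq hs hm x)) rfl⟩
  rw [FOp_eq hs hm, sylvester_iff (onePlusP_mul_rOp hs) (rOp_mul_onePlusP hs), sub_eq_zero]

/-- The assumed balance forces c² z + z c² = 0 for the defect z, and uniqueness is applied to the
positive invertible element c² instead of c. -/
theorem sylvester_of_commutator (hs : tr u = u) (hm : tr m = m) (hx : star x = -x)
    (hf : f = commutatorRHS u m x)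
    (hg : f * star (op u) - op u * star f = onePlusP u * x + x * onePlusP u) :
    onePlusP u * x + x * onePlusP u = FOp u m := by
  obtain ⟨z, hz, hb⟩ := commutator_defect hs hm hx hf
  refine hz.1 ?_
  rw [hg, eq_comm, sub_eq_self, smul_eq_zero, or_iff_right (by norm_num), add_comm] at hb
  have h1 := isUnit_of_one_le (one_le_onePlusP hs)
  refine sylvester_unique ?_ (h1.mul h1) hb
  rw [onePlusP_sq hs]
  exact add_nonneg zero_le_one (qOp_nonneg hs)

/-- The converse use of the defect identity: when z = 0 the balance holds for any skew-adjoint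
solution, not only for W(p). This is what the semilinear equation needs. -/
theorem balance_of_commutator (hs : tr u = u) (hm : tr m = m) (hx : star x = -x)
    (hf : f = commutatorRHS u m x) (h : onePlusP u * x + x * onePlusP u = FOp u m) :
    f * star (op u) - op u * star f = onePlusP u * x + x * onePlusP u := by
  obtain ⟨z, hz, hb⟩ := commutator_defect hs hm hx hf
  rw [hb, hz.2 h]
  simp

theorem onePlusP_eq (hs : tr u = u) : onePlusP u = 1 + op (kerOf (pOp u)) := by
  obtain ⟨α, hα, hα2, hα1⟩ := exists_stepsize ‖u‖
  rw [(tendsto_pIter hs le_rfl hα hα2 hα1).1, pOp]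
  abel

/-- Although c is not Hilbert-Schmidt, F is: expanding c = 1 + p leaves products that each contain
kernels. -/
theorem exists_sylvester_FOp (hs : tr u = u) :
    ∃ Y : Ker, onePlusP u * op Y + op Y * onePlusP u = FOp u m := by
  obtain ⟨α, hα, hα2, hα1⟩ := exists_stepsize ‖u‖
  have h5 := onePlusP_eq hs
  obtain ⟨Y, hY⟩ := exists_sylvester_kernel hα hα2 hα1.le (one_le_onePlusP hs)
    (onePlusP_le hs le_rfl) (tendsto_pIter hs le_rfl hα hα2 hα1).1
    (kmul m (star u) + kmul (kmul m (star u)) (kerOf (pOp u))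
      - (kmul u (star m) + kmul (kerOf (pOp u)) (kmul u (star m))))
  refine ⟨Y, ?_⟩
  have h4 := congrArg op hY
  simp only [op_add, op_sub, op_kmul, two_smul] at h4
  rw [FOp, h5]
  calc (1 + op (kerOf (pOp u))) * op Y + op Y * (1 + op (kerOf (pOp u)))
      = op Y + op Y + op (kerOf (pOp u)) * op Y + op Y * op (kerOf (pOp u)) := by noncomm_ring
    _ = _ := by rw [h4]; noncomm_ring

theorem contourW_FOp (hs : tr u = u) {γ : ℝ → ℂ} (hγ : IsContourAround γ (spectrum ℂ (qOp u)))
    {X : Ker} (h : onePlusP u * op X + op X * onePlusP u = FOp u m) :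
    contourW γ (qOp u) (FOp u m) = op X := by
  have hq : onePlusP u * onePlusP u - 1 = qOp u := by rw [onePlusP_sq hs]; abel
  have := contourW_eq (onePlusP_eq hs) (one_le_onePlusP hs) (by rwa [hq]) X
  rwa [hq, h] at this

/-- For symmetric k and u the conjugate kernel is the adjoint operator, so the abstract identity ch
= √(1 + sh sh*) applies. -/
theorem ch_eq_onePlusP {k : Ker} (hs : tr u = u) (hk : tr k = k) (h : op u = sh k) :
    ch k = onePlusP u := by
  rw [onePlusP, posSqrt, qOp_eq hs, h, sh, ch, op_star_of_symm hk]
  exact (sqrt_one_add_sinh_sq (op k)).symm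

end FixedTimeAlgebra

/-! ### Equivalence of the equations -/

section Equivalence

variable {T : ℝ} {L : ℝ → Ker →L[ℂ] Ker} {u m f : ℝ → Ker} {Γ : ℝ → ℝ → ℂ}

/-- The common content of the equations: `f = S(u)`, `X = W(p)`, `W(q) = F`. -/
structure Solution (T : ℝ) (L : ℝ → Ker →L[ℂ] Ker) (m u f X : ℝ → Ker) : Prop where
  integrable_f : Integrable f (timeMeasure T)
  integrable_X : Integrable X (timeMeasure T)
  sEq : SEq T L u f
  wEq : WEq T L (fun t => kerOf (pOp (u t))) X
  wEq_q : WEq T L (fun t => kmul (u t) (star (u t)))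
    (fun t => kmul (f t) (star (u t)) - kmul (u t) (star (f t)))
  balance : ∀ᵐ t ∂(timeMeasure T),
    op (kmul (f t) (star (u t)) - kmul (u t) (star (f t))) = FOp (u t) (m t)
  sylvester : ∀ᵐ t ∂(timeMeasure T),
    onePlusP (u t) * op (X t) + op (X t) * onePlusP (u t) = FOp (u t) (m t)
  quasilinear : ∀ᵐ t ∂(timeMeasure T), op (f t) = quasilinearRHS (u t) (m t) (op (X t))

/-- The facts that hold for any solution of S(u) = f, whatever f is: W(p) exists, is skew-adjoint,
and solves the Sylvester equation with right-hand side fū - u f*. Each of the three equations enters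
only through a formula for f. -/
theorem SEq.exists_sqrt (hT : 0 < T) (hL : Generator T L) (hu : MemLp u ∞ (timeMeasure T))
    (hs : ∀ᵐ t ∂(timeMeasure T), tr (u t) = u t) (H : SEq T L u f)
    (hf : Integrable f (timeMeasure T)) :
    ∃ X, Integrable X (timeMeasure T) ∧ WEq T L (fun t => kerOf (pOp (u t))) X ∧
      ∀ᵐ t ∂(timeMeasure T), star (op (X t)) = -op (X t) ∧
        op (kmul (f t) (star (u t)) - kmul (u t) (star (f t)))
          = op (f t) * star (op (u t)) - op (u t) * star (op (f t)) ∧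
        op (f t) * star (op (u t)) - op (u t) * star (op (f t))
          = onePlusP (u t) * op (X t) + op (X t) * onePlusP (u t) := by
  have hG : Integrable (fun t => kmul (f t) (star (u t)) - kmul (u t) (star (f t)))
      (timeMeasure T) :=
    (integrable_kmul hf (memLp_star hu)).sub (integrable_kmul' hu (integrable_star hf))
  obtain ⟨X, hX, hWX, hc⟩ := WEq.sqrt hT hL hu hs (H.wEq_mul_star hT hL hu hf) hG
  refine ⟨X, hX, hWX, ?_⟩
  filter_upwards [hs, H.symm hL hu hf hs, hc] with t h1 h2 h3
  have e : op (kmul (f t) (star (u t)) - kmul (u t) (star (f t)))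
      = op (f t) * star (op (u t)) - op (u t) * star (op (f t)) := by
    rw [op_sub, op_kmul, op_kmul, op_star_of_symm h1, op_star_of_symm h2]
  refine ⟨sylvester_star (zero_le_one.trans (one_le_onePlusP h1))
    (isUnit_of_one_le (one_le_onePlusP h1)) h3 ?_, e, by rw [h3, e]⟩
  rw [e, star_sub, star_mul, star_mul, star_star, star_star, neg_sub]

/-- The W(p) supplied with the equation agrees with the one built by the chain rule, since the
right-hand side of a weak equation is unique; the pointwise algebra then applies to it. -/
theorem solution_of_quasilinear (hT : 0 < T) (hL : Generator T L)
    (hu : MemLp u ∞ (timeMeasure T)) (hs : ∀ᵐ t ∂(timeMeasure T), tr (u t) = u t)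
    (hm : ∀ᵐ t ∂(timeMeasure T), tr (m t) = m t) {X : ℝ → Ker} (H : SEq T L u f)
    (hf : Integrable f (timeMeasure T)) (HX : WEq T L (fun t => kerOf (pOp (u t))) X)
    (hX : Integrable X (timeMeasure T))
    (h : ∀ᵐ t ∂(timeMeasure T), op (f t) = quasilinearRHS (u t) (m t) (op (X t))) :
    Solution T L m u f X := by
  obtain ⟨X', hX', HX', hc⟩ := H.exists_sqrt hT hL hu hs hf
  have hXX := HX.unique hL HX' (memLp_sqrt hu hs).1 hX hX'
  have hsyl : ∀ᵐ t ∂(timeMeasure T),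
      onePlusP (u t) * op (X t) + op (X t) * onePlusP (u t) = FOp (u t) (m t) := by
    filter_upwards [hs, hm, h, hc, hXX] with t h1 h2 h3 h4 h5
    rw [← h5] at h4
    exact sylvester_of_quasilinear h1 h2 h4.1 h3 h4.2.2
  refine ⟨hf, hX, H, HX, H.wEq_mul_star hT hL hu hf, ?_, hsyl, h⟩
  filter_upwards [hc, hXX, hsyl] with t h4 h5 h6
  rw [← h5] at h4
  rw [h4.2.1, h4.2.2, h6]

/-- Once the defect vanishes, the two right-hand sides agree and the quasilinear case takes over. -/
theorem solution_of_commutator (hT : 0 < T) (hL : Generator T L)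
    (hu : MemLp u ∞ (timeMeasure T)) (hs : ∀ᵐ t ∂(timeMeasure T), tr (u t) = u t)
    (hm : ∀ᵐ t ∂(timeMeasure T), tr (m t) = m t) {X : ℝ → Ker} (H : SEq T L u f)
    (hf : Integrable f (timeMeasure T)) (HX : WEq T L (fun t => kerOf (pOp (u t))) X)
    (hX : Integrable X (timeMeasure T))
    (h : ∀ᵐ t ∂(timeMeasure T), op (f t) = commutatorRHS (u t) (m t) (op (X t))) :
    Solution T L m u f X := by
  refine solution_of_quasilinear hT hL hu hs hm H hf HX hX ?_
  obtain ⟨X', hX', HX', hc⟩ := H.exists_sqrt hT hL hu hs hf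
  have hXX := HX.unique hL HX' (memLp_sqrt hu hs).1 hX hX'
  filter_upwards [hs, hm, h, hc, hXX] with t h1 h2 h3 h4 h5
  rw [← h5] at h4
  rw [h3, quasilinearRHS_eq_commutatorRHS h1 h2 (sylvester_of_commutator h1 h2 h4.1 h3 h4.2.2)]

/-- No W(p) is given here. The chain rule supplies it, and it is compared with the contour integral
Y through the two Sylvester equations, both of which have the right-hand side fū - u f*. -/
theorem solution_of_semilinear (hT : 0 < T) (hL : Generator T L)
    (hu : MemLp u ∞ (timeMeasure T)) (hs : ∀ᵐ t ∂(timeMeasure T), tr (u t) = u t)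
    (hm : ∀ᵐ t ∂(timeMeasure T), tr (m t) = m t)
    (hΓ : ∀ᵐ t ∂(timeMeasure T), IsContourAround (Γ t) (spectrum ℂ (qOp (u t))))
    (H : SEq T L u f) (hf : Integrable f (timeMeasure T))
    (h : ∀ᵐ t ∂(timeMeasure T), op (f t) = commutatorRHS (u t) (m t)
      (contourW (Γ t) (qOp (u t)) (FOp (u t) (m t)))) :
    ∃ X, Solution T L m u f X := by
  obtain ⟨X, hX, HX, hc⟩ := H.exists_sqrt hT hL hu hs hf
  refine ⟨X, solution_of_commutator hT hL hu hs hm H hf HX hX ?_⟩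
  filter_upwards [hs, hm, hΓ, h, hc] with t h1 h2 h3 h4 h5
  obtain ⟨Y, hY⟩ := exists_sylvester_FOp (m := m t) h1
  rw [contourW_FOp h1 h3 hY] at h4
  have hc0 := zero_le_one.trans (one_le_onePlusP h1)
  have hcu := isUnit_of_one_le (one_le_onePlusP h1)
  have hYs := sylvester_star hc0 hcu hY (star_FOp h1 h2)
  have hb := balance_of_commutator h1 h2 hYs h4 hY
  -- The difference solves the homogeneous Sylvester equation: cX + Xc is the balance by the chain
  -- rule, cY + Yc by the algebra for Y.
  have hXY : op (X t) - op Y = 0 := by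
    refine sylvester_unique hc0 hcu ?_
    rw [mul_sub, sub_mul]
    calc _ = (onePlusP (u t) * op (X t) + op (X t) * onePlusP (u t))
          - (onePlusP (u t) * op Y + op Y * onePlusP (u t)) := by abel
      _ = 0 := by rw [← h5.2.2, hb, sub_self]
  rw [h4, sub_eq_zero.1 hXY]

theorem EqW.congr {v : E3 → ℝ} {φ : ℝ → E3 → ℂ} {A A' B B' : ℝ → Op} (H : EqW T v φ B A)
    (hB : ∀ᵐ t ∂(timeMeasure T), B t = B' t) (hA : ∀ᵐ t ∂(timeMeasure T), A t = A' t) :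
    EqW T v φ B' A' := by
  obtain ⟨b, f, ⟨hb, hb'⟩, ⟨hf, hf'⟩, h⟩ := H
  refine ⟨b, f, ⟨hb, ?_⟩, ⟨hf, ?_⟩, h⟩
  · filter_upwards [hb', hB] with t h1 h2
    rw [h1, h2]
  · filter_upwards [hf', hA] with t h1 h2
    rw [h1, h2]

theorem EqS.congr {v : E3 → ℝ} {φ : ℝ → E3 → ℂ} {A A' : ℝ → Op} (H : EqS T v φ u A)
    (hA : ∀ᵐ t ∂(timeMeasure T), A t = A' t) : EqS T v φ u A' := by
  obtain ⟨f, ⟨hf, hf'⟩, h⟩ := H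
  refine ⟨f, ⟨hf, ?_⟩, h⟩
  filter_upwards [hf', hA] with t h1 h2
  rw [h1, h2]

/-- With ch(k) = 1 + p the two equations differ only by moving (1 + p)m across the equality. -/
theorem pairEq_iff_quasilinearEq {v : E3 → ℝ} {φ : ℝ → E3 → ℂ} {k : ℝ → Ker}
    (h : ∀ᵐ t ∂(timeMeasure T), ch (k t) = onePlusP (u t)) :
    PairEq T v φ k u ↔ QuasilinearEq T v φ u := by
  constructor
  · rintro ⟨P, A, hP, hA, hPA⟩
    refine ⟨P, hP.congr ?_ (ae_eq_refl _), hA.congr ?_⟩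
    · filter_upwards [h] with t ht
      rw [ht, pOp]
    · filter_upwards [h, hPA] with t h1 h2
      rw [h1, sub_eq_iff_eq_add'] at h2
      exact h2
  · rintro ⟨P, hP, hA⟩
    refine ⟨P, _, hP.congr ?_ (ae_eq_refl _), hA, ?_⟩
    · filter_upwards [h] with t ht
      rw [ht, pOp]
    · filter_upwards [h] with t h1
      rw [h1, sub_eq_iff_eq_add']
      rfl

end Equivalence

end

end PairExcitation

/-! ### Assembly: each equation produces a `Solution`, from which all the others are read off -/

theorem theorem6 (T : ℝ) (hT : 0 < T)
    (v : E3 → ℝ) (hv : MemLp v 2 volume) (hv_even : ∀ x, v (-x) = v x)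
    (φ : ℝ → E3 → ℂ) (hφ : Measurable (Function.uncurry φ))
    (hφ4 : ∫⁻ t, eLpNorm (φ t) 4 volume ^ 2 ∂(timeMeasure T) < ∞)
    (u : ℝ → Ker) (hu : MemLp u ∞ (timeMeasure T))
    (hu_symm : ∀ᵐ t ∂(timeMeasure T), IsSymm (u t))
    (Γ : ℝ → ℝ → ℂ)
    (hΓ : ∀ᵐ t ∂(timeMeasure T), IsContourAround (Γ t) (spectrum ℂ (qOp (u t)))) :
    [QuasilinearEq T v φ u, CommutatorEq T v φ u, SemilinearEq T v φ u Γ].TFAE ∧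
    (QuasilinearEq T v φ u →
      EqW T v φ (fun t => qOp (u t)) (fun t => FOp (u t) (mKer v φ t)) ∧
      EqW T v φ (fun t => pOp (u t)) (WGamma v φ u Γ)) ∧
    (∀ k : ℝ → Ker, (∀ᵐ t ∂(timeMeasure T), IsSymm (k t) ∧ op (u t) = sh (k t)) →
      (PairEq T v φ k u ↔ QuasilinearEq T v φ u)) := by
  obtain ⟨-, hm, L, hL, hW, hS⟩ := exists_generator hT hv hv_even hφ hφ4
  have hs : ∀ᵐ t ∂(timeMeasure T), tr (u t) = u t := hu_symm.mono fun t h => isSymm_iff.1 h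
  obtain ⟨hp, hp'⟩ := memLp_sqrt hu hs
  have hq : MemLp (fun t => kmul (u t) (star (u t))) ∞ (timeMeasure T) :=
    memLp_kmul hu (memLp_star hu)
  have of_EqW : ∀ {P : ℝ → Op}, EqW T v φ (fun t => pOp (u t)) P →
      ∃ X, Integrable X (timeMeasure T) ∧ WEq T L (fun t => kerOf (pOp (u t))) X ∧
        ∀ᵐ t ∂(timeMeasure T), op (X t) = P t := by
    rintro P ⟨b, X, ⟨hb, hb'⟩, ⟨hX, hX'⟩, h⟩
    have hX1 := memLp_one_iff_integrable.1 hX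
    refine ⟨X, hX1, WEq.congr ((hW b X hb hX1).1 h) ?_ (ae_eq_refl _), hX'⟩
    -- Any kernel representing p is the canonical one, because a Hilbert-Schmidt operator determines
    -- its kernel.
    filter_upwards [hb'] with t ht
    rw [← ht, kerOf_op]
  have to_EqW : ∀ {X : ℝ → Ker} {P : ℝ → Op}, Integrable X (timeMeasure T) →
      WEq T L (fun t => kerOf (pOp (u t))) X → (∀ᵐ t ∂(timeMeasure T), op (X t) = P t) →
      EqW T v φ (fun t => pOp (u t)) P := fun hX h hP =>
    ⟨_, _, ⟨hp, hp'⟩, ⟨memLp_one_iff_integrable.2 hX, hP⟩, (hW _ _ hp hX).2 h⟩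
  have to_EqS : ∀ {f : ℝ → Ker} {A : ℝ → Op}, Integrable f (timeMeasure T) → SEq T L u f →
      (∀ᵐ t ∂(timeMeasure T), op (f t) = A t) → EqS T v φ u A := fun hf h hA =>
    ⟨_, ⟨memLp_one_iff_integrable.2 hf, hA⟩, (hS _ _ hu hf).2 h⟩
  -- The contour enters only here and in the semilinear case: W(p) solves the Sylvester equation
  -- with right-hand side F, which the contour integral inverts.
  have contour : ∀ {f X : ℝ → Ker}, Solution T L (mKer v φ) u f X →
      ∀ᵐ t ∂(timeMeasure T), op (X t) = WGamma v φ u Γ t := fun H => by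
    filter_upwards [hs, hΓ, H.sylvester] with t h1 h2 h3
    exact (contourW_FOp h1 h2 h3).symm
  have to_comm : ∀ {f X : ℝ → Ker}, Solution T L (mKer v φ) u f X →
      ∀ᵐ t ∂(timeMeasure T), op (f t) = commutatorRHS (u t) (mKer v φ t) (op (X t)) := fun H => by
    filter_upwards [hs, hm, H.sylvester, H.quasilinear] with t h1 h2 h3 h4
    rw [h4, quasilinearRHS_eq_commutatorRHS h1 h2 h3]
  have sol₁ : QuasilinearEq T v φ u → ∃ f X, Solution T L (mKer v φ) u f X := by
    rintro ⟨P, hP, f, ⟨hf, hf'⟩, h⟩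
    have hf1 := memLp_one_iff_integrable.1 hf
    obtain ⟨X, hX, HX, hXP⟩ := of_EqW hP
    refine ⟨f, X, solution_of_quasilinear hT hL hu hs hm ((hS _ _ hu hf1).1 h) hf1 HX hX ?_⟩
    filter_upwards [hf', hXP] with t h1 h2
    rw [h1, h2]
  have sol₂ : CommutatorEq T v φ u → ∃ f X, Solution T L (mKer v φ) u f X := by
    rintro ⟨P, hP, f, ⟨hf, hf'⟩, h⟩
    have hf1 := memLp_one_iff_integrable.1 hf
    obtain ⟨X, hX, HX, hXP⟩ := of_EqW hP
    refine ⟨f, X, solution_of_commutator hT hL hu hs hm ((hS _ _ hu hf1).1 h) hf1 HX hX ?_⟩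
    filter_upwards [hf', hXP] with t h1 h2
    rw [h1, h2]
  have sol₃ : SemilinearEq T v φ u Γ → ∃ f X, Solution T L (mKer v φ) u f X := by
    rintro ⟨f, ⟨hf, hf'⟩, h⟩
    have hf1 := memLp_one_iff_integrable.1 hf
    exact ⟨f, solution_of_semilinear hT hL hu hs hm hΓ ((hS _ _ hu hf1).1 h) hf1 hf'⟩
  refine ⟨?_, fun h => ?_, fun k hk => pairEq_iff_quasilinearEq ?_⟩
  · tfae_have 1 → 2 := fun h => by
      obtain ⟨f, X, H⟩ := sol₁ h
      exact ⟨fun t => op (X t), to_EqW H.integrable_X H.wEq (ae_eq_refl _),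
        to_EqS H.integrable_f H.sEq (to_comm H)⟩
    tfae_have 2 → 3 := fun h => by
      obtain ⟨f, X, H⟩ := sol₂ h
      refine to_EqS H.integrable_f H.sEq ?_
      filter_upwards [to_comm H, contour H] with t h1 h2
      rw [h1, h2]
    tfae_have 3 → 1 := fun h => by
      obtain ⟨f, X, H⟩ := sol₃ h
      exact ⟨fun t => op (X t), to_EqW H.integrable_X H.wEq (ae_eq_refl _),
        to_EqS H.integrable_f H.sEq H.quasilinear⟩
    tfae_finish
  · obtain ⟨f, X, H⟩ := sol₁ h
    have hG : Integrable (fun t => kmul (f t) (star (u t)) - kmul (u t) (star (f t)))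
        (timeMeasure T) := (integrable_kmul H.integrable_f (memLp_star hu)).sub
      (integrable_kmul' hu (integrable_star H.integrable_f))
    exact ⟨⟨_, _, ⟨hq, .of_forall fun t => op_kmul_star (u t)⟩,
      ⟨memLp_one_iff_integrable.2 hG, H.balance⟩, (hW _ _ hq hG).2 H.wEq_q⟩,
      to_EqW H.integrable_X H.wEq (contour H)⟩
  · filter_upwards [hs, hk] with t h1 h2
    exact ch_eq_onePlusP h1 (isSymm_iff.1 h2.1) h2.2
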